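/- Let $n\ge 2$, $1\le k\le n$, let $(M,g)$ be a compact smooth Riemannian manifold of dimension $n$ with smooth nonempty boundary $\partial M$ ($\overline M$ denotes the manifold together with its boundary), and let $\chi$ be a smooth symmetric $(0,2)$-tensor field on $\overline M$. Let $\sigma_j$ be the $j$-th elementary symmetric function, $\Gamma_k=\{\lambda\in\mathbb R^n:\sigma_j(\lambda)>0,\ j=1,\dots,k\}$, and let $\lambda(h)$ denote the eigenvalues of a symmetric $(0,2)$-tensor $h$ with respect to $g$. A $C^2$ function $v$ on $\overline M$ is called admissible if $\lambda(\Delta v\,g-\nabla^2v+\chi)(x)\in\Gamma_k$ for all $x\in\overline M$. For $R\ge0$ put $S_R=\{(x,z,p): (x,p)\in T^*\overline M,\ z\in\mathbb R,\ |z|\le R,\ |p|_g\le R\}$; the norm $|f|_{C^2(S_R)}$ is taken in the coordinates of $T^*\overline M\times\mathbb R$ induced by a fixed finite family of charts of $\overline M$ with a fixed covering of $\overline M$ by compact subsets of the chart domains. Further $|v|_{C^1}=\max\{\sup|v|,\sup|\nabla v|_g\}$ and $|v|_{C^2}=\max\{|v|_{C^1},\sup|\nabla^2v|_g\}$ on $\overline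 M$. Then for all constants $K_1,K_2,K_3$ and $c_0>0$ there is a constant $C>0$, depending only on $K_1,K_2,K_3,c_0$ and on $(M,g)$, $\chi$, $k$ and the fixed charts and compact sets, with the following property. Let $f=f(x,z,p)$ be a smooth positive function on $T^*\overline M\times\mathbb R$ (not assumed convex in $p$) with $|f|_{C^2(S_{K_1})}\le K_3$ and $f\ge c_0$ on $S_{K_1}$; let $\underline u\in C^2(\overline M)$ be admissible with $|\underline u|_{C^2}\le K_2$; and let $u\in C^4(M\setminus\partial M)\cap C^2(\overline M)$ be an admissible solution of $$\sigma_k\big(\lambda(\Delta u\,g-\nabla^2u+\chi)\big)=f(x,u,\nabla u)\quad\text{on }\overline M$$ with $|u|_{C^1}\le K_1$. Then $$\sup_{\overline M}|\nabla^2u|_g\le C\Big(1+\sup_{\partial M}|\nabla^2u|_g\Big).$$ -/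

import Mathlib

open Set Bundle
open scoped Manifold ContDiff Matrix

noncomputable section

namespace HessianEq

/-- The model vector space `ℝⁿ`. -/
abbrev Rn (n : ℕ) : Type := EuclideanSpace ℝ (Fin n)

/-- The `i`-th standard basis vector of `ℝⁿ`. -/
def stdVec {n : ℕ} (i : Fin n) : Rn n := EuclideanSpace.single i (1 : ℝ)

section Manifold

variable {n : ℕ} [NeZero n]
  {M : Type*} [TopologicalSpace M] [ChartedSpace (EuclideanHalfSpace n) M]

variable (n) in
/-- The tangent space `T_x M` of a manifold with boundary. -/
abbrev Tan (x : M) : Type := TangentSpace (𝓡∂ n) x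

variable (n) in
/-- The cotangent space `T_x^* M`. -/
abbrev Cotan (x : M) : Type := Tan n x →L[ℝ] Trivial M ℝ x

variable (n M) in
/-- The total space `T^* M` of the cotangent bundle. -/
abbrev CotangentBundle [IsManifold (𝓡∂ n) ∞ M] : Type _ :=
  TotalSpace (Rn n →L[ℝ] ℝ) (fun x : M => Cotan n x)

variable (n M) in
/-- A (not necessarily continuous) `(0,2)`-tensor field. -/
abbrev TwoTensor : Type _ := ∀ x : M, Tan n x →L[ℝ] Tan n x →L[ℝ] ℝ

variable (n M) in
/-- Smooth Riemannian metrics on `M`. -/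
abbrev Metric [IsManifold (𝓡∂ n) ∞ M] : Type _ :=
  ContMDiffRiemannianMetric (𝓡∂ n) ∞ (Rn n) (fun x : M => Tan n x)

/-- Smoothness (up to the boundary) of a `(0,2)`-tensor field. -/
def SmoothTensor [IsManifold (𝓡∂ n) ∞ M] (h : TwoTensor n M) : Prop :=
  ContMDiff (𝓡∂ n) ((𝓡∂ n).prod 𝓘(ℝ, Rn n →L[ℝ] Rn n →L[ℝ] ℝ)) ∞
    (fun x : M => TotalSpace.mk' (Rn n →L[ℝ] Rn n →L[ℝ] ℝ) x (h x))

/-- Symmetry of a `(0,2)`-tensor field. -/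
def SymmTensor (h : TwoTensor n M) : Prop := ∀ (x : M) (v w : Tan n x), h x v w = h x w v

/-- A function `f (x, z, p)`, `(x, p) ∈ T^* M`, `z ∈ ℝ`, is smooth on `T^* M × ℝ`. -/
def SmoothRHS [IsManifold (𝓡∂ n) ∞ M] (f : ∀ x : M, ℝ → Cotan n x → ℝ) : Prop :=
  ContMDiff (((𝓡∂ n).prod 𝓘(ℝ, Rn n →L[ℝ] ℝ)).prod 𝓘(ℝ, ℝ)) 𝓘(ℝ, ℝ) ∞
    (fun w : CotangentBundle n M × ℝ => f w.1.1 w.2 w.1.2)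

/-! ### Coordinate expressions

Everything below is written in the chart `φ` centred at `c : M`, as a function of the
coordinates `y ∈ φ (source)`, a relatively open subset of the half space
`range (𝓡∂ n) ⊆ ℝⁿ`. -/

/-- The partial derivative `∂_i h` of a function on the half space (one-sided on its boundary). -/
def pd (i : Fin n) (h : Rn n → ℝ) (y : Rn n) : ℝ :=
  fderivWithin ℝ h (range (𝓡∂ n)) y (stdVec i)

/-- The coordinate vector field `∂/∂y_i` of the chart centred at `c`, at the point with
coordinates `y`. -/
def coordVec (c : M) (y : Rn n) (i : Fin n) : Tan n ((extChartAt (𝓡∂ n) c).symm y) :=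
  mfderivWithin 𝓘(ℝ, Rn n) (𝓡∂ n) (extChartAt (𝓡∂ n) c).symm (range (𝓡∂ n)) y (stdVec i)

/-- The components `h_{ij}` of a `(0,2)`-tensor field. -/
def coordTensor (h : TwoTensor n M) (c : M) (y : Rn n) : Matrix (Fin n) (Fin n) ℝ :=
  Matrix.of fun i j => h ((extChartAt (𝓡∂ n) c).symm y) (coordVec c y i) (coordVec c y j)

/-- The coordinate expression of a function. -/
def coordFun (u : M → ℝ) (c : M) (y : Rn n) : ℝ := u ((extChartAt (𝓡∂ n) c).symm y)

variable [IsManifold (𝓡∂ n) ∞ M]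

/-- The components `g_{ij}` of the metric. -/
def coordMetric (g : Metric n M) (c : M) (y : Rn n) : Matrix (Fin n) (Fin n) ℝ :=
  coordTensor (fun x => g.inner x) c y

/-- The Christoffel symbols
`Γ^l_{ij} = (1/2) ∑_m g^{lm} (∂_i g_{jm} + ∂_j g_{im} - ∂_m g_{ij})` of the Levi-Civita connection. -/
def christoffel (g : Metric n M) (c : M) (y : Rn n) (l i j : Fin n) : ℝ :=
  (1 / 2) * ∑ m, (coordMetric g c y)⁻¹ l m *
    (pd i (fun y' => coordMetric g c y' j m) y + pd j (fun y' => coordMetric g c y' i m) y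
      - pd m (fun y' => coordMetric g c y' i j) y)

/-- The components `∇_{ij} u = ∂_i ∂_j u - Γ^l_{ij} ∂_l u` of the Hessian `∇² u`. -/
def coordHess (g : Metric n M) (u : M → ℝ) (c : M) (y : Rn n) : Matrix (Fin n) (Fin n) ℝ :=
  Matrix.of fun i j =>
    pd i (pd j (coordFun u c)) y - ∑ l, christoffel g c y l i j * pd l (coordFun u c) y

/-! ### Tensors at a point

At a point `x` we use the frame of coordinate vectors of the chart centred at `x`. -/

/-- The matrix `g_{ij}` of the metric at `x`. -/
def gram (g : Metric n M) (x : M) : Matrix (Fin n) (Fin n) ℝ :=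
  coordMetric g x (extChartAt (𝓡∂ n) x x)

/-- The matrix of a `(0,2)`-tensor field at `x`. -/
def tensorAt (h : TwoTensor n M) (x : M) : Matrix (Fin n) (Fin n) ℝ :=
  coordTensor h x (extChartAt (𝓡∂ n) x x)

/-- The matrix `∇_{ij} u` of the Hessian at `x`. -/
def hess (g : Metric n M) (u : M → ℝ) (x : M) : Matrix (Fin n) (Fin n) ℝ :=
  coordHess g u x (extChartAt (𝓡∂ n) x x)

/-- The Laplacian `Δ u = g^{ij} ∇_{ij} u`. -/
def laplacian (g : Metric n M) (u : M → ℝ) (x : M) : ℝ := ((gram g x)⁻¹ * hess g u x).trace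

/-- The matrix of the `(0,2)`-tensor `Δu g - ∇²u + χ` at `x`. -/
def etaTensor (g : Metric n M) (χ : TwoTensor n M) (u : M → ℝ) (x : M) :
    Matrix (Fin n) (Fin n) ℝ :=
  laplacian g u x • gram g x - hess g u x + tensorAt χ x

/-- The norm `|A|_g = (g^{ik} g^{jl} A_{ij} A_{kl})^{1/2}` of a `(0,2)`-tensor at `x`. -/
def tensorNorm (g : Metric n M) (x : M) (A : Matrix (Fin n) (Fin n) ℝ) : ℝ :=
  Real.sqrt (∑ i, ∑ j, ∑ k, ∑ l, (gram g x)⁻¹ i k * (gram g x)⁻¹ j l * A i j * A k l)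

/-- The norm `|p|_g = (g^{ij} p_i p_j)^{1/2}` of a covector at `x`. -/
def covecNorm (g : Metric n M) (x : M) (p : Cotan n x) : ℝ :=
  Real.sqrt (∑ i, ∑ j, (gram g x)⁻¹ i j *
    p (coordVec x (extChartAt (𝓡∂ n) x x) i : Rn n) *
    p (coordVec x (extChartAt (𝓡∂ n) x x) j : Rn n))

/-- The differential `∇u ∈ T_x^* M`. -/
def grad (u : M → ℝ) (x : M) : Cotan n x := mfderiv (𝓡∂ n) 𝓘(ℝ, ℝ) u x

/-! ### The equation -/

/-- The eigenvalues, with multiplicity, of the symmetric `(0,2)`-tensor with matrix `A` at `x`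
with respect to the metric `g`: the roots `t` of `det (t - g⁻¹ A)`. -/
def eigenvals (g : Metric n M) (x : M) (A : Matrix (Fin n) (Fin n) ℝ) : Multiset ℝ :=
  ((gram g x)⁻¹ * A).charpoly.roots

/-- The Gårding cone `Γ_k`, for unordered tuples `λ` of real numbers: `σ_j(λ) > 0` for
`j = 1, …, k`. -/
def gardingCone (k : ℕ) : Set (Multiset ℝ) := {s | ∀ j, 1 ≤ j → j ≤ k → 0 < s.esymm j}

/-- `u` is admissible: `λ(Δu g - ∇²u + χ) ∈ Γ_k` at every point. -/
def Admissible (g : Metric n M) (χ : TwoTensor n M) (k : ℕ) (u : M → ℝ) : Prop :=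
  ∀ x : M, eigenvals g x (etaTensor g χ u x) ∈ gardingCone k

/-- `u` solves `σ_k(λ(Δu g - ∇²u + χ)) = f(x, u, ∇u)`. -/
def IsSolution (g : Metric n M) (χ : TwoTensor n M) (k : ℕ)
    (f : ∀ x : M, ℝ → Cotan n x → ℝ) (u : M → ℝ) : Prop :=
  ∀ x : M, (eigenvals g x (etaTensor g χ u x)).esymm k = f x (u x) (grad u x)

/-! ### Norms -/

/-- `|u|_{C¹} ≤ K`. -/
def C1NormLE (g : Metric n M) (u : M → ℝ) (K : ℝ) : Prop :=
  ∀ x : M, |u x| ≤ K ∧ covecNorm g x (grad u x) ≤ K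

/-- `|u|_{C²} ≤ K`. -/
def C2NormLE (g : Metric n M) (u : M → ℝ) (K : ℝ) : Prop :=
  C1NormLE g u K ∧ ∀ x : M, tensorNorm g x (hess g u x) ≤ K

variable (n M) in
/-- A finite family of charts together with compact subsets of their domains which cover `M`;
it is used to define `C²` norms on (subsets of) `T^* M × ℝ`. -/
structure ChartCover where
  /-- the centres of the charts -/
  centers : Finset M
  /-- the compact pieces -/
  piece : M → Set M
  isCompact_piece : ∀ c ∈ centers, IsCompact (piece c)
  piece_subset : ∀ c ∈ centers, piece c ⊆ (chartAt (EuclideanHalfSpace n) c).source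
  cover : ∀ x : M, ∃ c ∈ centers, x ∈ piece c

/-- The covector at the point with coordinates `y` (in the chart `φ` centred at `c`) whose
components are those of `q`: it is `q ∘ dφ`. -/
def coordCovec (c : M) (y : Rn n) (q : Rn n →L[ℝ] ℝ) :
    Cotan n ((extChartAt (𝓡∂ n) c).symm y) :=
  q.comp (mfderiv (𝓡∂ n) 𝓘(ℝ, Rn n) (extChartAt (𝓡∂ n) c) ((extChartAt (𝓡∂ n) c).symm y))

/-- The expression of `f` in the coordinates `(y, z, q)` of `T^* M × ℝ` induced by the chart
centred at `c`. -/
def coordRHS (f : ∀ x : M, ℝ → Cotan n x → ℝ) (c : M)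
    (w : Rn n × ℝ × (Rn n →L[ℝ] ℝ)) : ℝ :=
  f ((extChartAt (𝓡∂ n) c).symm w.1) w.2.1 (coordCovec c w.1 w.2.2)

/-- The `C²` norm, with respect to the finite family of charts `𝒜`, of `f` on the compact set
`{(x, z, p) ∈ T^* M × ℝ : |z| ≤ R, |p|_g ≤ R}` is at most `K`. -/
def RHSNormLE (𝒜 : ChartCover n M) (g : Metric n M) (f : ∀ x : M, ℝ → Cotan n x → ℝ)
    (R K : ℝ) : Prop :=
  ∀ c ∈ 𝒜.centers, ∀ y ∈ extChartAt (𝓡∂ n) c '' 𝒜.piece c, ∀ (z : ℝ) (q : Rn n →L[ℝ] ℝ),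
    |z| ≤ R → covecNorm g ((extChartAt (𝓡∂ n) c).symm y) (coordCovec c y q) ≤ R →
    ∀ m ≤ 2, ‖iteratedFDerivWithin ℝ m (coordRHS f c) (range (𝓡∂ n) ×ˢ univ) (y, z, q)‖ ≤ K

end Manifold

end HessianEq

end

/-!
The interior part of the Hessian estimate is a maximum principle argument; everything else serves
to reduce the theorem to an inequality between finitely many numbers at one point.

*The test function.* With `θ = (tr χ / (n - 1)) g - χ` and `W = ∇²u + θ` the tensor in the equation
is `(tr W) g - W`. If there is no admissible function, there is nothing to prove, and otherwise one
admissible `u_*` is fixed once and for all; a constant depending on it depends on `(M, g)`, `χ` and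
`k` only. Consider the maximum over `M` and over all tangent vectors `v ≠ 0` of
`exp ((b / 2) |∇u|² + a (u_* - u)) * W(v, v) / g(v, v)`, with `b` small and `a` large. The exponent
is bounded, so it suffices to bound the largest eigenvalue `w_o` of `W` at the maximum point
(`exists_max`): as `tr W > 0` in the cone, a bound from above for the eigenvalues bounds the Hessian
(`tensorNorm_hess_le`). At a boundary point `w_o` is bounded by the boundary values of the Hessian
(`le_tensorNorm_hess`). An interior point yields the data `InteriorMax` in a chart
(`exists_interiorMax`), for which `exists_bound_at_interiorMax` gives the estimate.

*The inequality at the maximum.* In normal coordinates and a frame diagonalizing `W`, the first and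
second order conditions and the equation, differentiated once and twice, become the relations of
`MaxPointData` (`exists_maxPointData`). Let `η_i = tr W - w_i`, `s_i = ∂ log σ_k / ∂η_i`, `T = ∑ s_i`
and let `G_i = T - s_i` be the coefficients of the linearized operator. The logarithm of `σ_k` is
concave on `Γ_k` (`InCone.es_mul_hessian_le`, from the superadditivity of the quotients
`σ_{j+1} / σ_j`, see `InCone.add_and_esq_add`), so the second derivative of the equation has a favourable sign up to
`O(w_o²)` from the right hand side and terms linear in third derivatives, which the first order
condition expresses through first and second derivatives. The right hand side enters only through
bounds on its derivatives, hence needs no convexity in the gradient. The weight contributes the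
good term `(b / 2) ∑ G_i w_i²` (`MaxPointData.combined`). Three cases remain
(`exists_bound_at_max`).

* Some `w_j`, `j ≠ o`, is comparable to `w_o`. Since `s_o` is the largest of the `s_i` and `G_j`
  contains it, `G_j` is comparable to `T`, so the good term is of order `T w_o²`, whereas the error
  terms are of order `T w_o`. This is where the structure `(tr W) g - W` is decisive.
* All other eigenvalues are small compared with `w_o`, and `k < n`. Then `η / w_o` is close to
  `(0, 1, …, 1)`, where `σ_k > 0`, and the bound on `σ_k` bounds `w_o`.
* The same with `k = n`. Here the terms with the squared first derivatives of the weight are absorbed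
  by the third order terms in the concavity inequality (`MaxPointData.third_order_absorbed`), and
  the barrier `u_*`, whose tensor is positive definite uniformly on the compact `M`, gives
  `a ∑ G_i ∂_i² (u_* - u) ≥ a ε T - O(a)`. This bounds `T`, and `w_o` is at most a multiple of `T`.

*Derivatives without tensor calculus.* Instead of commuting covariant derivatives, second
derivatives along coordinate curves are tracked as jets of curves (`HasJet`). The frame is
orthonormal to first order along these curves, so that the remainders are of lower order.
That the maximum, the norms and the equation can be read in any chart rests on the transformation
law of the Hessian, proved from the Koszul formula (`hessian_pullback`), and on the fact that the
coefficients of the characteristic polynomial do not depend on the frame.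
-/

set_option linter.unusedSectionVars false

/-! ### Elementary symmetric functions and the Gårding cone -/

namespace HessianEq

section Esymm

variable {ι : Type*} [DecidableEq ι]

/-- The `k`-th elementary symmetric function of the family `(x i)_{i ∈ s}`. Keeping the index set
`s` as an argument makes `σ_k(x | i)`, the function with the variable `i` left out, available as
`es (s.erase i) x k`. -/
noncomputable def es (s : Finset ι) (x : ι → ℝ) (k : ℕ) : ℝ :=
  ∑ t ∈ s.powersetCard k, ∏ i ∈ t, x i

@[simp] lemma es_zero (s : Finset ι) (x : ι → ℝ) : es s x 0 = 1 := by simp [es]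

lemma es_insert {s : Finset ι} {i : ι} (hi : i ∉ s) (x : ι → ℝ) (k : ℕ) :
    es (insert i s) x (k + 1) = es s x (k + 1) + x i * es s x k := by
  unfold es
  rw [Finset.powersetCard_succ_insert hi, Finset.sum_union, Finset.sum_image, Finset.mul_sum]
  · congr 1
    refine Finset.sum_congr rfl fun t ht => ?_
    rw [Finset.prod_insert]
    exact fun h => hi ((Finset.mem_powersetCard.1 ht).1 h)
  · intro t ht t' ht' h
    have h1 : i ∉ t := fun h => hi ((Finset.mem_powersetCard.1 ht).1 h)
    have h2 : i ∉ t' := fun h => hi ((Finset.mem_powersetCard.1 ht').1 h)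
    rw [← Finset.erase_insert h1, ← Finset.erase_insert h2, h]
  · rw [Finset.disjoint_left]
    intro t ht ht'
    obtain ⟨t', -, rfl⟩ := Finset.mem_image.1 ht'
    exact hi ((Finset.mem_powersetCard.1 ht).1 (Finset.mem_insert_self _ _))

lemma es_erase {s : Finset ι} {i : ι} (hi : i ∈ s) (x : ι → ℝ) (k : ℕ) :
    es s x (k + 1) = es (s.erase i) x (k + 1) + x i * es (s.erase i) x k := by
  rw [← es_insert (Finset.notMem_erase i s), Finset.insert_erase hi]

@[simp] lemma es_empty_succ (x : ι → ℝ) (k : ℕ) : es ∅ x (k + 1) = 0 := by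
  unfold es
  rw [Finset.powersetCard_eq_empty.2 (by simp), Finset.sum_empty]

lemma es_congr {s : Finset ι} {x y : ι → ℝ} (h : ∀ i ∈ s, x i = y i) (k : ℕ) :
    es s x k = es s y k := by
  unfold es
  refine Finset.sum_congr rfl fun t ht => Finset.prod_congr rfl fun i hi => ?_
  exact h i ((Finset.mem_powersetCard.1 ht).1 hi)

lemma es_smul (s : Finset ι) (c : ℝ) (x : ι → ℝ) (k : ℕ) :
    es s (fun i => c * x i) k = c ^ k * es s x k := by
  unfold es
  rw [Finset.mul_sum]
  refine Finset.sum_congr rfl fun t ht => ?_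
  rw [Finset.prod_mul_distrib, Finset.prod_const, (Finset.mem_powersetCard.1 ht).2]

lemma es_one (s : Finset ι) (x : ι → ℝ) : es s x 1 = ∑ i ∈ s, x i := by
  unfold es
  rw [Finset.powersetCard_one, Finset.sum_map]
  simp

lemma es_card (s : Finset ι) (x : ι → ℝ) : es s x s.card = ∏ i ∈ s, x i := by
  simp [es, Finset.powersetCard_self]

/-- A sum over pairs `(t, i)` with `i ∈ t ⊆ s`, `#t = k + 1`, can be taken over `i` and
`t \ {i}`. -/
lemma sum_powersetCard_succ (s : Finset ι) (k : ℕ) (F : ι → Finset ι → ℝ) :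
    ∑ t ∈ s.powersetCard (k + 1), ∑ i ∈ t, F i (t.erase i)
      = ∑ i ∈ s, ∑ t ∈ (s.erase i).powersetCard k, F i t := by
  rw [Finset.sum_sigma', Finset.sum_sigma']
  refine Finset.sum_bij' (fun p _ => ⟨p.2, p.1.erase p.2⟩) (fun p _ => ⟨insert p.1 p.2, p.1⟩)
    ?_ ?_ ?_ ?_ ?_
  · rintro ⟨t, i⟩ h
    simp only [Finset.mem_sigma, Finset.mem_powersetCard] at h ⊢
    refine ⟨h.1.1 h.2, Finset.erase_subset_erase _ h.1.1, ?_⟩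
    rw [Finset.card_erase_of_mem h.2, h.1.2]; rfl
  · rintro ⟨i, t⟩ h
    simp only [Finset.mem_sigma, Finset.mem_powersetCard] at h ⊢
    have hi : i ∉ t := fun hh => Finset.notMem_erase i s (h.2.1 hh)
    refine ⟨⟨Finset.insert_subset h.1 (h.2.1.trans (Finset.erase_subset _ _)), ?_⟩,
      Finset.mem_insert_self _ _⟩
    rw [Finset.card_insert_of_notMem hi, h.2.2]
  · rintro ⟨t, i⟩ h
    simp only [Finset.mem_sigma] at h
    simp [Finset.insert_erase h.2]
  · rintro ⟨i, t⟩ h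
    simp only [Finset.mem_sigma, Finset.mem_powersetCard] at h
    have hi : i ∉ t := fun hh => Finset.notMem_erase i s (h.2.1 hh)
    simp [Finset.erase_insert hi]
  · rintro ⟨t, i⟩ h
    rfl

lemma sum_mul_es_erase (s : Finset ι) (x : ι → ℝ) (k : ℕ) :
    ∑ i ∈ s, x i * es (s.erase i) x k = (k + 1) * es s x (k + 1) := by
  have := sum_powersetCard_succ s k (fun i t => x i * ∏ j ∈ t, x j)
  simp only [← Finset.mul_sum] at this
  unfold es
  rw [← this, Finset.mul_sum]
  refine Finset.sum_congr rfl fun t ht => ?_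
  rw [Finset.sum_congr rfl (fun i hi => Finset.mul_prod_erase t x hi), Finset.sum_const,
    (Finset.mem_powersetCard.1 ht).2]
  simp

lemma sum_es_erase (s : Finset ι) (x : ι → ℝ) (k : ℕ) :
    ∑ i ∈ s, es (s.erase i) x k = (s.card - k) * es s x k := by
  rcases k with _ | k
  · simp
  · have h : ∑ i ∈ s, es (s.erase i) x (k + 1)
        = ∑ i ∈ s, (es s x (k + 1) - x i * es (s.erase i) x k) :=
      Finset.sum_congr rfl fun i hi => by rw [es_erase hi]; ring
    rw [h, Finset.sum_sub_distrib, sum_mul_es_erase, Finset.sum_const]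
    push_cast
    simp only [nsmul_eq_mul]
    ring

/-! The inequality `σ_j σ_{j+2} ≤ σ_{j+1}²` (a weak form of Newton's): the polynomial
`∏ (1 + x_i X)` and all its derivatives split over `ℝ`. -/

open Polynomial in
lemma splits_derivative {p : ℝ[X]} (hp : p.Splits) : p.derivative.Splits := by
  rw [splits_iff_card_roots]
  refine le_antisymm (card_roots' _) ?_
  have h1 := card_roots_le_derivative p
  rw [splits_iff_card_roots.1 hp] at h1
  have h2 := natDegree_derivative_le p
  omega

open Polynomial in
lemma two_mul_coeff_le_of_splits {p : ℝ[X]} (hp : p.Splits) :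
    2 * (p.coeff 0 * p.coeff 2) ≤ p.coeff 1 ^ 2 := by
  have key : ∀ m : Multiset ℝ, 2 * ((m.map fun a => X - C a).prod.coeff 0 *
      (m.map fun a => X - C a).prod.coeff 2) ≤ ((m.map fun a => X - C a).prod.coeff 1) ^ 2 := by
    intro m
    induction m using Multiset.induction with
    | empty => simp [coeff_one]
    | cons r m ih =>
      rw [Multiset.map_cons, Multiset.prod_cons]
      set q := (m.map fun a => X - C a).prod
      have e0 : ((X - C r) * q).coeff 0 = - r * q.coeff 0 := by simp [sub_mul]
      have e1 : ((X - C r) * q).coeff 1 = q.coeff 0 - r * q.coeff 1 := by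
        simp [sub_mul, coeff_X_mul]
      have e2 : ((X - C r) * q).coeff 2 = q.coeff 1 - r * q.coeff 2 := by
        simp [sub_mul, coeff_X_mul]
      rw [e0, e1, e2]
      nlinarith [mul_nonneg (sq_nonneg r) (sub_nonneg.2 ih), sq_nonneg (q.coeff 0)]
  rw [hp.eq_prod_roots]
  simp only [coeff_C_mul]
  nlinarith [mul_nonneg (sq_nonneg p.leadingCoeff) (sub_nonneg.2 (key p.roots))]

open Polynomial in
lemma coeff_prod_one_add (s : Finset ι) (x : ι → ℝ) (k : ℕ) :
    (∏ i ∈ s, (1 + C (x i) * X)).coeff k = es s x k := by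
  induction s using Finset.induction_on generalizing k with
  | empty => rcases k with _ | k <;> simp [coeff_one]
  | insert i s hi ih =>
    rw [Finset.prod_insert hi]
    rcases k with _ | k
    · have := ih 0
      simp [add_mul, mul_assoc, this]
    · rw [es_insert hi, add_mul, one_mul, coeff_add, ih, mul_assoc, coeff_C_mul, coeff_X_mul, ih]

open Polynomial in
/-- A weak form of Newton's inequalities. -/
lemma es_mul_es_le (s : Finset ι) (x : ι → ℝ) (j : ℕ) :
    es s x j * es s x (j + 2) ≤ es s x (j + 1) ^ 2 := by
  set p := ∏ i ∈ s, (1 + C (x i) * X) with hp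
  have hs : p.Splits := Splits.prod fun i _ => by
    apply Splits.of_natDegree_le_one
    compute_degree
  have hd : ∀ j, (derivative^[j] p).Splits := by
    intro j
    induction j with
    | zero => exact hs
    | succ j ih => rw [Function.iterate_succ_apply']; exact splits_derivative ih
  have h := two_mul_coeff_le_of_splits (hd j)
  simp only [coeff_iterate_derivative, hp, coeff_prod_one_add, nsmul_eq_mul] at h
  rw [zero_add, Nat.descFactorial_self, add_comm 1 j, add_comm 2 j] at h
  have f1 : ((j + 1).descFactorial j : ℝ) = (j + 1) * (j.factorial : ℝ) := by
    have := Nat.factorial_mul_descFactorial (show j ≤ j + 1 by omega)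
    rw [show j + 1 - j = 1 by omega, Nat.factorial_one, one_mul] at this
    rw [this, Nat.factorial_succ]; push_cast; ring
  have f2 : 2 * ((j + 2).descFactorial j : ℝ) = (j + 2) * (j + 1) * (j.factorial : ℝ) := by
    have := Nat.factorial_mul_descFactorial (show j ≤ j + 2 by omega)
    rw [show j + 2 - j = 2 by omega] at this
    have h2 : (2 : ℝ) * ((j + 2).descFactorial j : ℝ) = ((j + 2).factorial : ℝ) := by
      exact_mod_cast this
    rw [h2, Nat.factorial_succ, Nat.factorial_succ]; push_cast; ring
  set a := es s x j
  set b := es s x (j + 1)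
  set c := es s x (j + 2)
  have hj : (0 : ℝ) < j.factorial := by positivity
  rw [f1] at h
  have h' : (j.factorial : ℝ) ^ 2 * ((j + 1) * ((j + 2) * (a * c)))
      ≤ (j.factorial : ℝ) ^ 2 * ((j + 1) * ((j + 1) * b ^ 2)) := by
    calc _ = (j.factorial : ℝ) * a * (((j + 2) * (j + 1) * (j.factorial : ℝ)) * c) := by ring
      _ = 2 * ((j.factorial : ℝ) * a * (((j + 2).descFactorial j : ℝ) * c)) := by
          rw [← f2]; ring
      _ ≤ _ := h
      _ = _ := by ring
  have h3 := le_of_mul_le_mul_left h' (by positivity)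
  have h4 : ((j : ℝ) + 2) * (a * c) ≤ (j + 1) * b ^ 2 :=
    le_of_mul_le_mul_left h3 (by positivity)
  have hj' : (0 : ℝ) ≤ j := by positivity
  rcases le_or_gt (a * c) 0 with hn | hn
  · exact hn.trans (sq_nonneg _)
  · nlinarith [mul_nonneg hj' hn.le]

/-- The Gårding cone `Γ_k` for families indexed by a finite set; the condition at `j = 0` is
vacuous. -/
def InCone (s : Finset ι) (x : ι → ℝ) (k : ℕ) : Prop := ∀ j ≤ k, 0 < es s x j

lemma InCone.mono {s : Finset ι} {x : ι → ℝ} {k l : ℕ} (h : InCone s x k) (hl : l ≤ k) :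
    InCone s x l := fun j hj => h j (hj.trans hl)

/-- Leaving out one variable maps `Γ_{k+1}` to `Γ_k`. -/
lemma InCone.erase {s : Finset ι} {x : ι → ℝ} {k : ℕ} (h : InCone s x (k + 1)) {i : ι}
    (hi : i ∈ s) : InCone (s.erase i) x k := by
  intro j
  induction j with
  | zero => intro _; simp
  | succ j ih =>
    intro hj
    have h0 := ih (by omega)
    by_contra! hneg
    have h1 := h (j + 1) (by omega)
    have h2 := h (j + 2) (by omega)
    rw [es_erase hi] at h1 h2
    have hN := es_mul_es_le (s.erase i) x j
    set a := es (s.erase i) x j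
    set b := es (s.erase i) x (j + 1)
    set c := es (s.erase i) x (j + 2)
    have hx : 0 < x i := by
      by_contra! hx
      nlinarith [mul_nonneg (neg_nonneg.2 hx) h0.le]
    nlinarith [mul_pos h0 h2, mul_nonneg (neg_nonneg.2 hneg) h1.le]

/-- The quotient `q_j = σ_{j+1} / σ_j`. -/
noncomputable def esq (s : Finset ι) (x : ι → ℝ) (j : ℕ) : ℝ := es s x (j + 1) / es s x j

lemma esq_smul (s : Finset ι) {c : ℝ} (hc : 0 < c) (x : ι → ℝ) (j : ℕ) :
    esq s (fun i => c * x i) j = c * esq s x j := by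
  unfold esq
  rw [es_smul, es_smul, pow_succ, mul_comm (c ^ j) c, mul_assoc, mul_div_assoc,
    mul_div_mul_left _ _ (pow_ne_zero _ hc.ne')]

lemma InCone.esq_pos {s : Finset ι} {x : ι → ℝ} {k : ℕ} (h : InCone s x (k + 1)) {j : ℕ}
    (hj : j ≤ k) : 0 < esq s x j := div_pos (h _ (by omega)) (h _ (by omega))

/-- The recursion behind the concavity of `q_j`. -/
lemma InCone.mul_esq_succ {s : Finset ι} {x : ι → ℝ} {k : ℕ} (h : InCone s x (k + 1)) :
    ((k : ℝ) + 2) * esq s x (k + 1)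
      = ∑ i ∈ s, (x i - x i ^ 2 / (x i + esq (s.erase i) x k)) := by
  have hpos := h (k + 1) le_rfl
  unfold esq
  rw [← mul_div_assoc, show ((k : ℝ) + 2) = ((k + 1 : ℕ) : ℝ) + 1 by push_cast; ring,
    ← sum_mul_es_erase, Finset.sum_div]
  refine Finset.sum_congr rfl fun i hi => ?_
  have hp := h.erase hi k le_rfl
  have he := es_erase hi x k
  have h1 : x i + es (s.erase i) x (k + 1) / es (s.erase i) x k
      = es s x (k + 1) / es (s.erase i) x k := by
    rw [he]; field_simp; ring
  rw [h1, div_div_eq_mul_div]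
  field_simp
  rw [he]; ring

lemma add_sq_div_add_le {a b p q : ℝ} (hp : 0 < p) (hq : 0 < q) :
    (a + b) ^ 2 / (p + q) ≤ a ^ 2 / p + b ^ 2 / q := by
  rw [div_add_div _ _ hp.ne' hq.ne', div_le_div_iff₀ (by positivity) (by positivity)]
  nlinarith [mul_nonneg (mul_nonneg hp.le hq.le) (sq_nonneg (a * q - b * p)),
    sq_nonneg (a * q - b * p)]

/-- Marcus–Lopes: `Γ_k` is closed under addition and `q_j` is superadditive on `Γ_{j+1}`. -/
lemma InCone.add_and_esq_add (k : ℕ) : ∀ {s : Finset ι} {x y : ι → ℝ}, InCone s x k →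
    InCone s y k → InCone s (fun i => x i + y i) k ∧
      ∀ j, j + 1 ≤ k → esq s x j + esq s y j ≤ esq s (fun i => x i + y i) j := by
  induction k with
  | zero =>
    intro s x y _ _
    exact ⟨fun j hj => by rw [Nat.le_zero.1 hj]; simp, fun j hj => by omega⟩
  | succ k ih =>
    intro s x y hx hy
    obtain ⟨hc, hq⟩ := ih (hx.mono (by omega)) (hy.mono (by omega))
    have main : esq s x k + esq s y k ≤ esq s (fun i => x i + y i) k := by
      rcases k with _ | k
      · simp [esq, es_one, Finset.sum_add_distrib]
      · have hx' := hx.mono (show k + 1 ≤ k + 2 by omega)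
        have hy' := hy.mono (show k + 1 ≤ k + 2 by omega)
        have key : ((k : ℝ) + 2) * (esq s x (k + 1) + esq s y (k + 1))
            ≤ (k + 2) * esq s (fun i => x i + y i) (k + 1) := by
          rw [mul_add, hx'.mul_esq_succ, hy'.mul_esq_succ, hc.mul_esq_succ,
            ← Finset.sum_add_distrib]
          refine Finset.sum_le_sum fun i hi => ?_
          have den : ∀ z : ι → ℝ, InCone s z (k + 1) → 0 < z i + esq (s.erase i) z k := by
            intro z hz
            have hp := hz.erase hi k le_rfl
            have he := es_erase hi z k
            have : z i + esq (s.erase i) z k = es s z (k + 1) / es (s.erase i) z k := by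
              unfold esq; rw [he]; field_simp; ring
            rw [this]
            exact div_pos (hz _ le_rfl) hp
          have dx := den x hx'
          have dy := den y hy'
          have dz := den _ hc
          have hsup : esq (s.erase i) x k + esq (s.erase i) y k
              ≤ esq (s.erase i) (fun i => x i + y i) k :=
            (ih (hx.erase hi) (hy.erase hi)).2 k le_rfl
          have h1 : (x i + y i) ^ 2 / (x i + y i + esq (s.erase i) (fun i => x i + y i) k)
              ≤ (x i + y i) ^ 2 /
                ((x i + esq (s.erase i) x k) + (y i + esq (s.erase i) y k)) := by
            apply div_le_div_of_nonneg_left (sq_nonneg _) (add_pos dx dy)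
            linarith
          have h2 : (x i + y i) ^ 2 /
                ((x i + esq (s.erase i) x k) + (y i + esq (s.erase i) y k))
              ≤ x i ^ 2 / (x i + esq (s.erase i) x k) + y i ^ 2 / (y i + esq (s.erase i) y k) :=
            add_sq_div_add_le dx dy
          linarith
        exact le_of_mul_le_mul_left key (by positivity)
    have hcone : InCone s (fun i => x i + y i) (k + 1) := by
      intro j hj
      rcases Nat.lt_or_ge j (k + 1) with hj' | hj'
      · exact hc j (by omega)
      · obtain rfl : j = k + 1 := le_antisymm hj hj'
        have h0 := hc k le_rfl
        have : 0 < esq s (fun i => x i + y i) k :=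
          lt_of_lt_of_le (add_pos (hx.esq_pos le_rfl) (hy.esq_pos le_rfl)) main
        unfold esq at this
        have := mul_pos this h0
        rwa [div_mul_cancel₀ _ h0.ne'] at this
    refine ⟨hcone, fun j hj => ?_⟩
    rcases Nat.lt_or_ge j k with hj' | hj'
    · exact hq j (by omega)
    · obtain rfl : j = k := by omega
      exact main

lemma InCone.es_eq_prod {s : Finset ι} {x : ι → ℝ} {k : ℕ} (h : InCone s x k) :
    es s x k = ∏ j ∈ Finset.range k, esq s x j := by
  induction k with
  | zero => simp
  | succ k ih =>
    rw [Finset.prod_range_succ, ← ih (h.mono (by omega)), esq, mul_div_cancel₀]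
    exact (h k (by omega)).ne'

/-- Midpoint log-concavity of `σ_k` on `Γ_k`. -/
lemma InCone.es_mul_es_le_sq {s : Finset ι} {x b : ι → ℝ} {k : ℕ}
    (h1 : InCone s (fun i => x i + b i) k) (h2 : InCone s (fun i => x i - b i) k)
    (hx : InCone s x k) :
    es s (fun i => x i + b i) k * es s (fun i => x i - b i) k ≤ es s x k ^ 2 := by
  rw [h1.es_eq_prod, h2.es_eq_prod, hx.es_eq_prod, ← Finset.prod_mul_distrib, ← Finset.prod_pow]
  refine Finset.prod_le_prod (fun j hj => ?_) fun j hj => ?_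
  · have hj := Finset.mem_range.1 hj
    obtain ⟨k, rfl⟩ : ∃ l, k = l + 1 := ⟨k - 1, by omega⟩
    exact (mul_pos (h1.esq_pos (by omega)) (h2.esq_pos (by omega))).le
  · have hj := Finset.mem_range.1 hj
    have h := (InCone.add_and_esq_add k h1 h2).2 j (by omega)
    have e : (fun i => x i + b i + (x i - b i)) = fun i => 2 * x i := by ext i; ring
    rw [e, esq_smul _ two_pos] at h
    obtain ⟨k, rfl⟩ : ∃ l, k = l + 1 := ⟨k - 1, by omega⟩
    have p1 := h1.esq_pos (show j ≤ k by omega)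
    have p2 := h2.esq_pos (show j ≤ k by omega)
    nlinarith [sq_nonneg (esq s (fun i => x i + b i) j - esq s (fun i => x i - b i) j)]

/-- `q_{k} ≤ σ_{k+1}^{1/(k+1)}`, because `q_0 ≥ q_1 ≥ …` by Newton's inequalities. -/
lemma InCone.esq_pow_le {s : Finset ι} {x : ι → ℝ} {k : ℕ} (h : InCone s x (k + 1)) :
    esq s x k ^ (k + 1) ≤ es s x (k + 1) := by
  have mono : ∀ m j, m + j = k → esq s x k ≤ esq s x j := by
    intro m
    induction m with
    | zero => intro j hj; rw [show j = k by omega]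
    | succ m ih =>
      intro j hj
      refine (ih (j + 1) (by omega)).trans ?_
      unfold esq
      rw [div_le_div_iff₀ (h _ (by omega)) (h _ (by omega))]
      nlinarith [es_mul_es_le s x j]
  have hc : esq s x k ^ (k + 1) = ∏ _j ∈ Finset.range (k + 1), esq s x k := by simp
  rw [h.es_eq_prod, hc]
  refine Finset.prod_le_prod (fun j _ => (h.esq_pos le_rfl).le) fun j hj => ?_
  have hj := Finset.mem_range.1 hj
  exact mono (k - j) j (by omega)

end Esymm

end HessianEq

/-! ### Second order jets of curves -/

namespace HessianEq

open Filter Topology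

section Jet

variable {E F G : Type*} [NormedAddCommGroup E] [NormedSpace ℝ E]
  [NormedAddCommGroup F] [NormedSpace ℝ F] [NormedAddCommGroup G] [NormedSpace ℝ G]

/-- The curve `f` is twice differentiable at `0`, with `f 0 = a`, `f' 0 = b` and `f'' 0 = c`. -/
def HasJet (f : ℝ → E) (a b c : E) : Prop :=
  f 0 = a ∧ ∃ f' : ℝ → E, (∀ᶠ t in 𝓝 (0 : ℝ), HasDerivAt f (f' t) t) ∧ f' 0 = b ∧
    HasDerivAt f' c 0

namespace HasJet

variable {f g : ℝ → E} {a b c a' b' c' : E}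

lemma hasDerivAt (h : HasJet f a b c) : HasDerivAt f b 0 := by
  obtain ⟨-, f', h1, rfl, -⟩ := h
  exact h1.self_of_nhds

lemma continuousAt (h : HasJet f a b c) : ContinuousAt f 0 := h.hasDerivAt.continuousAt

lemma congr (h : HasJet f a b c) (hg : g =ᶠ[𝓝 0] f) : HasJet g a b c := by
  obtain ⟨h0, f', h1, h2, h3⟩ := h
  refine ⟨hg.self_of_nhds.trans h0, f', ?_, h2, h3⟩
  filter_upwards [h1, hg.eventuallyEq_nhds] with t ht ht'
  exact ht.congr_of_eventuallyEq ht'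

lemma unique (h : HasJet f a b c) (h' : HasJet f a' b' c') : a = a' ∧ b = b' ∧ c = c' := by
  refine ⟨h.1.symm.trans h'.1, h.hasDerivAt.unique h'.hasDerivAt, ?_⟩
  obtain ⟨-, f', h1, -, h3⟩ := h
  obtain ⟨-, g', h1', -, h3'⟩ := h'
  refine h3.unique (h3'.congr_of_eventuallyEq ?_)
  filter_upwards [h1, h1'] with t ht ht'
  exact ht.unique ht'

lemma const (a : E) : HasJet (fun _ => a) a 0 0 :=
  ⟨rfl, fun _ => 0, Eventually.of_forall fun t => hasDerivAt_const t a, rfl, hasDerivAt_const _ _⟩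

/-- The jet of a quadratic curve. -/
lemma quadratic (a b c : E) : HasJet (fun t => a + t • b + (t ^ 2 / 2) • c) a b c := by
  refine ⟨by simp, fun t => b + t • c, Eventually.of_forall fun t => ?_, by simp, ?_⟩
  · have h1 : HasDerivAt (fun t : ℝ => t • b) ((1 : ℝ) • b) t := (hasDerivAt_id t).smul_const b
    have h2 : HasDerivAt (fun t : ℝ => (t ^ 2 / 2) • c) (t • c) t := by
      have := ((hasDerivAt_pow 2 t).div_const 2).smul_const c
      convert this using 2
      ring
    have := (h1.const_add a).add h2
    rw [one_smul] at this
    exact this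
  · have h1 : HasDerivAt (fun t : ℝ => t • c) ((1 : ℝ) • c) 0 := (hasDerivAt_id _).smul_const c
    simpa using h1.const_add b

lemma line (a b : E) : HasJet (fun t => a + t • b) a b 0 := by
  simpa using quadratic a b 0

lemma add (h : HasJet f a b c) (h' : HasJet g a' b' c') :
    HasJet (fun t => f t + g t) (a + a') (b + b') (c + c') := by
  obtain ⟨h0, f', h1, h2, h3⟩ := h
  obtain ⟨h0', g', h1', h2', h3'⟩ := h'
  refine ⟨by simp [h0, h0'], fun t => f' t + g' t, ?_, by simp [h2, h2'], h3.add h3'⟩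
  filter_upwards [h1, h1'] with t ht ht'
  exact ht.add ht'

lemma neg (h : HasJet f a b c) : HasJet (fun t => - f t) (-a) (-b) (-c) := by
  obtain ⟨h0, f', h1, h2, h3⟩ := h
  refine ⟨by simp [h0], fun t => - f' t, ?_, by simp [h2], h3.neg⟩
  filter_upwards [h1] with t ht
  exact ht.neg

lemma sub (h : HasJet f a b c) (h' : HasJet g a' b' c') :
    HasJet (fun t => f t - g t) (a - a') (b - b') (c - c') := by
  simpa [sub_eq_add_neg] using h.add h'.neg

lemma sum {ι : Type*} {s : Finset ι} {f : ι → ℝ → E} {a b c : ι → E}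
    (h : ∀ i ∈ s, HasJet (f i) (a i) (b i) (c i)) :
    HasJet (fun t => ∑ i ∈ s, f i t) (∑ i ∈ s, a i) (∑ i ∈ s, b i) (∑ i ∈ s, c i) := by
  classical
  induction s using Finset.induction_on with
  | empty => simpa using const (0 : E)
  | insert i s hi ih =>
    simp only [Finset.sum_insert hi]
    exact (h i (Finset.mem_insert_self _ _)).add
      (ih fun j hj => h j (Finset.mem_insert_of_mem hj))

/-- Post-composition with a continuous linear map. -/
lemma clm (L : E →L[ℝ] F) (h : HasJet f a b c) : HasJet (fun t => L (f t)) (L a) (L b) (L c) := by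
  obtain ⟨h0, f', h1, h2, h3⟩ := h
  refine ⟨by simp [h0], fun t => L (f' t), ?_, by simp [h2], L.hasFDerivAt.comp_hasDerivAt _ h3⟩
  filter_upwards [h1] with t ht
  exact L.hasFDerivAt.comp_hasDerivAt _ ht

/-- Leibniz rule for a continuous bilinear map. -/
lemma bilin (L : E →L[ℝ] F →L[ℝ] G) {g : ℝ → F} {a' b' c' : F} (h : HasJet f a b c)
    (h' : HasJet g a' b' c') :
    HasJet (fun t => L (f t) (g t)) (L a a') (L b a' + L a b')
      (L c a' + (2 : ℝ) • L b b' + L a c') := by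
  obtain ⟨h0, f', h1, h2, h3⟩ := h
  obtain ⟨h0', g', h1', h2', h3'⟩ := h'
  refine ⟨by simp [h0, h0'], fun t => L (f' t) (g t) + L (f t) (g' t), ?_,
    by simp [h0, h0', h2, h2'], ?_⟩
  · filter_upwards [h1, h1'] with t ht ht'
    have := (L.hasFDerivAt.comp_hasDerivAt _ ht).clm_apply ht'
    simpa using this
  · have A := (L.hasFDerivAt.comp_hasDerivAt _ h3).clm_apply h1'.self_of_nhds
    have B := (L.hasFDerivAt.comp_hasDerivAt _ h1.self_of_nhds).clm_apply h3'
    have := A.add B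
    simp only [Function.comp, h0, h0', h2, h2'] at this
    rw [two_smul]
    have e : ∀ p q r : G, p + (q + q) + r = p + q + (q + r) := fun p q r => by abel
    rw [e]
    exact this

lemma clm_apply {f : ℝ → F →L[ℝ] G} {a b c : F →L[ℝ] G} {g : ℝ → F} {a' b' c' : F}
    (h : HasJet f a b c) (h' : HasJet g a' b' c') :
    HasJet (fun t => f t (g t)) (a a') (b a' + a b') (c a' + (2 : ℝ) • b b' + a c') :=
  bilin (ContinuousLinearMap.id ℝ (F →L[ℝ] G)) h h'

lemma mul {f g : ℝ → ℝ} {a b c a' b' c' : ℝ} (h : HasJet f a b c) (h' : HasJet g a' b' c') :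
    HasJet (fun t => f t * g t) (a * a') (b * a' + a * b') (c * a' + 2 * (b * b') + a * c') := by
  simpa using bilin (ContinuousLinearMap.mul ℝ ℝ) h h'

lemma const_mul {f : ℝ → ℝ} {a b c : ℝ} (r : ℝ) (h : HasJet f a b c) :
    HasJet (fun t => r * f t) (r * a) (r * b) (r * c) := by
  simpa using (const r).mul h

/-- Chain rule for a `C²` map. -/
lemma comp {Φ : E → F} (hΦ : ContDiffAt ℝ 2 Φ a) (h : HasJet f a b c) :
    HasJet (fun t => Φ (f t)) (Φ a) (fderiv ℝ Φ a b)
      (fderiv ℝ (fderiv ℝ Φ) a b b + fderiv ℝ Φ a c) := by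
  have hcont := h.continuousAt
  obtain ⟨h0, f', h1, h2, h3⟩ := h
  refine ⟨by simp only [h0], fun t => fderiv ℝ Φ (f t) (f' t), ?_, by simp only [h0, h2], ?_⟩
  · have hd : ∀ᶠ y in 𝓝 a, DifferentiableAt ℝ Φ y :=
      (hΦ.eventually (by simp)).mono fun y hy => hy.differentiableAt (by simp)
    rw [ContinuousAt, h0] at hcont
    filter_upwards [h1, hcont.eventually hd] with t ht ht'
    exact ht'.hasFDerivAt.comp_hasDerivAt _ ht
  · have hd : HasFDerivAt (fderiv ℝ Φ) (fderiv ℝ (fderiv ℝ Φ) a) (f 0) := by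
      rw [h0]
      exact ((hΦ.fderiv_right (m := 1) (by norm_num)).differentiableAt (by simp)).hasFDerivAt
    have := (hd.comp_hasDerivAt _ h1.self_of_nhds).clm_apply h3
    simp only [Function.comp, h0, h2] at this
    exact this

/-- The jet of a `C²` map along a line. -/
lemma of_contDiffAt {Φ : E → F} {x : E} (hΦ : ContDiffAt ℝ 2 Φ x) (v : E) :
    HasJet (fun t : ℝ => Φ (x + t • v)) (Φ x) (fderiv ℝ Φ x v)
      (fderiv ℝ (fderiv ℝ Φ) x v v) := by
  simpa using comp hΦ (line x v)

/-- First and second order conditions at a local maximum. -/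
lemma of_isLocalMax {f : ℝ → ℝ} {a b c : ℝ} (h : HasJet f a b c)
    (hmax : ∀ᶠ t in 𝓝 0, f t ≤ a) : b = 0 ∧ c ≤ 0 := by
  have hm : IsLocalMax f 0 := by
    filter_upwards [hmax] with t ht
    rw [h.1]; exact ht
  have hb : b = 0 := hm.hasDerivAt_eq_zero h.hasDerivAt
  refine ⟨hb, ?_⟩
  by_contra! hc
  have hcont := h.continuousAt
  have h' := h
  obtain ⟨h0, f', h1, h2, h3⟩ := h
  have hd : deriv f =ᶠ[𝓝 0] f' := h1.mono fun t ht => ht.deriv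
  have hdd : deriv (deriv f) 0 = c := by rw [hd.deriv_eq, h3.deriv]
  have hmin := isLocalMin_of_deriv_deriv_pos (by rw [hdd]; exact hc)
    (by rw [hd.self_of_nhds, h2, hb]) hcont
  have heq : f =ᶠ[𝓝 0] fun _ => a := by
    filter_upwards [hmin, hm] with t ht ht'
    rw [← h0]; exact le_antisymm ht' ht
  have := (h'.unique ((const a).congr heq)).2.2
  linarith

end HasJet

end Jet

/-! ### Principal minors along a curve through a diagonal matrix -/

section Det

variable {m : Type*} [Fintype m] [DecidableEq m]

lemma HasJet.finset_prod {ι : Type*} [DecidableEq ι] {s : Finset ι} {f : ι → ℝ → ℝ}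
    {a b c : ι → ℝ} (h : ∀ i ∈ s, HasJet (f i) (a i) (b i) (c i)) :
    HasJet (fun t => ∏ i ∈ s, f i t) (∏ i ∈ s, a i) (∑ i ∈ s, b i * ∏ j ∈ s.erase i, a j)
      (∑ i ∈ s, c i * ∏ j ∈ s.erase i, a j +
        ∑ i ∈ s, ∑ j ∈ s.erase i, b i * b j * ∏ l ∈ (s.erase i).erase j, a l) := by
  induction s using Finset.induction_on with
  | empty => simpa using HasJet.const (1 : ℝ)
  | insert k s hk ih =>
    have hs := ih fun j hj => h j (Finset.mem_insert_of_mem hj)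
    have := (h k (Finset.mem_insert_self _ _)).mul hs
    have e1 : ∀ i ∈ s, (insert k s).erase i = insert k (s.erase i) := fun i hi =>
      Finset.erase_insert_of_ne (by rintro rfl; exact hk hi)
    have k1 : ∀ i, k ∉ s.erase i := fun i hh => hk (Finset.mem_of_mem_erase hh)
    have E : ∀ d : ι → ℝ, ∑ i ∈ insert k s, d i * ∏ j ∈ (insert k s).erase i, a j
        = d k * ∏ j ∈ s, a j + a k * ∑ i ∈ s, d i * ∏ j ∈ s.erase i, a j := by
      intro d
      rw [Finset.sum_insert hk, Finset.erase_insert hk, Finset.mul_sum]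
      congr 1
      refine Finset.sum_congr rfl fun i hi => ?_
      rw [e1 i hi, Finset.prod_insert (k1 i)]; ring
    have E2 : ∑ i ∈ insert k s, ∑ j ∈ (insert k s).erase i,
          b i * b j * ∏ l ∈ ((insert k s).erase i).erase j, a l
        = 2 * (b k * ∑ i ∈ s, b i * ∏ j ∈ s.erase i, a j)
          + a k * ∑ i ∈ s, ∑ j ∈ s.erase i, b i * b j * ∏ l ∈ (s.erase i).erase j, a l := by
      rw [Finset.sum_insert hk, Finset.erase_insert hk]
      have : ∀ i ∈ s, ∑ j ∈ (insert k s).erase i,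
          b i * b j * ∏ l ∈ ((insert k s).erase i).erase j, a l
          = b k * (b i * ∏ j ∈ s.erase i, a j)
            + a k * ∑ j ∈ s.erase i, b i * b j * ∏ l ∈ (s.erase i).erase j, a l := by
        intro i hi
        rw [e1 i hi, Finset.sum_insert (k1 i), Finset.erase_insert (k1 i), Finset.mul_sum]
        congr 1
        · ring
        · refine Finset.sum_congr rfl fun j hj => ?_
          rw [Finset.erase_insert_of_ne (by rintro rfl; exact k1 i hj), Finset.prod_insert]
          · ring
          · exact fun hh => k1 i (Finset.mem_of_mem_erase hh)
      rw [Finset.sum_congr rfl this, Finset.sum_add_distrib, ← Finset.mul_sum, ← Finset.mul_sum]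
      simp only [mul_assoc, ← Finset.mul_sum]
      ring
    rw [E b, E c, E2, Finset.prod_insert hk]
    simp only [Finset.prod_insert hk]
    convert this using 1
    ring

lemma perm_eq_one_of_fixed {i : m} {σ : Equiv.Perm m} (h : ∀ l, l ≠ i → σ l = l) : σ = 1 := by
  ext l
  by_cases hl : l = i
  · subst hl
    by_contra hne
    exact hne (σ.injective (h _ hne))
  · exact h l hl

lemma perm_eq_of_fixed {i j : m} {σ : Equiv.Perm m}
    (h : ∀ l, l ≠ i → l ≠ j → σ l = l) : σ = 1 ∨ σ = Equiv.swap i j := by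
  by_cases hi : σ i = i
  · left
    refine perm_eq_one_of_fixed (i := j) fun l hl => ?_
    by_cases hli : l = i
    · rw [hli, hi]
    · exact h l hli hl
  · right
    have h1 : σ i = j := by
      by_contra hne
      exact hi (σ.injective (h _ hi hne))
    have h2 : σ j = i := by
      by_contra hne
      by_cases hj : σ j = j
      · exact hi ((σ.injective (h1.trans hj.symm)) ▸ hj)
      · exact hj (σ.injective (h _ hne hj))
    ext l
    by_cases hli : l = i
    · rw [hli, h1, Equiv.swap_apply_left]
    by_cases hlj : l = j
    · rw [hlj, h2, Equiv.swap_apply_right]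
    rw [h l hli hlj, Equiv.swap_apply_of_ne_of_ne hli hlj]

/-- Second order expansion of the determinant at a diagonal matrix: only the identity and the
transpositions contribute. -/
lemma HasJet.det {N : ℝ → Matrix m m ℝ} {η : m → ℝ} {B C : Matrix m m ℝ}
    (h : ∀ i j, HasJet (fun t => N t i j) (Matrix.diagonal η i j) (B i j) (C i j)) :
    HasJet (fun t => (N t).det) (∏ i, η i) (∑ i, B i i * ∏ j ∈ Finset.univ.erase i, η j)
      (∑ i, C i i * ∏ j ∈ Finset.univ.erase i, η j +
        ∑ i, ∑ j ∈ Finset.univ.erase i, (B i i * B j j - B i j * B j i) *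
          ∏ l ∈ (Finset.univ.erase i).erase j, η l) := by
  simp only [Matrix.det_apply']
  have key := HasJet.sum (s := (Finset.univ : Finset (Equiv.Perm m))) fun σ _ =>
    HasJet.const_mul ((Equiv.Perm.sign σ : ℤ) : ℝ)
      (HasJet.finset_prod (s := Finset.univ) fun i _ => h (σ i) i)
  have a0 : ∑ σ : Equiv.Perm m, ((Equiv.Perm.sign σ : ℤ) : ℝ) *
      ∏ i, Matrix.diagonal η (σ i) i = ∏ i, η i := by
    rw [← Matrix.det_apply', Matrix.det_diagonal]
  have single : ∀ (D : Matrix m m ℝ), ∑ σ : Equiv.Perm m, ((Equiv.Perm.sign σ : ℤ) : ℝ) *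
      ∑ i, D (σ i) i * ∏ j ∈ Finset.univ.erase i, Matrix.diagonal η (σ j) j
      = ∑ i, D i i * ∏ j ∈ Finset.univ.erase i, η j := by
    intro D
    simp only [Finset.mul_sum]
    rw [Finset.sum_comm]
    refine Finset.sum_congr rfl fun i _ => ?_
    rw [Finset.sum_eq_single (1 : Equiv.Perm m)]
    · simp
    · intro σ _ hσ
      have : ∃ l, l ≠ i ∧ σ l ≠ l := by
        by_contra! hh
        exact hσ (perm_eq_one_of_fixed hh)
      obtain ⟨l, hl, hl'⟩ := this
      have hz : ∏ j ∈ Finset.univ.erase i, Matrix.diagonal η (σ j) j = 0 :=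
        Finset.prod_eq_zero (i := l) (by simp [hl]) (Matrix.diagonal_apply_ne _ hl')
      rw [hz, mul_zero, mul_zero]
    · simp
  have double : ∑ σ : Equiv.Perm m, ((Equiv.Perm.sign σ : ℤ) : ℝ) *
      ∑ i, ∑ j ∈ Finset.univ.erase i, B (σ i) i * B (σ j) j *
        ∏ l ∈ (Finset.univ.erase i).erase j, Matrix.diagonal η (σ l) l
      = ∑ i, ∑ j ∈ Finset.univ.erase i, (B i i * B j j - B i j * B j i) *
          ∏ l ∈ (Finset.univ.erase i).erase j, η l := by
    simp only [Finset.mul_sum]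
    rw [Finset.sum_comm]
    refine Finset.sum_congr rfl fun i _ => ?_
    rw [Finset.sum_comm]
    refine Finset.sum_congr rfl fun j hj => ?_
    have hij : j ≠ i := Finset.ne_of_mem_erase hj
    have hne : (1 : Equiv.Perm m) ≠ Equiv.swap i j := by
      intro hh
      have := congrArg (fun σ => σ i) hh
      simp only [Equiv.Perm.coe_one, id, Equiv.swap_apply_left] at this
      exact hij this.symm
    rw [Finset.sum_eq_add (1 : Equiv.Perm m) (Equiv.swap i j) hne]
    · have : ∏ l ∈ (Finset.univ.erase i).erase j, Matrix.diagonal η ((Equiv.swap i j) l) l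
          = ∏ l ∈ (Finset.univ.erase i).erase j, η l := by
        refine Finset.prod_congr rfl fun l hl => ?_
        simp only [Finset.mem_erase, Finset.mem_univ, and_true] at hl
        rw [Equiv.swap_apply_of_ne_of_ne hl.2 hl.1, Matrix.diagonal_apply_eq]
      rw [this, Equiv.swap_apply_left, Equiv.swap_apply_right, Equiv.Perm.sign_swap hij.symm]
      simp
      ring
    · intro σ _ hσ
      have : ∃ l, l ≠ i ∧ l ≠ j ∧ σ l ≠ l := by
        by_contra! hh
        rcases perm_eq_of_fixed hh with h | h
        · exact hσ.1 h
        · exact hσ.2 h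
      obtain ⟨l, hl, hl', hl''⟩ := this
      have hz : ∏ l ∈ (Finset.univ.erase i).erase j, Matrix.diagonal η (σ l) l = 0 :=
        Finset.prod_eq_zero (i := l) (by simp [hl, hl']) (Matrix.diagonal_apply_ne _ hl'')
      rw [hz, mul_zero, mul_zero]
    · simp
    · simp
  rw [a0, single B] at key
  simp only [mul_add, Finset.sum_add_distrib] at key
  rw [single C, double] at key
  exact key

/-- The sum of the principal `k × k` minors, i.e. the `k`-th elementary symmetric function of the
eigenvalues, as a function of the matrix. -/
noncomputable def minorSum (k : ℕ) (N : Matrix m m ℝ) : ℝ :=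
  ∑ s ∈ Finset.univ.powersetCard k,
    (N.submatrix (Subtype.val : {i // i ∈ s} → m) (Subtype.val : {i // i ∈ s} → m)).det

lemma minorSum_eq_coeff {k : ℕ} (hk : k ≤ Fintype.card m) (N : Matrix m m ℝ) :
    minorSum k N = (-1) ^ k * N.charpoly.coeff (Fintype.card m - k) := by
  rw [Matrix.charpoly_coeff_eq_sum_minors N k hk, ← mul_assoc, ← pow_add, ← two_mul]
  simp [minorSum]

lemma minorSum_diagonal (k : ℕ) (η : m → ℝ) :
    minorSum k (Matrix.diagonal η) = es Finset.univ η k := by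
  unfold minorSum es
  refine Finset.sum_congr rfl fun s _ => ?_
  have : (Matrix.diagonal η).submatrix (Subtype.val : {i // i ∈ s} → m) Subtype.val
      = Matrix.diagonal fun i : s => η i := by
    exact Matrix.submatrix_diagonal _ _ Subtype.val_injective
  rw [this, Matrix.det_diagonal]
  exact Finset.prod_coe_sort s η

lemma sum_prod_erase_subtype (s : Finset m) (D : m → ℝ) (η : m → ℝ) :
    ∑ i : s, D i * ∏ j ∈ Finset.univ.erase i, η (j : m) = ∑ i ∈ s, D i * ∏ j ∈ s.erase i, η j := by
  rw [← Finset.sum_coe_sort s (fun i => D i * ∏ j ∈ s.erase i, η j)]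
  refine Finset.sum_congr rfl fun i _ => ?_
  congr 1
  refine Finset.prod_bij (fun j _ => (j : m)) ?_ ?_ ?_ ?_
  · intro j hj
    simp only [Finset.mem_erase, Finset.mem_univ, and_true] at hj
    exact Finset.mem_erase.2 ⟨fun hh => hj (Subtype.ext hh), j.2⟩
  · intro j _ j' _ hh
    exact Subtype.ext hh
  · intro j hj
    obtain ⟨h1, h2⟩ := Finset.mem_erase.1 hj
    exact ⟨⟨j, h2⟩, by simpa [Subtype.ext_iff] using h1, rfl⟩
  · intro j _; rfl

lemma sum_sum_prod_erase_subtype (s : Finset m) (D : m → m → ℝ) (η : m → ℝ) :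
    ∑ i : s, ∑ j ∈ Finset.univ.erase i, D i j * ∏ l ∈ (Finset.univ.erase i).erase j, η (l : m)
      = ∑ i ∈ s, ∑ j ∈ s.erase i, D i j * ∏ l ∈ (s.erase i).erase j, η l := by
  rw [← Finset.sum_coe_sort s (fun i => ∑ j ∈ s.erase i, D i j * ∏ l ∈ (s.erase i).erase j, η l)]
  refine Finset.sum_congr rfl fun i _ => ?_
  refine Finset.sum_bij (fun j _ => (j : m)) ?_ ?_ ?_ ?_
  · intro j hj
    simp only [Finset.mem_erase, Finset.mem_univ, and_true] at hj
    exact Finset.mem_erase.2 ⟨fun hh => hj (Subtype.ext hh), j.2⟩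
  · intro j _ j' _ hh
    exact Subtype.ext hh
  · intro j hj
    obtain ⟨h1, h2⟩ := Finset.mem_erase.1 hj
    exact ⟨⟨j, h2⟩, by simpa [Subtype.ext_iff] using h1, rfl⟩
  · intro j _
    congr 1
    refine Finset.prod_bij (fun j _ => (j : m)) ?_ ?_ ?_ ?_
    · intro l hl
      simp only [Finset.mem_erase, Finset.mem_univ, and_true] at hl
      exact Finset.mem_erase.2 ⟨fun hh => hl.1 (Subtype.ext hh),
        Finset.mem_erase.2 ⟨fun hh => hl.2 (Subtype.ext hh), l.2⟩⟩
    · intro j _ j' _ hh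
      exact Subtype.ext hh
    · intro l hl
      obtain ⟨h1, h2⟩ := Finset.mem_erase.1 hl
      obtain ⟨h2, h3⟩ := Finset.mem_erase.1 h2
      refine ⟨⟨l, h3⟩, ?_, rfl⟩
      simp only [Finset.mem_erase, Finset.mem_univ, and_true, Subtype.ext_iff, ne_eq]
      exact ⟨h1, h2⟩
    · intro l _; rfl

/-- Second order expansion of `σ_{k+2}` of the eigenvalues at a diagonal matrix. -/
lemma HasJet.minorSum {N : ℝ → Matrix m m ℝ} {η : m → ℝ} {B C : Matrix m m ℝ}
    (h : ∀ i j, HasJet (fun t => N t i j) (Matrix.diagonal η i j) (B i j) (C i j)) (k : ℕ) :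
    HasJet (fun t => minorSum (k + 1) (N t)) (es Finset.univ η (k + 1))
      (∑ i, es (Finset.univ.erase i) η k * B i i)
      (∑ i, es (Finset.univ.erase i) η k * C i i +
        if k = 0 then 0 else ∑ i, ∑ j ∈ Finset.univ.erase i,
          es ((Finset.univ.erase i).erase j) η (k - 1) * (B i i * B j j - B i j * B j i)) := by
  have key := HasJet.sum (s := (Finset.univ : Finset m).powersetCard (k + 1)) fun s _ =>
    HasJet.det (N := fun t => (N t).submatrix (Subtype.val : {i // i ∈ s} → m) Subtype.val)
      (η := fun i => η i) (B := B.submatrix Subtype.val Subtype.val)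
      (C := C.submatrix Subtype.val Subtype.val) (fun i j => by
        have e : Matrix.diagonal (fun i : {i // i ∈ s} => η i) i j = Matrix.diagonal η i j := by
          rw [← Function.comp_def η, ← Matrix.submatrix_diagonal _ _ Subtype.val_injective]
          rfl
        rw [e]
        exact h i j)
  have single : ∀ D : m → ℝ, ∑ s ∈ (Finset.univ : Finset m).powersetCard (k + 1),
      ∑ i : s, D i * ∏ j ∈ Finset.univ.erase i, η (j : m)
      = ∑ i, es (Finset.univ.erase i) η k * D i := by
    intro D
    simp only [sum_prod_erase_subtype]
    rw [sum_powersetCard_succ Finset.univ k fun i t => D i * ∏ j ∈ t, η j]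
    refine Finset.sum_congr rfl fun i _ => ?_
    rw [← Finset.mul_sum, mul_comm]; rfl
  have a0 : ∑ s ∈ (Finset.univ : Finset m).powersetCard (k + 1), ∏ i : s, η (i : m)
      = es Finset.univ η (k + 1) :=
    Finset.sum_congr rfl fun s _ => Finset.prod_coe_sort s η
  have double : ∑ s ∈ (Finset.univ : Finset m).powersetCard (k + 1),
      ∑ i : s, ∑ j ∈ Finset.univ.erase i, (B i i * B j j - B i j * B j i) *
        ∏ l ∈ (Finset.univ.erase i).erase j, η (l : m)
      = if k = 0 then 0 else ∑ i, ∑ j ∈ Finset.univ.erase i,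
          es ((Finset.univ.erase i).erase j) η (k - 1) * (B i i * B j j - B i j * B j i) := by
    simp only [sum_sum_prod_erase_subtype _ (fun i j => B i i * B j j - B i j * B j i)]
    rw [sum_powersetCard_succ Finset.univ k fun i t => ∑ j ∈ t,
      (B i i * B j j - B i j * B j i) * ∏ l ∈ t.erase j, η l]
    rcases k with _ | k
    · simp
    · simp only [Nat.add_eq_zero_iff, one_ne_zero, and_false, if_false, Nat.add_sub_cancel]
      refine Finset.sum_congr rfl fun i _ => ?_
      rw [sum_powersetCard_succ (Finset.univ.erase i) k fun j t =>
        (B i i * B j j - B i j * B j i) * ∏ l ∈ t, η l]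
      refine Finset.sum_congr rfl fun j _ => ?_
      rw [← Finset.mul_sum, mul_comm]; rfl
  simp only [Matrix.submatrix_apply, Finset.sum_add_distrib] at key
  rw [a0, single (fun i => B i i), single (fun i => C i i), double] at key
  exact key

end Det

end HessianEq

/-! ### Concavity of `log σ_k` at second order -/

namespace HessianEq

open Filter Topology

section LogConcave

variable {ι : Type*} [Fintype ι] [DecidableEq ι]

lemma continuous_es (s : Finset ι) (k : ℕ) : Continuous fun x : ι → ℝ => es s x k := by
  unfold es
  fun_prop

/-- The mixed second derivatives `∂²σ_{k+1} / ∂x_i ∂x_j` for `i ≠ j`. -/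
noncomputable def es₂ (η : ι → ℝ) (k : ℕ) (i j : ι) : ℝ :=
  if k = 0 then 0 else es ((Finset.univ.erase i).erase j) η (k - 1)

lemma es₂_symm (η : ι → ℝ) (k : ℕ) (i j : ι) : es₂ η k i j = es₂ η k j i := by
  unfold es₂
  rw [Finset.erase_right_comm]

lemma InCone.es₂_nonneg {η : ι → ℝ} {k : ℕ} (h : InCone Finset.univ η (k + 1)) {i j : ι}
    (hij : j ≠ i) : 0 ≤ es₂ η k i j := by
  unfold es₂
  split_ifs with hk
  · exact le_rfl
  · obtain ⟨k, rfl⟩ : ∃ l, k = l + 1 := ⟨k - 1, by omega⟩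
    exact ((h.erase (Finset.mem_univ i)).erase (by simp [hij]) k le_rfl).le

lemma es_erase_sub_es_erase (η : ι → ℝ) (k : ℕ) {i j : ι} (hij : j ≠ i) :
    es (Finset.univ.erase i) η k - es (Finset.univ.erase j) η k = (η j - η i) * es₂ η k i j := by
  unfold es₂
  rcases k with _ | k
  · simp
  · rw [es_erase (s := Finset.univ.erase i) (i := j) (by simp [hij]),
      es_erase (s := Finset.univ.erase j) (i := i) (by simp [hij.symm]), Finset.erase_right_comm]
    simp
    ring

lemma HasJet.minorSum' {N : ℝ → Matrix ι ι ℝ} {η : ι → ℝ} {B C : Matrix ι ι ℝ}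
    (h : ∀ i j, HasJet (fun t => N t i j) (Matrix.diagonal η i j) (B i j) (C i j)) (k : ℕ) :
    HasJet (fun t => HessianEq.minorSum (k + 1) (N t)) (es Finset.univ η (k + 1))
      (∑ i, es (Finset.univ.erase i) η k * B i i)
      (∑ i, es (Finset.univ.erase i) η k * C i i + ∑ i, ∑ j ∈ Finset.univ.erase i,
          es₂ η k i j * (B i i * B j j - B i j * B j i)) := by
  convert HasJet.minorSum h k using 2
  unfold es₂
  split_ifs <;> simp

/-- Second order form of the concavity of `log σ_{k+1}` on `Γ_{k+1}`. -/
lemma InCone.es_mul_hessian_le {η : ι → ℝ} {k : ℕ} (h : InCone Finset.univ η (k + 1))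
    (b : ι → ℝ) :
    es Finset.univ η (k + 1) *
        (∑ i, ∑ j ∈ Finset.univ.erase i, es₂ η k i j * (b i * b j))
      ≤ (∑ i, es (Finset.univ.erase i) η k * b i) ^ 2 := by
  have jet : ∀ b : ι → ℝ, HasJet (fun t => es Finset.univ (fun i => η i + t * b i) (k + 1))
      (es Finset.univ η (k + 1)) (∑ i, es (Finset.univ.erase i) η k * b i)
      (∑ i, ∑ j ∈ Finset.univ.erase i, es₂ η k i j * (b i * b j)) := by
    intro b
    have := HasJet.minorSum' (N := fun t => Matrix.diagonal fun i => η i + t * b i) (η := η)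
      (B := Matrix.diagonal b) (C := 0) (fun i j => by
        by_cases hij : i = j
        · subst hij
          simpa using HasJet.line (η i) (b i)
        · simpa [Matrix.diagonal_apply_ne _ hij] using HasJet.const (0 : ℝ)) k
    simp only [minorSum_diagonal, Matrix.diagonal_apply_eq, Matrix.zero_apply, mul_zero,
      Finset.sum_const_zero, zero_add] at this
    convert this using 1
    refine Finset.sum_congr rfl fun i _ => Finset.sum_congr rfl fun j hj => ?_
    rw [Matrix.diagonal_apply_ne _ (Finset.ne_of_mem_erase hj).symm]
    ring
  have hopen : ∀ b : ι → ℝ, ∀ᶠ t : ℝ in 𝓝 0, InCone Finset.univ (fun i => η i + t * b i) (k + 1) := by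
    intro b
    have : ∀ j ∈ Finset.range (k + 2), ∀ᶠ t : ℝ in 𝓝 0,
        0 < es Finset.univ (fun i => η i + t * b i) j := by
      intro j hj
      have hc : Continuous fun t : ℝ => es Finset.univ (fun i => η i + t * b i) j :=
        (continuous_es _ _).comp (by fun_prop)
      refine hc.continuousAt.eventually (lt_mem_nhds ?_)
      simpa using h j (by have := Finset.mem_range.1 hj; omega)
    filter_upwards [(Finset.eventually_all _).2 this] with t ht j hj
    exact ht j (Finset.mem_range.2 (by omega))
  have hp := (jet b).mul (jet fun i => - b i)
  have hmax := hp.of_isLocalMax (by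
    filter_upwards [hopen b, hopen fun i => - b i] with t h1 h2
    have := InCone.es_mul_es_le_sq (x := η) (b := fun i => t * b i) h1
      (by simpa [sub_eq_add_neg] using h2) h
    simpa [sub_eq_add_neg, ← sq] using this)
  have := hmax.2
  simp only [mul_neg, neg_mul, Finset.sum_neg_distrib, neg_neg] at this
  nlinarith

/-- The second derivative of `σ_{k+1}` along a curve of matrices through a point of `Γ_{k+1}`,
estimated by the concavity of `log σ_{k+1}`; the off-diagonal entries of the velocity contribute
with a good sign. -/
lemma HasJet.minorSum_le {N : ℝ → Matrix ι ι ℝ} {η : ι → ℝ} {B C : Matrix ι ι ℝ} {k : ℕ}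
    (h : ∀ i j, HasJet (fun t => N t i j) (Matrix.diagonal η i j) (B i j) (C i j))
    (hB : ∀ i j, B i j = B j i) (hη : InCone Finset.univ η (k + 1)) {f₀ f₁ f₂ : ℝ}
    (hf : HasJet (fun t => HessianEq.minorSum (k + 1) (N t)) f₀ f₁ f₂) :
    f₀ = es Finset.univ η (k + 1) ∧ f₁ = ∑ i, es (Finset.univ.erase i) η k * B i i ∧
    f₂ + ∑ i, ∑ j ∈ Finset.univ.erase i, es₂ η k i j * B i j ^ 2
      ≤ ∑ i, es (Finset.univ.erase i) η k * C i i + f₁ ^ 2 / f₀ := by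
  obtain ⟨h0, h1, h2⟩ := hf.unique (HasJet.minorSum' h k)
  refine ⟨h0, h1, ?_⟩
  have hpos := hη (k + 1) le_rfl
  have hc := hη.es_mul_hessian_le fun i => B i i
  rw [← h1, ← h0] at hc
  rw [← h0] at hpos
  have hc' : ∑ i, ∑ j ∈ Finset.univ.erase i, es₂ η k i j * (B i i * B j j) ≤ f₁ ^ 2 / f₀ := by
    rw [le_div_iff₀ hpos, mul_comm]; exact hc
  have : ∑ i, ∑ j ∈ Finset.univ.erase i, es₂ η k i j * (B i i * B j j - B i j * B j i)
      = ∑ i, ∑ j ∈ Finset.univ.erase i, es₂ η k i j * (B i i * B j j)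
        - ∑ i, ∑ j ∈ Finset.univ.erase i, es₂ η k i j * B i j ^ 2 := by
    rw [← Finset.sum_sub_distrib]
    refine Finset.sum_congr rfl fun i _ => ?_
    rw [← Finset.sum_sub_distrib]
    refine Finset.sum_congr rfl fun j _ => ?_
    rw [hB j i]; ring
  rw [h2, this]
  linarith

end LogConcave

/-! ### The inequality at an interior maximum -/

section Core

variable {ι : Type*} [Fintype ι] [DecidableEq ι]

/-- The normalized derivatives `s_i = ∂ log σ_{k+1} / ∂η_i`. -/
noncomputable def sw (η : ι → ℝ) (k : ℕ) (i : ι) : ℝ :=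
  es (Finset.univ.erase i) η k / es Finset.univ η (k + 1)

/-- The trace `T = ∑ s_i`. -/
noncomputable def swT (η : ι → ℝ) (k : ℕ) : ℝ := ∑ i, sw η k i

/-- The coefficients `G_i = T - s_i` of the linearized operator. -/
noncomputable def gw (η : ι → ℝ) (k : ℕ) (i : ι) : ℝ := swT η k - sw η k i

/-- The eigenvalues `η_i = ∑_{j ≠ i} w_j` of `(tr W) g - W`. -/
def etaOf (w : ι → ℝ) (i : ι) : ℝ := ∑ j, w j - w i

lemma sum_etaOf (w : ι → ℝ) : ∑ i, etaOf w i = (Fintype.card ι - 1) * ∑ i, w i := by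
  simp [etaOf, Finset.sum_sub_distrib]
  ring

/-- The terms on the right of `combined_arith` carry at least one factor `w`, as `1 + w ≤ 2 w`. -/
lemma combined_arith₁ {n Λ T Gs w a b : ℝ} (hn2 : 2 ≤ n) (hΛ : 1 ≤ Λ) (hT0 : 0 ≤ T)
    (hGs0 : 0 ≤ Gs) (hw : 1 ≤ w) (hb1 : b ≤ 1) :
    w * (Λ * Gs + b * ((Λ ^ 2 + Λ + n * Λ ^ 2) * Gs + n * Λ ^ 2 * (1 + w)))
        + Λ * (1 + w) * Gs + Λ * T * (1 + w) + Λ * (1 + w) ^ 2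
        + Λ * (w * (Λ * n ^ 2 * w + n ^ 2 * Λ ^ 2 + n * (a * Λ)))
      ≤ w * (Λ * Gs + ((Λ ^ 2 + Λ + n * Λ ^ 2) * Gs + n * Λ ^ 2 * (2 * w))
        + Λ * 2 * Gs + Λ * T * 2 + Λ * 4 * w
        + Λ * (Λ * n ^ 2 * w + n ^ 2 * Λ ^ 2 + n * (a * Λ))) := by
  have hw0 : 0 < w := by linarith
  have hΛ0 : 0 ≤ Λ := by linarith
  have hX : 1 + w ≤ 2 * w := by linarith
  have k1 : b * ((Λ ^ 2 + Λ + n * Λ ^ 2) * Gs + n * Λ ^ 2 * (1 + w))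
      ≤ (Λ ^ 2 + Λ + n * Λ ^ 2) * Gs + n * Λ ^ 2 * (2 * w) := by
    refine (mul_le_of_le_one_left (by positivity) hb1).trans ?_
    gcongr
  have k2 : Λ * (1 + w) * Gs ≤ w * (Λ * 2 * Gs) := by
    have := mul_le_mul_of_nonneg_left hX (mul_nonneg hΛ0 hGs0)
    nlinarith
  have k3 : Λ * T * (1 + w) ≤ w * (Λ * T * 2) := by
    have := mul_le_mul_of_nonneg_left hX (mul_nonneg hΛ0 hT0)
    nlinarith
  have k4 : Λ * (1 + w) ^ 2 ≤ w * (Λ * 4 * w) := by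
    have : (1 + w) ^ 2 ≤ (2 * w) ^ 2 := by gcongr
    have := mul_le_mul_of_nonneg_left this hΛ0
    nlinarith
  have := mul_le_mul_of_nonneg_left k1 hw0.le
  nlinarith

/-- The error terms collected in `MaxPointData.combined`, with one factor `w` cancelled. -/
lemma combined_arith {n Λ T Gs w a b L S : ℝ} (hn2 : 2 ≤ n) (hΛ : 1 ≤ Λ) (hT0 : 0 ≤ T)
    (hGs0 : 0 ≤ Gs) (hGs : Gs ≤ n * T) (hw : 1 ≤ w) (ha : 0 ≤ a) (hb1 : b ≤ 1)
    (h5 : w * L + S ≤ w * (Λ * Gs + b * ((Λ ^ 2 + Λ + n * Λ ^ 2) * Gs + n * Λ ^ 2 * (1 + w)))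
        + Λ * (1 + w) * Gs + Λ * T * (1 + w) + Λ * (1 + w) ^ 2
        + Λ * (w * (Λ * n ^ 2 * w + n ^ 2 * Λ ^ 2 + n * (a * Λ)))) :
    L + S / w ≤ 8 * n ^ 2 * Λ ^ 3 * (T + w + a) := by
  have hw0 : 0 < w := by linarith
  have hΛ0 : 0 ≤ Λ := by linarith
  have h6 := h5.trans (combined_arith₁ (a := a) hn2 hΛ hT0 hGs0 hw hb1)
  have h7 : L + S / w
      ≤ Λ * Gs + ((Λ ^ 2 + Λ + n * Λ ^ 2) * Gs + n * Λ ^ 2 * (2 * w))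
        + Λ * 2 * Gs + Λ * T * 2 + Λ * 4 * w
        + Λ * (Λ * n ^ 2 * w + n ^ 2 * Λ ^ 2 + n * (a * Λ)) := by
    refine le_of_mul_le_mul_left (le_trans (le_of_eq ?_) h6) hw0
    field_simp
  refine h7.trans ?_
  have m1 : (1 : ℝ) ≤ n := by linarith
  have c1 : Λ ≤ n ^ 2 * Λ ^ 3 / n := by
    rw [le_div_iff₀ (by linarith)]
    calc Λ * n = n ^ 1 * Λ ^ 1 := by ring
      _ ≤ n ^ 2 * Λ ^ 3 := by gcongr <;> first | assumption | norm_num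
  have c2 : Λ ^ 2 ≤ n ^ 2 * Λ ^ 3 / n := by
    rw [le_div_iff₀ (by linarith)]
    calc Λ ^ 2 * n = n ^ 1 * Λ ^ 2 := by ring
      _ ≤ n ^ 2 * Λ ^ 3 := by gcongr <;> first | assumption | norm_num
  have c3 : n * Λ ^ 2 ≤ n ^ 2 * Λ ^ 3 / n := by
    rw [le_div_iff₀ (by linarith)]
    calc n * Λ ^ 2 * n = n ^ 2 * Λ ^ 2 := by ring
      _ ≤ n ^ 2 * Λ ^ 3 := by gcongr; first | assumption | norm_num
  set P := n ^ 2 * Λ ^ 3 with hP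
  have hP0 : 0 ≤ P := by positivity
  have c4 : P / n ≤ P := div_le_self hP0 m1
  have c5 : Λ ^ 2 * n ^ 2 ≤ P := by
    rw [hP, mul_comm]; gcongr; first | assumption | norm_num
  have hGsT : P / n * Gs ≤ P * T := by
    calc P / n * Gs ≤ P / n * (n * T) := by gcongr
      _ = P * T := by field_simp
  have d1 : (Λ + Λ ^ 2 + Λ + n * Λ ^ 2 + 2 * Λ) * Gs ≤ 6 * (P * T) := by
    calc _ ≤ (6 * (P / n)) * Gs := mul_le_mul_of_nonneg_right (by linarith) hGs0
      _ ≤ _ := by linarith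
  have d2 : Λ * T * 2 ≤ 2 * (P * T) := by
    have := mul_le_mul_of_nonneg_right (c1.trans c4) hT0
    linarith
  have d3 : (2 * (n * Λ ^ 2) + 4 * Λ + Λ ^ 2 * n ^ 2) * w ≤ 7 * (P * w) := by
    have := mul_le_mul_of_nonneg_right
      (show 2 * (n * Λ ^ 2) + 4 * Λ + Λ ^ 2 * n ^ 2 ≤ 7 * P by linarith) hw0.le
    linarith
  have d4 : Λ * (n ^ 2 * Λ ^ 2) ≤ P * w := by
    have : Λ * (n ^ 2 * Λ ^ 2) = P := by rw [hP]; ring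
    rw [this]
    exact le_mul_of_one_le_right hP0 hw
  have d5 : n * Λ ^ 2 * a ≤ P * a := mul_le_mul_of_nonneg_right (c3.trans c4) ha
  have d6 : 0 ≤ P * a := mul_nonneg hP0 ha
  calc _ = (Λ + Λ ^ 2 + Λ + n * Λ ^ 2 + 2 * Λ) * Gs + Λ * T * 2
        + (2 * (n * Λ ^ 2) + 4 * Λ + Λ ^ 2 * n ^ 2) * w + Λ * (n ^ 2 * Λ ^ 2) + n * Λ ^ 2 * a := by
        ring
    _ ≤ 6 * (P * T) + 2 * (P * T) + 7 * (P * w) + P * w + P * a := by linarith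
    _ ≤ _ := by nlinarith

/-- The derivatives at an interior maximum point of the test function, in normal coordinates and
in a frame which diagonalizes `W = ∇²u + ω`, together with the relations between them that the
estimate uses. `w` are the eigenvalues of `W`, the largest being `w o`; `W1 i a b = ∂_i W_{ab}`,
`q i = ∂_i² W_{oo}`, `r i = ∂_o² W_{ii}`; `u`, `u2`, `u3` are the derivatives of the solution;
`d`, `e` are the first and (unmixed) second derivatives of `u_* - u`; `h`, `h2` are the first
derivatives and the second derivative in direction `o` of the logarithm of the right-hand side;
`β`, `β2` are the first and unmixed second derivatives of the weight
`(b / 2) |∇u|² + a (u_* - u)`. -/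
structure MaxPointData (ι : Type*) [Fintype ι] [DecidableEq ι] (k : ℕ) (Λ ε a b : ℝ) where
  (w : ι → ℝ) (o : ι) (W1 : ι → ι → ι → ℝ) (q r u d e h β β2 : ι → ℝ) (u2 u3 : ι → ι → ℝ)
  (h2 : ℝ)
  le_max : ∀ i, w i ≤ w o
  cone : InCone Finset.univ (etaOf w) (k + 1)
  sigma_le : es Finset.univ (etaOf w) (k + 1) ≤ Λ
  W1_symm : ∀ i j l, W1 i j l = W1 i l j
  q_sub_r : ∀ i, r i - Λ * (1 + w o) ≤ q i
  codazzi : ∀ i, |W1 i o o - W1 o o i| ≤ Λ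
  first : ∀ i, ∑ j, gw (etaOf w) k j * W1 i j j = h i
  h_le : ∀ i, |h i| ≤ Λ * (1 + w o)
  second : h2 + ∑ i, ∑ j ∈ Finset.univ.erase i,
      es₂ (etaOf w) k i j / es Finset.univ (etaOf w) (k + 1) * W1 o i j ^ 2
    ≤ ∑ i, gw (etaOf w) k i * r i + Λ * swT (etaOf w) k * (1 + w o)
  h2_ge : - (Λ * (1 + w o) ^ 2) - Λ * ∑ i, |W1 i o o| ≤ h2
  crit : ∀ i, W1 i o o = - (w o * β i)
  max₂ : ∀ i, q i ≤ w o * (Λ + β i ^ 2 - β2 i)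
  β_eq : ∀ i, β i = b * ∑ l, u l * u2 l i + a * d i
  β2_ge : ∀ i, b * (∑ l, u2 l i ^ 2 + ∑ l, u l * u3 l i - Λ) + a * e i ≤ β2 i
  u_le : ∀ i, |u i| ≤ Λ
  d_le : ∀ i, |d i| ≤ Λ
  u2_diag : ∀ i, |u2 i i - w i| ≤ Λ
  u2_off : ∀ i l, l ≠ i → |u2 l i| ≤ Λ
  u3_le : ∀ i l, |u3 l i - W1 l i i| ≤ Λ
  e_ge : ∀ i, - (Λ * (1 + w o)) ≤ e i
  barrier : k + 1 = Fintype.card ι →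
    ε * swT (etaOf w) k - Λ ≤ ∑ i, gw (etaOf w) k i * e i

namespace MaxPointData

variable {k : ℕ} {Λ ε a b : ℝ} (D : MaxPointData ι k Λ ε a b)

local notation "n" => (Fintype.card ι : ℝ)

include D in
lemma es_pos : 0 < es Finset.univ (etaOf D.w) (k + 1) := D.cone _ le_rfl

lemma wo_pos (hn : 2 ≤ Fintype.card ι) : 0 < D.w D.o := by
  have h1 := D.cone 1 (by omega)
  rw [es_one, sum_etaOf] at h1
  have hn' : (2 : ℝ) ≤ n := by exact_mod_cast hn
  have h2 : 0 < ∑ i, D.w i := by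
    by_contra! hneg
    nlinarith
  have h3 : ∑ i, D.w i ≤ ∑ _i : ι, D.w D.o := Finset.sum_le_sum fun i _ => D.le_max i
  rw [Finset.sum_const, nsmul_eq_mul, Finset.card_univ] at h3
  by_contra! hneg
  nlinarith

/-- The sum of the eigenvalues is positive, hence none of them is very negative. -/
lemma abs_w_le (hn : 2 ≤ Fintype.card ι) (i : ι) : |D.w i| ≤ n * D.w D.o := by
  have hpos := D.wo_pos hn
  have h1 := D.cone 1 (by omega)
  rw [es_one, sum_etaOf] at h1
  have hn' : (2 : ℝ) ≤ n := by exact_mod_cast hn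
  have h2 : 0 < ∑ i, D.w i := by
    by_contra! hneg
    nlinarith
  rw [abs_le]
  constructor
  · rw [← Finset.add_sum_erase _ _ (Finset.mem_univ i)] at h2
    have h3 : ∑ j ∈ Finset.univ.erase i, D.w j ≤ ∑ _j ∈ Finset.univ.erase i, D.w D.o :=
      Finset.sum_le_sum fun j _ => D.le_max j
    rw [Finset.sum_const, nsmul_eq_mul, Finset.card_erase_of_mem (Finset.mem_univ i),
      Finset.card_univ, Nat.cast_sub (by omega)] at h3
    push_cast at h3
    nlinarith
  · nlinarith [D.le_max i]

lemma sw_pos (i : ι) : 0 < sw (etaOf D.w) k i :=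
  div_pos (D.cone.erase (Finset.mem_univ i) k le_rfl) D.es_pos

lemma gw_eq (i : ι) :
    gw (etaOf D.w) k i = ∑ j ∈ Finset.univ.erase i, sw (etaOf D.w) k j := by
  rw [gw, swT, ← Finset.add_sum_erase _ _ (Finset.mem_univ i)]
  ring

lemma gw_nonneg (i : ι) : 0 ≤ gw (etaOf D.w) k i := by
  rw [D.gw_eq]
  exact Finset.sum_nonneg fun j _ => (D.sw_pos j).le

lemma sum_gw_le : ∑ i, gw (etaOf D.w) k i ≤ n * swT (etaOf D.w) k := by
  calc _ ≤ ∑ _i : ι, swT (etaOf D.w) k :=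
        Finset.sum_le_sum fun i _ => by rw [gw]; linarith [D.sw_pos i]
    _ = _ := by simp

lemma tau_nonneg {i j : ι} (hij : j ≠ i) :
    0 ≤ es₂ (etaOf D.w) k i j / es Finset.univ (etaOf D.w) (k + 1) :=
  div_nonneg (D.cone.es₂_nonneg hij) D.es_pos.le

lemma sw_sub_sw {i : ι} (hi : i ≠ D.o) : sw (etaOf D.w) k D.o - sw (etaOf D.w) k i
    = (D.w D.o - D.w i) * (es₂ (etaOf D.w) k D.o i / es Finset.univ (etaOf D.w) (k + 1)) := by
  rw [sw, sw, ← sub_div, es_erase_sub_es_erase _ _ hi, mul_div_assoc]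
  congr 1
  simp [etaOf]

/-- The coefficient `s_o` belonging to the largest eigenvalue of `W`, that is, to the smallest
`η_i`, is the largest. -/
lemma sw_le (i : ι) : sw (etaOf D.w) k i ≤ sw (etaOf D.w) k D.o := by
  by_cases hi : i = D.o
  · rw [hi]
  · have := D.sw_sub_sw hi
    have h2 := mul_nonneg (sub_nonneg.2 (D.le_max i)) (D.tau_nonneg hi)
    linarith

/-- All the coefficients `G_i = T - s_i` with `i ≠ o` are comparable to `T`, since they contain the
largest of the `s_j`, which is `s_o`. Operators `F(∇²u)` without the trace term lack this. -/
lemma swT_le_gw {i : ι} (hi : i ≠ D.o) : swT (etaOf D.w) k ≤ n * gw (etaOf D.w) k i := by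
  have h1 : swT (etaOf D.w) k ≤ n * sw (etaOf D.w) k D.o := by
    calc _ ≤ ∑ _i : ι, sw (etaOf D.w) k D.o := Finset.sum_le_sum fun i _ => D.sw_le i
      _ = _ := by simp
  have h2 : sw (etaOf D.w) k D.o ≤ gw (etaOf D.w) k i := by
    rw [D.gw_eq]
    exact Finset.single_le_sum (f := fun j => sw (etaOf D.w) k j)
      (fun j _ => (D.sw_pos j).le) (by simp [hi.symm])
  exact h1.trans (by gcongr)

/-- `T = (n - k) σ_k / σ_{k+1}` is bounded below, since `(σ_{k+1} / σ_k)^{k+1} ≤ σ_{k+1} ≤ Λ`. -/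
lemma one_le_swT (hk : k + 1 ≤ Fintype.card ι) (hΛ : 1 ≤ Λ) : 1 ≤ Λ * swT (etaOf D.w) k := by
  have hpos := D.es_pos
  have hpos' := D.cone k (by omega)
  have hT : swT (etaOf D.w) k = (n - k) * (esq Finset.univ (etaOf D.w) k)⁻¹ := by
    unfold swT sw esq
    rw [← Finset.sum_div, sum_es_erase, Finset.card_univ, inv_div, mul_div_assoc]
  have hq := D.cone.esq_pos le_rfl
  have hqΛ : esq Finset.univ (etaOf D.w) k ≤ Λ := by
    by_contra! hlt
    have h1 := D.cone.esq_pow_le.trans D.sigma_le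
    have h2 : esq Finset.univ (etaOf D.w) k ≤ esq Finset.univ (etaOf D.w) k ^ (k + 1) :=
      le_self_pow₀ (hΛ.trans hlt.le) (by omega)
    linarith
  have hnk : (1 : ℝ) ≤ n - k := by
    have : (k : ℝ) + 1 ≤ n := by exact_mod_cast hk
    linarith
  rw [hT]
  calc (1 : ℝ) ≤ Λ * (esq Finset.univ (etaOf D.w) k)⁻¹ := by
        rw [← div_eq_mul_inv, le_div_iff₀ hq, one_mul]; exact hqΛ
    _ ≤ Λ * ((n - k) * (esq Finset.univ (etaOf D.w) k)⁻¹) := by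
        gcongr
        exact le_mul_of_one_le_left (inv_pos.2 hq).le hnk

lemma abs_β_le (ha : 0 ≤ a) (hb : 0 ≤ b) (hΛ : 1 ≤ Λ) (i : ι) :
    |D.β i| ≤ b * (Λ * |D.w i| + n * Λ ^ 2) + a * Λ := by
  have h1 : |∑ l, D.u l * D.u2 l i| ≤ Λ * |D.w i| + n * Λ ^ 2 := by
    calc |∑ l, D.u l * D.u2 l i| ≤ ∑ l, |D.u l * D.u2 l i| := Finset.abs_sum_le_sum_abs _ _
      _ ≤ ∑ l, Λ * ((if l = i then |D.w i| else 0) + Λ) := by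
          refine Finset.sum_le_sum fun l _ => ?_
          rw [abs_mul]
          have hu := D.u_le l
          refine mul_le_mul hu ?_ (abs_nonneg _) (by linarith)
          split_ifs with hl
          · subst hl
            have := abs_sub_abs_le_abs_sub (D.u2 l l) (D.w l)
            linarith [D.u2_diag l]
          · rw [zero_add]; exact D.u2_off i l hl
      _ = _ := by
          rw [← Finset.mul_sum, Finset.sum_add_distrib]
          simp
          ring
  rw [D.β_eq]
  calc |b * ∑ l, D.u l * D.u2 l i + a * D.d i| ≤ |b * ∑ l, D.u l * D.u2 l i| + |a * D.d i| :=
        abs_add_le _ _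
    _ ≤ _ := by
        rw [abs_mul, abs_mul, abs_of_nonneg hb, abs_of_nonneg ha]
        gcongr
        exact D.d_le i

lemma β_sq_le (ha : 0 ≤ a) (hb : 0 ≤ b) (hΛ : 1 ≤ Λ) (i : ι) :
    D.β i ^ 2 ≤ 3 * (b ^ 2 * Λ ^ 2 * D.w i ^ 2 + b ^ 2 * n ^ 2 * Λ ^ 4 + a ^ 2 * Λ ^ 2) := by
  have h := D.abs_β_le ha hb hΛ i
  have hnn : (0 : ℝ) ≤ n := by positivity
  calc D.β i ^ 2 = |D.β i| ^ 2 := (sq_abs _).symm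
    _ ≤ (b * (Λ * |D.w i| + n * Λ ^ 2) + a * Λ) ^ 2 := by gcongr
    _ = (b * Λ * |D.w i| + b * n * Λ ^ 2 + a * Λ) ^ 2 := by ring
    _ ≤ 3 * ((b * Λ * |D.w i|) ^ 2 + (b * n * Λ ^ 2) ^ 2 + (a * Λ) ^ 2) := by
        nlinarith [sq_nonneg (b * Λ * |D.w i| - b * n * Λ ^ 2), sq_nonneg (b * Λ * |D.w i| - a * Λ),
          sq_nonneg (b * n * Λ ^ 2 - a * Λ)]
    _ = _ := by rw [mul_pow, mul_pow, sq_abs]; ring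

/-- The good third order term. -/
noncomputable def thirdOrder : ℝ := ∑ i, ∑ j ∈ Finset.univ.erase i,
  es₂ (etaOf D.w) k i j / es Finset.univ (etaOf D.w) (k + 1) * D.W1 D.o i j ^ 2

lemma thirdOrder_nonneg : 0 ≤ D.thirdOrder :=
  Finset.sum_nonneg fun _ _ => Finset.sum_nonneg fun _ hj =>
    mul_nonneg (D.tau_nonneg (Finset.ne_of_mem_erase hj)) (sq_nonneg _)

/-- The linearized operator applied to the weight: the gradient term gives the good term
`b ∑ G_i w_i²`, its third derivatives being given by the differentiated equation. -/
lemma sum_gw_mul_β2_ge (hb : 0 ≤ b) (hΛ : 1 ≤ Λ) :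
    b * (1 / 2 * ∑ i, gw (etaOf D.w) k i * D.w i ^ 2
        - (Λ ^ 2 + Λ + n * Λ ^ 2) * ∑ i, gw (etaOf D.w) k i - n * Λ ^ 2 * (1 + D.w D.o))
      + a * ∑ i, gw (etaOf D.w) k i * D.e i ≤ ∑ i, gw (etaOf D.w) k i * D.β2 i := by
  set G := gw (etaOf D.w) k with hG
  have hG0 : ∀ i, 0 ≤ G i := D.gw_nonneg
  have h1 : ∑ i, G i * (b * (1 / 2 * D.w i ^ 2 - Λ ^ 2 + ∑ l, D.u l * D.u3 l i - Λ) + a * D.e i)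
      ≤ ∑ i, G i * D.β2 i := by
    refine Finset.sum_le_sum fun i _ => mul_le_mul_of_nonneg_left ?_ (hG0 i)
    refine le_trans ?_ (D.β2_ge i)
    have h2 : D.u2 i i ^ 2 ≤ ∑ l, D.u2 l i ^ 2 :=
      Finset.single_le_sum (f := fun l => D.u2 l i ^ 2) (fun l _ => sq_nonneg _)
        (Finset.mem_univ i)
    have h3 : (D.u2 i i - D.w i) ^ 2 ≤ Λ ^ 2 := sq_le_sq' (abs_le.1 (D.u2_diag i)).1
      (abs_le.1 (D.u2_diag i)).2
    have h4 : 1 / 2 * D.w i ^ 2 - Λ ^ 2 ≤ ∑ l, D.u2 l i ^ 2 := by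
      nlinarith [sq_nonneg (2 * D.u2 i i - D.w i)]
    have := mul_le_mul_of_nonneg_left h4 hb
    nlinarith
  -- the once differentiated equation bounds the third derivatives contracted with `G`
  have h5 : ∀ l, |∑ i, G i * D.u3 l i| ≤ Λ * (1 + D.w D.o) + Λ * ∑ i, G i := by
    intro l
    have e : ∑ i, G i * D.u3 l i = D.h l + ∑ i, G i * (D.u3 l i - D.W1 l i i) := by
      rw [← D.first l, ← Finset.sum_add_distrib]
      exact Finset.sum_congr rfl fun i _ => by ring
    rw [e]
    refine (abs_add_le _ _).trans (add_le_add (D.h_le l) ?_)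
    refine (Finset.abs_sum_le_sum_abs _ _).trans ?_
    rw [Finset.mul_sum]
    refine Finset.sum_le_sum fun i _ => ?_
    rw [abs_mul, abs_of_nonneg (hG0 i), mul_comm]
    exact mul_le_mul_of_nonneg_right (D.u3_le i l) (hG0 i)
  have h6 : - (n * Λ ^ 2 * (1 + D.w D.o + ∑ i, G i)) ≤ ∑ i, G i * ∑ l, D.u l * D.u3 l i := by
    have e : ∑ i, G i * ∑ l, D.u l * D.u3 l i = ∑ l, D.u l * ∑ i, G i * D.u3 l i := by
      simp only [Finset.mul_sum]
      rw [Finset.sum_comm]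
      exact Finset.sum_congr rfl fun l _ => Finset.sum_congr rfl fun i _ => by ring
    rw [e]
    refine (abs_le.1 ?_).1
    refine (Finset.abs_sum_le_sum_abs _ _).trans ?_
    calc ∑ l, |D.u l * ∑ i, G i * D.u3 l i|
        ≤ ∑ _l : ι, Λ * (Λ * (1 + D.w D.o) + Λ * ∑ i, G i) := by
          refine Finset.sum_le_sum fun l _ => ?_
          rw [abs_mul]
          exact mul_le_mul (D.u_le l) (h5 l) (abs_nonneg _) (by linarith)
      _ = _ := by
          rw [Finset.sum_const, Finset.card_univ, nsmul_eq_mul]; ring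
  refine le_trans ?_ h1
  have e : ∑ i, G i * (b * (1 / 2 * D.w i ^ 2 - Λ ^ 2 + ∑ l, D.u l * D.u3 l i - Λ) + a * D.e i)
      = b * (1 / 2 * ∑ i, G i * D.w i ^ 2 - (Λ ^ 2 + Λ) * ∑ i, G i
          + ∑ i, G i * ∑ l, D.u l * D.u3 l i) + a * ∑ i, G i * D.e i := by
    have : ∀ i, G i * (b * (1 / 2 * D.w i ^ 2 - Λ ^ 2 + ∑ l, D.u l * D.u3 l i - Λ) + a * D.e i)
        = b * (1 / 2 * (G i * D.w i ^ 2) - (Λ ^ 2 + Λ) * G i + G i * ∑ l, D.u l * D.u3 l i)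
          + a * (G i * D.e i) := fun i => by ring
    simp only [this]
    rw [Finset.sum_add_distrib, ← Finset.mul_sum, ← Finset.mul_sum, Finset.sum_add_distrib,
      Finset.sum_sub_distrib, ← Finset.mul_sum, ← Finset.mul_sum]
  rw [e]
  have := mul_le_mul_of_nonneg_left h6 hb
  nlinarith

/-- All the relations combined, before the third order terms are absorbed. -/
lemma combined (hn : 2 ≤ Fintype.card ι) (hΛ : 1 ≤ Λ) (ha : 0 ≤ a)
    (hb : 0 ≤ b) (hb1 : b ≤ 1) (hw : 1 ≤ D.w D.o) :
    b / 2 * ∑ i, gw (etaOf D.w) k i * D.w i ^ 2 - ∑ i, gw (etaOf D.w) k i * D.β i ^ 2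
      + D.thirdOrder / D.w D.o + a * ∑ i, gw (etaOf D.w) k i * D.e i
      ≤ 8 * n ^ 2 * Λ ^ 3 * (swT (etaOf D.w) k + D.w D.o + a) := by
  have hβ2 := D.sum_gw_mul_β2_ge hb hΛ
  have hS : D.h2 + D.thirdOrder ≤ _ := D.second
  have hβ := D.abs_β_le ha hb hΛ
  have hGs := D.sum_gw_le
  have hG0 := D.gw_nonneg
  set G := gw (etaOf D.w) k with hG
  set T := swT (etaOf D.w) k with hT
  set w := D.w D.o with hwo
  set Gs := ∑ i, G i with hGsdef
  set Q := ∑ i, G i * D.w i ^ 2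
  set Bq := ∑ i, G i * D.β i ^ 2
  set Ee := ∑ i, G i * D.e i
  set S := D.thirdOrder
  have hGs0 : 0 ≤ Gs := Finset.sum_nonneg fun i _ => hG0 i
  have hn2 : (2 : ℝ) ≤ n := by exact_mod_cast hn
  have hT0 : 0 ≤ T := by nlinarith
  -- the sum of the third derivatives in the equation
  have h1 : ∑ i, |D.W1 i D.o D.o| ≤ w * (Λ * n ^ 2 * w + n ^ 2 * Λ ^ 2 + n * (a * Λ)) := by
    calc ∑ i, |D.W1 i D.o D.o| = ∑ i, w * |D.β i| := Finset.sum_congr rfl fun i _ => by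
          rw [D.crit, abs_neg, abs_mul, abs_of_pos (by linarith)]
      _ ≤ ∑ _i : ι, w * (Λ * (n * w) + n * Λ ^ 2 + a * Λ) := by
          refine Finset.sum_le_sum fun i _ => mul_le_mul_of_nonneg_left ?_ (by linarith)
          refine (hβ i).trans ?_
          have h2 : Λ * |D.w i| + n * Λ ^ 2 ≤ Λ * (n * w) + n * Λ ^ 2 := by
            have := D.abs_w_le hn i
            gcongr
          have h3 : 0 ≤ Λ * |D.w i| + n * Λ ^ 2 := by positivity
          nlinarith
      _ = _ := by rw [Finset.sum_const, Finset.card_univ, nsmul_eq_mul]; ring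
  have h2 : ∑ i, G i * D.r i - Λ * (1 + w) * Gs ≤ ∑ i, G i * D.q i := by
    rw [hGsdef, Finset.mul_sum, ← Finset.sum_sub_distrib]
    refine Finset.sum_le_sum fun i _ => ?_
    have := mul_le_mul_of_nonneg_left (D.q_sub_r i) (hG0 i)
    linarith
  have h3 : ∑ i, G i * D.q i ≤ w * (Λ * Gs + Bq - ∑ i, G i * D.β2 i) := by
    have e : w * (Λ * Gs + Bq - ∑ i, G i * D.β2 i)
        = ∑ i, G i * (w * (Λ + D.β i ^ 2 - D.β2 i)) := by
      rw [hGsdef, Finset.mul_sum, ← Finset.sum_add_distrib, ← Finset.sum_sub_distrib,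
        Finset.mul_sum]
      exact Finset.sum_congr rfl fun i _ => by ring
    rw [e]
    exact Finset.sum_le_sum fun i _ => mul_le_mul_of_nonneg_left (D.max₂ i) (hG0 i)
  have h4 := D.h2_ge
  have hw0 : 0 < w := by linarith
  have hΛ0 : 0 ≤ Λ := by linarith
  have h5 : w * (b / 2 * Q - Bq + a * Ee) + S
      ≤ w * (Λ * Gs + b * ((Λ ^ 2 + Λ + n * Λ ^ 2) * Gs + n * Λ ^ 2 * (1 + w)))
        + Λ * (1 + w) * Gs + Λ * T * (1 + w) + Λ * (1 + w) ^ 2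
        + Λ * (w * (Λ * n ^ 2 * w + n ^ 2 * Λ ^ 2 + n * (a * Λ))) := by
    have := mul_le_mul_of_nonneg_left hβ2 hw0.le
    have := mul_le_mul_of_nonneg_left h1 hΛ0
    nlinarith
  have := combined_arith hn2 hΛ hT0 hGs0 hGs hw ha hb1 h5
  linarith

/-- If some other eigenvalue `w j` is comparable to the largest one, then the term `G_j w_j²` is
comparable to `T w_o²`, and dominates all error terms, which are at most `T w_o`. -/
lemma bound_of_second_eigenvalue (hn : 2 ≤ Fintype.card ι) (hk : k + 1 ≤ Fintype.card ι)
    (hΛ : 1 ≤ Λ) (ha : 0 ≤ a) (hb : 0 < b) (hb1 : b ≤ 1) (hbΛ : 12 * b * Λ ^ 2 ≤ 1)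
    (hw : 1 ≤ D.w D.o) {δ : ℝ} (hδ : 0 < δ) {j : ι} (hj : j ≠ D.o)
    (hδj : δ * D.w D.o ≤ |D.w j|) :
    D.w D.o ≤ 4 * n * (8 * n ^ 2 * Λ ^ 3 * (1 + Λ + a * Λ) + 3 * n * (n ^ 2 * Λ ^ 4 + a ^ 2 * Λ ^ 2)
      + 2 * a * Λ * n) / (b * δ ^ 2) := by
  have hcomb := D.combined hn hΛ ha hb.le hb1 hw
  have hS := div_nonneg D.thirdOrder_nonneg (zero_le_one.trans hw)
  have hG0 := D.gw_nonneg
  have hGs := D.sum_gw_le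
  have hT := D.one_le_swT hk hΛ
  have hGj := D.swT_le_gw hj
  have hβ := D.β_sq_le ha hb.le hΛ
  set G := gw (etaOf D.w) k with hG
  set T := swT (etaOf D.w) k with hTdef
  set w := D.w D.o with hwo
  set A := 8 * n ^ 2 * Λ ^ 3 with hA
  set R := 3 * (n ^ 2 * Λ ^ 4 + a ^ 2 * Λ ^ 2) with hR
  have hn2 : (2 : ℝ) ≤ n := by exact_mod_cast hn
  have hT0 : 0 < T := by
    by_contra! h
    nlinarith
  have hw0 : 0 < w := by linarith
  have hR0 : 0 ≤ R := by positivity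
  have hA0 : 0 ≤ A := by positivity
  -- for small `b` half of the good term absorbs the squares of the first derivatives
  have e1 : ∑ i, G i * D.β i ^ 2 ≤ b / 4 * ∑ i, G i * D.w i ^ 2 + n * T * R := by
    calc ∑ i, G i * D.β i ^ 2 ≤ ∑ i, (b / 4 * (G i * D.w i ^ 2) + G i * R) := by
          refine Finset.sum_le_sum fun i _ => ?_
          have h1 : D.β i ^ 2 ≤ b / 4 * D.w i ^ 2 + R := by
            refine (hβ i).trans ?_
            have h2 : 3 * (b ^ 2 * Λ ^ 2) ≤ b / 4 := by nlinarith
            have h3 := mul_le_mul_of_nonneg_right h2 (sq_nonneg (D.w i))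
            have h4 : b ^ 2 * (n ^ 2 * Λ ^ 4) ≤ 1 * (n ^ 2 * Λ ^ 4) := by
              gcongr
              exact pow_le_one₀ hb.le hb1
            rw [hR]
            nlinarith
          have := mul_le_mul_of_nonneg_left h1 (hG0 i)
          linarith
      _ = b / 4 * ∑ i, G i * D.w i ^ 2 + (∑ i, G i) * R := by
          rw [Finset.sum_add_distrib, ← Finset.mul_sum, Finset.sum_mul]
      _ ≤ _ := by gcongr
  have e2 : -(2 * Λ * w * (n * T)) ≤ ∑ i, G i * D.e i := by
    calc -(2 * Λ * w * (n * T)) ≤ -(2 * Λ * w * ∑ i, G i) := by gcongr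
      _ = ∑ i, G i * -(2 * Λ * w) := by rw [← Finset.sum_mul]; ring
      _ ≤ _ := by
          refine Finset.sum_le_sum fun i _ => mul_le_mul_of_nonneg_left ?_ (hG0 i)
          have := D.e_ge i
          nlinarith
  have e3 : T * (δ * w) ^ 2 ≤ n * ∑ i, G i * D.w i ^ 2 := by
    calc T * (δ * w) ^ 2 ≤ T * |D.w j| ^ 2 := by gcongr
      _ ≤ n * G j * D.w j ^ 2 := by rw [sq_abs]; gcongr
      _ = n * (G j * D.w j ^ 2) := by ring
      _ ≤ _ := by
          gcongr
          exact Finset.single_le_sum (f := fun i => G i * D.w i ^ 2)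
            (fun i _ => mul_nonneg (hG0 i) (sq_nonneg _)) (Finset.mem_univ j)
  have e4 : b / 4 * ∑ i, G i * D.w i ^ 2 ≤ A * (T + w + a) + n * T * R
      + a * (2 * Λ * w * (n * T)) := by
    have := mul_le_mul_of_nonneg_left e2 ha
    linarith
  have e5 : A * (T + w + a) + n * T * R + a * (2 * Λ * w * (n * T))
      ≤ T * w * (A * (1 + Λ + a * Λ) + n * R + 2 * a * Λ * n) := by
    have f1 : T ≤ T * w := le_mul_of_one_le_right hT0.le hw
    have f2 : w ≤ T * w * Λ := by nlinarith
    have f3 : a ≤ T * w * (a * Λ) := by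
      calc a = 1 * 1 * a := by ring
        _ ≤ (Λ * T) * w * a := by gcongr
        _ = _ := by ring
    have f4 : n * T * R ≤ T * w * (n * R) := by
      have := mul_le_mul_of_nonneg_right f1 (show 0 ≤ n * R by positivity)
      linarith
    have f5 := mul_le_mul_of_nonneg_left (add_le_add (add_le_add f1 f2) f3) hA0
    linarith
  set Z := A * (1 + Λ + a * Λ) + n * R + 2 * a * Λ * n with hZ
  have e6 : T * w * (b * δ ^ 2 * w) ≤ T * w * (4 * n * Z) := by
    have h1 := mul_le_mul_of_nonneg_left (e4.trans e5) (show 0 ≤ 4 * n by positivity)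
    have h2 := mul_le_mul_of_nonneg_left e3 hb.le
    calc T * w * (b * δ ^ 2 * w) = b * (T * (δ * w) ^ 2) := by ring
      _ ≤ b * (n * ∑ i, G i * D.w i ^ 2) := h2
      _ = 4 * n * (b / 4 * ∑ i, G i * D.w i ^ 2) := by ring
      _ ≤ 4 * n * (T * w * Z) := h1
      _ = _ := by ring
  have e7 := le_of_mul_le_mul_left e6 (mul_pos hT0 hw0)
  rw [le_div_iff₀ (by positivity)]
  have : 4 * n * Z = 4 * n * (A * (1 + Λ + a * Λ) + 3 * n * (n ^ 2 * Λ ^ 4 + a ^ 2 * Λ ^ 2)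
      + 2 * a * Λ * n) := by rw [hZ, hR]; ring
  linarith

/-- In the determinant case the coefficients are the reciprocals of the `η_i`. -/
lemma sw_mul_eta (hkn : k + 1 = Fintype.card ι) (i : ι) :
    sw (etaOf D.w) k i * etaOf D.w i = 1 := by
  have h1 : es Finset.univ (etaOf D.w) (k + 1) = ∏ i, etaOf D.w i := by
    rw [hkn, ← Finset.card_univ, es_card]
  have h2 : es (Finset.univ.erase i) (etaOf D.w) k = ∏ j ∈ Finset.univ.erase i, etaOf D.w j := by
    rw [← es_card, Finset.card_erase_of_mem (Finset.mem_univ i), Finset.card_univ, ← hkn,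
      Nat.add_sub_cancel]
  have h3 := D.es_pos
  rw [sw, h2, div_mul_eq_mul_div, Finset.prod_erase_mul _ _ (Finset.mem_univ i), ← h1,
    div_self h3.ne']

/-- When all eigenvalues of `W` but the largest are small, the third order terms are absorbed by
the concavity of the logarithm of the determinant. -/
lemma third_order_absorbed (hw : 1 ≤ D.w D.o)
    (hsmall : ∀ j, j ≠ D.o → |D.w j| ≤ 1 / 3 * D.w D.o) :
    ∑ i, gw (etaOf D.w) k i * D.β i ^ 2 ≤ D.thirdOrder / D.w D.o
      + gw (etaOf D.w) k D.o * ∑ i, D.β i ^ 2 + 3 * Λ ^ 2 * (n * swT (etaOf D.w) k) := by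
  have hG0 := D.gw_nonneg
  have hGs := D.sum_gw_le
  set G := gw (etaOf D.w) k with hG
  set τ := fun i j => es₂ (etaOf D.w) k i j / es Finset.univ (etaOf D.w) (k + 1) with hτ
  set w := D.w D.o with hwo
  have hw0 : 0 < w := by linarith
  have hS : ∑ j ∈ Finset.univ.erase D.o, 2 * (τ D.o j * D.W1 D.o D.o j ^ 2) ≤ D.thirdOrder := by
    unfold thirdOrder
    rw [← Finset.add_sum_erase _ _ (Finset.mem_univ D.o), Finset.sum_congr rfl (fun j _ => two_mul _),
      Finset.sum_add_distrib]
    gcongr with j hj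
    have hj' := Finset.ne_of_mem_erase hj
    refine le_trans (le_of_eq ?_) (Finset.single_le_sum
      (f := fun i => es₂ (etaOf D.w) k j i / es Finset.univ (etaOf D.w) (k + 1) * D.W1 D.o j i ^ 2)
      (fun i hi => mul_nonneg (D.tau_nonneg (Finset.ne_of_mem_erase hi)) (sq_nonneg _))
      (Finset.mem_erase.2 ⟨hj'.symm, Finset.mem_univ _⟩))
    simp only [hτ]
    rw [es₂_symm, D.W1_symm]
  -- `G_j - G_o = (w_o - w_j) τ_{oj}` (`sw_sub_sw`), and `w_o - w_j ≤ 4/3 w_o`; the room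
  -- between `4/3` and the factor `2` of `hS` pays for exchanging the indices of `W1`
  have key : ∀ j ∈ Finset.univ.erase D.o, (G j - G D.o) * (D.β j ^ 2 - 3 * Λ ^ 2)
      ≤ 2 * (τ D.o j * D.W1 D.o D.o j ^ 2) / w := by
    intro j hj
    have hj' := Finset.ne_of_mem_erase hj
    have h1 : G j - G D.o = (w - D.w j) * τ D.o j := by
      rw [← D.sw_sub_sw hj', hG, gw, gw]; ring
    have hτ0 : 0 ≤ τ D.o j := D.tau_nonneg hj'
    have h2 : 0 ≤ w - D.w j := sub_nonneg.2 (D.le_max j)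
    have h3 : w - D.w j ≤ 4 / 3 * w := by
      have := (abs_le.1 (hsmall j hj')).1
      linarith
    set x := D.W1 j D.o D.o with hx
    set y := D.W1 D.o D.o j with hy
    have hxy : |x - y| ≤ Λ := D.codazzi j
    have hxy2 : (x - y) ^ 2 ≤ Λ ^ 2 := sq_le_sq' (abs_le.1 hxy).1 (abs_le.1 hxy).2
    have hxβ : x ^ 2 = w ^ 2 * D.β j ^ 2 := by rw [hx, D.crit]; ring
    have h4 : w ^ 2 * (D.β j ^ 2 - 3 * Λ ^ 2) ≤ 3 / 2 * y ^ 2 := by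
      have : Λ ^ 2 ≤ w ^ 2 * Λ ^ 2 := le_mul_of_one_le_left (sq_nonneg _) (one_le_pow₀ hw)
      nlinarith [sq_nonneg (x - 3 * (x - y))]
    rw [h1, le_div_iff₀ hw0]
    have h5 : w ^ 2 * ((w - D.w j) * τ D.o j * (D.β j ^ 2 - 3 * Λ ^ 2))
        ≤ (w - D.w j) * τ D.o j * (3 / 2 * y ^ 2) := by
      have := mul_le_mul_of_nonneg_left h4 (mul_nonneg h2 hτ0)
      linarith
    have h6 : (w - D.w j) * τ D.o j * (3 / 2 * y ^ 2) ≤ w * (2 * (τ D.o j * y ^ 2)) := by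
      have := mul_le_mul_of_nonneg_right h3 (mul_nonneg hτ0 (sq_nonneg y))
      linarith
    have h7 : w * ((w - D.w j) * τ D.o j * (D.β j ^ 2 - 3 * Λ ^ 2) * w)
        ≤ w * (2 * (τ D.o j * y ^ 2)) := by linarith
    exact le_of_mul_le_mul_left h7 hw0
  have hsum := Finset.sum_le_sum key
  rw [← Finset.sum_div] at hsum
  have hsum' := hsum.trans (div_le_div_of_nonneg_right hS hw0.le)
  have hG1 : ∀ j, j ≠ D.o → G D.o ≤ G j := by
    intro j hj
    rw [hG, gw, gw]
    linarith [D.sw_le j]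
  have e1 : ∑ i, G i * D.β i ^ 2 = ∑ j ∈ Finset.univ.erase D.o,
      (G j - G D.o) * (D.β j ^ 2 - 3 * Λ ^ 2) + G D.o * ∑ i, D.β i ^ 2
      + 3 * Λ ^ 2 * ∑ j ∈ Finset.univ.erase D.o, (G j - G D.o) := by
    rw [← Finset.add_sum_erase _ _ (Finset.mem_univ D.o),
      ← Finset.add_sum_erase (a := D.o) Finset.univ (fun i => D.β i ^ 2) (Finset.mem_univ D.o),
      mul_add, Finset.mul_sum, Finset.mul_sum]
    have : ∀ j ∈ Finset.univ.erase D.o, G j * D.β j ^ 2 = (G j - G D.o) * (D.β j ^ 2 - 3 * Λ ^ 2)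
        + G D.o * D.β j ^ 2 + 3 * Λ ^ 2 * (G j - G D.o) := fun j _ => by ring
    rw [Finset.sum_congr rfl this, Finset.sum_add_distrib, Finset.sum_add_distrib]
    ring
  have e2 : ∑ j ∈ Finset.univ.erase D.o, (G j - G D.o) ≤ n * swT (etaOf D.w) k := by
    refine le_trans ?_ hGs
    rw [← Finset.add_sum_erase _ _ (Finset.mem_univ D.o)]
    have : ∑ j ∈ Finset.univ.erase D.o, (G j - G D.o) ≤ ∑ j ∈ Finset.univ.erase D.o, G j :=
      Finset.sum_le_sum fun j _ => by linarith [hG0 D.o]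
    linarith [hG0 D.o]
  rw [e1]
  have := mul_le_mul_of_nonneg_left e2 (show 0 ≤ 3 * Λ ^ 2 by positivity)
  linarith

/-- For `j ≠ o` the eigenvalue `η_j` contains `w_o`, and the other terms are small. -/
lemma half_le_eta (hn : 2 ≤ Fintype.card ι) (hw : 1 ≤ D.w D.o)
    (hsmall : ∀ j, j ≠ D.o → |D.w j| ≤ 1 / (3 * n) * D.w D.o) {j : ι} (hj : j ≠ D.o) :
    D.w D.o / 2 ≤ etaOf D.w j := by
  have hn2 : (2 : ℝ) ≤ n := by exact_mod_cast hn
  have h1 : etaOf D.w j = D.w D.o + ∑ i ∈ (Finset.univ.erase j).erase D.o, D.w i := by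
    rw [etaOf, ← Finset.add_sum_erase _ _ (Finset.mem_univ j), add_sub_cancel_left,
      ← Finset.add_sum_erase _ _ (show D.o ∈ Finset.univ.erase j by simp [hj.symm])]
  have h2 : -(1 / 3 * D.w D.o) ≤ ∑ i ∈ (Finset.univ.erase j).erase D.o, D.w i := by
    have h3 : ∑ _i ∈ (Finset.univ.erase j).erase D.o, (-(1 / (3 * n) * D.w D.o))
        ≤ ∑ i ∈ (Finset.univ.erase j).erase D.o, D.w i := by
      refine Finset.sum_le_sum fun i hi => (abs_le.1 (hsmall i ?_)).1
      exact Finset.ne_of_mem_erase hi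
    refine le_trans ?_ h3
    rw [Finset.sum_const, nsmul_eq_mul]
    have h4 : (((Finset.univ.erase j).erase D.o).card : ℝ) ≤ n := by
      exact_mod_cast (Finset.card_le_univ _)
    have h5 : 0 ≤ 1 / (3 * n) * D.w D.o := by positivity
    have h6 : n * (1 / (3 * n) * D.w D.o) = 1 / 3 * D.w D.o := by field_simp
    nlinarith
  rw [h1]
  linarith

/-- The determinant case with all eigenvalues but the largest small: the third order terms are
absorbed by `third_order_absorbed`, and the barrier term `a ε T` dominates the error terms of size
`T`. As `G_o` is of order `1 / w_o`, the good term `b G_o w_o²` takes care of `∑ G_o β_i²`. -/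
lemma bound_of_det (hn : 2 ≤ Fintype.card ι) (hkn : k + 1 = Fintype.card ι)
    (hΛ : 1 ≤ Λ) (ha : 0 ≤ a) (hb : 0 < b) (hb1 : b ≤ 1) (hbΛ : 12 * b * Λ ^ 2 * n ^ 3 ≤ 1)
    (haε : 8 * n ^ 2 * Λ ^ 3 * (1 + 2 * Λ) + 3 * Λ ^ 2 * n + 1 ≤ a * ε)
    (hw : 2 ≤ D.w D.o) (hsmall : ∀ j, j ≠ D.o → |D.w j| ≤ 1 / (3 * n) * D.w D.o) :
    D.w D.o ≤ 2 * Λ * (8 * n ^ 2 * Λ ^ 3 * a + a * Λ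
      + 6 * n ^ 2 * (n ^ 2 * Λ ^ 4 + a ^ 2 * Λ ^ 2)) := by
  have hw1 : 1 ≤ D.w D.o := by linarith
  have hcomb := D.combined hn hΛ ha hb.le hb1 hw1
  have hn2 : (2 : ℝ) ≤ n := by exact_mod_cast hn
  have habs := D.third_order_absorbed hw1 (fun j hj => (hsmall j hj).trans (by
    gcongr
    linarith))
  have hG0 := D.gw_nonneg
  have hβ := D.β_sq_le ha hb.le hΛ
  have hbar := D.barrier hkn
  have hwi := D.abs_w_le hn
  have hw0 : 0 < D.w D.o := by linarith
  have hη : ∀ j, j ≠ D.o → D.w D.o / 2 ≤ etaOf D.w j := fun j hj =>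
    D.half_le_eta hn hw1 hsmall hj
  have hs : ∀ j, j ≠ D.o → sw (etaOf D.w) k j ≤ 2 / D.w D.o := by
    intro j hj
    rw [le_div_iff₀ hw0]
    have h1 := D.sw_mul_eta hkn j
    have := mul_le_mul_of_nonneg_left (hη j hj) (D.sw_pos j).le
    linarith
  have hGo : gw (etaOf D.w) k D.o * D.w D.o ≤ 2 * n := by
    rw [← le_div_iff₀ hw0, D.gw_eq]
    calc _ ≤ ∑ _j ∈ Finset.univ.erase D.o, 2 / D.w D.o :=
          Finset.sum_le_sum fun j hj => hs j (Finset.ne_of_mem_erase hj)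
      _ ≤ ∑ _j : ι, 2 / D.w D.o := Finset.sum_le_sum_of_subset_of_nonneg
          (Finset.erase_subset _ _) fun _ _ _ => by positivity
      _ = _ := by rw [Finset.sum_const, Finset.card_univ, nsmul_eq_mul]; ring
  -- `s_o` is the product of the other `η_j`, each at least `w_o / 2`, divided by `σ_n ≤ Λ`
  have hTw : D.w D.o ≤ 2 * Λ * swT (etaOf D.w) k := by
    have h1 : sw (etaOf D.w) k D.o ≤ swT (etaOf D.w) k :=
      Finset.single_le_sum (f := fun i => sw (etaOf D.w) k i) (fun i _ => (D.sw_pos i).le)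
        (Finset.mem_univ _)
    have h2 : es (Finset.univ.erase D.o) (etaOf D.w) k
        = ∏ j ∈ Finset.univ.erase D.o, etaOf D.w j := by
      rw [← es_card, Finset.card_erase_of_mem (Finset.mem_univ _), Finset.card_univ, ← hkn,
        Nat.add_sub_cancel]
    have h3 : D.w D.o / 2 ≤ es (Finset.univ.erase D.o) (etaOf D.w) k := by
      rw [h2]
      calc D.w D.o / 2 ≤ (D.w D.o / 2) ^ (Finset.univ.erase D.o).card := by
            refine le_self_pow₀ (by linarith) ?_
            rw [Finset.card_erase_of_mem (Finset.mem_univ _), Finset.card_univ]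
            omega
        _ = ∏ _j ∈ Finset.univ.erase D.o, D.w D.o / 2 := by rw [Finset.prod_const]
        _ ≤ _ := Finset.prod_le_prod (fun _ _ => by positivity)
            fun j hj => hη j (Finset.ne_of_mem_erase hj)
    have h4 : D.w D.o / 2 ≤ Λ * sw (etaOf D.w) k D.o := by
      have h5 : es (Finset.univ.erase D.o) (etaOf D.w) k
          = es Finset.univ (etaOf D.w) (k + 1) * sw (etaOf D.w) k D.o := by
        rw [sw, mul_div_cancel₀ _ D.es_pos.ne']
      rw [h5] at h3
      exact h3.trans (mul_le_mul_of_nonneg_right D.sigma_le (D.sw_pos _).le)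
    nlinarith
  set G := gw (etaOf D.w) k with hG
  set T := swT (etaOf D.w) k with hTdef
  set w := D.w D.o with hwo
  set A := 8 * n ^ 2 * Λ ^ 3 with hA
  set R := n ^ 2 * Λ ^ 4 + a ^ 2 * Λ ^ 2 with hR
  have hR0 : 0 ≤ R := by positivity
  have hA0 : 0 ≤ A := by positivity
  have e1 : ∑ i, D.β i ^ 2 ≤ b / 2 * w ^ 2 + 3 * n * R := by
    calc ∑ i, D.β i ^ 2 ≤ ∑ _i : ι, (b / (2 * n) * w ^ 2 + 3 * R) := by
          refine Finset.sum_le_sum fun i _ => (hβ i).trans ?_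
          have h1 : D.w i ^ 2 ≤ (n * w) ^ 2 := by
            rw [← sq_abs]; gcongr; exact hwi i
          have h2 : 3 * (b ^ 2 * Λ ^ 2 * D.w i ^ 2) ≤ b / (2 * n) * w ^ 2 := by
            calc 3 * (b ^ 2 * Λ ^ 2 * D.w i ^ 2) ≤ 3 * (b ^ 2 * Λ ^ 2 * (n * w) ^ 2) := by gcongr
              _ = (12 * b * Λ ^ 2 * n ^ 3) * (b / (4 * n) * w ^ 2) := by field_simp; ring
              _ ≤ 1 * (b / (4 * n) * w ^ 2) := by gcongr
              _ ≤ b / (2 * n) * w ^ 2 := by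
                  rw [one_mul]
                  gcongr
                  norm_num
          have h4 : b ^ 2 * (n ^ 2 * Λ ^ 4) ≤ 1 * (n ^ 2 * Λ ^ 4) := by
            gcongr
            exact pow_le_one₀ hb.le hb1
          rw [hR]
          nlinarith
      _ = _ := by
          rw [Finset.sum_const, Finset.card_univ, nsmul_eq_mul]
          field_simp
  have e2 : G D.o * ∑ i, D.β i ^ 2 ≤ b / 2 * ∑ i, G i * D.w i ^ 2 + 6 * n ^ 2 * R := by
    have h1 : G D.o * w ^ 2 ≤ ∑ i, G i * D.w i ^ 2 :=
      Finset.single_le_sum (f := fun i => G i * D.w i ^ 2)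
        (fun i _ => mul_nonneg (hG0 i) (sq_nonneg _)) (Finset.mem_univ D.o)
    have h2 := mul_le_mul_of_nonneg_left e1 (hG0 D.o)
    have h3 : G D.o ≤ 2 * n := le_trans (le_mul_of_one_le_right (hG0 _) hw1) hGo
    have h4 := mul_le_mul_of_nonneg_right h3 (show 0 ≤ 3 * n * R by positivity)
    have h5 := mul_le_mul_of_nonneg_left h1 (show 0 ≤ b / 2 by positivity)
    nlinarith
  have e3 := mul_le_mul_of_nonneg_left hbar ha
  have hT0 : 0 ≤ T := by
    by_contra! h
    nlinarith
  have e4 : T ≤ A * a + a * Λ + 6 * n ^ 2 * R := by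
    have h1 := mul_le_mul_of_nonneg_left hTw hA0
    have h2 := mul_le_mul_of_nonneg_right haε hT0
    linarith
  calc w ≤ 2 * Λ * T := hTw
    _ ≤ _ := by gcongr

lemma abs_sum_le_of_small (hn : 2 ≤ Fintype.card ι) {δ : ℝ} (hδ : 0 ≤ δ)
    (hsmall : ∀ j, j ≠ D.o → |D.w j| ≤ δ * D.w D.o) {s : Finset ι} (hs : D.o ∉ s) :
    |∑ i ∈ s, D.w i / D.w D.o| ≤ n * δ := by
  have hw := D.wo_pos hn
  calc |∑ i ∈ s, D.w i / D.w D.o| ≤ ∑ i ∈ s, |D.w i / D.w D.o| := Finset.abs_sum_le_sum_abs _ _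
    _ ≤ ∑ _i ∈ s, δ := by
        refine Finset.sum_le_sum fun i hi => ?_
        rw [abs_div, abs_of_pos hw, div_le_iff₀ hw]
        exact hsmall i (by rintro rfl; exact hs hi)
    _ = s.card * δ := by rw [Finset.sum_const, nsmul_eq_mul]
    _ ≤ n * δ := by
        gcongr
        exact_mod_cast Finset.card_le_univ s

end MaxPointData

/-- Near the vectors with one entry `0` and all others `1`, `σ_{k+1}` is positive if
`k + 1 < n`. -/
lemma exists_radius_es_pos {k : ℕ} (hk : k + 1 < Fintype.card ι) :
    ∃ δ : ℝ, 0 < δ ∧ ∀ (o : ι) (y : ι → ℝ), |y o| ≤ δ → (∀ j, j ≠ o → |y j - 1| ≤ δ) →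
      1 / 2 < es Finset.univ y (k + 1) := by
  have h : ∀ o : ι, ∀ᶠ δ : ℝ in 𝓝[>] 0, ∀ y : ι → ℝ, |y o| ≤ δ → (∀ j, j ≠ o → |y j - 1| ≤ δ) →
      1 / 2 < es Finset.univ y (k + 1) := by
    intro o
    set y₀ : ι → ℝ := fun j => if j = o then 0 else 1 with hy₀
    have h1 : 1 ≤ es Finset.univ y₀ (k + 1) := by
      have e : es (Finset.univ.erase o) y₀ (k + 1) = es (Finset.univ.erase o) (fun _ => 1) (k + 1) :=
        es_congr (fun i hi => by simp [hy₀, Finset.ne_of_mem_erase hi]) _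
      rw [es_erase (Finset.mem_univ o), e]
      have h3 : es (Finset.univ.erase o) (fun _ => (1 : ℝ)) (k + 1)
          = ((Fintype.card ι - 1).choose (k + 1) : ℕ) := by
        unfold es
        simp [Finset.card_powersetCard, Finset.card_erase_of_mem]
      rw [h3]
      have : 1 ≤ (Fintype.card ι - 1).choose (k + 1) := Nat.choose_pos (by omega)
      have : (1 : ℝ) ≤ ((Fintype.card ι - 1).choose (k + 1) : ℕ) := by exact_mod_cast this
      simpa [hy₀] using this
    have h2 : ∀ᶠ y in 𝓝 y₀, 1 / 2 < es Finset.univ y (k + 1) :=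
      (continuous_es Finset.univ (k + 1)).continuousAt.eventually (lt_mem_nhds (by linarith))
    obtain ⟨r, hr, hball⟩ := Metric.eventually_nhds_iff.1 h2
    filter_upwards [Ioo_mem_nhdsGT hr] with δ hδ y hyo hy
    refine hball (lt_of_le_of_lt ((dist_pi_le_iff hδ.1.le).2 fun j => ?_) hδ.2)
    rw [Real.dist_eq]
    by_cases hj : j = o
    · subst hj; simpa [hy₀] using hyo
    · simpa [hy₀, hj] using hy j hj
  obtain ⟨δ, hδ, hpos⟩ := ((Filter.eventually_all.2 h).and self_mem_nhdsWithin).exists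
  exact ⟨δ, hpos, hδ⟩

/-- The estimate at an interior maximum. If some other eigenvalue of `W` is comparable to the
largest, the term `b ∑ G_i w_i²` dominates. Otherwise the bound on `σ_{k+1}` forces `k + 1 = n`,
and the barrier term `a ε T` dominates. -/
theorem exists_bound_at_max {k : ℕ} (hn : 2 ≤ Fintype.card ι) (hk : k + 1 ≤ Fintype.card ι)
    {Λ ε : ℝ} (hΛ : 1 ≤ Λ) (hε : 0 < ε) :
    ∃ a b C : ℝ, 0 ≤ a ∧ 0 < b ∧ ∀ D : MaxPointData ι k Λ ε a b, D.w D.o ≤ C := by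
  set n := (Fintype.card ι : ℝ) with hndef
  have hn2 : (2 : ℝ) ≤ n := by rw [hndef]; exact_mod_cast hn
  set b : ℝ := 1 / (12 * Λ ^ 2 * n ^ 3) with hb
  set a : ℝ := (8 * n ^ 2 * Λ ^ 3 * (1 + 2 * Λ) + 3 * Λ ^ 2 * n + 1) / ε with ha
  have hΛ2 : 1 ≤ Λ ^ 2 := one_le_pow₀ hΛ
  have hn3 : 1 ≤ n ^ 3 := one_le_pow₀ (by linarith)
  have hb0 : 0 < b := by positivity
  have ha0 : 0 ≤ a := by positivity
  have hbeq : 12 * b * Λ ^ 2 * n ^ 3 = 1 := by rw [hb]; field_simp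
  have hbΛ : 12 * b * Λ ^ 2 ≤ 1 := by
    rw [← hbeq]
    exact le_mul_of_one_le_right (by positivity) hn3
  have hb1 : b ≤ 1 := by nlinarith
  have haε : a * ε = 8 * n ^ 2 * Λ ^ 3 * (1 + 2 * Λ) + 3 * Λ ^ 2 * n + 1 := by
    rw [ha]; field_simp
  obtain ⟨δ, hδ, hC⟩ : ∃ δ : ℝ, 0 < δ ∧ ∃ C : ℝ, ∀ D : MaxPointData ι k Λ ε a b,
      2 ≤ D.w D.o → (∀ j, j ≠ D.o → |D.w j| ≤ δ * D.w D.o) → D.w D.o ≤ C := by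
    rcases Nat.lt_or_ge (k + 1) (Fintype.card ι) with hlt | hge
    · -- here `η / w_o` is close to a vector of one `0` and `n - 1` ones, where `σ_{k+1} ≥ 1`, so
      -- that the bound on `σ_{k+1}` bounds `w_o`
      obtain ⟨δ, hδ, hes⟩ := exists_radius_es_pos hlt
      have hδn : 0 < δ / n := by positivity
      refine ⟨δ / n, hδn, 2 * Λ, fun D hw hsmall => ?_⟩
      have hw0 : 0 < D.w D.o := by linarith
      have hnδ : n * (δ / n) = δ := by field_simp
      have h1 := hes D.o (fun i => etaOf D.w i / D.w D.o) (by
          have := D.abs_sum_le_of_small hn hδn.le hsmall (s := Finset.univ.erase D.o) (by simp)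
          rw [← hndef, hnδ, ← Finset.sum_div] at this
          rwa [etaOf, ← Finset.add_sum_erase _ _ (Finset.mem_univ D.o), add_sub_cancel_left])
        (fun j hj => by
          have := D.abs_sum_le_of_small hn hδn.le hsmall
            (s := (Finset.univ.erase j).erase D.o) (by simp)
          rw [← hndef, hnδ, ← Finset.sum_div] at this
          rw [etaOf, ← Finset.add_sum_erase _ _ (Finset.mem_univ j), add_sub_cancel_left,
            ← Finset.add_sum_erase _ _ (show D.o ∈ Finset.univ.erase j by simp [hj.symm]),
            add_div, div_self hw0.ne', add_sub_cancel_left]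
          exact this)
      have h2 : es Finset.univ (etaOf D.w) (k + 1) = D.w D.o ^ (k + 1) *
          es Finset.univ (fun i => etaOf D.w i / D.w D.o) (k + 1) := by
        rw [← es_smul]
        congr 1
        ext i
        field_simp
      have h3 := D.sigma_le
      rw [h2] at h3
      have h4 : D.w D.o ≤ D.w D.o ^ (k + 1) := le_self_pow₀ (by linarith) (by omega)
      nlinarith
    · exact ⟨1 / (3 * n), by positivity, _, fun D hw hsmall =>
        D.bound_of_det hn (le_antisymm hk hge) hΛ ha0 hb0 hb1 hbeq.le haε.ge hw hsmall⟩
  obtain ⟨C, hC⟩ := hC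
  refine ⟨a, b, max 2 (max C (4 * n * (8 * n ^ 2 * Λ ^ 3 * (1 + Λ + a * Λ)
    + 3 * n * (n ^ 2 * Λ ^ 4 + a ^ 2 * Λ ^ 2) + 2 * a * Λ * n) / (b * δ ^ 2))), ha0, hb0,
    fun D => ?_⟩
  by_cases hw : 2 ≤ D.w D.o
  · by_cases hsmall : ∀ j, j ≠ D.o → |D.w j| ≤ δ * D.w D.o
    · exact (hC D hw hsmall).trans ((le_max_left _ _).trans (le_max_right _ _))
    · push Not at hsmall
      obtain ⟨j, hj, hlt⟩ := hsmall
      exact (D.bound_of_second_eigenvalue hn hk hΛ ha0 hb0 hb1 hbΛ (by linarith) hδ hj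
        hlt.le).trans ((le_max_right _ _).trans (le_max_right _ _))
  · exact (not_le.1 hw).le.trans (le_max_left _ _)

end Core

end HessianEq

/-! ### Pairs of quadratic forms and changes of frame -/

namespace HessianEq

section Frame

variable {n : ℕ}

/-- The matrix of a bilinear form in the standard basis. -/
noncomputable def bilMat (B : Rn n →L[ℝ] Rn n →L[ℝ] ℝ) : Matrix (Fin n) (Fin n) ℝ :=
  Matrix.of fun i j => B (stdVec i) (stdVec j)

/-- The matrix whose columns are the vectors `X i`. -/
noncomputable def frameMat (X : Fin n → Rn n) : Matrix (Fin n) (Fin n) ℝ := Matrix.of fun l i => X i l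

/-- For `G` the Gram matrix of a metric and `W` the matrix of a symmetric bilinear form, the matrix
of the endomorphism associated with `(tr W) g - W`. -/
noncomputable def traceSub (G W : Matrix (Fin n) (Fin n) ℝ) : Matrix (Fin n) (Fin n) ℝ :=
  (G⁻¹ * W).trace • (1 : Matrix (Fin n) (Fin n) ℝ) - G⁻¹ * W

lemma sum_smul_stdVec (v : Rn n) : v = ∑ l, v l • stdVec l := by
  ext i
  simp [stdVec, Finset.sum_apply, Pi.single_apply]

lemma bilMat_frame (B : Rn n →L[ℝ] Rn n →L[ℝ] ℝ) (X : Fin n → Rn n) :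
    (Matrix.of fun i j => B (X i) (X j)) = (frameMat X)ᵀ * bilMat B * frameMat X := by
  ext i j
  conv_lhs => rw [Matrix.of_apply, sum_smul_stdVec (X i), sum_smul_stdVec (X j)]
  simp only [map_sum, map_smul, sum_apply, smul_apply,
    Matrix.mul_apply, Matrix.transpose_apply, frameMat, bilMat, Matrix.of_apply, smul_eq_mul,
    Finset.sum_mul, Finset.mul_sum]
  refine Finset.sum_congr rfl fun l _ => Finset.sum_congr rfl fun m _ => ?_
  ring

lemma form_frame (p : Rn n →L[ℝ] ℝ) (X : Fin n → Rn n) :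
    (fun i => p (X i)) = (frameMat X)ᵀ *ᵥ fun l => p (stdVec l) := by
  ext i
  conv_lhs => rw [sum_smul_stdVec (X i)]
  simp [Matrix.mulVec, dotProduct, frameMat]

lemma mem_span_stdVec (v : Rn n) : v ∈ Submodule.span ℝ (range (stdVec : Fin n → Rn n)) := by
  rw [sum_smul_stdVec v]
  exact Submodule.sum_mem _ fun i _ => Submodule.smul_mem _ _ (Submodule.subset_span ⟨i, rfl⟩)

lemma stdVec_apply (i j : Fin n) : (stdVec i : Rn n) j = if i = j then 1 else 0 := by
  simp [stdVec, eq_comm]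

lemma posDef_bilMat {B : Rn n →L[ℝ] Rn n →L[ℝ] ℝ} (hsymm : ∀ v w, B v w = B w v)
    (hpos : ∀ v, v ≠ 0 → 0 < B v v) : (bilMat B).PosDef := by
  refine Matrix.PosDef.of_dotProduct_mulVec_pos ?_ fun v hv => ?_
  · ext i j
    simp [bilMat, hsymm (stdVec i)]
  · have h1 := hpos (∑ l, v l • stdVec l) (fun h => hv ?_)
    · simp only [map_sum, map_smul, sum_apply, smul_apply, smul_eq_mul] at h1
      simp only [dotProduct, Matrix.mulVec, bilMat, Matrix.of_apply, Pi.star_apply, star_trivial,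
        Finset.mul_sum]
      refine h1.trans_le (le_of_eq ?_)
      rw [Finset.sum_comm]
      refine Finset.sum_congr rfl fun i _ => ?_
      rw [Finset.mul_sum]
      exact Finset.sum_congr rfl fun j _ => by ring
    · funext i
      have := congrArg (fun z : Rn n => z i) h
      simpa [stdVec_apply] using this

/-- Coordinates of a vector in a frame. -/
lemma exists_frame_coords {e : Fin n → Rn n} (he : IsUnit (frameMat e).det) (v : Rn n) :
    ∃ c : Fin n → ℝ, v = ∑ i, c i • e i := by
  refine ⟨(frameMat e)⁻¹ *ᵥ fun l => v l, ?_⟩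
  ext l
  have : (frameMat e *ᵥ ((frameMat e)⁻¹ *ᵥ fun l => v l)) l = v l := by
    rw [Matrix.mulVec_mulVec, Matrix.mul_nonsing_inv _ he, Matrix.one_mulVec]
  rw [← this]
  simp [frameMat, Matrix.mulVec, dotProduct, mul_comm]

variable {G W J : Matrix (Fin n) (Fin n) ℝ}

lemma inv_mul_frame (hJ : IsUnit J.det) :
    (Jᵀ * G * J)⁻¹ * (Jᵀ * W * J) = J⁻¹ * (G⁻¹ * W) * J := by
  have h : IsUnit (Jᵀ).det := by rwa [Matrix.det_transpose]
  rw [Matrix.mul_inv_rev, Matrix.mul_inv_rev]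
  calc J⁻¹ * (G⁻¹ * Jᵀ⁻¹) * (Jᵀ * W * J)
      = J⁻¹ * G⁻¹ * (Jᵀ⁻¹ * Jᵀ) * W * J := by simp only [Matrix.mul_assoc]
    _ = _ := by rw [Matrix.nonsing_inv_mul _ h]; simp only [Matrix.mul_assoc, Matrix.one_mul]

lemma trace_inv_mul_frame (hJ : IsUnit J.det) :
    ((Jᵀ * G * J)⁻¹ * (Jᵀ * W * J)).trace = (G⁻¹ * W).trace := by
  rw [inv_mul_frame hJ, Matrix.trace_mul_comm, ← Matrix.mul_assoc, Matrix.mul_nonsing_inv _ hJ,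
    Matrix.one_mul]

lemma charpoly_inv_conj (hJ : IsUnit J.det) (N : Matrix (Fin n) (Fin n) ℝ) :
    (J⁻¹ * N * J).charpoly = N.charpoly := by
  exact Matrix.charpoly_units_conj' (J.nonsingInvUnit hJ) N

lemma traceSub_frame (hJ : IsUnit J.det) :
    traceSub (Jᵀ * G * J) (Jᵀ * W * J) = J⁻¹ * traceSub G W * J := by
  rw [traceSub, traceSub, trace_inv_mul_frame hJ, inv_mul_frame hJ, Matrix.mul_sub, Matrix.sub_mul,
    Matrix.mul_smul, Matrix.smul_mul, Matrix.mul_one, Matrix.nonsing_inv_mul _ hJ]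

lemma minorSum_traceSub_frame (hJ : IsUnit J.det) {k : ℕ} (hk : k ≤ n) :
    minorSum k (traceSub (Jᵀ * G * J) (Jᵀ * W * J)) = minorSum k (traceSub G W) := by
  rw [minorSum_eq_coeff (by simpa using hk), minorSum_eq_coeff (by simpa using hk),
    traceSub_frame hJ, charpoly_inv_conj hJ]

/-- The squared norm of a covector does not depend on the frame. -/
lemma dotProduct_inv_frame (hJ : IsUnit J.det) (p : Fin n → ℝ) :
    (Jᵀ *ᵥ p) ⬝ᵥ ((Jᵀ * G * J)⁻¹ *ᵥ (Jᵀ *ᵥ p)) = p ⬝ᵥ (G⁻¹ *ᵥ p) := by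
  have h : IsUnit (Jᵀ).det := by rwa [Matrix.det_transpose]
  rw [Matrix.mul_inv_rev, Matrix.mul_inv_rev, Matrix.mulVec_mulVec, Matrix.mulVec_transpose J p,
    ← Matrix.dotProduct_mulVec, Matrix.mulVec_mulVec]
  congr 2
  calc J * (J⁻¹ * (G⁻¹ * Jᵀ⁻¹) * Jᵀ) = (J * J⁻¹) * G⁻¹ * (Jᵀ⁻¹ * Jᵀ) := by
        simp only [Matrix.mul_assoc]
    _ = _ := by rw [Matrix.nonsing_inv_mul _ h, Matrix.mul_nonsing_inv _ hJ]; simp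

open scoped MatrixOrder Matrix.Norms.L2Operator in
/-- Simultaneous diagonalization of a metric and a quadratic form. -/
lemma exists_frame (hG : G.PosDef) (hW : W.IsHermitian) :
    ∃ (P : Matrix (Fin n) (Fin n) ℝ) (w : Fin n → ℝ), IsUnit P.det ∧ Pᵀ * G * P = 1 ∧
      Pᵀ * W * P = Matrix.diagonal w := by
  obtain ⟨B, hB⟩ := CStarAlgebra.nonneg_iff_eq_star_mul_self.mp hG.posSemidef.nonneg
  rw [Matrix.star_eq_conjTranspose] at hB
  have hBd : IsUnit B.det := by
    have := hG.det_pos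
    rw [hB, Matrix.det_mul] at this
    exact isUnit_iff_ne_zero.2 fun h => by simp [h] at this
  rw [Matrix.conjTranspose_eq_transpose_of_trivial] at hB
  have hBt : IsUnit (Bᵀ).det := by rwa [Matrix.det_transpose]
  set W' := (B⁻¹)ᵀ * W * B⁻¹ with hW'
  have hW'h : W'.IsHermitian := by
    have e : Wᵀ = W := by simpa [Matrix.IsHermitian] using hW
    rw [Matrix.IsHermitian, Matrix.conjTranspose_eq_transpose_of_trivial, hW']
    simp [Matrix.transpose_mul, Matrix.mul_assoc, e]
  set U : Matrix (Fin n) (Fin n) ℝ := hW'h.eigenvectorUnitary.1 with hU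
  have hUU : Uᵀ * U = 1 := by
    have := Unitary.star_mul_self_of_mem hW'h.eigenvectorUnitary.2
    rwa [Matrix.star_eq_conjTranspose, Matrix.conjTranspose_eq_transpose_of_trivial] at this
  have hUd : IsUnit U.det := by
    have := congrArg Matrix.det hUU
    rw [Matrix.det_mul, Matrix.det_one] at this
    exact IsUnit.of_mul_eq_one _ ((mul_comm _ _).trans this)
  refine ⟨B⁻¹ * U, hW'h.eigenvalues, ?_, ?_, ?_⟩
  · rw [Matrix.det_mul]
    exact (Matrix.isUnit_nonsing_inv_det _ hBd).mul hUd
  · rw [hB, Matrix.transpose_mul]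
    calc Uᵀ * (B⁻¹)ᵀ * (Bᵀ * B) * (B⁻¹ * U) = Uᵀ * ((B⁻¹)ᵀ * Bᵀ) * (B * B⁻¹) * U := by
          simp only [Matrix.mul_assoc]
      _ = 1 := by
          rw [← Matrix.transpose_mul, Matrix.mul_nonsing_inv _ hBd]; simp [hUU]
  · have h1 : (B⁻¹ * U)ᵀ * W * (B⁻¹ * U) = Uᵀ * W' * U := by
      rw [hW', Matrix.transpose_mul]; simp only [Matrix.mul_assoc]
    have h2 : W' = U * Matrix.diagonal hW'h.eigenvalues * Uᵀ := by
      have := hW'h.spectral_theorem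
      rw [Unitary.conjStarAlgAut_apply] at this
      exact this
    rw [h1]
    conv_lhs => rw [h2]
    calc Uᵀ * (U * Matrix.diagonal hW'h.eigenvalues * Uᵀ) * U
        = (Uᵀ * U) * Matrix.diagonal hW'h.eigenvalues * (Uᵀ * U) := by
          simp only [Matrix.mul_assoc]
      _ = _ := by simp [hUU]

end Frame

/-! ### Jets of frame components -/

section Jet

variable {E F : Type*} [NormedAddCommGroup E] [NormedSpace ℝ E]
  [NormedAddCommGroup F] [NormedSpace ℝ F]

/-- A second order jet whose three components are bounded by `A`. -/
def JetLE (f : ℝ → E) (A : ℝ) : Prop :=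
  ∃ a b c, HasJet f a b c ∧ ‖a‖ ≤ A ∧ ‖b‖ ≤ A ∧ ‖c‖ ≤ A

lemma JetLE.mono {f : ℝ → E} {A B : ℝ} (h : JetLE f A) (hAB : A ≤ B) : JetLE f B := by
  obtain ⟨a, b, c, h, h1, h2, h3⟩ := h
  exact ⟨a, b, c, h, h1.trans hAB, h2.trans hAB, h3.trans hAB⟩

lemma JetLE.nonneg {f : ℝ → E} {A : ℝ} (h : JetLE f A) : 0 ≤ A := by
  obtain ⟨a, b, c, h, h1, h2, h3⟩ := h
  exact (norm_nonneg a).trans h1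

lemma JetLE.clm_apply {f : ℝ → F →L[ℝ] E} {g : ℝ → F} {A B : ℝ} (hf : JetLE f A)
    (hg : JetLE g B) : JetLE (fun t => f t (g t)) (4 * A * B) := by
  have hA := hf.nonneg
  have hB := hg.nonneg
  obtain ⟨a, b, c, h, h1, h2, h3⟩ := hf
  obtain ⟨a', b', c', h', h1', h2', h3'⟩ := hg
  have e : ∀ {p : F →L[ℝ] E} {q : F}, ‖p‖ ≤ A → ‖q‖ ≤ B → ‖p q‖ ≤ A * B := fun hp hq =>
    (ContinuousLinearMap.le_opNorm _ _).trans (mul_le_mul hp hq (norm_nonneg _) hA)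
  have hAB : 0 ≤ A * B := mul_nonneg hA hB
  refine ⟨_, _, _, h.clm_apply h', ?_, ?_, ?_⟩
  · linarith [e h1 h1']
  · linarith [norm_add_le (b a') (a b'), e h2 h1', e h1 h2']
  · have h5 : ‖(2 : ℝ) • b b'‖ ≤ 2 * (A * B) := by
      rw [norm_smul, Real.norm_ofNat]
      linarith [e h2 h2']
    linarith [norm_add₃_le (a := c a') (b := (2 : ℝ) • b b') (c := a c'), e h3 h1', e h1 h3']

lemma exists_hasJet_det {m : Type*} [Fintype m] [DecidableEq m] {N : ℝ → Matrix m m ℝ}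
    (h : ∀ i j, ∃ a b c, HasJet (fun t => N t i j) a b c) :
    ∃ a b c, HasJet (fun t => (N t).det) a b c := by
  choose a b c h using h
  simp only [Matrix.det_apply']
  exact ⟨_, _, _, HasJet.sum (s := (Finset.univ : Finset (Equiv.Perm m))) fun σ _ =>
    HasJet.const_mul ((Equiv.Perm.sign σ : ℤ) : ℝ)
      (HasJet.finset_prod (s := Finset.univ) fun i _ => h (σ i) i)⟩

lemma hasJet_inv {m : Type*} [Fintype m] [DecidableEq m] {G : ℝ → Matrix m m ℝ}
    {G₂ : Matrix m m ℝ}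
    (h : ∀ i j, HasJet (fun t => G t i j) ((1 : Matrix m m ℝ) i j) 0 (G₂ i j)) :
    ∀ i j, HasJet (fun t => (G t)⁻¹ i j) ((1 : Matrix m m ℝ) i j) 0 (- G₂ i j) := by
  have hG0 : G 0 = 1 := by ext i j; exact (h i j).1
  obtain ⟨da, db, dc, hdet⟩ := exists_hasJet_det fun i j => ⟨_, _, _, h i j⟩
  have hda : da = 1 := by simp [← hdet.1, hG0]
  subst hda
  have hdet' := HasJet.comp (Φ := fun x : ℝ => x⁻¹)
    ((contDiffAt_inv ℝ one_ne_zero)) hdet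
  have hadj : ∀ i j, ∃ a b c, HasJet (fun t => (G t).adjugate i j) a b c := by
    intro i j
    simp only [Matrix.adjugate_apply]
    refine exists_hasJet_det fun i' j' => ?_
    simp only [Matrix.updateRow_apply]
    split_ifs with hh
    · exact ⟨_, _, _, HasJet.const _⟩
    · exact ⟨_, _, _, h i' j'⟩
  have hex : ∀ i j, ∃ a b c, HasJet (fun t => (G t)⁻¹ i j) a b c := by
    intro i j
    obtain ⟨a, b, c, h1⟩ := hadj i j
    refine ⟨_, _, _, (hdet'.mul h1).congr (Filter.Eventually.of_forall fun t => ?_)⟩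
    simp [Matrix.inv_def, Ring.inverse_eq_inv']
  choose a b c hm using hex
  have hunit : ∀ᶠ t in nhds (0 : ℝ), IsUnit (G t).det := by
    have := hdet.continuousAt.eventually_ne (y := 0) (by simp [hG0])
    exact this.mono fun t ht => isUnit_iff_ne_zero.2 ht
  -- the jet of the constant product `G⁻¹ * G` determines the jet of `G⁻¹`
  have hprod : ∀ i j, HasJet (fun t => ((G t)⁻¹ * G t) i j) ((1 : Matrix m m ℝ) i j) 0 0 := by
    intro i j
    refine (HasJet.const _).congr ?_
    filter_upwards [hunit] with t ht
    rw [Matrix.nonsing_inv_mul _ ht]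
  have ha : ∀ i j, a i j = (1 : Matrix m m ℝ) i j := by
    intro i j
    simp [← (hm i j).1, hG0]
  intro i j
  have key := HasJet.sum (s := Finset.univ) fun l _ => (hm i l).mul (h l j)
  obtain ⟨-, e1, e2⟩ := ((hprod i j).congr
    (Filter.Eventually.of_forall fun t => by simp [Matrix.mul_apply])).unique key
  have hj := hm i j
  simp only [ha, Matrix.one_apply, mul_ite, mul_one, mul_zero, add_zero, ite_mul, one_mul,
    zero_mul, Finset.sum_ite_eq', Finset.sum_ite_eq, Finset.mem_univ, if_true,
    Finset.sum_add_distrib] at e1 e2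
  have h2 : c i j = - G₂ i j := by linarith
  rw [ha, ← e1, h2] at hj
  exact hj

end Jet
end HessianEq

/-! ### The test function at an interior maximum, in coordinates -/

namespace HessianEq

open Filter Topology

section Local

/-- `Φ` is `C²` at `y`, and its derivatives of order at most `2` at `y` are bounded by `L`. -/
structure C2BoundAt {E F : Type*} [NormedAddCommGroup E] [NormedSpace ℝ E]
    [NormedAddCommGroup F] [NormedSpace ℝ F] (Φ : E → F) (y : E) (L : ℝ) : Prop where
  contDiffAt : ContDiffAt ℝ 2 Φ y
  norm_le : ‖Φ y‖ ≤ L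
  norm_fderiv_le : ‖fderiv ℝ Φ y‖ ≤ L
  norm_fderiv_fderiv_le : ‖fderiv ℝ (fderiv ℝ Φ) y‖ ≤ L

variable {n : ℕ}

/-- The Hessian `D²u - Du ∘ Γ` of `u` with respect to a connection with Christoffel symbols `Γ`. -/
noncomputable def hessForm (u : Rn n → ℝ) (Γ : Rn n → Rn n →L[ℝ] Rn n →L[ℝ] Rn n) (y : Rn n) :
    Rn n →L[ℝ] Rn n →L[ℝ] ℝ :=
  fderiv ℝ (fderiv ℝ u) y -
    (ContinuousLinearMap.compL ℝ (Rn n) (Rn n) ℝ (fderiv ℝ u y)).comp (Γ y)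

lemma hessForm_apply (u : Rn n → ℝ) (Γ : Rn n → Rn n →L[ℝ] Rn n →L[ℝ] Rn n) (y v w : Rn n) :
    hessForm u Γ y v w = fderiv ℝ (fderiv ℝ u) y v w - fderiv ℝ u y (Γ y v w) := by
  simp [hessForm]

/-- The squared norm of the covector `p` with respect to the metric `g`. -/
noncomputable def covecSq (g : Rn n →L[ℝ] Rn n →L[ℝ] ℝ) (p : Rn n →L[ℝ] ℝ) : ℝ :=
  (fun i => p (stdVec i)) ⬝ᵥ ((bilMat g)⁻¹ *ᵥ fun i => p (stdVec i))

/-- The exponent `(b/2) |∇u|² + a (u_* - u)` of the test function. -/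
noncomputable def testExp (a b : ℝ) (u us : Rn n → ℝ) (g : Rn n → Rn n →L[ℝ] Rn n →L[ℝ] ℝ)
    (y : Rn n) : ℝ :=
  b / 2 * covecSq (g y) (fderiv ℝ u y) + a * (us y - u y)

/-- The situation in a chart at an interior maximum point `y₀` of
`exp (testExp a b u us g) * W(v, v) / g(v, v)`, where `W = ∇²u + θ` and `u` solves
`σ_{k+1}((tr W) g - W) = f`. The constant `L` bounds all the data which are under control, and
`w₀` is the largest eigenvalue of `W` at `y₀`. -/
structure InteriorMax (n k : ℕ) (L ε a b : ℝ) where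
  (y₀ : Rn n) (u us : Rn n → ℝ) (g θ : Rn n → Rn n →L[ℝ] Rn n →L[ℝ] ℝ)
  (Γ : Rn n → Rn n →L[ℝ] Rn n →L[ℝ] Rn n) (f : Rn n × ℝ × (Rn n →L[ℝ] ℝ) → ℝ) (w₀ : ℝ)
  contDiffAt_u : ContDiffAt ℝ 4 u y₀
  norm_fderiv_u_le : ‖fderiv ℝ u y₀‖ ≤ L
  us_bound : C2BoundAt us y₀ L
  g_bound : C2BoundAt g y₀ L
  θ_bound : C2BoundAt θ y₀ L
  Γ_bound : C2BoundAt Γ y₀ L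
  f_bound : C2BoundAt f (y₀, u y₀, fderiv ℝ u y₀) L
  g_symm : ∀ᶠ y in 𝓝 y₀, ∀ v w, g y v w = g y w v
  θ_symm : ∀ᶠ y in 𝓝 y₀, ∀ v w, θ y v w = θ y w v
  Γ_symm : ∀ᶠ y in 𝓝 y₀, ∀ v w, Γ y v w = Γ y w v
  sq_norm_le : ∀ v, ‖v‖ ^ 2 ≤ L * g y₀ v v
  compat : ∀ v x z, fderiv ℝ g y₀ v x z = g y₀ (Γ y₀ v x) z + g y₀ x (Γ y₀ v z)
  equation : ∀ᶠ y in 𝓝 y₀,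
    minorSum (k + 1) (traceSub (bilMat (g y)) (bilMat (hessForm u Γ y + θ y))) =
      f (y, u y, fderiv ℝ u y)
  admissible : ∀ j ≤ k + 1,
    0 < minorSum j (traceSub (bilMat (g y₀)) (bilMat (hessForm u Γ y₀ + θ y₀)))
  one_le : 1 ≤ L * f (y₀, u y₀, fderiv ℝ u y₀)
  barrier : k + 1 = n → ∀ v, ε * g y₀ v v ≤
    ((bilMat (g y₀))⁻¹ * bilMat (hessForm us Γ y₀ + θ y₀)).trace * g y₀ v v -
      (hessForm us Γ y₀ v v + θ y₀ v v)
  le_max : ∀ᶠ y in 𝓝 y₀, ∀ v, (hessForm u Γ y v v + θ y v v) * Real.exp (testExp a b u us g y) ≤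
    w₀ * Real.exp (testExp a b u us g y₀) * g y v v
  max_attained : ∃ v, v ≠ 0 ∧ hessForm u Γ y₀ v v + θ y₀ v v = w₀ * g y₀ v v

namespace InteriorMax

variable {k : ℕ} {L ε a b : ℝ}

/-- The tensor `W = ∇²u + θ`. -/
noncomputable def W (D : InteriorMax n k L ε a b) (y : Rn n) : Rn n →L[ℝ] Rn n →L[ℝ] ℝ :=
  hessForm D.u D.Γ y + D.θ y

lemma W_apply (D : InteriorMax n k L ε a b) (y v w : Rn n) :
    D.W y v w = fderiv ℝ (fderiv ℝ D.u) y v w - fderiv ℝ D.u y (D.Γ y v w) + D.θ y v w := by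
  simp [W, hessForm_apply]

/-- A frame at `y₀`, orthonormal for the metric, which diagonalizes `W`; `o` is the index
of the largest eigenvalue. -/
structure EigenFrame (D : InteriorMax n k L ε a b) where
  (e : Fin n → Rn n) (w : Fin n → ℝ) (o : Fin n)
  gram_eq : ∀ i j, D.g D.y₀ (e i) (e j) = (1 : Matrix (Fin n) (Fin n) ℝ) i j
  form_eq : ∀ i j, D.W D.y₀ (e i) (e j) = Matrix.diagonal w i j
  isUnit_det : IsUnit (frameMat e).det
  w_o : w o = D.w₀
  w_le : ∀ i, w i ≤ D.w₀

lemma eventually_W_symm (D : InteriorMax n k L ε a b) :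
    ∀ᶠ y in 𝓝 D.y₀, ∀ v w, D.W y v w = D.W y w v := by
  filter_upwards [D.θ_symm, D.Γ_symm,
    (D.contDiffAt_u.of_le (m := 2) (by norm_num)).eventually (by simp)] with y h1 h2 h3 v w
  rw [D.W_apply, D.W_apply, h1, h2, (h3.isSymmSndFDerivAt (by simp)).eq]

lemma metric_pos (D : InteriorMax n k L ε a b) (hL : 1 ≤ L) {v : Rn n} (hv : v ≠ 0) :
    0 < D.g D.y₀ v v := by
  have h1 := D.sq_norm_le v
  have h2 : 0 < ‖v‖ ^ 2 := by positivity
  by_contra! h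
  nlinarith

lemma nonempty_eigenFrame (D : InteriorMax n k L ε a b) (hL : 1 ≤ L) :
    Nonempty D.EigenFrame := by
  have hG : (bilMat (D.g D.y₀)).PosDef :=
    posDef_bilMat D.g_symm.self_of_nhds fun _ hv => D.metric_pos hL hv
  have hW : (bilMat (D.W D.y₀)).IsHermitian := by
    ext i j
    simp [bilMat, D.eventually_W_symm.self_of_nhds (stdVec i) (stdVec j)]
  obtain ⟨P, w, hP, h1, h2⟩ := exists_frame hG hW
  set e : Fin n → Rn n := fun i => WithLp.toLp 2 fun l => P l i with he
  have hPe : frameMat e = P := by ext l i; rfl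
  have hg : ∀ i j, D.g D.y₀ (e i) (e j) = (1 : Matrix (Fin n) (Fin n) ℝ) i j := fun i j => by
    rw [← h1, ← hPe, ← bilMat_frame]; rfl
  have hw : ∀ i j, D.W D.y₀ (e i) (e j) = Matrix.diagonal w i j := fun i j => by
    rw [← h2, ← hPe, ← bilMat_frame]; rfl
  have hle : ∀ i, w i ≤ D.w₀ := by
    intro i
    have := D.le_max.self_of_nhds (e i)
    have e1 : hessForm D.u D.Γ D.y₀ (e i) (e i) + D.θ D.y₀ (e i) (e i) = w i := by
      have := hw i i
      rw [Matrix.diagonal_apply_eq] at this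
      exact this
    rw [e1, hg, Matrix.one_apply_eq, mul_one] at this
    exact le_of_mul_le_mul_right this (Real.exp_pos _)
  obtain ⟨v, hv, hvmax⟩ := D.max_attained
  -- expand the maximizing direction in the frame
  obtain ⟨c, hc⟩ := exists_frame_coords (by rwa [hPe] : IsUnit (frameMat e).det) v
  have hgv : D.g D.y₀ v v = ∑ i, c i ^ 2 := by
    rw [hc]
    simp [hg, Matrix.one_apply, sq]
  have hWv : D.W D.y₀ v v = ∑ i, w i * c i ^ 2 := by
    rw [hc]
    simp [hw, Matrix.diagonal_apply, sq]
    exact Finset.sum_congr rfl fun i _ => by ring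
  have hsum : ∑ i, (D.w₀ - w i) * c i ^ 2 = 0 := by
    have : D.W D.y₀ v v = D.w₀ * D.g D.y₀ v v := hvmax
    rw [hgv, hWv, Finset.mul_sum] at this
    simp only [sub_mul, Finset.sum_sub_distrib, this, sub_self]
  have hz := (Finset.sum_eq_zero_iff_of_nonneg fun i _ =>
    mul_nonneg (sub_nonneg.2 (hle i)) (sq_nonneg (c i))).1 hsum
  obtain ⟨o, ho⟩ : ∃ o, c o ≠ 0 := by
    by_contra! h
    exact hv (by rw [hc]; simp [h])
  refine ⟨⟨e, w, o, hg, hw, by rw [hPe]; exact hP, ?_, hle⟩⟩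
  have := hz o (Finset.mem_univ _)
  have h3 : c o ^ 2 ≠ 0 := pow_ne_zero _ ho
  rcases mul_eq_zero.1 this with h | h
  · linarith
  · exact absurd h h3

end InteriorMax
end Local
end HessianEq

namespace HessianEq

open Filter Topology

/-! ### Normal coordinates -/

section Normal

variable {n : ℕ} {u : Rn n → ℝ} {y₀ : Rn n} {B : Rn n →L[ℝ] Rn n →L[ℝ] Rn n}

/-- The coordinate change `z ↦ y₀ + z - B(z, z) / 2`, which removes the Christoffel symbols `B`
at `y₀`. -/
noncomputable def normalMap (y₀ : Rn n) (B : Rn n →L[ℝ] Rn n →L[ℝ] Rn n) (z : Rn n) : Rn n :=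
  y₀ + z - (1 / 2 : ℝ) • B z z

/-- The differential of `normalMap` at `z`. -/
noncomputable def normalDeriv (B : Rn n →L[ℝ] Rn n →L[ℝ] Rn n) (z : Rn n) : Rn n →L[ℝ] Rn n :=
  ContinuousLinearMap.id ℝ (Rn n) - B z

lemma hasFDerivAt_normalMap (hB : ∀ v w, B v w = B w v) (z : Rn n) :
    HasFDerivAt (normalMap y₀ B) (normalDeriv B z) z := by
  have h1 : HasFDerivAt (fun z => B z z) _ z := (B.hasFDerivAt (x := z)).clm_apply (hasFDerivAt_id z)
  have h2 := ((hasFDerivAt_const y₀ z).add (hasFDerivAt_id z)).sub (h1.const_smul (1 / 2 : ℝ))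
  refine h2.congr_fderiv ?_
  ext v : 1
  simp only [normalDeriv, zero_add, sub_apply, ContinuousLinearMap.id_apply, smul_apply, add_apply,
    ContinuousLinearMap.comp_apply, ContinuousLinearMap.flip_apply, hB v z]
  rw [← two_smul ℝ (B z v), smul_smul]
  norm_num

@[simp] lemma normalMap_zero : normalMap y₀ B 0 = y₀ := by simp [normalMap]

lemma contDiff_normalMap {m : WithTop ℕ∞} : ContDiff ℝ m (normalMap y₀ B) := by
  unfold normalMap
  fun_prop

lemma tendsto_normalMap : Tendsto (normalMap y₀ B) (𝓝 0) (𝓝 y₀) := by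
  have := (contDiff_normalMap (y₀ := y₀) (B := B) (m := 1)).continuous.tendsto 0
  rwa [normalMap_zero] at this

lemma contDiffAt_comp_normalMap (hu : ContDiffAt ℝ 4 u y₀) :
    ContDiffAt ℝ 4 (u ∘ normalMap y₀ B) 0 :=
  ContDiffAt.comp _ (by simpa using hu) contDiff_normalMap.contDiffAt

lemma fderiv_comp_normalMap (hB : ∀ v w, B v w = B w v) (hu : ContDiffAt ℝ 4 u y₀) :
    ∀ᶠ z in 𝓝 0, fderiv ℝ (u ∘ normalMap y₀ B) z =
      (fderiv ℝ u (normalMap y₀ B z)).comp (normalDeriv B z) := by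
  filter_upwards [tendsto_normalMap.eventually (hu.eventually (by simp))] with z hz
  exact ((hz.differentiableAt (by simp)).hasFDerivAt.comp z (hasFDerivAt_normalMap hB z)).fderiv

lemma fderiv_fderiv_comp_normalMap (hB : ∀ v w, B v w = B w v) (hu : ContDiffAt ℝ 4 u y₀) :
    ∀ᶠ z in 𝓝 0, ∀ v w, fderiv ℝ (fderiv ℝ (u ∘ normalMap y₀ B)) z v w =
      fderiv ℝ (fderiv ℝ u) (normalMap y₀ B z) (normalDeriv B z v) (normalDeriv B z w) -
        fderiv ℝ u (normalMap y₀ B z) (B v w) := by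
  filter_upwards [tendsto_normalMap.eventually (hu.eventually (by simp)),
    (fderiv_comp_normalMap hB hu).eventually_nhds] with z hz hz' v w
  have h1 : HasFDerivAt (fderiv ℝ u) _ (normalMap y₀ B z) :=
    ((hz.fderiv_right (m := 3) (by norm_num)).differentiableAt (by simp)).hasFDerivAt
  have h2 := h1.comp z (hasFDerivAt_normalMap (y₀ := y₀) hB z)
  have h3 : HasFDerivAt (fun z => normalDeriv B z w) (-(B.flip w)) z := by
    have : HasFDerivAt (fun z => w - B.flip w z) _ z :=
      (hasFDerivAt_const w z).sub (B.flip w).hasFDerivAt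
    refine (this.congr_fderiv (by simp)).congr_of_eventuallyEq (Eventually.of_forall fun y => ?_)
    simp [normalDeriv]
  have h4 := h2.clm_apply h3
  have h5 : HasFDerivAt (fun z => fderiv ℝ (u ∘ normalMap y₀ B) z w) _ z :=
    h4.congr_of_eventuallyEq (by
      filter_upwards [hz'] with y hy
      rw [hy]; rfl)
  have h6 : DifferentiableAt ℝ (fderiv ℝ (u ∘ normalMap y₀ B)) z :=
    (((hz.comp z contDiff_normalMap.contDiffAt).fderiv_right (m := 3)
      (by norm_num)).differentiableAt (by simp))
  have h7 := (h6.hasFDerivAt.clm_apply (hasFDerivAt_const w z)).unique h5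
  have h8 := congrArg (fun T => T v) h7
  simp at h8
  rw [h8]
  ring

end Normal

section Symm

variable {E : Type*} [NormedAddCommGroup E] [NormedSpace ℝ E]

lemma hasFDerivAt_fderiv_apply {F : Type*} [NormedAddCommGroup F] [NormedSpace ℝ F] {Q : E → F}
    {z : E} (hQ : ContDiffAt ℝ 2 Q z) (b : E) :
    HasFDerivAt (fun y => fderiv ℝ Q y b) ((fderiv ℝ (fderiv ℝ Q) z).flip b) z := by
  have h : HasFDerivAt (fderiv ℝ Q) _ z :=
    ((hQ.fderiv_right (m := 1) (by norm_num)).differentiableAt (by simp)).hasFDerivAt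
  exact (h.clm_apply (hasFDerivAt_const b z)).congr_fderiv (by simp)

/-- Symmetry of the fourth derivative. -/
lemma fourth_deriv_symm {u : E → ℝ} {z : E} (hu : ContDiffAt ℝ 4 u z) (v w : E) :
    fderiv ℝ (fderiv ℝ (fderiv ℝ (fderiv ℝ u))) z v v w w =
      fderiv ℝ (fderiv ℝ (fderiv ℝ (fderiv ℝ u))) z w w v v := by
  have hP : ContDiffAt ℝ 3 (fderiv ℝ u) z := hu.fderiv_right (by norm_num)
  have hQ : ContDiffAt ℝ 2 (fderiv ℝ (fderiv ℝ u)) z := hP.fderiv_right (by norm_num)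
  generalize hQdef : fderiv ℝ (fderiv ℝ u) = Q at hQ ⊢
  have s1 : ∀ a b c d, fderiv ℝ (fderiv ℝ Q) z a b c d = fderiv ℝ (fderiv ℝ Q) z b a c d :=
    fun a b c d => by
      rw [(hQ.isSymmSndFDerivAt (by simp)).eq]
  have k : ∀ b c d, HasFDerivAt (fun y => fderiv ℝ Q y b c d) _ z := fun b c d =>
    ((hasFDerivAt_fderiv_apply hQ b).clm_apply (hasFDerivAt_const c z)).clm_apply
      (hasFDerivAt_const d z)
  have s2 : ∀ a b c d, fderiv ℝ (fderiv ℝ Q) z a b c d = fderiv ℝ (fderiv ℝ Q) z a c b d :=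
    fun a b c d => by
      have e : (fun y => fderiv ℝ Q y b c d) =ᶠ[𝓝 z] fun y => fderiv ℝ Q y c b d := by
        filter_upwards [hP.eventually (by simp)] with y hy
        have hy2 : ContDiffAt ℝ 2 (fderiv ℝ u) y := hy.of_le (by norm_num)
        rw [← hQdef, (hy2.isSymmSndFDerivAt (by simp)).eq]
      have := congrArg (fun T => T a) ((k b c d).unique ((k c b d).congr_of_eventuallyEq e))
      simpa using this
  have s3 : ∀ a b c d, fderiv ℝ (fderiv ℝ Q) z a b c d = fderiv ℝ (fderiv ℝ Q) z a b d c :=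
    fun a b c d => by
      have e : ∀ᶠ y in 𝓝 z, (fun y => Q y c d) =ᶠ[𝓝 y] fun y => Q y d c := by
        refine Eventually.eventually_nhds ?_
        filter_upwards [hu.eventually (by simp)] with y hy
        have hy2 : ContDiffAt ℝ 2 u y := hy.of_le (by norm_num)
        rw [← hQdef, (hy2.isSymmSndFDerivAt (by simp)).eq]
      have e' : (fun y => fderiv ℝ Q y b c d) =ᶠ[𝓝 z] fun y => fderiv ℝ Q y b d c := by
        filter_upwards [e, hQ.eventually (by simp)] with y hy hy'
        have k' : ∀ c d, HasFDerivAt (fun y => Q y c d) _ y := fun c d =>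
          (((hy'.differentiableAt (by simp)).hasFDerivAt).clm_apply
            (hasFDerivAt_const c y)).clm_apply (hasFDerivAt_const d y)
        have := congrArg (fun T => T b) ((k' c d).unique ((k' d c).congr_of_eventuallyEq hy))
        simpa using this
      have := congrArg (fun T => T a) ((k b c d).unique ((k b d c).congr_of_eventuallyEq e'))
      simpa using this
  rw [s2, s1, s3, s2]

lemma third_deriv_symm {u : E → ℝ} {z : E} (hu : ContDiffAt ℝ 4 u z) (a b c : E) :
    fderiv ℝ (fderiv ℝ (fderiv ℝ u)) z a b c = fderiv ℝ (fderiv ℝ (fderiv ℝ u)) z b a c := by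
  have hP : ContDiffAt ℝ 2 (fderiv ℝ u) z := hu.fderiv_right (by norm_num)
  rw [(hP.isSymmSndFDerivAt (by simp)).eq]

lemma third_deriv_symm' {u : E → ℝ} {z : E} (hu : ContDiffAt ℝ 4 u z) (a b c : E) :
    fderiv ℝ (fderiv ℝ (fderiv ℝ u)) z a b c = fderiv ℝ (fderiv ℝ (fderiv ℝ u)) z a c b := by
  have hQ : ContDiffAt ℝ 2 (fderiv ℝ (fderiv ℝ u)) z :=
    ContDiffAt.fderiv_right (m := 2) (n := 3) (hu.fderiv_right (by norm_num)) (by norm_num)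
  have e : (fun y => fderiv ℝ (fderiv ℝ u) y b c) =ᶠ[𝓝 z] fun y => fderiv ℝ (fderiv ℝ u) y c b := by
    filter_upwards [hu.eventually (by simp)] with y hy
    have hy2 : ContDiffAt ℝ 2 u y := hy.of_le (by norm_num)
    rw [(hy2.isSymmSndFDerivAt (by simp)).eq]
  have k : ∀ c d, HasFDerivAt (fun y => fderiv ℝ (fderiv ℝ u) y c d) _ z := fun c d =>
    (((hQ.differentiableAt (by simp)).hasFDerivAt).clm_apply
      (hasFDerivAt_const c z)).clm_apply (hasFDerivAt_const d z)
  have := congrArg (fun T => T a) ((k b c).unique ((k c b).congr_of_eventuallyEq e))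
  simpa using this

end Symm

end HessianEq

namespace HessianEq

open Filter Topology

/-! ### Jets along the coordinate curves of normal coordinates -/

lemma HasJet.apply_const {E F : Type*} [NormedAddCommGroup E] [NormedSpace ℝ E]
    [NormedAddCommGroup F] [NormedSpace ℝ F] {f : ℝ → E →L[ℝ] F} {a b c : E →L[ℝ] F}
    (h : HasJet f a b c) (v : E) : HasJet (fun t => f t v) (a v) (b v) (c v) :=
  h.clm (ContinuousLinearMap.apply ℝ F v)

lemma HasJet.of_contDiffAt_zero {E F : Type*} [NormedAddCommGroup E] [NormedSpace ℝ E]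
    [NormedAddCommGroup F] [NormedSpace ℝ F] {Φ : E → F} (hΦ : ContDiffAt ℝ 2 Φ 0) (v : E) :
    HasJet (fun t : ℝ => Φ (t • v)) (Φ 0) (fderiv ℝ Φ 0 v) (fderiv ℝ (fderiv ℝ Φ) 0 v v) := by
  simpa using HasJet.of_contDiffAt hΦ v

namespace InteriorMax.EigenFrame

variable {n k : ℕ} {L ε a b : ℝ} {D : InteriorMax n k L ε a b} (S : D.EigenFrame)

/-- The function `u` in normal coordinates. -/
noncomputable def ut (_ : D.EigenFrame) : Rn n → ℝ := D.u ∘ normalMap D.y₀ (D.Γ D.y₀)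

/-- The curve in direction `e i`. -/
noncomputable def curve (i : Fin n) (t : ℝ) : Rn n := normalMap D.y₀ (D.Γ D.y₀) (t • S.e i)

/-- The frame along the curve in direction `e i` given by the coordinate vector fields. -/
noncomputable def X (i j : Fin n) (t : ℝ) : Rn n := normalDeriv (D.Γ D.y₀) (t • S.e i) (S.e j)

/-- The second derivatives of `u` in normal coordinates. -/
noncomputable def U2 (i j : Fin n) : ℝ := fderiv ℝ (fderiv ℝ S.ut) 0 (S.e i) (S.e j)

/-- The third derivatives of `u` in normal coordinates. -/
noncomputable def U3 (i j l : Fin n) : ℝ :=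
  fderiv ℝ (fderiv ℝ (fderiv ℝ S.ut)) 0 (S.e i) (S.e j) (S.e l)

/-- The fourth derivatives, twice in direction `e i`, of `u` in normal coordinates. -/
noncomputable def U4 (i j l : Fin n) : ℝ :=
  fderiv ℝ (fderiv ℝ (fderiv ℝ (fderiv ℝ S.ut))) 0 (S.e i) (S.e i) (S.e j) (S.e l)

lemma Γ₀_symm (D : InteriorMax n k L ε a b) (v w : Rn n) : D.Γ D.y₀ v w = D.Γ D.y₀ w v :=
  D.Γ_symm.self_of_nhds v w

lemma contDiffAt_ut : ContDiffAt ℝ 4 S.ut 0 := contDiffAt_comp_normalMap D.contDiffAt_u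

lemma U3_symm (i j l : Fin n) : S.U3 i j l = S.U3 j i l := third_deriv_symm S.contDiffAt_ut _ _ _

lemma U3_symm' (i j l : Fin n) : S.U3 i j l = S.U3 i l j := third_deriv_symm' S.contDiffAt_ut _ _ _

lemma U4_symm (i j : Fin n) : S.U4 i j j = S.U4 j i i := fourth_deriv_symm S.contDiffAt_ut _ _

lemma hasJet_curve (i : Fin n) :
    HasJet (S.curve i) D.y₀ (S.e i) (- D.Γ D.y₀ (S.e i) (S.e i)) := by
  refine (HasJet.quadratic D.y₀ (S.e i) (- D.Γ D.y₀ (S.e i) (S.e i))).congr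
    (Eventually.of_forall fun t => ?_)
  simp only [curve, normalMap, map_smul, smul_apply, smul_smul, smul_neg]
  rw [sub_eq_add_neg]
  congr 3
  ring

lemma hasJet_X (i j : Fin n) :
    HasJet (S.X i j) (S.e j) (- D.Γ D.y₀ (S.e i) (S.e j)) 0 := by
  refine (HasJet.line (S.e j) (- D.Γ D.y₀ (S.e i) (S.e j))).congr
    (Eventually.of_forall fun t => ?_)
  simp [X, normalDeriv, sub_eq_add_neg]

lemma hasJet_line (i : Fin n) : HasJet (fun t : ℝ => t • S.e i) 0 (S.e i) 0 := by
  simpa using HasJet.line 0 (S.e i)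

lemma hasJet_fderiv_ut (i l : Fin n) :
    HasJet (fun t : ℝ => fderiv ℝ S.ut (t • S.e i) (S.e l)) (fderiv ℝ S.ut 0 (S.e l))
      (S.U2 i l) (S.U3 i i l) := by
  exact (HasJet.of_contDiffAt_zero ((S.contDiffAt_ut.fderiv_right (m := 3)
    (by norm_num)).of_le (by norm_num)) (S.e i)).apply_const (S.e l)

lemma hasJet_hess_ut (i j l : Fin n) :
    HasJet (fun t : ℝ => fderiv ℝ (fderiv ℝ S.ut) (t • S.e i) (S.e j) (S.e l))
      (S.U2 j l) (S.U3 i j l) (S.U4 i j l) := by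
  have h3 : ContDiffAt ℝ 3 (fderiv ℝ S.ut) 0 := S.contDiffAt_ut.fderiv_right (by norm_num)
  exact ((HasJet.of_contDiffAt_zero (h3.fderiv_right (m := 2) (by norm_num))
    (S.e i)).apply_const (S.e j)).apply_const (S.e l)

lemma tendsto_curve (i : Fin n) : Tendsto (S.curve i) (𝓝 0) (𝓝 D.y₀) := by
  have := (S.hasJet_curve i).continuousAt.tendsto
  rwa [(S.hasJet_curve i).1] at this

lemma tendsto_line (i : Fin n) : Tendsto (fun t : ℝ => t • S.e i) (𝓝 0) (𝓝 0) := by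
  have := (S.hasJet_line i).continuousAt.tendsto
  simpa using this

lemma fderiv_ut_eq (i l : Fin n) :
    ∀ᶠ t in 𝓝 0, fderiv ℝ D.u (S.curve i t) (S.X i l t) = fderiv ℝ S.ut (t • S.e i) (S.e l) := by
  filter_upwards [(S.tendsto_line i).eventually
    (fderiv_comp_normalMap (Γ₀_symm D) D.contDiffAt_u)] with t ht
  rw [ut, ht]; rfl

/-- The difference between `W` and the second derivatives in normal coordinates. -/
noncomputable def rem (i j l : Fin n) (t : ℝ) : ℝ :=
  D.θ (S.curve i t) (S.X i j t) (S.X i l t) - fderiv ℝ D.u (S.curve i t)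
    (D.Γ (S.curve i t) (S.X i j t) (S.X i l t) - D.Γ D.y₀ (S.e j) (S.e l))

lemma W_eq (i j l : Fin n) : ∀ᶠ t in 𝓝 0, D.W (S.curve i t) (S.X i j t) (S.X i l t) =
    fderiv ℝ (fderiv ℝ S.ut) (t • S.e i) (S.e j) (S.e l) + S.rem i j l t := by
  filter_upwards [(S.tendsto_line i).eventually
    (fderiv_fderiv_comp_normalMap (Γ₀_symm D) D.contDiffAt_u)] with t ht
  rw [ut, ht, D.W_apply, rem, map_sub]
  simp only [curve, X]
  ring

lemma norm_e_le (hL : 1 ≤ L) (i : Fin n) : ‖S.e i‖ ≤ L := by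
  have := D.sq_norm_le (S.e i)
  rw [S.gram_eq, Matrix.one_apply_eq, mul_one] at this
  nlinarith [norm_nonneg (S.e i)]

lemma norm_Γ₀_le (hL : 1 ≤ L) (i j : Fin n) : ‖D.Γ D.y₀ (S.e i) (S.e j)‖ ≤ L ^ 3 := by
  have h1 := (D.Γ D.y₀).le_opNorm₂ (S.e i) (S.e j)
  have h2 := D.Γ_bound.norm_le
  have h3 := S.norm_e_le hL i
  have h4 := S.norm_e_le hL j
  calc _ ≤ _ := h1
    _ ≤ L * L * L := by gcongr
    _ = L ^ 3 := by ring

lemma jetLE_X (hL : 1 ≤ L) (i j : Fin n) : JetLE (S.X i j) (L ^ 3) :=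
  ⟨_, _, _, S.hasJet_X i j, (S.norm_e_le hL j).trans (le_self_pow₀ hL (by norm_num)),
    by rw [norm_neg]; exact S.norm_Γ₀_le hL i j, by simp; positivity⟩

lemma jetLE_comp {F : Type*} [NormedAddCommGroup F] [NormedSpace ℝ F] {Φ : Rn n → F}
    (hL : 1 ≤ L) (hΦ : C2BoundAt Φ D.y₀ L) (i : Fin n) :
    JetLE (fun t => Φ (S.curve i t)) (2 * L ^ 4) := by
  have h1 : L ≤ L ^ 4 := le_self_pow₀ hL (by norm_num)
  have h2 : L ^ 2 ≤ L ^ 4 := pow_le_pow_right₀ hL (by norm_num)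
  have h3 : L ^ 3 ≤ L ^ 4 := pow_le_pow_right₀ hL (by norm_num)
  have he := S.norm_e_le hL i
  refine ⟨_, _, _, HasJet.comp hΦ.contDiffAt (S.hasJet_curve i), ?_, ?_, ?_⟩
  · linarith [hΦ.norm_le]
  · calc _ ≤ ‖fderiv ℝ Φ D.y₀‖ * ‖S.e i‖ := ContinuousLinearMap.le_opNorm _ _
      _ ≤ L * L := by gcongr; exact hΦ.norm_fderiv_le
      _ ≤ _ := by nlinarith
  · have e1 : ‖fderiv ℝ (fderiv ℝ Φ) D.y₀ (S.e i) (S.e i)‖ ≤ L * L * L :=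
      (ContinuousLinearMap.le_opNorm₂ _ _ _).trans (by
        gcongr; exact hΦ.norm_fderiv_fderiv_le)
    have e2 : ‖fderiv ℝ Φ D.y₀ (- D.Γ D.y₀ (S.e i) (S.e i))‖ ≤ L * L ^ 3 := by
      refine (ContinuousLinearMap.le_opNorm _ _).trans ?_
      rw [norm_neg]
      have := S.norm_Γ₀_le hL i i
      gcongr
      exact hΦ.norm_fderiv_le
    refine (norm_add_le _ _).trans ?_
    nlinarith

lemma jetLE_frame {F : Type*} [NormedAddCommGroup F] [NormedSpace ℝ F]
    {Φ : Rn n → Rn n →L[ℝ] Rn n →L[ℝ] F} (hL : 1 ≤ L) (hΦ : C2BoundAt Φ D.y₀ L)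
    (i j l : Fin n) :
    JetLE (fun t => Φ (S.curve i t) (S.X i j t) (S.X i l t)) (32 * L ^ 10) := by
  have := ((S.jetLE_comp hL hΦ i).clm_apply (S.jetLE_X hL i j)).clm_apply (S.jetLE_X hL i l)
  refine this.mono (le_of_eq ?_)
  ring

/-- The metric in normal coordinates agrees with the Euclidean one to first order. -/
lemma exists_hasJet_metric (hL : 1 ≤ L) (i j l : Fin n) :
    ∃ c, HasJet (fun t => D.g (S.curve i t) (S.X i j t) (S.X i l t))
      ((1 : Matrix (Fin n) (Fin n) ℝ) j l) 0 c ∧ |c| ≤ 32 * L ^ 10 := by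
  obtain ⟨p, q, r, h, -, -, hr⟩ := S.jetLE_frame hL D.g_bound i j l
  have h' := ((HasJet.comp D.g_bound.contDiffAt (S.hasJet_curve i)).clm_apply
    (S.hasJet_X i j)).clm_apply (S.hasJet_X i l)
  obtain ⟨hp, hq, -⟩ := h.unique h'
  have hp' : p = (1 : Matrix (Fin n) (Fin n) ℝ) j l := by rw [hp, S.gram_eq]
  have hq' : q = 0 := by
    rw [hq]
    simp [D.compat]
  rw [hp', hq'] at h
  exact ⟨r, h, hr⟩

lemma hasJet_fderiv_u (i : Fin n) : ∃ c, HasJet (fun t => fderiv ℝ D.u (S.curve i t))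
    (fderiv ℝ D.u D.y₀) (fderiv ℝ (fderiv ℝ D.u) D.y₀ (S.e i)) c :=
  ⟨_, HasJet.comp ((D.contDiffAt_u.fderiv_right (m := 3) (by norm_num)).of_le (by norm_num))
    (S.hasJet_curve i)⟩

lemma exists_hasJet_rem (hL : 1 ≤ L) (i j l : Fin n) :
    ∃ R₁ R₂, HasJet (S.rem i j l) (D.θ D.y₀ (S.e j) (S.e l)) R₁ R₂ ∧
      |D.θ D.y₀ (S.e j) (S.e l)| ≤ 32 * L ^ 10 ∧ |R₁| ≤ 2 * L * (32 * L ^ 10) ∧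
      |R₂| ≤ 2 * (L + ‖fderiv ℝ (fderiv ℝ D.u) D.y₀ (S.e i)‖) * (32 * L ^ 10) := by
  obtain ⟨p, q, r, h, hp, hq, hr⟩ := S.jetLE_frame hL D.Γ_bound i j l
  obtain ⟨p', q', r', h', hp', hq', hr'⟩ := S.jetLE_frame hL D.θ_bound i j l
  obtain ⟨c, hc⟩ := S.hasJet_fderiv_u i
  have hX : ∀ j, S.X i j 0 = S.e j := fun j => (S.hasJet_X i j).1
  have hcurve : S.curve i 0 = D.y₀ := (S.hasJet_curve i).1
  have e1 : p = D.Γ D.y₀ (S.e j) (S.e l) := by rw [← h.1]; simp [hX, hcurve]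
  have e2 : p' = D.θ D.y₀ (S.e j) (S.e l) := by rw [← h'.1]; simp [hX, hcurve]
  have key := h'.sub (hc.clm_apply (h.sub (HasJet.const (D.Γ D.y₀ (S.e j) (S.e l)))))
  rw [← e2]
  simp only [← e1, sub_self, sub_zero, map_zero, zero_add] at key
  have hP : ‖fderiv ℝ D.u D.y₀‖ ≤ L := D.norm_fderiv_u_le
  have f1 : ‖fderiv ℝ D.u D.y₀ q‖ ≤ L * (32 * L ^ 10) :=
    (ContinuousLinearMap.le_opNorm _ _).trans (by gcongr)
  have f2 : ‖fderiv ℝ D.u D.y₀ r‖ ≤ L * (32 * L ^ 10) :=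
    (ContinuousLinearMap.le_opNorm _ _).trans (by gcongr)
  have f3 : ‖fderiv ℝ (fderiv ℝ D.u) D.y₀ (S.e i) q‖ ≤
      ‖fderiv ℝ (fderiv ℝ D.u) D.y₀ (S.e i)‖ * (32 * L ^ 10) :=
    (ContinuousLinearMap.le_opNorm _ _).trans (by gcongr)
  have hB : 0 ≤ 32 * L ^ 10 := by positivity
  refine ⟨_, _, key.congr (Eventually.of_forall fun t => by simp [rem, e1]), hp', ?_, ?_⟩
  · refine (abs_sub _ _).trans ?_
    rw [Real.norm_eq_abs] at f1 hq'
    nlinarith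
  · refine (abs_sub _ _).trans ?_
    refine (add_le_add_right (abs_add_le _ _) _).trans ?_
    rw [Real.norm_eq_abs] at f2 f3 hr'
    simp only [smul_eq_mul, abs_mul, abs_two]
    nlinarith

/-- The jet of `W` in normal coordinates. -/
lemma exists_hasJet_W (hL : 1 ≤ L) (i j l : Fin n) :
    ∃ R₁ R₂, HasJet (fun t => D.W (S.curve i t) (S.X i j t) (S.X i l t))
      (Matrix.diagonal S.w j l) (S.U3 i j l + R₁) (S.U4 i j l + R₂) ∧
      |R₁| ≤ 2 * L * (32 * L ^ 10) ∧
      |R₂| ≤ 2 * (L + ‖fderiv ℝ (fderiv ℝ D.u) D.y₀ (S.e i)‖) * (32 * L ^ 10) := by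
  obtain ⟨R₁, R₂, h, -, h1, h2⟩ := S.exists_hasJet_rem hL i j l
  have key := ((S.hasJet_hess_ut i j l).add h).congr (S.W_eq i j l)
  have hX : ∀ j, S.X i j 0 = S.e j := fun j => (S.hasJet_X i j).1
  have hcurve : S.curve i 0 = D.y₀ := (S.hasJet_curve i).1
  have e : S.U2 j l + D.θ D.y₀ (S.e j) (S.e l) = Matrix.diagonal S.w j l := by
    rw [← key.1, ← S.form_eq]; simp [hX, hcurve]
  rw [e] at key
  exact ⟨R₁, R₂, key, h1, h2⟩

lemma abs_U2_sub_le (hL : 1 ≤ L) (j l : Fin n) :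
    |S.U2 j l - Matrix.diagonal S.w j l| ≤ 32 * L ^ 10 := by
  obtain ⟨R₁, R₂, h, h0, h1, h2⟩ := S.exists_hasJet_rem hL j j l
  have key := ((S.hasJet_hess_ut j j l).add h).congr (S.W_eq j j l)
  have hX : ∀ l, S.X j l 0 = S.e l := fun l => (S.hasJet_X j l).1
  have hcurve : S.curve j 0 = D.y₀ := (S.hasJet_curve j).1
  have e : S.U2 j l + D.θ D.y₀ (S.e j) (S.e l) = Matrix.diagonal S.w j l := by
    rw [← key.1, ← S.form_eq]; simp [hX, hcurve]
  rw [← e, sub_add_cancel_left, abs_neg]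
  exact h0

end InteriorMax.EigenFrame

end HessianEq

namespace HessianEq

open Filter Topology

/-! ### The interior estimate in a chart -/

lemma HasJet.exp {f : ℝ → ℝ} {a b c : ℝ} (h : HasJet f a b c) :
    HasJet (fun t => Real.exp (f t)) (Real.exp a) (Real.exp a * b)
      (Real.exp a * (b ^ 2 + c)) := by
  obtain ⟨h0, f', h1, h2, h3⟩ := h
  refine ⟨by simp [h0], fun t => Real.exp (f t) * f' t, h1.mono fun t ht => ht.exp,
    by simp [h0, h2], ?_⟩
  refine (h1.self_of_nhds.exp.mul h3).congr_deriv ?_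
  rw [h0, h2]; ring

lemma traceSub_one_diagonal {n : ℕ} (w : Fin n → ℝ) :
    traceSub 1 (Matrix.diagonal w) = Matrix.diagonal (etaOf w) := by
  ext i j
  rcases eq_or_ne i j with rfl | h
  · simp [traceSub, etaOf, Matrix.trace]
  · simp [traceSub, h]

lemma sum_pos_of_inCone {ι : Type*} [Fintype ι] [DecidableEq ι] (hn : 2 ≤ Fintype.card ι)
    {w : ι → ℝ} {k : ℕ} (h : InCone Finset.univ (etaOf w) (k + 1)) : 0 < ∑ i, w i := by
  have h1 := h 1 (by omega)
  rw [es_one, sum_etaOf] at h1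
  have hn' : (2 : ℝ) ≤ Fintype.card ι := by exact_mod_cast hn
  by_contra! hneg
  nlinarith

namespace InteriorMax.EigenFrame

variable {n k : ℕ} {L ε a b : ℝ} {D : InteriorMax n k L ε a b} (S : D.EigenFrame)

lemma frame_metric : (frameMat S.e)ᵀ * bilMat (D.g D.y₀) * frameMat S.e = 1 := by
  rw [← bilMat_frame]; ext i j; exact S.gram_eq i j

lemma frame_W : (frameMat S.e)ᵀ * bilMat (D.W D.y₀) * frameMat S.e = Matrix.diagonal S.w := by
  rw [← bilMat_frame]; ext i j; exact S.form_eq i j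

lemma cone (hk : k + 1 ≤ n) : InCone Finset.univ (etaOf S.w) (k + 1) := by
  intro j hj
  have := D.admissible j hj
  rw [← minorSum_traceSub_frame S.isUnit_det (hj.trans hk), S.frame_metric] at this
  have e := S.frame_W
  rw [W] at e
  rwa [e, traceSub_one_diagonal, minorSum_diagonal] at this

lemma w₀_pos (S : D.EigenFrame) (hn : 2 ≤ n) (hk : k + 1 ≤ n) : 0 < D.w₀ := by
  have h2 := sum_pos_of_inCone (by simpa using hn) (S.cone hk)
  have h3 : ∑ i, S.w i ≤ ∑ _i : Fin n, D.w₀ := Finset.sum_le_sum fun i _ => S.w_le i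
  rw [Finset.sum_const, nsmul_eq_mul, Finset.card_univ, Fintype.card_fin] at h3
  by_contra! hneg
  have : (0 : ℝ) ≤ n := by positivity
  nlinarith

lemma abs_w_le (hn : 2 ≤ n) (hk : k + 1 ≤ n) (i : Fin n) : |S.w i| ≤ n * D.w₀ := by
  have hpos := S.w₀_pos hn hk
  have h2 := sum_pos_of_inCone (by simpa using hn) (S.cone hk)
  have hn' : (2 : ℝ) ≤ n := by exact_mod_cast hn
  rw [abs_le]
  constructor
  · rw [← Finset.add_sum_erase _ _ (Finset.mem_univ i)] at h2
    have h3 : ∑ j ∈ Finset.univ.erase i, S.w j ≤ ∑ _j ∈ Finset.univ.erase i, D.w₀ :=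
      Finset.sum_le_sum fun j _ => S.w_le j
    rw [Finset.sum_const, nsmul_eq_mul, Finset.card_erase_of_mem (Finset.mem_univ i),
      Finset.card_univ, Fintype.card_fin, Nat.cast_sub (by omega)] at h3
    push_cast at h3
    nlinarith
  · nlinarith [S.w_le i]

/-- Every vector expands in the orthonormal frame. -/
lemma expand (v : Rn n) : v = ∑ l, D.g D.y₀ v (S.e l) • S.e l := by
  obtain ⟨c, hc⟩ : ∃ c : Fin n → ℝ, v = ∑ i, c i • S.e i := by
    refine ⟨(frameMat S.e)⁻¹ *ᵥ fun l => v l, ?_⟩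
    ext l
    have : (frameMat S.e *ᵥ ((frameMat S.e)⁻¹ *ᵥ fun l => v l)) l = v l := by
      rw [Matrix.mulVec_mulVec, Matrix.mul_nonsing_inv _ S.isUnit_det, Matrix.one_mulVec]
    rw [← this]
    simp [Matrix.mulVec, dotProduct, mul_comm, frameMat]
  conv_lhs => rw [hc]
  refine Finset.sum_congr rfl fun l _ => ?_
  congr 1
  rw [hc]
  simp [S.gram_eq, Matrix.one_apply]

lemma norm_covec_le (hL : 1 ≤ L) (q : Rn n →L[ℝ] ℝ) : ‖q‖ ≤ L ^ 2 * ∑ l, |q (S.e l)| := by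
  refine ContinuousLinearMap.opNorm_le_bound _ (by positivity) fun v => ?_
  conv_lhs => rw [S.expand v]
  rw [map_sum, Finset.mul_sum, Finset.sum_mul]
  refine (norm_sum_le _ _).trans (Finset.sum_le_sum fun l _ => ?_)
  rw [map_smul, norm_smul, Real.norm_eq_abs, Real.norm_eq_abs]
  have h1 : ‖D.g D.y₀ v (S.e l)‖ ≤ L * ‖v‖ * L := by
    refine ((D.g D.y₀).le_opNorm₂ _ _).trans ?_
    gcongr
    · exact D.g_bound.norm_le
    · exact S.norm_e_le hL l
  rw [Real.norm_eq_abs] at h1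
  calc _ ≤ (L * ‖v‖ * L) * |q (S.e l)| := by gcongr
    _ = _ := by ring

section Bounds

variable {B : ℝ} (hn : 2 ≤ n) (hk : k + 1 ≤ n) (hL : 1 ≤ L) (hB : 32 * n * L ^ 10 ≤ B)
include hn hL hB

lemma bounds (_S : D.EigenFrame) : 1 ≤ B ∧ L ≤ B ∧ (n : ℝ) ≤ B ∧ 32 * L ^ 10 ≤ B ∧ L ^ 4 ≤ B := by
  have hn' : (1 : ℝ) ≤ n := by exact_mod_cast (by omega : 1 ≤ n)
  have h1 : 1 ≤ L ^ 10 := one_le_pow₀ hL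
  have h2 : L ≤ L ^ 10 := le_self_pow₀ hL (by norm_num)
  have h3 : L ^ 4 ≤ L ^ 10 := pow_le_pow_right₀ hL (by norm_num)
  have h4 : 32 * L ^ 10 ≤ B := by nlinarith
  refine ⟨by linarith, by linarith, by nlinarith, h4, by linarith⟩

lemma norm_hess_le (hk : k + 1 ≤ n) (i : Fin n) :
    ‖fderiv ℝ (fderiv ℝ D.u) D.y₀ (S.e i)‖ ≤ 3 * B ^ 4 * (1 + D.w₀) := by
  obtain ⟨b1, b2, b3, b4, b5⟩ := S.bounds hn hL hB
  have hw := S.w₀_pos hn hk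
  refine (S.norm_covec_le hL _).trans ?_
  have h1 : ∀ l, |fderiv ℝ (fderiv ℝ D.u) D.y₀ (S.e i) (S.e l)| ≤ B * D.w₀ + 2 * B := by
    intro l
    obtain ⟨-, -, -, h0, -, -⟩ := S.exists_hasJet_rem hL i i l
    have e := D.W_apply D.y₀ (S.e i) (S.e l)
    rw [S.form_eq] at e
    have h2 : |Matrix.diagonal S.w i l| ≤ B * D.w₀ := by
      rcases eq_or_ne i l with rfl | h
      · rw [Matrix.diagonal_apply_eq]
        exact (S.abs_w_le hn hk i).trans (by gcongr)
      · rw [Matrix.diagonal_apply_ne _ h, abs_zero]; positivity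
    have h3 : |fderiv ℝ D.u D.y₀ (D.Γ D.y₀ (S.e i) (S.e l))| ≤ B := by
      rw [← Real.norm_eq_abs]
      refine ((fderiv ℝ D.u D.y₀).le_opNorm _).trans ?_
      have h5 := S.norm_Γ₀_le hL i l
      calc _ ≤ L * L ^ 3 := by gcongr; exact D.norm_fderiv_u_le
        _ = L ^ 4 := by ring
        _ ≤ B := b5
    have e' : fderiv ℝ (fderiv ℝ D.u) D.y₀ (S.e i) (S.e l) = Matrix.diagonal S.w i l +
      fderiv ℝ D.u D.y₀ (D.Γ D.y₀ (S.e i) (S.e l)) - D.θ D.y₀ (S.e i) (S.e l) := by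
      linarith
    rw [e']
    refine (abs_sub _ _).trans ?_
    linarith [abs_add_le (Matrix.diagonal S.w i l)
      (fderiv ℝ D.u D.y₀ (D.Γ D.y₀ (S.e i) (S.e l)))]
  calc _ ≤ B ^ 2 * ∑ _l : Fin n, (B * D.w₀ + 2 * B) := by
        gcongr with l _
        exact h1 l
    _ = B ^ 2 * (n * (B * D.w₀ + 2 * B)) := by
        rw [Finset.sum_const, Finset.card_univ, Fintype.card_fin, nsmul_eq_mul]
    _ ≤ B ^ 2 * (B * (B * D.w₀ + 2 * B)) := by gcongr
    _ = B ^ 4 * (2 + D.w₀) := by ring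
    _ ≤ _ := by nlinarith [pow_pos (by linarith : 0 < B) 4]

end Bounds

/-- The Gram matrix of the coordinate frame along the curve in direction `e i`. -/
noncomputable def Gt (i : Fin n) (t : ℝ) : Matrix (Fin n) (Fin n) ℝ :=
  Matrix.of fun j l => D.g (S.curve i t) (S.X i j t) (S.X i l t)

/-- The matrix of `W` in the coordinate frame along the curve in direction `e i`. -/
noncomputable def Wt (i : Fin n) (t : ℝ) : Matrix (Fin n) (Fin n) ℝ :=
  Matrix.of fun j l => D.W (S.curve i t) (S.X i j t) (S.X i l t)

lemma eventually_isUnit (i : Fin n) :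
    ∀ᶠ t in 𝓝 0, IsUnit (frameMat fun j => S.X i j t).det := by
  obtain ⟨p, q, r, h⟩ := exists_hasJet_det (N := fun t => frameMat fun j => S.X i j t)
    fun l j => ⟨_, _, _, (S.hasJet_X i j).clm (EuclideanSpace.proj (𝕜 := ℝ) l)⟩
  have h0 : frameMat (fun j => S.X i j 0) = frameMat S.e := by
    congr 1; ext1 j; exact (S.hasJet_X i j).1
  have := h.continuousAt.eventually_ne (y := 0) (by
    simp only [h0]; exact S.isUnit_det.ne_zero)
  exact this.mono fun t ht => isUnit_iff_ne_zero.2 ht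

lemma Gt_eq (i : Fin n) (t : ℝ) : S.Gt i t = (frameMat fun j => S.X i j t)ᵀ *
    bilMat (D.g (S.curve i t)) * frameMat fun j => S.X i j t :=
  bilMat_frame _ fun j => S.X i j t

lemma Wt_eq (i : Fin n) (t : ℝ) : S.Wt i t = (frameMat fun j => S.X i j t)ᵀ *
    bilMat (D.W (S.curve i t)) * frameMat fun j => S.X i j t :=
  bilMat_frame _ fun j => S.X i j t

lemma equation_eventually (hk : k + 1 ≤ n) (i : Fin n) :
    ∀ᶠ t in 𝓝 0, minorSum (k + 1) (traceSub (S.Gt i t) (S.Wt i t)) =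
      D.f (S.curve i t, D.u (S.curve i t), fderiv ℝ D.u (S.curve i t)) := by
  filter_upwards [S.eventually_isUnit i, (S.tendsto_curve i).eventually D.equation] with t h1 h2
  rw [← h2, S.Gt_eq, S.Wt_eq, minorSum_traceSub_frame h1 hk]
  rfl

lemma hasJet_inv_metric {i : Fin n} {G₂ : Matrix (Fin n) (Fin n) ℝ}
    (hG : ∀ j l, HasJet (fun t => D.g (S.curve i t) (S.X i j t) (S.X i l t))
      ((1 : Matrix (Fin n) (Fin n) ℝ) j l) 0 (G₂ j l)) (j l : Fin n) :
    HasJet (fun t => (S.Gt i t)⁻¹ j l) ((1 : Matrix (Fin n) (Fin n) ℝ) j l) 0 (- G₂ j l) :=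
  hasJet_inv (G := S.Gt i) hG j l

lemma hasJet_traceSub {i : Fin n} {G₂ W₁ W₂ : Matrix (Fin n) (Fin n) ℝ}
    (hG : ∀ j l, HasJet (fun t => D.g (S.curve i t) (S.X i j t) (S.X i l t))
      ((1 : Matrix (Fin n) (Fin n) ℝ) j l) 0 (G₂ j l))
    (hW : ∀ j l, HasJet (fun t => D.W (S.curve i t) (S.X i j t) (S.X i l t))
      (Matrix.diagonal S.w j l) (W₁ j l) (W₂ j l)) (j l : Fin n) :
    HasJet (fun t => traceSub (S.Gt i t) (S.Wt i t) j l) (Matrix.diagonal (etaOf S.w) j l)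
      ((W₁.trace • (1 : Matrix (Fin n) (Fin n) ℝ) - W₁) j l)
      ((∑ m, (W₂ m m - G₂ m m * S.w m)) * (1 : Matrix (Fin n) (Fin n) ℝ) j l -
        (W₂ j l - G₂ j l * S.w l)) := by
  have hprod : ∀ j l, HasJet (fun t => ((S.Gt i t)⁻¹ * S.Wt i t) j l)
      (Matrix.diagonal S.w j l) (W₁ j l) (W₂ j l - G₂ j l * S.w l) := by
    intro j l
    have := HasJet.sum (s := Finset.univ) fun m _ => (S.hasJet_inv_metric hG j m).mul (hW m l)
    simp only [Matrix.one_apply, ite_mul, one_mul, zero_mul, zero_add, mul_zero, add_zero,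
      Finset.sum_add_distrib, Finset.sum_ite_eq, Finset.mem_univ, if_true, neg_mul,
      Finset.sum_neg_distrib] at this
    have e : ∑ m, G₂ j m * Matrix.diagonal S.w m l = G₂ j l * S.w l := by
      simp [Matrix.diagonal_apply]
    rw [e] at this
    rw [neg_add_eq_sub] at this
    exact this
  have htr : HasJet (fun t => ((S.Gt i t)⁻¹ * S.Wt i t).trace) (∑ m, S.w m) W₁.trace
      (∑ m, (W₂ m m - G₂ m m * S.w m)) := by
    simpa [Matrix.trace] using HasJet.sum (s := Finset.univ) fun m _ => hprod m m
  have := (htr.mul (HasJet.const ((1 : Matrix (Fin n) (Fin n) ℝ) j l))).sub (hprod j l)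
  simp only [mul_zero, add_zero] at this
  have e1 : Matrix.diagonal (etaOf S.w) j l =
      (∑ m, S.w m) * (1 : Matrix (Fin n) (Fin n) ℝ) j l - Matrix.diagonal S.w j l := by
    rcases eq_or_ne j l with rfl | h
    · simp [etaOf]
    · simp [h]
  rw [e1]
  exact this

end InteriorMax.EigenFrame

end HessianEq

/-! ### The conditions at the maximum -/

namespace HessianEq

open Filter Topology

namespace InteriorMax.EigenFrame

variable {n k : ℕ} {L ε a b : ℝ} {D : InteriorMax n k L ε a b} (S : D.EigenFrame)

/-- The second derivative of a function along the curve in direction `e i` is its Hessian. -/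
lemma hasJet_comp_curve {v : Rn n → ℝ} (hv : ContDiffAt ℝ 2 v D.y₀) (i : Fin n) :
    HasJet (fun t => v (S.curve i t)) (v D.y₀) (fderiv ℝ v D.y₀ (S.e i))
      (hessForm v D.Γ D.y₀ (S.e i) (S.e i)) := by
  have := HasJet.comp hv (S.hasJet_curve i)
  rwa [map_neg, ← sub_eq_add_neg, ← hessForm_apply] at this

lemma hess_u_eq (i : Fin n) : hessForm D.u D.Γ D.y₀ (S.e i) (S.e i) =
    S.w i - D.θ D.y₀ (S.e i) (S.e i) := by
  have := S.form_eq i i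
  rw [Matrix.diagonal_apply_eq] at this
  rw [← this, W, add_apply, add_apply]
  ring

lemma fderiv_ut_zero (l : Fin n) : fderiv ℝ S.ut 0 (S.e l) = fderiv ℝ D.u D.y₀ (S.e l) := by
  have := (S.fderiv_ut_eq l l).self_of_nhds
  rw [(S.hasJet_curve l).1, (S.hasJet_X l l).1, zero_smul] at this
  exact this.symm

lemma abs_fderiv_u_le (hL : 1 ≤ L) (l : Fin n) : |fderiv ℝ D.u D.y₀ (S.e l)| ≤ L ^ 2 := by
  rw [← Real.norm_eq_abs]
  refine ((fderiv ℝ D.u D.y₀).le_opNorm _).trans ?_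
  have h5 := S.norm_e_le hL l
  calc _ ≤ L * L := by gcongr; exact D.norm_fderiv_u_le
    _ = L ^ 2 := by ring

lemma covecSq_curve (i : Fin n) :
    ∀ᶠ t in 𝓝 0, covecSq (D.g (S.curve i t)) (fderiv ℝ D.u (S.curve i t)) =
      ∑ l, ∑ m, (S.Gt i t)⁻¹ l m * (fderiv ℝ S.ut (t • S.e i) (S.e l) *
        fderiv ℝ S.ut (t • S.e i) (S.e m)) := by
  filter_upwards [S.eventually_isUnit i, eventually_all.2 (S.fderiv_ut_eq i)] with t h1 h2
  rw [covecSq, ← dotProduct_inv_frame h1, ← S.Gt_eq, ← form_frame]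
  simp only [h2, dotProduct, Matrix.mulVec, Finset.mul_sum]
  exact Finset.sum_congr rfl fun l _ => Finset.sum_congr rfl fun m _ => by ring

/-- The derivatives of the exponent of the test function. The gradient term contributes
`b * ∑ (∂_i ∂_l u)²` to the second derivative, the term the estimate lives on; the frame being
parallel to first order at the maximum point, the metric only adds a bounded term. -/
lemma exists_hasJet_testExp (hL : 1 ≤ L) (hb : 0 ≤ b) (i : Fin n) :
    ∃ β₂, HasJet (fun t => testExp a b D.u D.us D.g (S.curve i t))
      (testExp a b D.u D.us D.g D.y₀)
      (b * ∑ l, fderiv ℝ D.u D.y₀ (S.e l) * S.U2 i l +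
        a * (fderiv ℝ D.us D.y₀ (S.e i) - fderiv ℝ D.u D.y₀ (S.e i))) β₂ ∧
      b * (∑ l, S.U2 i l ^ 2 + ∑ l, fderiv ℝ D.u D.y₀ (S.e l) * S.U3 i i l
          - 32 * n ^ 2 * L ^ 14) +
        a * (hessForm D.us D.Γ D.y₀ (S.e i) (S.e i) + D.θ D.y₀ (S.e i) (S.e i) - S.w i) ≤ β₂ := by
  choose G₂ hG hG' using S.exists_hasJet_metric hL i
  have hinv := S.hasJet_inv_metric (G₂ := G₂) hG
  have hu := S.hasJet_fderiv_ut i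
  have hQ := HasJet.sum (s := Finset.univ) fun l _ => HasJet.sum (s := Finset.univ) fun m _ =>
    (hinv l m).mul ((hu l).mul (hu m))
  have hQ' := hQ.congr (S.covecSq_curve i)
  have h1 := S.hasJet_comp_curve D.us_bound.contDiffAt i
  have h2 := S.hasJet_comp_curve (D.contDiffAt_u.of_le (by norm_num)) i
  rw [S.hess_u_eq] at h2
  have key := (hQ'.const_mul (b / 2)).add ((h1.sub h2).const_mul a)
  simp only [Matrix.one_apply, ite_mul, one_mul, zero_mul, zero_add, mul_zero, add_zero,
      Finset.sum_add_distrib, Finset.sum_ite_eq, Finset.mem_univ, if_true, neg_mul,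
      Finset.sum_neg_distrib, S.fderiv_ut_zero] at key
  have key2 : HasJet (fun t => testExp a b D.u D.us D.g (S.curve i t)) _ _ _ := key
  have hv := key2.1
  beta_reduce at hv
  rw [(S.hasJet_curve i).1] at hv
  rw [← hv] at key2
  have e1 : (b / 2 * (∑ l, S.U2 i l * fderiv ℝ D.u D.y₀ (S.e l) +
        ∑ l, fderiv ℝ D.u D.y₀ (S.e l) * S.U2 i l) +
      a * (fderiv ℝ D.us D.y₀ (S.e i) - fderiv ℝ D.u D.y₀ (S.e i))) =
      b * ∑ l, fderiv ℝ D.u D.y₀ (S.e l) * S.U2 i l +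
        a * (fderiv ℝ D.us D.y₀ (S.e i) - fderiv ℝ D.u D.y₀ (S.e i)) := by
    have : ∑ l, S.U2 i l * fderiv ℝ D.u D.y₀ (S.e l) =
      ∑ l, fderiv ℝ D.u D.y₀ (S.e l) * S.U2 i l := Finset.sum_congr rfl fun l _ => mul_comm _ _
    rw [this]; ring
  rw [e1] at key2
  refine ⟨_, key2, ?_⟩
  have hG3 : |∑ l, ∑ m, G₂ l m * (fderiv ℝ D.u D.y₀ (S.e l) * fderiv ℝ D.u D.y₀ (S.e m))| ≤
      32 * n ^ 2 * L ^ 14 := by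
    calc _ ≤ ∑ l, ∑ m, |G₂ l m * (fderiv ℝ D.u D.y₀ (S.e l) * fderiv ℝ D.u D.y₀ (S.e m))| :=
          (Finset.abs_sum_le_sum_abs _ _).trans
            (Finset.sum_le_sum fun l _ => Finset.abs_sum_le_sum_abs _ _)
      _ ≤ ∑ _l : Fin n, ∑ _m : Fin n, (32 * L ^ 10 * (L ^ 2 * L ^ 2)) := by
          refine Finset.sum_le_sum fun l _ => Finset.sum_le_sum fun m _ => ?_
          rw [abs_mul, abs_mul]
          have := S.abs_fderiv_u_le hL l
          have := S.abs_fderiv_u_le hL m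
          have := hG' l m
          gcongr
      _ = _ := by
          simp only [Finset.sum_const, Finset.card_univ, Fintype.card_fin, nsmul_eq_mul]
          ring
  have e2 : ∑ l, S.U3 i i l * fderiv ℝ D.u D.y₀ (S.e l) =
    ∑ l, fderiv ℝ D.u D.y₀ (S.e l) * S.U3 i i l := Finset.sum_congr rfl fun l _ => mul_comm _ _
  have e3 : ∑ l, 2 * (S.U2 i l * S.U2 i l) = 2 * ∑ l, S.U2 i l ^ 2 := by
    rw [Finset.mul_sum]; exact Finset.sum_congr rfl fun l _ => by ring
  have hG4 := neg_abs_le (∑ l, ∑ m, G₂ l m * (fderiv ℝ D.u D.y₀ (S.e l) *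
    fderiv ℝ D.u D.y₀ (S.e m)))
  have hG5 := le_abs_self (∑ l, ∑ m, G₂ l m * (fderiv ℝ D.u D.y₀ (S.e l) *
    fderiv ℝ D.u D.y₀ (S.e m)))
  rw [e2, e3]
  have hpos : 0 ≤ (n : ℝ) ^ 2 * L ^ 14 := by positivity
  nlinarith [mul_le_mul_of_nonneg_left (hG5.trans hG3) hb, mul_nonneg hb hpos]

/-- The first and second order conditions at the maximum, in direction `e i`. -/
lemma max_conditions {i : Fin n} {W₁ W₂ g₂ β₁ β₂ : ℝ}
    (hW : HasJet (fun t => D.W (S.curve i t) (S.X i S.o t) (S.X i S.o t)) D.w₀ W₁ W₂)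
    (hg : HasJet (fun t => D.g (S.curve i t) (S.X i S.o t) (S.X i S.o t)) 1 0 g₂)
    (hβ : HasJet (fun t => testExp a b D.u D.us D.g (S.curve i t))
      (testExp a b D.u D.us D.g D.y₀) β₁ β₂) :
    W₁ = - (D.w₀ * β₁) ∧ W₂ ≤ D.w₀ * (g₂ + β₁ ^ 2 - β₂) := by
  set E := Real.exp (testExp a b D.u D.us D.g D.y₀) with hE
  have hEpos : 0 < E := Real.exp_pos _
  -- `W(X, X) exp β - w₀ E g(X, X)` is at most its value `0` at the maximum point
  have h := (hW.mul hβ.exp).sub (hg.const_mul (D.w₀ * E))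
  rw [← hE, mul_one, sub_self] at h
  obtain ⟨h1, h2⟩ := h.of_isLocalMax (by
    filter_upwards [(S.tendsto_curve i).eventually D.le_max] with t ht
    have := ht (S.X i S.o t)
    rw [sub_nonpos]
    exact this)
  have e1 : W₁ = - (D.w₀ * β₁) := by
    have : (W₁ + D.w₀ * β₁) * E = 0 := by linarith
    rcases mul_eq_zero.1 this with h | h
    · linarith
    · exact absurd h hEpos.ne'
  refine ⟨e1, ?_⟩
  have : (W₂ - D.w₀ * (g₂ + β₁ ^ 2 - β₂)) * E ≤ 0 := by
    rw [e1] at h2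
    calc _ = _ := by ring
      _ ≤ 0 := h2
  have := nonpos_of_mul_nonpos_left this hEpos
  linarith

end InteriorMax.EigenFrame

end HessianEq

/-! ### The differentiated equation -/

namespace HessianEq

open Filter Topology

lemma HasJet.prodMk {E F : Type*} [NormedAddCommGroup E] [NormedSpace ℝ E]
    [NormedAddCommGroup F] [NormedSpace ℝ F] {f : ℝ → E} {g : ℝ → F} {a b c : E} {a' b' c' : F}
    (h : HasJet f a b c) (h' : HasJet g a' b' c') :
    HasJet (fun t => (f t, g t)) (a, a') (b, b') (c, c') := by
  simpa using (h.clm (ContinuousLinearMap.inl ℝ E F)).add (h'.clm (ContinuousLinearMap.inr ℝ E F))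

lemma C2BoundAt.hasJet {E F : Type*} [NormedAddCommGroup E] [NormedSpace ℝ E]
    [NormedAddCommGroup F] [NormedSpace ℝ F] {Φ : E → F} {x : ℝ → E} {y p q : E} {L P Q : ℝ}
    (hΦ : C2BoundAt Φ y L) (h : HasJet x y p q) (hp : ‖p‖ ≤ P) (hq : ‖q‖ ≤ Q) :
    ∃ f₁ f₂, HasJet (fun t => Φ (x t)) (Φ y) f₁ f₂ ∧ ‖f₁‖ ≤ L * P ∧
      ‖f₂‖ ≤ L * P * P + L * Q := by
  have hL : 0 ≤ L := (norm_nonneg _).trans hΦ.norm_le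
  have hP : 0 ≤ P := (norm_nonneg _).trans hp
  refine ⟨_, _, HasJet.comp hΦ.contDiffAt h, ?_, (norm_add_le _ _).trans (add_le_add ?_ ?_)⟩
  · refine (ContinuousLinearMap.le_opNorm _ _).trans ?_
    gcongr
    exact hΦ.norm_fderiv_le
  · refine (ContinuousLinearMap.le_opNorm₂ _ _ _).trans ?_
    gcongr
    exact hΦ.norm_fderiv_fderiv_le
  · refine (ContinuousLinearMap.le_opNorm _ _).trans ?_
    gcongr
    exact hΦ.norm_fderiv_le

lemma sum_gw_mul {ι : Type*} [Fintype ι] [DecidableEq ι] (η x : ι → ℝ) (k : ℕ) :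
    ∑ j, gw η k j * x j = ∑ m, sw η k m * (∑ j, x j - x m) := by
  simp only [gw, swT, sub_mul, mul_sub, Finset.sum_sub_distrib, ← Finset.mul_sum,
    ← Finset.sum_mul]

namespace InteriorMax.EigenFrame

variable {n k : ℕ} {L ε a b : ℝ} {D : InteriorMax n k L ε a b} (S : D.EigenFrame)

/-- The value of the right hand side at the maximum point. -/
noncomputable def f₀ (_ : D.EigenFrame) : ℝ := D.f (D.y₀, D.u D.y₀, fderiv ℝ D.u D.y₀)

lemma f₀_pos (hL : 1 ≤ L) : 0 < S.f₀ := by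
  have := D.one_le
  by_contra! h
  have : L * S.f₀ ≤ 0 := by nlinarith
  unfold f₀ at this
  linarith

lemma inv_f₀_le (hL : 1 ≤ L) : 1 / S.f₀ ≤ L := by
  rw [div_le_iff₀ (S.f₀_pos hL)]
  exact D.one_le

section Bounds

variable {B : ℝ} (hn : 2 ≤ n) (hk : k + 1 ≤ n) (hL : 1 ≤ L) (hB : 32 * n * L ^ 10 ≤ B)
include hn hk hL hB

/-- Differentiating the right hand side `f(x, u, ∇u)` twice gives terms quadratic in the second
derivatives of `u` and terms linear in the third ones; no sign of `∂²f/∂p²` is used. -/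
lemma exists_hasJet_f (i : Fin n) : ∃ f₁ f₂,
    HasJet (fun t => D.f (S.curve i t, D.u (S.curve i t), fderiv ℝ D.u (S.curve i t)))
      S.f₀ f₁ f₂ ∧ |f₁| ≤ 3 * B ^ 5 * (1 + D.w₀) ∧
      |f₂| ≤ 17 * B ^ 9 * (1 + D.w₀) ^ 2 + B ^ 3 * ∑ l, |S.U3 i i l| := by
  obtain ⟨b1, b2, b3, b4, b5⟩ := S.bounds hn hL hB
  have hw := S.w₀_pos hn hk
  obtain ⟨c, hc⟩ := S.hasJet_fderiv_u i
  have hu := S.hasJet_comp_curve (D.contDiffAt_u.of_le (m := 2) (by norm_num)) i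
  have hA := S.norm_hess_le hn hL hB hk i
  have hB0 : 0 < B := by linarith
  have L2 : L ^ 2 ≤ B := (pow_le_pow_right₀ hL (by norm_num)).trans b5
  have L3 : L ^ 3 ≤ B := (pow_le_pow_right₀ hL (by norm_num)).trans b5
  have B4 : B ≤ B ^ 4 := le_self_pow₀ b1 (by norm_num)
  have B8 : B ≤ B ^ 8 := le_self_pow₀ b1 (by norm_num)
  have B48 : B ^ 4 ≤ B ^ 8 := pow_le_pow_right₀ b1 (by norm_num)
  have hx1 : ‖(S.e i, fderiv ℝ D.u D.y₀ (S.e i), fderiv ℝ (fderiv ℝ D.u) D.y₀ (S.e i))‖ ≤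
      3 * B ^ 4 * (1 + D.w₀) := by
    refine norm_prod_le_iff.2 ⟨?_, norm_prod_le_iff.2 ⟨?_, hA⟩⟩
    · have := S.norm_e_le hL i
      dsimp only
      nlinarith
    · have := S.abs_fderiv_u_le hL i
      dsimp only
      rw [Real.norm_eq_abs]
      nlinarith
  -- `c` is the second derivative of `∇u` along the curve: `U3` up to Christoffel terms
  have hcl : ∀ l, |c (S.e l)| ≤ |S.U3 i i l| + 6 * B ^ 5 * (1 + D.w₀) := by
    intro l
    have h1 := ((hc.clm_apply (S.hasJet_X i l)).unique
      ((S.hasJet_fderiv_ut i l).congr (S.fderiv_ut_eq i l))).2.2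
    simp only [map_zero, add_zero, map_neg, smul_eq_mul] at h1
    have h2 : |fderiv ℝ (fderiv ℝ D.u) D.y₀ (S.e i) (D.Γ D.y₀ (S.e i) (S.e l))| ≤
        3 * B ^ 4 * (1 + D.w₀) * B := by
      rw [← Real.norm_eq_abs]
      refine ((fderiv ℝ (fderiv ℝ D.u) D.y₀ (S.e i)).le_opNorm _).trans ?_
      have := (S.norm_Γ₀_le hL i l).trans L3
      gcongr
    have h3 : c (S.e l) = S.U3 i i l +
        2 * fderiv ℝ (fderiv ℝ D.u) D.y₀ (S.e i) (D.Γ D.y₀ (S.e i) (S.e l)) := by linarith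
    rw [h3]
    refine (abs_add_le _ _).trans ?_
    rw [abs_mul, abs_two]
    linarith
  have hcn : ‖c‖ ≤ B ^ 2 * ∑ l, |S.U3 i i l| + 6 * B ^ 8 * (1 + D.w₀) := by
    refine (S.norm_covec_le hL c).trans ?_
    calc L ^ 2 * ∑ l, |c (S.e l)|
        ≤ B ^ 2 * ∑ l, (|S.U3 i i l| + 6 * B ^ 5 * (1 + D.w₀)) := by
          gcongr with l _
          exact hcl l
      _ = B ^ 2 * ∑ l, |S.U3 i i l| + B ^ 2 * (n * (6 * B ^ 5 * (1 + D.w₀))) := by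
          rw [Finset.sum_add_distrib, Finset.sum_const, Finset.card_univ, Fintype.card_fin,
            nsmul_eq_mul, mul_add]
      _ ≤ B ^ 2 * ∑ l, |S.U3 i i l| + B ^ 2 * (B * (6 * B ^ 5 * (1 + D.w₀))) := by gcongr
      _ = _ := by ring
  have hS : 0 ≤ ∑ l, |S.U3 i i l| := Finset.sum_nonneg fun l _ => abs_nonneg _
  have hx2 : ‖(- D.Γ D.y₀ (S.e i) (S.e i), hessForm D.u D.Γ D.y₀ (S.e i) (S.e i), c)‖ ≤
      B ^ 2 * ∑ l, |S.U3 i i l| + 8 * B ^ 8 * (1 + D.w₀) := by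
    have hp : 0 ≤ B ^ 2 * ∑ l, |S.U3 i i l| := by positivity
    have hp8 : 0 < B ^ 8 := by positivity
    refine norm_prod_le_iff.2 ⟨?_, norm_prod_le_iff.2 ⟨?_, ?_⟩⟩
    · have := (S.norm_Γ₀_le hL i i).trans L3
      dsimp only
      rw [norm_neg]
      nlinarith
    · obtain ⟨-, -, -, h0, -, -⟩ := S.exists_hasJet_rem hL i i i
      dsimp only
      rw [S.hess_u_eq, Real.norm_eq_abs]
      refine (abs_sub _ _).trans ?_
      have h1 : |S.w i| ≤ B * D.w₀ := (S.abs_w_le hn hk i).trans (by gcongr)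
      nlinarith
    · dsimp only
      nlinarith
  obtain ⟨f₁, f₂, hf, h1, h2⟩ := D.f_bound.hasJet ((S.hasJet_curve i).prodMk (hu.prodMk hc)) hx1 hx2
  have h0 : 0 ≤ B ^ 2 * ∑ l, |S.U3 i i l| + 8 * B ^ 8 * (1 + D.w₀) := by positivity
  refine ⟨f₁, f₂, hf, h1.trans ?_, h2.trans ?_⟩
  · calc _ ≤ B * (3 * B ^ 4 * (1 + D.w₀)) := by gcongr
      _ = _ := by ring
  · have h3 : L * (3 * B ^ 4 * (1 + D.w₀)) * (3 * B ^ 4 * (1 + D.w₀)) ≤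
        B * (3 * B ^ 4 * (1 + D.w₀)) * (3 * B ^ 4 * (1 + D.w₀)) := by gcongr
    have h4 : L * (B ^ 2 * ∑ l, |S.U3 i i l| + 8 * B ^ 8 * (1 + D.w₀)) ≤
        B * (B ^ 2 * ∑ l, |S.U3 i i l| + 8 * B ^ 8 * (1 + D.w₀)) := by gcongr
    have h5 : B ^ 9 * (1 + D.w₀) ≤ B ^ 9 * (1 + D.w₀) ^ 2 := by
      gcongr
      nlinarith
    linarith

end Bounds

end InteriorMax.EigenFrame

open InteriorMax.EigenFrame in
/-- The numbers extracted from an interior maximum satisfy the relations of `MaxPointData`. -/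
lemma exists_maxPointData {n k : ℕ} {L ε a b B : ℝ} (D : InteriorMax n k L ε a b) (hn : 2 ≤ n)
    (hk : k + 1 ≤ n) (hL : 1 ≤ L) (hb : 0 ≤ b) (hB : 32 * n * L ^ 10 ≤ B) :
    ∃ M : MaxPointData (Fin n) k (100 * B ^ 12) ε a b, M.w M.o = D.w₀ := by
  obtain ⟨S⟩ := D.nonempty_eigenFrame hL
  obtain ⟨b1, b2, b3, b4, b5⟩ := S.bounds hn hL hB
  have hB0 : 0 < B := by linarith
  have hw := S.w₀_pos hn hk
  have hcone := S.cone hk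
  have hcard : Fintype.card (Fin n) = n := Fintype.card_fin n
  choose G₂ hG hG' using S.exists_hasJet_metric hL
  choose R₁ R₂ hW hR₁ hR₂ using S.exists_hasJet_W hL
  choose f₁ f₂ hf hf₁ hf₂ using S.exists_hasJet_f hn hk hL hB
  choose β₂ hβ hβ' using S.exists_hasJet_testExp hL hb
  have hR₁' : ∀ i j l, |R₁ i j l| ≤ 2 * B ^ 2 := fun i j l => by
    calc _ ≤ 2 * L * (32 * L ^ 10) := hR₁ i j l
      _ ≤ 2 * B * B := by gcongr
      _ = _ := by ring
  have hR₂' : ∀ i j l, |R₂ i j l| ≤ 8 * B ^ 5 * (1 + D.w₀) := fun i j l => by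
    calc _ ≤ _ := hR₂ i j l
      _ ≤ 2 * (B + 3 * B ^ 4 * (1 + D.w₀)) * B := by
          gcongr
          exact S.norm_hess_le hn hL hB hk i
      _ ≤ _ := by
          have : B ^ 2 ≤ B ^ 5 := pow_le_pow_right₀ b1 (by norm_num)
          nlinarith [pow_pos hB0 5]
  have hpow : ∀ m ≤ 12, B ^ m ≤ B ^ 12 := fun m hm => pow_le_pow_right₀ b1 hm
  have hN := fun i => S.hasJet_traceSub (hG i) (W₁ := Matrix.of fun j l => S.U3 i j l + R₁ i j l)
    (W₂ := Matrix.of fun j l => S.U4 i j l + R₂ i j l) (hW i)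
  have hWsymm : ∀ i j l, S.U3 i j l + R₁ i j l = S.U3 i l j + R₁ i l j := fun i j l => by
    refine ((hW i j l).unique ((hW i l j).congr ?_)).2.1
    filter_upwards [(S.tendsto_curve i).eventually D.eventually_W_symm] with t ht
    exact ht _ _
  -- the equation, differentiated twice in direction `e i`
  have hσ := fun i => HasJet.minorSum_le (hN i) (fun j l => by
    simp only [Matrix.sub_apply, Matrix.smul_apply, Matrix.of_apply, hWsymm i l j]
    rw [Matrix.one_apply, Matrix.one_apply]
    simp [eq_comm]) hcone ((hf i).congr (S.equation_eventually hk i))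
  have hf₀ := S.f₀_pos hL
  have hinv : 1 / S.f₀ ≤ B := (S.inv_f₀_le hL).trans b2
  have hsw : ∀ m, sw (etaOf S.w) k m = es (Finset.univ.erase m) (etaOf S.w) k / S.f₀ := fun m => by
    rw [sw, ← (hσ m).1]
  have hsw0 : ∀ m, 0 < sw (etaOf S.w) k m := fun m => by
    rw [hsw]
    exact div_pos (hcone.erase (Finset.mem_univ m) k le_rfl) hf₀
  have hswT : ∀ m, sw (etaOf S.w) k m ≤ swT (etaOf S.w) k := fun m =>
    Finset.single_le_sum (f := sw (etaOf S.w) k) (fun i _ => (hsw0 i).le) (Finset.mem_univ m)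
  have hw1 : 1 ≤ 1 + D.w₀ := by linarith
  have hw2 : 1 + D.w₀ ≤ (1 + D.w₀) ^ 2 := by nlinarith
  have B12 : 1 ≤ B ^ 12 := one_le_pow₀ b1
  refine ⟨{
    w := S.w
    o := S.o
    W1 := fun i j l => S.U3 i j l + R₁ i j l
    q := fun i => S.U4 i S.o S.o + R₂ i S.o S.o
    r := fun i => S.U4 S.o i i + R₂ S.o i i
    u := fun l => fderiv ℝ D.u D.y₀ (S.e l)
    d := fun i => fderiv ℝ D.us D.y₀ (S.e i) - fderiv ℝ D.u D.y₀ (S.e i)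
    e := fun i => hessForm D.us D.Γ D.y₀ (S.e i) (S.e i) + D.θ D.y₀ (S.e i) (S.e i) - S.w i
    h := fun i => f₁ i / S.f₀
    β := fun i => b * ∑ l, fderiv ℝ D.u D.y₀ (S.e l) * S.U2 i l +
      a * (fderiv ℝ D.us D.y₀ (S.e i) - fderiv ℝ D.u D.y₀ (S.e i))
    β2 := β₂
    u2 := fun l i => S.U2 i l
    u3 := fun l i => S.U3 i i l
    h2 := f₂ S.o / S.f₀ - (f₁ S.o / S.f₀) ^ 2
    le_max := fun i => by rw [S.w_o]; exact S.w_le i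
    cone := hcone
    sigma_le := ?_
    W1_symm := hWsymm
    q_sub_r := ?_
    codazzi := ?_
    first := ?_
    h_le := ?_
    second := ?_
    h2_ge := ?_
    crit := ?_
    max₂ := ?_
    β_eq := fun i => rfl
    β2_ge := ?_
    u_le := ?_
    d_le := ?_
    u2_diag := ?_
    u2_off := ?_
    u3_le := ?_
    e_ge := ?_
    barrier := ?_ }, S.w_o⟩
  · rw [← (hσ S.o).1]
    have := (le_abs_self S.f₀).trans D.f_bound.norm_le
    linarith [hpow 1 (by norm_num)]
  · intro i
    simp only [S.w_o]
    have h1 := abs_le.1 (hR₂' i S.o S.o)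
    have h2 := abs_le.1 (hR₂' S.o i i)
    rw [S.U4_symm i S.o]
    have h3 : B ^ 5 * (1 + D.w₀) ≤ B ^ 12 * (1 + D.w₀) :=
      mul_le_mul_of_nonneg_right (hpow 5 (by norm_num)) (by linarith)
    have h4 : 0 ≤ B ^ 12 * (1 + D.w₀) := by positivity
    linarith
  · intro i
    have h1 := hR₁' i S.o S.o
    have h2 := hR₁' S.o S.o i
    have e : S.U3 i S.o S.o = S.U3 S.o S.o i := by rw [S.U3_symm, S.U3_symm']
    rw [e, add_sub_add_left_eq_sub]
    refine (abs_sub _ _).trans ?_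
    linarith [hpow 2 (by norm_num)]
  · intro i
    rw [sum_gw_mul, (hσ i).2.1, Finset.sum_div]
    refine Finset.sum_congr rfl fun m _ => ?_
    rw [hsw]
    simp [Matrix.trace]
    ring
  · intro i
    simp only [S.w_o]
    rw [abs_div, abs_of_pos hf₀, div_eq_mul_one_div]
    calc _ ≤ 3 * B ^ 5 * (1 + D.w₀) * B := by
          gcongr
          exact hf₁ i
      _ = 3 * B ^ 6 * (1 + D.w₀) := by ring
      _ ≤ 100 * B ^ 12 * (1 + D.w₀) := by
          have := hpow 6 (by norm_num)
          gcongr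
          norm_num
  · simp only [S.w_o]
    have h1 := (hσ S.o).2.2
    simp only [Matrix.of_apply] at h1
    have h2 : ∑ i, gw (etaOf S.w) k i * (S.U4 S.o i i + R₂ S.o i i - G₂ S.o i i * S.w i) =
        (∑ m, es (Finset.univ.erase m) (etaOf S.w) k *
          ((∑ i, (S.U4 S.o i i + R₂ S.o i i - G₂ S.o i i * S.w i)) *
            (1 : Matrix (Fin n) (Fin n) ℝ) m m -
              (S.U4 S.o m m + R₂ S.o m m - G₂ S.o m m * S.w m))) / S.f₀ := by
      rw [sum_gw_mul, Finset.sum_div]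
      refine Finset.sum_congr rfl fun m _ => ?_
      rw [hsw, Matrix.one_apply_eq, mul_one]
      ring
    have h3 : ∑ i, ∑ j ∈ Finset.univ.erase i,
        es₂ (etaOf S.w) k i j / es Finset.univ (etaOf S.w) (k + 1) *
          (S.U3 S.o i j + R₁ S.o i j) ^ 2 =
        (∑ i, ∑ j ∈ Finset.univ.erase i, es₂ (etaOf S.w) k i j *
          (((Matrix.of fun j l => S.U3 S.o j l + R₁ S.o j l).trace •
            (1 : Matrix (Fin n) (Fin n) ℝ) -
              Matrix.of fun j l => S.U3 S.o j l + R₁ S.o j l) i j) ^ 2) / S.f₀ := by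
      rw [Finset.sum_div]
      refine Finset.sum_congr rfl fun i _ => ?_
      rw [Finset.sum_div]
      refine Finset.sum_congr rfl fun j hj => ?_
      rw [← (hσ S.o).1, Matrix.sub_apply, Matrix.smul_apply,
        Matrix.one_apply_ne (Finset.ne_of_mem_erase hj).symm, Matrix.of_apply]
      simp only [smul_zero, zero_sub]
      ring
    have h4 : ∑ i, gw (etaOf S.w) k i * (S.U4 S.o i i + R₂ S.o i i - G₂ S.o i i * S.w i) ≤
        ∑ i, gw (etaOf S.w) k i * (S.U4 S.o i i + R₂ S.o i i) +
          100 * B ^ 12 * swT (etaOf S.w) k * (1 + D.w₀) := by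
      have hT : 0 ≤ swT (etaOf S.w) k := (hsw0 S.o).le.trans (hswT S.o)
      have h5 : ∀ i, gw (etaOf S.w) k i * (S.U4 S.o i i + R₂ S.o i i - G₂ S.o i i * S.w i) ≤
          gw (etaOf S.w) k i * (S.U4 S.o i i + R₂ S.o i i) +
            swT (etaOf S.w) k * (B * (B * D.w₀)) := by
        intro i
        have h6 : |G₂ S.o i i * S.w i| ≤ B * (B * D.w₀) := by
          rw [abs_mul]
          have h7 := (hG' S.o i i).trans b4
          have h8 : |S.w i| ≤ B * D.w₀ := (S.abs_w_le hn hk i).trans (by gcongr)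
          gcongr
        have h9 : 0 ≤ gw (etaOf S.w) k i := sub_nonneg.2 (hswT i)
        have h10 : gw (etaOf S.w) k i ≤ swT (etaOf S.w) k := by
          rw [gw]; linarith [hsw0 i]
        have h11 : - (G₂ S.o i i * S.w i) ≤ B * (B * D.w₀) := (neg_le_abs _).trans h6
        have h12 : 0 ≤ B * (B * D.w₀) := by positivity
        have h13 := mul_le_mul_of_nonneg_left h11 h9
        have h14 := mul_le_mul_of_nonneg_right h10 h12
        linarith
      refine (Finset.sum_le_sum fun i _ => h5 i).trans ?_
      rw [Finset.sum_add_distrib, Finset.sum_const, Finset.card_univ, hcard, nsmul_eq_mul]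
      refine add_le_add_right ?_ _
      have h15 : (n : ℝ) * (swT (etaOf S.w) k * (B * (B * D.w₀))) ≤
          B * (swT (etaOf S.w) k * (B * (B * D.w₀))) := by gcongr
      have h16 : B ^ 3 * (swT (etaOf S.w) k * D.w₀) ≤ B ^ 12 * (swT (etaOf S.w) k * D.w₀) :=
        mul_le_mul_of_nonneg_right (hpow 3 (by norm_num)) (by positivity)
      have h17 : 0 ≤ B ^ 12 * (swT (etaOf S.w) k * D.w₀) := by positivity
      have h18 : 0 ≤ B ^ 12 * swT (etaOf S.w) k := by positivity
      linarith
    refine le_trans ?_ h4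
    rw [h2, h3]
    have h5 := div_le_div_of_nonneg_right h1 hf₀.le
    rw [add_div, add_div] at h5
    have h6 : f₁ S.o ^ 2 / S.f₀ / S.f₀ = (f₁ S.o / S.f₀) ^ 2 := by
      rw [div_pow, div_div, sq S.f₀]
    rw [h6] at h5
    linarith
  · simp only [S.w_o]
    have h1 : |f₂ S.o / S.f₀| ≤ (17 * B ^ 9 * (1 + D.w₀) ^ 2 + B ^ 3 *
        (∑ i, |S.U3 i S.o S.o + R₁ i S.o S.o| + 2 * B ^ 3)) * B := by
      rw [abs_div, abs_of_pos hf₀, div_eq_mul_one_div]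
      have h2 : ∑ l, |S.U3 S.o S.o l| ≤ ∑ i, |S.U3 i S.o S.o + R₁ i S.o S.o| + 2 * B ^ 3 := by
        calc _ ≤ ∑ i, (|S.U3 i S.o S.o + R₁ i S.o S.o| + 2 * B ^ 2) := by
              refine Finset.sum_le_sum fun i _ => ?_
              have e : S.U3 S.o S.o i = (S.U3 i S.o S.o + R₁ i S.o S.o) - R₁ i S.o S.o := by
                rw [S.U3_symm' S.o S.o i, S.U3_symm S.o i]; ring
              rw [e]
              exact (abs_sub _ _).trans (by linarith [hR₁' i S.o S.o])
          _ = ∑ i, |S.U3 i S.o S.o + R₁ i S.o S.o| + n * (2 * B ^ 2) := by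
              rw [Finset.sum_add_distrib, Finset.sum_const, Finset.card_univ, hcard, nsmul_eq_mul]
          _ ≤ ∑ i, |S.U3 i S.o S.o + R₁ i S.o S.o| + B * (2 * B ^ 2) := by gcongr
          _ = _ := by ring
      have h3 := (hf₂ S.o).trans (add_le_add_right
        (mul_le_mul_of_nonneg_left h2 (by positivity : 0 ≤ B ^ 3)) _)
      gcongr
    have h2 : (f₁ S.o / S.f₀) ^ 2 ≤ (3 * B ^ 6 * (1 + D.w₀)) ^ 2 := by
      rw [← sq_abs, abs_div, abs_of_pos hf₀, div_eq_mul_one_div]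
      have h3 : |f₁ S.o| * (1 / S.f₀) ≤ 3 * B ^ 6 * (1 + D.w₀) := by
        calc _ ≤ 3 * B ^ 5 * (1 + D.w₀) * B := by
              gcongr
              exact hf₁ S.o
          _ = _ := by ring
      gcongr
    have h3 := neg_le_of_abs_le h1
    have hS : 0 ≤ ∑ i, |S.U3 i S.o S.o + R₁ i S.o S.o| :=
      Finset.sum_nonneg fun i _ => abs_nonneg _
    have h4 := mul_le_mul_of_nonneg_right (hpow 4 (by norm_num)) hS
    have h5 : B ^ 10 * (1 + D.w₀) ^ 2 ≤ B ^ 12 * (1 + D.w₀) ^ 2 :=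
      mul_le_mul_of_nonneg_right (hpow 10 (by norm_num)) (by positivity)
    have h6 : B ^ 7 ≤ B ^ 12 * (1 + D.w₀) ^ 2 := by
      nlinarith [hpow 7 (by norm_num)]
    have h7 : 0 ≤ B ^ 12 * ∑ i, |S.U3 i S.o S.o + R₁ i S.o S.o| := by positivity
    have h8 : 0 ≤ B ^ 12 * (1 + D.w₀) ^ 2 := by positivity
    linarith
  · intro i
    have hWo := hW i S.o S.o
    rw [Matrix.diagonal_apply_eq, S.w_o] at hWo
    have hGo := hG i S.o S.o
    rw [Matrix.one_apply_eq] at hGo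
    simp only [S.w_o]
    exact (S.max_conditions hWo hGo (hβ i)).1
  · intro i
    have hWo := hW i S.o S.o
    rw [Matrix.diagonal_apply_eq, S.w_o] at hWo
    have hGo := hG i S.o S.o
    rw [Matrix.one_apply_eq] at hGo
    simp only [S.w_o]
    refine (S.max_conditions hWo hGo (hβ i)).2.trans ?_
    have h1 := (le_abs_self _).trans ((hG' i S.o S.o).trans b4)
    have h2 := hpow 1 (by norm_num)
    refine mul_le_mul_of_nonneg_left ?_ hw.le
    linarith
  · intro i
    refine le_trans (add_le_add_left (mul_le_mul_of_nonneg_left ?_ hb) _) (hβ' i)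
    have h1 : 32 * (n : ℝ) ^ 2 * L ^ 14 ≤ B ^ 3 := by
      calc _ = (32 * n * L ^ 10) * n * L ^ 4 := by ring
        _ ≤ B * B * B := by gcongr
        _ = B ^ 3 := by ring
    linarith [hpow 3 (by norm_num)]
  · intro i
    refine (S.abs_fderiv_u_le hL i).trans ?_
    have h1 : L ^ 2 ≤ L ^ 4 := pow_le_pow_right₀ hL (by norm_num)
    linarith [hpow 1 (by norm_num)]
  · intro i
    have h1 : |fderiv ℝ D.us D.y₀ (S.e i)| ≤ L ^ 2 := by
      rw [← Real.norm_eq_abs]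
      refine ((fderiv ℝ D.us D.y₀).le_opNorm _).trans ?_
      have h5 := S.norm_e_le hL i
      calc _ ≤ L * L := by gcongr; exact D.us_bound.norm_fderiv_le
        _ = L ^ 2 := by ring
    have h2 : L ^ 2 ≤ L ^ 4 := pow_le_pow_right₀ hL (by norm_num)
    refine (abs_sub _ _).trans ?_
    linarith [hpow 1 (by norm_num), S.abs_fderiv_u_le hL i]
  · intro i
    have := S.abs_U2_sub_le hL i i
    rw [Matrix.diagonal_apply_eq] at this
    linarith [hpow 1 (by norm_num)]
  · intro i l hl
    have := S.abs_U2_sub_le hL i l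
    rw [Matrix.diagonal_apply_ne _ hl.symm, sub_zero] at this
    linarith [hpow 1 (by norm_num)]
  · intro i l
    have := hR₁' l i i
    rw [S.U3_symm' i i l, S.U3_symm i l, sub_add_cancel_left, abs_neg]
    linarith [hpow 2 (by norm_num)]
  · intro i
    simp only [S.w_o]
    have h1 : |hessForm D.us D.Γ D.y₀ (S.e i) (S.e i)| ≤ 2 * B := by
      rw [hessForm_apply]
      have he := S.norm_e_le hL i
      have h2 : |fderiv ℝ (fderiv ℝ D.us) D.y₀ (S.e i) (S.e i)| ≤ L * L * L := by
        rw [← Real.norm_eq_abs]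
        refine ((fderiv ℝ (fderiv ℝ D.us) D.y₀).le_opNorm₂ _ _).trans ?_
        have := D.us_bound.norm_fderiv_fderiv_le
        gcongr
      have h3 : |fderiv ℝ D.us D.y₀ (D.Γ D.y₀ (S.e i) (S.e i))| ≤ L * L ^ 3 := by
        rw [← Real.norm_eq_abs]
        refine ((fderiv ℝ D.us D.y₀).le_opNorm _).trans ?_
        have h5 := S.norm_Γ₀_le hL i i
        gcongr
        exact D.us_bound.norm_fderiv_le
      have h4 : L ^ 3 ≤ L ^ 4 := pow_le_pow_right₀ hL (by norm_num)
      refine (abs_sub _ _).trans ?_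
      linarith
    obtain ⟨-, -, -, h0, -, -⟩ := S.exists_hasJet_rem hL i i i
    have h2 := abs_le.1 h0
    have h3 : |S.w i| ≤ B * D.w₀ := (S.abs_w_le hn hk i).trans (by gcongr)
    have h4 := abs_le.1 h1
    have h5 := (le_abs_self _).trans h3
    have h6 := hpow 1 (by norm_num)
    have h7 : B ^ 1 * (1 + D.w₀) ≤ B ^ 12 * (1 + D.w₀) :=
      mul_le_mul_of_nonneg_right h6 (by linarith)
    have h8 : 0 ≤ B ^ 12 * (1 + D.w₀) := by positivity
    have h9 : 0 ≤ B * D.w₀ := by positivity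
    linarith
  · intro hkn
    rw [hcard] at hkn
    have htr : ((bilMat (D.g D.y₀))⁻¹ * bilMat (hessForm D.us D.Γ D.y₀ + D.θ D.y₀)).trace =
        ∑ j, (hessForm D.us D.Γ D.y₀ (S.e j) (S.e j) + D.θ D.y₀ (S.e j) (S.e j)) := by
      rw [← trace_inv_mul_frame S.isUnit_det, S.frame_metric, inv_one, Matrix.one_mul,
        ← bilMat_frame]
      rfl
    have h1 : ∀ i, ε ≤ ∑ j, (hessForm D.us D.Γ D.y₀ (S.e j) (S.e j) +
        D.θ D.y₀ (S.e j) (S.e j)) - (hessForm D.us D.Γ D.y₀ (S.e i) (S.e i) +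
        D.θ D.y₀ (S.e i) (S.e i)) := by
      intro i
      have := D.barrier hkn (S.e i)
      rwa [htr, S.gram_eq, Matrix.one_apply_eq, mul_one, mul_one] at this
    have h2 : ∑ m, sw (etaOf S.w) k m * (∑ j, S.w j - S.w m) = k + 1 := by
      have := sum_mul_es_erase Finset.univ (etaOf S.w) k
      rw [← (hσ S.o).1] at this
      rw [eq_comm, ← mul_div_cancel_right₀ ((k : ℝ) + 1) hf₀.ne', ← this, Finset.sum_div]
      refine Finset.sum_congr rfl fun m _ => ?_
      rw [hsw, etaOf]; ring
    rw [sum_gw_mul]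
    have h3 : ε * swT (etaOf S.w) k ≤ ∑ m, sw (etaOf S.w) k m *
        (∑ j, (hessForm D.us D.Γ D.y₀ (S.e j) (S.e j) + D.θ D.y₀ (S.e j) (S.e j)) -
          (hessForm D.us D.Γ D.y₀ (S.e m) (S.e m) + D.θ D.y₀ (S.e m) (S.e m))) := by
      rw [swT, Finset.mul_sum]
      refine Finset.sum_le_sum fun m _ => ?_
      rw [mul_comm]
      exact mul_le_mul_of_nonneg_left (h1 m) (hsw0 m).le
    have h4 : ∑ m, sw (etaOf S.w) k m *
        (∑ j, (hessForm D.us D.Γ D.y₀ (S.e j) (S.e j) + D.θ D.y₀ (S.e j) (S.e j) - S.w j) -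
          (hessForm D.us D.Γ D.y₀ (S.e m) (S.e m) + D.θ D.y₀ (S.e m) (S.e m) - S.w m)) =
        ∑ m, sw (etaOf S.w) k m *
          (∑ j, (hessForm D.us D.Γ D.y₀ (S.e j) (S.e j) + D.θ D.y₀ (S.e j) (S.e j)) -
            (hessForm D.us D.Γ D.y₀ (S.e m) (S.e m) + D.θ D.y₀ (S.e m) (S.e m))) -
        ∑ m, sw (etaOf S.w) k m * (∑ j, S.w j - S.w m) := by
      rw [← Finset.sum_sub_distrib]
      refine Finset.sum_congr rfl fun m _ => ?_
      rw [Finset.sum_sub_distrib]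
      ring
    rw [h4, h2]
    have h5 : ((k : ℝ) + 1) ≤ B := by
      have : ((k : ℝ) + 1) = n := by exact_mod_cast hkn
      linarith
    linarith [hpow 1 (by norm_num)]

/-- The largest eigenvalue of `W` at an interior maximum of the test function is bounded. -/
theorem exists_bound_at_interiorMax {n k : ℕ} (hn : 2 ≤ n) (hk : k + 1 ≤ n) {L ε : ℝ} (hL : 1 ≤ L)
    (hε : 0 < ε) :
    ∃ a b C : ℝ, 0 ≤ a ∧ 0 < b ∧ ∀ D : InteriorMax n k L ε a b, D.w₀ ≤ C := by
  have hn' : (1 : ℝ) ≤ n := by exact_mod_cast (by omega : 1 ≤ n)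
  have hB : 1 ≤ 32 * n * L ^ 10 := by
    have := one_le_pow₀ hL (n := 10)
    nlinarith
  have hΛ : 1 ≤ 100 * (32 * n * L ^ 10) ^ 12 := by
    have := one_le_pow₀ hB (n := 12)
    linarith
  obtain ⟨a, b, C, ha, hb, h⟩ := exists_bound_at_max (ι := Fin n) (k := k) (by simpa using hn)
    (by simpa using hk) hΛ hε
  refine ⟨a, b, C, ha, hb, fun D => ?_⟩
  obtain ⟨M, hM⟩ := exists_maxPointData D hn hk hL hb.le le_rfl
  rw [← hM]
  exact h M

end HessianEq

namespace HessianEq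

open Filter Topology

/-! ### Christoffel symbols and Hessians under a change of coordinates -/

section CoordChange

variable {E : Type*} [NormedAddCommGroup E] [NormedSpace ℝ E] {S : Set E} {τ : E → E} {y : E}

/-- The Koszul formula: `Γ` is the Levi-Civita connection at `y` of the metric `G` on `S`. -/
def Koszul (S : Set E) (G : E → E →L[ℝ] E →L[ℝ] ℝ) (Γ : E →L[ℝ] E →L[ℝ] E) (y : E) : Prop :=
  ∀ v w z, 2 * G y (Γ v w) z = fderivWithin ℝ G S y v w z + fderivWithin ℝ G S y w v z -
    fderivWithin ℝ G S y z v w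

/-- `τ` is a `C²` change of coordinates near the point `y` of `S`. -/
structure CoordChangeAt (S : Set E) (τ : E → E) (y : E) : Prop where
  mem : y ∈ S
  mem_closure : y ∈ closure (interior S)
  map_mem : τ y ∈ S
  contDiffWithinAt : ContDiffWithinAt ℝ 2 τ S y
  tendsto : Tendsto τ (𝓝[S] y) (𝓝[S] (τ y))
  surjective : Function.Surjective (fderivWithin ℝ τ S y)

namespace CoordChangeAt

variable (hS : UniqueDiffOn ℝ S) (h : CoordChangeAt S τ y)
include hS h

lemma hasFDerivWithinAt : HasFDerivWithinAt τ (fderivWithin ℝ τ S y) S y :=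
  (h.contDiffWithinAt.differentiableWithinAt (by simp)).hasFDerivWithinAt

lemma hasFDerivWithinAt_fderivWithin : HasFDerivWithinAt (fderivWithin ℝ τ S)
    (fderivWithin ℝ (fderivWithin ℝ τ S) S y) S y := by
  have h1 : ContDiffWithinAt ℝ 1 (fderivWithin ℝ τ S) S y :=
    h.contDiffWithinAt.fderivWithin_right hS (by norm_num) h.mem
  exact (h1.differentiableWithinAt (by simp)).hasFDerivWithinAt

lemma snd_symm (v w : E) : fderivWithin ℝ (fderivWithin ℝ τ S) S y v w =
    fderivWithin ℝ (fderivWithin ℝ τ S) S y w v :=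
  (h.contDiffWithinAt.isSymmSndFDerivWithinAt (by simp) hS h.mem_closure h.mem).eq v w

lemma hasFDerivWithinAt_comp {F : Type*} [NormedAddCommGroup F] [NormedSpace ℝ F] {Φ : E → F}
    (hΦ : DifferentiableWithinAt ℝ Φ S (τ y)) : HasFDerivWithinAt (fun z => Φ (τ z))
      ((fderivWithin ℝ Φ S (τ y)).comp (fderivWithin ℝ τ S y)) S y :=
  HasFDerivWithinAt.comp_of_tendsto y hΦ.hasFDerivWithinAt (h.hasFDerivWithinAt hS) h.tendsto

lemma fderivWithin_pullback {G₁ G₂ : E → E →L[ℝ] E →L[ℝ] ℝ}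
    (hG₁ : DifferentiableWithinAt ℝ G₁ S y)
    (hG₂ : DifferentiableWithinAt ℝ G₂ S (τ y))
    (hG : ∀ᶠ z in 𝓝[S] y, ∀ v w,
      G₁ z v w = G₂ (τ z) (fderivWithin ℝ τ S z v) (fderivWithin ℝ τ S z w)) (v p q : E) :
    fderivWithin ℝ G₁ S y v p q =
      fderivWithin ℝ G₂ S (τ y) (fderivWithin ℝ τ S y v) (fderivWithin ℝ τ S y p)
          (fderivWithin ℝ τ S y q) +
        G₂ (τ y) (fderivWithin ℝ (fderivWithin ℝ τ S) S y v p) (fderivWithin ℝ τ S y q) +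
        G₂ (τ y) (fderivWithin ℝ τ S y p) (fderivWithin ℝ (fderivWithin ℝ τ S) S y v q) := by
  have hT := h.hasFDerivWithinAt_fderivWithin hS
  have h1 := h.hasFDerivWithinAt_comp hS (F := E →L[ℝ] E →L[ℝ] ℝ) hG₂
  have h2 := (h1.clm_apply (hT.clm_apply (hasFDerivWithinAt_const p y S))).clm_apply
    (hT.clm_apply (hasFDerivWithinAt_const q y S))
  have h3 := (hG₁.hasFDerivWithinAt.clm_apply (hasFDerivWithinAt_const p y S)).clm_apply
    (hasFDerivWithinAt_const q y S)
  have h4 := h2.congr_of_eventuallyEq (f₁ := fun z => G₁ z p q)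
    (by filter_upwards [hG] with z hz using hz p q) (hG.self_of_nhdsWithin h.mem p q)
  have h5 := congrArg (fun T => T v) ((hS y h.mem).eq h3 h4)
  simp at h5
  rw [h5]
  ring

/-- The transformation law of the Christoffel symbols. -/
lemma koszul_pullback {G₁ G₂ : E → E →L[ℝ] E →L[ℝ] ℝ} {Γ₁ Γ₂ : E →L[ℝ] E →L[ℝ] E}
    (hG₁ : DifferentiableWithinAt ℝ G₁ S y) (hG₂ : DifferentiableWithinAt ℝ G₂ S (τ y))
    (hG : ∀ᶠ z in 𝓝[S] y, ∀ v w,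
      G₁ z v w = G₂ (τ z) (fderivWithin ℝ τ S z v) (fderivWithin ℝ τ S z w))
    (hsymm : ∀ v w, G₂ (τ y) v w = G₂ (τ y) w v) (hpos : ∀ v, v ≠ 0 → 0 < G₂ (τ y) v v)
    (h₁ : Koszul S G₁ Γ₁ y) (h₂ : Koszul S G₂ Γ₂ (τ y)) (v w : E) :
    fderivWithin ℝ τ S y (Γ₁ v w) = Γ₂ (fderivWithin ℝ τ S y v) (fderivWithin ℝ τ S y w) +
      fderivWithin ℝ (fderivWithin ℝ τ S) S y v w := by
  set J := fderivWithin ℝ τ S y with hJ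
  set T := fderivWithin ℝ (fderivWithin ℝ τ S) S y with hT
  have key : ∀ z, G₂ (τ y) (J (Γ₁ v w) - (Γ₂ (J v) (J w) + T v w)) (J z) = 0 := by
    intro z
    have e1 := h₁ v w z
    have e2 := h₂ (J v) (J w) (J z)
    rw [h.fderivWithin_pullback hS hG₁ hG₂ hG, h.fderivWithin_pullback hS hG₁ hG₂ hG,
      h.fderivWithin_pullback hS hG₁ hG₂ hG, hG.self_of_nhdsWithin h.mem] at e1
    simp only [← hJ, ← hT] at e1
    have s1 := h.snd_symm hS w v
    have s2 := h.snd_symm hS z v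
    have s3 := h.snd_symm hS z w
    simp only [← hT] at s1 s2 s3
    rw [s1, s2, s3, hsymm (J w) (T v z), hsymm (J v) (T w z)] at e1
    rw [map_sub, map_add, sub_apply, add_apply]
    linarith
  by_contra hne
  have hne' : J (Γ₁ v w) - (Γ₂ (J v) (J w) + T v w) ≠ 0 := sub_ne_zero.2 hne
  obtain ⟨z, hz⟩ := h.surjective (J (Γ₁ v w) - (Γ₂ (J v) (J w) + T v w))
  have h5 := key z
  rw [← hJ] at hz
  rw [hz] at h5
  exact (hpos _ hne').ne' h5

/-- The Hessian is a tensor. -/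
lemma hessian_pullback {u₁ u₂ : E → ℝ} {Γ₁ Γ₂ : E →L[ℝ] E →L[ℝ] E}
    (hu₂ : ∀ᶠ z in 𝓝[S] (τ y), ContDiffWithinAt ℝ 2 u₂ S z)
    (hτ : ∀ᶠ z in 𝓝[S] y, CoordChangeAt S τ z)
    (hu : ∀ᶠ z in 𝓝[S] y, u₁ z = u₂ (τ z))
    (hΓ : ∀ v w, fderivWithin ℝ τ S y (Γ₁ v w) =
      Γ₂ (fderivWithin ℝ τ S y v) (fderivWithin ℝ τ S y w) +
        fderivWithin ℝ (fderivWithin ℝ τ S) S y v w) :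
    (∀ v, fderivWithin ℝ u₁ S y v = fderivWithin ℝ u₂ S (τ y) (fderivWithin ℝ τ S y v)) ∧
    ∀ v w, fderivWithin ℝ (fderivWithin ℝ u₁ S) S y v w - fderivWithin ℝ u₁ S y (Γ₁ v w) =
      fderivWithin ℝ (fderivWithin ℝ u₂ S) S (τ y) (fderivWithin ℝ τ S y v)
          (fderivWithin ℝ τ S y w) -
        fderivWithin ℝ u₂ S (τ y) (Γ₂ (fderivWithin ℝ τ S y v) (fderivWithin ℝ τ S y w)) := by
  have hD : ∀ᶠ z in 𝓝[S] y, fderivWithin ℝ u₁ S z =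
      (fderivWithin ℝ u₂ S (τ z)).comp (fderivWithin ℝ τ S z) := by
    filter_upwards [h.tendsto.eventually hu₂, hτ, eventually_eventually_nhdsWithin.2 hu]
      with z h1 h2 h3
    have h4 := HasFDerivWithinAt.comp_of_tendsto z
      (h1.differentiableWithinAt (by simp)).hasFDerivWithinAt (h2.hasFDerivWithinAt hS) h2.tendsto
    exact (h4.congr_of_eventuallyEq h3 (h3.self_of_nhdsWithin h2.mem)).fderivWithin (hS z h2.mem)
  have hD0 := hD.self_of_nhdsWithin h.mem
  refine ⟨fun v => by rw [hD0]; rfl, fun v w => ?_⟩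
  have hu₂' : ContDiffWithinAt ℝ 2 u₂ S (τ y) := hu₂.self_of_nhdsWithin h.map_mem
  have h1 : ContDiffWithinAt ℝ 1 (fderivWithin ℝ u₂ S) S (τ y) :=
    hu₂'.fderivWithin_right hS (by norm_num) h.map_mem
  have h2 := h.hasFDerivWithinAt_comp hS (h1.differentiableWithinAt (by simp))
  have h3 := h2.clm_comp (h.hasFDerivWithinAt_fderivWithin hS)
  have h4 := (h3.congr_of_eventuallyEq hD hD0).fderivWithin (hS y h.mem)
  rw [h4, hD0]
  simp [hΓ]
  ring

end CoordChangeAt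

end CoordChange

end HessianEq

namespace HessianEq

open Filter Topology

/-! ### Tensors and functions in charts -/

section Chart

variable {n : ℕ} [NeZero n]
  {M : Type*} [TopologicalSpace M] [ChartedSpace (EuclideanHalfSpace n) M]

/-- The differential of the inverse of the chart centred at `c`. -/
noncomputable def chartDeriv (c : M) (y : Rn n) :
    Rn n →L[ℝ] Tan n ((extChartAt (𝓡∂ n) c).symm y) :=
  mfderivWithin 𝓘(ℝ, Rn n) (𝓡∂ n) (extChartAt (𝓡∂ n) c).symm (range (𝓡∂ n)) y

/-- The expression of a `(0,2)`-tensor field in the chart centred at `c`, as a bilinear form. -/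
noncomputable def coordForm (h : TwoTensor n M) (c : M) (y : Rn n) : Rn n →L[ℝ] Rn n →L[ℝ] ℝ :=
  ContinuousLinearMap.bilinearComp (E := Rn n) (F := Rn n)
    (h ((extChartAt (𝓡∂ n) c).symm y)) (chartDeriv c y) (chartDeriv c y)

lemma coordForm_apply (h : TwoTensor n M) (c : M) (y v w : Rn n) :
    coordForm h c y v w =
      h ((extChartAt (𝓡∂ n) c).symm y) (chartDeriv c y v) (chartDeriv c y w) := rfl

lemma bilMat_coordForm (h : TwoTensor n M) (c : M) (y : Rn n) :
    bilMat (coordForm h c y) = coordTensor h c y := rfl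

variable [IsManifold (𝓡∂ n) ∞ M]

lemma isManifold_of_le (m : WithTop ℕ∞) (hm : m ≤ ∞) : IsManifold (𝓡∂ n) m M :=
  IsManifold.of_le (n := ∞) hm

lemma contDiffOn_coordFun {u : M → ℝ} {m : WithTop ℕ∞} (hm : m ≤ ∞)
    (hu : ContMDiff (𝓡∂ n) 𝓘(ℝ, ℝ) m u) (c : M) :
    ContDiffOn ℝ m (coordFun u c) (extChartAt (𝓡∂ n) c).target := by
  rw [← contMDiffOn_iff_contDiffOn]
  have := isManifold_of_le (n := n) (M := M) m hm
  exact hu.comp_contMDiffOn (contMDiffOn_extChartAt_symm c)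

lemma target_mem {c : M} {y : Rn n} (hy : y ∈ (extChartAt (𝓡∂ n) c).target) :
    (extChartAt (𝓡∂ n) c).target ∈ 𝓝[range (𝓡∂ n)] y :=
  extChartAt_target_mem_nhdsWithin_of_mem hy

lemma target_subset (c : M) : (extChartAt (𝓡∂ n) c).target ⊆ range (𝓡∂ n) :=
  extChartAt_target_subset_range c

lemma symm_mem_source {c : M} {y : Rn n} (hy : y ∈ (extChartAt (𝓡∂ n) c).target) :
    (extChartAt (𝓡∂ n) c).symm y ∈ (chartAt (EuclideanHalfSpace n) c).source := by
  rw [← extChartAt_source (I := 𝓡∂ n)]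
  exact (extChartAt (𝓡∂ n) c).map_target hy

lemma symmL_eq_chartDeriv {c : M} {y : Rn n} (hy : y ∈ (extChartAt (𝓡∂ n) c).target) :
    (trivializationAt (Rn n) (TangentSpace (𝓡∂ n)) c).symmL ℝ ((extChartAt (𝓡∂ n) c).symm y) =
      chartDeriv c y := by
  rw [TangentBundle.symmL_trivializationAt (symm_mem_source hy), chartDeriv,
    (extChartAt (𝓡∂ n) c).right_inv hy]

lemma contMDiffOn_chartDeriv (c : M) (v : Rn n) :
    ContMDiffOn 𝓘(ℝ, Rn n) ((𝓡∂ n).prod 𝓘(ℝ, Rn n)) ∞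
      (fun y => TotalSpace.mk' (Rn n) (E := fun x : M => Tan n x)
        ((extChartAt (𝓡∂ n) c).symm y) (chartDeriv c y v)) (extChartAt (𝓡∂ n) c).target := by
  have h1 : ContMDiffOn 𝓘(ℝ, Rn n) ((𝓡∂ n).prod 𝓘(ℝ, Rn n)) ∞
      (fun y => ((extChartAt (𝓡∂ n) c).symm y, v)) (extChartAt (𝓡∂ n) c).target :=
    (contMDiffOn_extChartAt_symm c).prodMk contMDiffOn_const
  have h2 := (trivializationAt (Rn n) (TangentSpace (𝓡∂ n) (M := M)) c).contMDiffOn_symm (n := ∞)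
    (IB := 𝓡∂ n)
  refine (h2.comp h1 fun y hy => ?_).congr fun y hy => ?_
  · rw [mem_preimage, Trivialization.mem_target]
    exact symm_mem_source hy
  · have hb : (extChartAt (𝓡∂ n) c).symm y ∈
        (trivializationAt (Rn n) (TangentSpace (𝓡∂ n)) c).baseSet := symm_mem_source hy
    rw [Function.comp_apply, ← Trivialization.mk_symm _ hb, ← symmL_eq_chartDeriv hy,
      Trivialization.symmL_apply _ hb]

lemma contDiffOn_coordForm_apply {h : TwoTensor n M} (hh : SmoothTensor h) (c : M) (v w : Rn n) :
    ContDiffOn ℝ ∞ (fun y => coordForm h c y v w) (extChartAt (𝓡∂ n) c).target := by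
  rw [← contMDiffOn_iff_contDiffOn]
  have h1 := hh.comp_contMDiffOn (contMDiffOn_extChartAt_symm c)
  have h2 := ContMDiffOn.clm_bundle_apply₂ (F₁ := Rn n) (F₂ := Rn n) (F₃ := ℝ)
    (E₁ := fun x : M => Tan n x) (E₂ := fun x : M => Tan n x) (E₃ := Bundle.Trivial M ℝ) h1
    (contMDiffOn_chartDeriv c v) (contMDiffOn_chartDeriv c w)
  intro y hy
  have h3 := (contMDiffWithinAt_totalSpace.1 (h2 y hy)).2
  exact h3

lemma bilin_expand (B : Rn n →L[ℝ] Rn n →L[ℝ] ℝ) :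
    B = ∑ i : Fin n, ∑ j : Fin n, B (stdVec i) (stdVec j) •
      ((EuclideanSpace.proj (𝕜 := ℝ) i).smulRight (EuclideanSpace.proj (𝕜 := ℝ) j) :
        Rn n →L[ℝ] Rn n →L[ℝ] ℝ) := by
  ext v w
  conv_lhs => rw [sum_smul_stdVec v, sum_smul_stdVec w]
  simp only [map_sum, map_smul, sum_apply, smul_apply, smul_eq_mul,
    ContinuousLinearMap.smulRight_apply, Finset.mul_sum]
  rw [Finset.sum_comm]
  refine Finset.sum_congr rfl fun i _ => Finset.sum_congr rfl fun j _ => ?_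
  change w j * (v i * _) = _ * (v i * w j)
  ring

lemma contDiffOn_sum_sum_smul {ι F : Type*} [Fintype ι] [NormedAddCommGroup F] [NormedSpace ℝ F]
    {a : ι → ι → Rn n → ℝ} (b : ι → ι → F) {m : WithTop ℕ∞} {s : Set (Rn n)}
    (ha : ∀ i j, ContDiffOn ℝ m (a i j) s) :
    ContDiffOn ℝ m (fun y => ∑ i, ∑ j, a i j y • b i j) s :=
  ContDiffOn.sum fun i _ => ContDiffOn.sum fun j _ => (ha i j).smul contDiffOn_const

lemma contDiffOn_coordForm {h : TwoTensor n M} (hh : SmoothTensor h) (c : M) :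
    ContDiffOn ℝ ∞ (coordForm h c) (extChartAt (𝓡∂ n) c).target := by
  have : coordForm h c = fun y => ∑ i : Fin n, ∑ j : Fin n,
      coordForm h c y (stdVec i) (stdVec j) •
        ((EuclideanSpace.proj (𝕜 := ℝ) i).smulRight (EuclideanSpace.proj (𝕜 := ℝ) j) :
          Rn n →L[ℝ] Rn n →L[ℝ] ℝ) := funext fun y => bilin_expand _
  rw [this]
  exact contDiffOn_sum_sum_smul (F := Rn n →L[ℝ] Rn n →L[ℝ] ℝ) _ fun i j =>
    contDiffOn_coordForm_apply hh c _ _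

lemma hasMFDerivWithinAt_symm {c : M} {y : Rn n} (hy : y ∈ (extChartAt (𝓡∂ n) c).target) :
    HasMFDerivWithinAt 𝓘(ℝ, Rn n) (𝓡∂ n) (extChartAt (𝓡∂ n) c).symm (range (𝓡∂ n)) y
      (chartDeriv c y) :=
  (mdifferentiableWithinAt_extChartAt_symm hy).hasMFDerivWithinAt

/-- The differential of `u` in coordinates. -/
lemma grad_chartDeriv {u : M → ℝ} (hu : MDifferentiable (𝓡∂ n) 𝓘(ℝ, ℝ) u) {c : M} {y : Rn n}
    (hy : y ∈ (extChartAt (𝓡∂ n) c).target) (v : Rn n) :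
    (grad u ((extChartAt (𝓡∂ n) c).symm y)) (chartDeriv c y v) =
      fderivWithin ℝ (coordFun u c) (range (𝓡∂ n)) y v := by
  have h1 := (hu ((extChartAt (𝓡∂ n) c).symm y)).hasMFDerivAt.comp_hasMFDerivWithinAt y
    (hasMFDerivWithinAt_symm hy)
  have h2 : HasFDerivWithinAt (coordFun u c)
      (ContinuousLinearMap.comp (M₁ := Rn n) (M₂ := Rn n) (M₃ := ℝ)
        (grad u ((extChartAt (𝓡∂ n) c).symm y)) (chartDeriv c y)) (range (𝓡∂ n)) y :=
    h1.hasFDerivWithinAt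
  rw [h2.fderivWithin ((𝓡∂ n).uniqueDiffOn y (target_subset c hy))]
  rfl

lemma coordCovec_fderivWithin {u : M → ℝ} (hu : MDifferentiable (𝓡∂ n) 𝓘(ℝ, ℝ) u) {c : M}
    {y : Rn n} (hy : y ∈ (extChartAt (𝓡∂ n) c).target) :
    coordCovec c y (fderivWithin ℝ (coordFun u c) (range (𝓡∂ n)) y) =
      grad u ((extChartAt (𝓡∂ n) c).symm y) := by
  have h := mfderivWithin_extChartAt_symm_comp_mfderiv_extChartAt (I := 𝓡∂ n) hy
  ext v
  have h1 := grad_chartDeriv hu hy (mfderiv (𝓡∂ n) 𝓘(ℝ, Rn n) (extChartAt (𝓡∂ n) c)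
    ((extChartAt (𝓡∂ n) c).symm y) v)
  have h2 := DFunLike.congr_fun h v
  have h3 : chartDeriv c y (mfderiv (𝓡∂ n) 𝓘(ℝ, Rn n) (extChartAt (𝓡∂ n) c)
    ((extChartAt (𝓡∂ n) c).symm y) v) = v := h2
  rw [h3] at h1
  exact h1.symm

end Chart

end HessianEq

namespace HessianEq

set_option maxSynthPendingDepth 3

open Filter Topology

/-! ### Differentiation of bilinear forms -/

section Bilinear

variable {E F : Type*} [NormedAddCommGroup E] [NormedSpace ℝ E] [NormedAddCommGroup F]
  [NormedSpace ℝ F] {S : Set E} {y : E}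

lemma fderivWithin_apply_const {Φ : E → E →L[ℝ] F} (hS : UniqueDiffWithinAt ℝ S y)
    (hΦ : DifferentiableWithinAt ℝ Φ S y) (a v : E) :
    fderivWithin ℝ (fun z => Φ z v) S y a = fderivWithin ℝ Φ S y a v := by
  have h := hΦ.hasFDerivWithinAt.clm_apply (hasFDerivWithinAt_const v y S)
  have h2 := DFunLike.congr_fun (h.fderivWithin hS) a
  simpa using h2

lemma fderivWithin_apply_apply_const {G : E → E →L[ℝ] E →L[ℝ] ℝ} (hS : UniqueDiffWithinAt ℝ S y)
    (hG : DifferentiableWithinAt ℝ G S y) (a v w : E) :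
    fderivWithin ℝ (fun z => G z v w) S y a = fderivWithin ℝ G S y a v w := by
  have h := (hG.hasFDerivWithinAt.clm_apply (hasFDerivWithinAt_const v y S)).clm_apply
    (hasFDerivWithinAt_const w y S)
  have h2 := DFunLike.congr_fun (h.fderivWithin hS) a
  simpa using h2

lemma fderivWithin_symm {G : E → E →L[ℝ] E →L[ℝ] ℝ} (hS : UniqueDiffWithinAt ℝ S y)
    (hG : DifferentiableWithinAt ℝ G S y) (hsymm : ∀ z v w, G z v w = G z w v) (a v w : E) :
    fderivWithin ℝ G S y a v w = fderivWithin ℝ G S y a w v := by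
  rw [← fderivWithin_apply_apply_const hS hG, ← fderivWithin_apply_apply_const hS hG]
  simp only [hsymm _ v w]

variable {G : E → E →L[ℝ] E →L[ℝ] ℝ} {Γ : E →L[ℝ] E →L[ℝ] E}

lemma eq_of_span {ι : Type*} {b : ι → E} (hb : ∀ v, v ∈ Submodule.span ℝ (range b))
    {A B : E →L[ℝ] F} (h : ∀ i, A (b i) = B (b i)) : A = B := by
  ext v
  induction hb v using Submodule.span_induction with
  | mem _ hx => obtain ⟨m, rfl⟩ := hx; exact h m
  | zero => rw [map_zero, map_zero]
  | add x y _ _ hx hy => rw [map_add, map_add, hx, hy]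
  | smul a x _ hx => rw [map_smul, map_smul, hx]

lemma Koszul.of_span {ι : Type*} {b : ι → E} (hb : ∀ v, v ∈ Submodule.span ℝ (range b))
    (h : ∀ i j m, 2 * G y (Γ (b i) (b j)) (b m) = fderivWithin ℝ G S y (b i) (b j) (b m) +
      fderivWithin ℝ G S y (b j) (b i) (b m) - fderivWithin ℝ G S y (b m) (b i) (b j)) :
    Koszul S G Γ y := by
  set D : E →L[ℝ] E →L[ℝ] E →L[ℝ] ℝ := fderivWithin ℝ G S y with hD
  set A : E →L[ℝ] E →L[ℝ] E →L[ℝ] ℝ :=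
    (2 : ℝ) • (ContinuousLinearMap.compL ℝ E E (E →L[ℝ] ℝ) (G y)).comp Γ with hA
  set B : E →L[ℝ] E →L[ℝ] E →L[ℝ] ℝ := D + D.flip -
    (ContinuousLinearMap.flipₗᵢ ℝ E E ℝ : (E →L[ℝ] E →L[ℝ] ℝ) →L[ℝ] E →L[ℝ] E →L[ℝ] ℝ).comp
      D.flip with hB
  have hAB : A = B := by
    refine eq_of_span hb fun i => eq_of_span hb fun j => eq_of_span hb fun m => ?_
    exact h i j m
  intro v w z
  exact DFunLike.congr_fun (DFunLike.congr_fun (DFunLike.congr_fun hAB v) w) z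

lemma Koszul.symm (hS : UniqueDiffWithinAt ℝ S y) (hG : DifferentiableWithinAt ℝ G S y)
    (hsymm : ∀ z v w, G z v w = G z w v) (hpos : ∀ v, v ≠ 0 → 0 < G y v v) (h : Koszul S G Γ y)
    (v w : E) : Γ v w = Γ w v := by
  by_contra hne
  have hp := hpos _ (sub_ne_zero.2 hne)
  have e1 := h v w (Γ v w - Γ w v)
  have e2 := h w v (Γ v w - Γ w v)
  rw [fderivWithin_symm hS hG hsymm _ w v] at e2
  have e3 : G y (Γ v w - Γ w v) (Γ v w - Γ w v) =
      G y (Γ v w) (Γ v w - Γ w v) - G y (Γ w v) (Γ v w - Γ w v) := by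
    rw [map_sub (G y), sub_apply]
  linarith

/-- The Levi-Civita connection is compatible with the metric. -/
lemma Koszul.compat (hS : UniqueDiffWithinAt ℝ S y) (hG : DifferentiableWithinAt ℝ G S y)
    (hsymm : ∀ z v w, G z v w = G z w v) (h : Koszul S G Γ y) (v x z : E) :
    fderivWithin ℝ G S y v x z = G y (Γ v x) z + G y x (Γ v z) := by
  have e1 := h v x z
  have e2 := h v z x
  rw [hsymm y x]
  have s1 := fderivWithin_symm hS hG hsymm v z x
  have s2 := fderivWithin_symm hS hG hsymm z v x
  have s3 := fderivWithin_symm hS hG hsymm x v z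
  linarith

end Bilinear

/-! ### Changes of charts -/

section ChartChange

variable {n : ℕ} [NeZero n]
  {M : Type*} [TopologicalSpace M] [ChartedSpace (EuclideanHalfSpace n) M]

/-- The change of coordinates from the chart centred at `c` to the chart centred at `c'`. -/
noncomputable def chartChange (c c' : M) (y : Rn n) : Rn n :=
  extChartAt (𝓡∂ n) c' ((extChartAt (𝓡∂ n) c).symm y)

/-- The domain of the change of coordinates from the chart centred at `c` to the chart centred
at `c'`. -/
def chartOverlap (c c' : M) : Set (Rn n) :=
  {y | y ∈ (extChartAt (𝓡∂ n) c).target ∧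
    (extChartAt (𝓡∂ n) c).symm y ∈ (extChartAt (𝓡∂ n) c').source}

lemma symm_chartChange {c c' : M} {y : Rn n} (hy : y ∈ chartOverlap c c') :
    (extChartAt (𝓡∂ n) c').symm (chartChange c c' y) = (extChartAt (𝓡∂ n) c).symm y :=
  (extChartAt (𝓡∂ n) c').left_inv hy.2

lemma chartChange_mem_target {c c' : M} {y : Rn n} (hy : y ∈ chartOverlap c c') :
    chartChange c c' y ∈ (extChartAt (𝓡∂ n) c').target :=
  (extChartAt (𝓡∂ n) c').map_source hy.2

lemma chartChange_mem_range (c c' : M) (y : Rn n) : chartChange c c' y ∈ range (𝓡∂ n) :=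
  mem_range_self _

lemma chartOverlap_mem {c c' : M} {y : Rn n} (hy : y ∈ chartOverlap c c') :
    chartOverlap c c' ∈ 𝓝[range (𝓡∂ n)] y := by
  have h1 : (extChartAt (𝓡∂ n) c).target ∈ 𝓝[range (𝓡∂ n)] y :=
    extChartAt_target_mem_nhdsWithin_of_mem hy.1
  have h2 := continuousAt_extChartAt_symm'' (I := 𝓡∂ n) hy.1
  have h3 := h2.preimage_mem_nhds ((isOpen_extChartAt_source (I := 𝓡∂ n) c').mem_nhds hy.2)
  filter_upwards [h1, mem_nhdsWithin_of_mem_nhds h3] with z hz1 hz2 using ⟨hz1, hz2⟩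

variable [IsManifold (𝓡∂ n) ∞ M]

lemma contDiffWithinAt_chartChange {c c' : M} {y : Rn n} (hy : y ∈ chartOverlap c c') :
    ContDiffWithinAt ℝ 2 (chartChange c c') (range (𝓡∂ n)) y := by
  have := isManifold_of_le (n := n) (M := M) 2 (by norm_cast)
  refine contDiffWithinAt_ext_coord_change (I := 𝓡∂ n) c' c ?_
  rw [PartialEquiv.trans_source]
  exact hy

lemma chartDeriv_bijective {c : M} {y : Rn n} (hy : y ∈ (extChartAt (𝓡∂ n) c).target) :
    Function.Bijective (chartDeriv c y) := by
  have h1 := mfderivWithin_extChartAt_symm_comp_mfderiv_extChartAt (I := 𝓡∂ n) hy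
  have h2 := mfderiv_extChartAt_comp_mfderivWithin_extChartAt_symm (I := 𝓡∂ n) hy
  exact ⟨Function.LeftInverse.injective fun v => DFunLike.congr_fun h2 v,
    Function.RightInverse.surjective fun v => DFunLike.congr_fun h1 v⟩

lemma chartDeriv_chartChange {c c' : M} {y : Rn n} (hy : y ∈ chartOverlap c c') (v : Rn n) :
    (chartDeriv c y v : Rn n) = chartDeriv c' (chartChange c c' y)
      (fderivWithin ℝ (chartChange c c') (range (𝓡∂ n)) y v) := by
  have h1 : HasMFDerivWithinAt 𝓘(ℝ, Rn n) 𝓘(ℝ, Rn n) (chartChange c c') (range (𝓡∂ n)) y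
      (fderivWithin ℝ (chartChange c c') (range (𝓡∂ n)) y) :=
    ((contDiffWithinAt_chartChange hy).differentiableWithinAt
      (by simp)).hasFDerivWithinAt.hasMFDerivWithinAt
  have h2 := (hasMFDerivWithinAt_symm (chartChange_mem_target hy)).comp y h1
    (fun z _ => chartChange_mem_range c c' z)
  have h3 : (extChartAt (𝓡∂ n) c).symm =ᶠ[𝓝[range (𝓡∂ n)] y]
      (extChartAt (𝓡∂ n) c').symm ∘ chartChange c c' := by
    filter_upwards [chartOverlap_mem hy] with z hz using (symm_chartChange hz).symm
  have h4 := h2.congr_of_eventuallyEq h3 (symm_chartChange hy).symm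
  have h5 := h4.mfderivWithin ((𝓡∂ n).uniqueDiffOn y (target_subset c hy.1)).uniqueMDiffWithinAt
  exact DFunLike.congr_fun h5 v

lemma coordChangeAt_chartChange {c c' : M} {y : Rn n} (hy : y ∈ chartOverlap c c') :
    CoordChangeAt (range (𝓡∂ n)) (chartChange c c') y where
  mem := target_subset c hy.1
  mem_closure := (𝓡∂ n).range_subset_closure_interior (target_subset c hy.1)
  map_mem := chartChange_mem_range c c' y
  contDiffWithinAt := contDiffWithinAt_chartChange hy
  tendsto := tendsto_nhdsWithin_iff.2
    ⟨(contDiffWithinAt_chartChange hy).continuousWithinAt,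
      Eventually.of_forall fun z => chartChange_mem_range c c' z⟩
  surjective := by
    intro w
    obtain ⟨v, hv⟩ := (chartDeriv_bijective hy.1).2 (chartDeriv c' (chartChange c c' y) w)
    refine ⟨v, (chartDeriv_bijective (chartChange_mem_target hy)).1 ?_⟩
    exact (chartDeriv_chartChange hy v).symm.trans hv

lemma coordForm_chartChange (h : TwoTensor n M) {c c' : M} {y : Rn n}
    (hy : y ∈ chartOverlap c c') (v w : Rn n) :
    coordForm h c y v w = coordForm h c' (chartChange c c' y)
      (fderivWithin ℝ (chartChange c c') (range (𝓡∂ n)) y v)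
      (fderivWithin ℝ (chartChange c c') (range (𝓡∂ n)) y w) := by
  rw [coordForm_apply, coordForm_apply]
  have h1 := congrArg (fun x => (h x : Rn n →L[ℝ] Rn n →L[ℝ] ℝ) (chartDeriv c y v)
    (chartDeriv c y w)) (symm_chartChange hy)
  refine h1.symm.trans ?_
  exact congrArg₂ (fun a b : Rn n =>
    (h ((extChartAt (𝓡∂ n) c').symm (chartChange c c' y)) : Rn n →L[ℝ] Rn n →L[ℝ] ℝ) a b)
    (chartDeriv_chartChange hy v) (chartDeriv_chartChange hy w)

lemma coordFun_chartChange (u : M → ℝ) {c c' : M} {y : Rn n} (hy : y ∈ chartOverlap c c') :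
    coordFun u c y = coordFun u c' (chartChange c c' y) :=
  congrArg u (symm_chartChange hy).symm

end ChartChange

/-! ### Christoffel symbols and Hessians in charts -/

section Christoffel

variable {n : ℕ} [NeZero n]
  {M : Type*} [TopologicalSpace M] [ChartedSpace (EuclideanHalfSpace n) M]
  [IsManifold (𝓡∂ n) ∞ M]

/-- The Christoffel symbols in the chart centred at `c`, as a bilinear map. -/
noncomputable def christoffelForm (g : Metric n M) (c : M) (y : Rn n) :
    Rn n →L[ℝ] Rn n →L[ℝ] Rn n :=
  ∑ i : Fin n, ∑ j : Fin n, ∑ l : Fin n, christoffel g c y l i j •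
    (EuclideanSpace.proj (𝕜 := ℝ) i).smulRight
      ((EuclideanSpace.proj (𝕜 := ℝ) j).smulRight (stdVec l))

/-- The metric in the chart centred at `c`. -/
noncomputable abbrev metricForm (g : Metric n M) (c : M) (y : Rn n) : Rn n →L[ℝ] Rn n →L[ℝ] ℝ :=
  coordForm (fun x => g.inner x) c y

/-- The Hessian of `u` in the chart centred at `c`, as a bilinear form. -/
noncomputable def hessianForm (g : Metric n M) (u : M → ℝ) (c : M) (y : Rn n) :
    Rn n →L[ℝ] Rn n →L[ℝ] ℝ :=
  fderivWithin ℝ (fderivWithin ℝ (coordFun u c) (range (𝓡∂ n))) (range (𝓡∂ n)) y -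
    (ContinuousLinearMap.compL ℝ (Rn n) (Rn n) ℝ
      (fderivWithin ℝ (coordFun u c) (range (𝓡∂ n)) y)).comp (christoffelForm g c y)

lemma hessianForm_apply (g : Metric n M) (u : M → ℝ) (c : M) (y v w : Rn n) :
    hessianForm g u c y v w =
      fderivWithin ℝ (fderivWithin ℝ (coordFun u c) (range (𝓡∂ n))) (range (𝓡∂ n)) y v w -
        fderivWithin ℝ (coordFun u c) (range (𝓡∂ n)) y (christoffelForm g c y v w) := rfl

lemma christoffelForm_apply (g : Metric n M) (c : M) (y v w : Rn n) :
    christoffelForm g c y v w =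
      ∑ i : Fin n, ∑ j : Fin n, ∑ l : Fin n, (christoffel g c y l i j * v i * w j) • stdVec l := by
  simp only [christoffelForm, sum_apply, smul_apply, ContinuousLinearMap.smulRight_apply, smul_smul]
  rfl

lemma christoffelForm_stdVec (g : Metric n M) (c : M) (y : Rn n) (i j : Fin n) :
    christoffelForm g c y (stdVec i) (stdVec j) = ∑ l, christoffel g c y l i j • stdVec l := by
  simp [christoffelForm_apply, stdVec_apply, Finset.sum_ite_irrel]

lemma coordForm_symm {h : TwoTensor n M} (hh : SymmTensor h) (c : M) (y v w : Rn n) :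
    coordForm h c y v w = coordForm h c y w v :=
  hh ((extChartAt (𝓡∂ n) c).symm y) (chartDeriv c y v) (chartDeriv c y w)

lemma metricForm_symm (g : Metric n M) (c : M) (y v w : Rn n) :
    metricForm g c y v w = metricForm g c y w v :=
  g.symm ((extChartAt (𝓡∂ n) c).symm y) (chartDeriv c y v) (chartDeriv c y w)

lemma metricForm_pos (g : Metric n M) {c : M} {y : Rn n}
    (hy : y ∈ (extChartAt (𝓡∂ n) c).target) {v : Rn n} (hv : v ≠ 0) :
    0 < metricForm g c y v v := by
  refine g.pos ((extChartAt (𝓡∂ n) c).symm y) (chartDeriv c y v) fun h => hv ((chartDeriv_bijective hy).1 ?_)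
  exact h.trans (map_zero (chartDeriv c y)).symm

lemma posDef_coordMetric (g : Metric n M) {c : M} {y : Rn n}
    (hy : y ∈ (extChartAt (𝓡∂ n) c).target) : (coordMetric g c y).PosDef :=
  posDef_bilMat (B := metricForm g c y) (metricForm_symm g c y) fun _ hv => metricForm_pos g hy hv

lemma contDiffOn_metricForm (g : Metric n M) (c : M) :
    ContDiffOn ℝ ∞ (metricForm g c) (extChartAt (𝓡∂ n) c).target :=
  contDiffOn_coordForm g.contMDiff c

lemma contDiffWithinAt_metricForm (g : Metric n M) {c : M} {y : Rn n}
    (hy : y ∈ (extChartAt (𝓡∂ n) c).target) :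
    ContDiffWithinAt ℝ ∞ (metricForm g c) (range (𝓡∂ n)) y :=
  (contDiffOn_metricForm g c y hy).mono_of_mem_nhdsWithin (target_mem hy)

lemma differentiableWithinAt_metricForm (g : Metric n M) {c : M} {y : Rn n}
    (hy : y ∈ (extChartAt (𝓡∂ n) c).target) :
    DifferentiableWithinAt ℝ (metricForm g c) (range (𝓡∂ n)) y :=
  (contDiffWithinAt_metricForm g hy).differentiableWithinAt (by simp)

lemma uniqueDiffWithinAt_range {c : M} {y : Rn n} (hy : y ∈ (extChartAt (𝓡∂ n) c).target) :
    UniqueDiffWithinAt ℝ (range (𝓡∂ n)) y :=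
  (𝓡∂ n).uniqueDiffOn y (target_subset c hy)

lemma pd_coordMetric (g : Metric n M) {c : M} {y : Rn n}
    (hy : y ∈ (extChartAt (𝓡∂ n) c).target) (m i j : Fin n) :
    pd m (fun z => coordMetric g c z i j) y =
      fderivWithin ℝ (metricForm g c) (range (𝓡∂ n)) y (stdVec m) (stdVec i) (stdVec j) :=
  fderivWithin_apply_apply_const (uniqueDiffWithinAt_range hy)
    (differentiableWithinAt_metricForm g hy) _ _ _

lemma koszul_christoffelForm (g : Metric n M) {c : M} {y : Rn n}
    (hy : y ∈ (extChartAt (𝓡∂ n) c).target) :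
    Koszul (range (𝓡∂ n)) (metricForm g c) (christoffelForm g c y) y := by
  refine Koszul.of_span mem_span_stdVec fun i j m => ?_
  rw [← pd_coordMetric g hy, ← pd_coordMetric g hy, ← pd_coordMetric g hy, christoffelForm_stdVec]
  simp only [map_sum, map_smul, sum_apply, smul_apply, smul_eq_mul, christoffel]
  set d : Fin n → ℝ := fun m => pd i (fun z => coordMetric g c z j m) y +
    pd j (fun z => coordMetric g c z i m) y - pd m (fun z => coordMetric g c z i j) y with hd
  have hu : IsUnit (coordMetric g c y).det := (posDef_coordMetric g hy).det_pos.ne'.isUnit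
  have h1 : (coordMetric g c y *ᵥ ((coordMetric g c y)⁻¹ *ᵥ d)) m = d m := by
    rw [Matrix.mulVec_mulVec, Matrix.mul_nonsing_inv _ hu, Matrix.one_mulVec]
  rw [show pd i (fun z => coordMetric g c z j m) y + pd j (fun z => coordMetric g c z i m) y -
    pd m (fun z => coordMetric g c z i j) y = d m from rfl, ← h1]
  simp only [Matrix.mulVec, dotProduct, Finset.mul_sum]
  refine Finset.sum_congr rfl fun l _ => ?_
  rw [Finset.sum_mul, Finset.mul_sum]
  refine Finset.sum_congr rfl fun a _ => ?_
  have h2 : coordMetric g c y m l = metricForm g c y (stdVec l) (stdVec m) :=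
    metricForm_symm g c y _ _
  rw [h2]
  ring

lemma christoffelForm_symm (g : Metric n M) {c : M} {y : Rn n}
    (hy : y ∈ (extChartAt (𝓡∂ n) c).target) (v w : Rn n) :
    christoffelForm g c y v w = christoffelForm g c y w v :=
  (koszul_christoffelForm g hy).symm (uniqueDiffWithinAt_range hy)
    (differentiableWithinAt_metricForm g hy) (metricForm_symm g c)
    (fun _ hv => metricForm_pos g hy hv) v w

lemma contDiffWithinAt_coordFun {u : M → ℝ} (hu : ContMDiff (𝓡∂ n) 𝓘(ℝ, ℝ) 2 u) (c : M)
    {y : Rn n} (hy : y ∈ (extChartAt (𝓡∂ n) c).target) :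
    ContDiffWithinAt ℝ 2 (coordFun u c) (range (𝓡∂ n)) y ∧
    ContDiffWithinAt ℝ 1 (fderivWithin ℝ (coordFun u c) (range (𝓡∂ n))) (range (𝓡∂ n)) y := by
  have h1 : ContDiffWithinAt ℝ 2 (coordFun u c) (range (𝓡∂ n)) y :=
    (contDiffOn_coordFun (by norm_cast) hu c y hy).mono_of_mem_nhdsWithin (target_mem hy)
  exact ⟨h1, h1.fderivWithin_right (𝓡∂ n).uniqueDiffOn (by norm_num) (target_subset c hy)⟩

lemma bilMat_hessianForm (g : Metric n M) {u : M → ℝ} (hu : ContMDiff (𝓡∂ n) 𝓘(ℝ, ℝ) 2 u) {c : M}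
    {y : Rn n} (hy : y ∈ (extChartAt (𝓡∂ n) c).target) :
    bilMat (hessianForm g u c y) = coordHess g u c y := by
  ext i j
  have h3 : pd i (pd j (coordFun u c)) y = _ :=
    fderivWithin_apply_const (uniqueDiffWithinAt_range hy)
      ((contDiffWithinAt_coordFun hu c hy).2.differentiableWithinAt (by simp))
      (stdVec i) (stdVec j)
  simp only [bilMat, coordHess, Matrix.of_apply, hessianForm_apply, christoffelForm_stdVec, map_sum,
    map_smul, smul_eq_mul]
  rw [h3]
  rfl

/-- The Jacobian matrix of a change of charts. -/
noncomputable def chartJac (c c' : M) (y : Rn n) : Matrix (Fin n) (Fin n) ℝ :=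
  frameMat fun i => fderivWithin ℝ (chartChange c c') (range (𝓡∂ n)) y (stdVec i)

lemma coordTensor_chartChange (h : TwoTensor n M) {c c' : M} {y : Rn n}
    (hy : y ∈ chartOverlap c c') : coordTensor h c y =
      (chartJac c c' y)ᵀ * coordTensor h c' (chartChange c c' y) * chartJac c c' y := by
  rw [← bilMat_coordForm, ← bilMat_coordForm, chartJac, ← bilMat_frame]
  ext i j
  exact coordForm_chartChange h hy (stdVec i) (stdVec j)

lemma isUnit_det_chartJac (g : Metric n M) {c c' : M} {y : Rn n} (hy : y ∈ chartOverlap c c') :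
    IsUnit (chartJac c c' y).det := by
  have h1 := (posDef_coordMetric g hy.1).det_pos
  rw [coordMetric, coordTensor_chartChange _ hy, Matrix.det_mul] at h1
  exact (right_ne_zero_of_mul h1.ne').isUnit

lemma christoffelForm_chartChange (g : Metric n M) {c c' : M} {y : Rn n}
    (hy : y ∈ chartOverlap c c') (v w : Rn n) :
    fderivWithin ℝ (chartChange c c') (range (𝓡∂ n)) y (christoffelForm g c y v w) =
      christoffelForm g c' (chartChange c c' y)
          (fderivWithin ℝ (chartChange c c') (range (𝓡∂ n)) y v)
          (fderivWithin ℝ (chartChange c c') (range (𝓡∂ n)) y w) +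
        fderivWithin ℝ (fderivWithin ℝ (chartChange c c') (range (𝓡∂ n))) (range (𝓡∂ n)) y v w := by
  have hτt := chartChange_mem_target hy
  refine (coordChangeAt_chartChange hy).koszul_pullback (𝓡∂ n).uniqueDiffOn
    (differentiableWithinAt_metricForm g hy.1) (differentiableWithinAt_metricForm g hτt) ?_
    (metricForm_symm g c' _) (fun v hv => metricForm_pos g hτt hv)
    (koszul_christoffelForm g hy.1) (koszul_christoffelForm g hτt) v w
  filter_upwards [chartOverlap_mem hy] with z hz v w using coordForm_chartChange _ hz v w

lemma hessianForm_chartChange (g : Metric n M) {u : M → ℝ} (hu : ContMDiff (𝓡∂ n) 𝓘(ℝ, ℝ) 2 u)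
    {c c' : M} {y : Rn n} (hy : y ∈ chartOverlap c c') (v w : Rn n) :
    hessianForm g u c y v w = hessianForm g u c' (chartChange c c' y)
      (fderivWithin ℝ (chartChange c c') (range (𝓡∂ n)) y v)
      (fderivWithin ℝ (chartChange c c') (range (𝓡∂ n)) y w) := by
  refine ((coordChangeAt_chartChange hy).hessian_pullback (𝓡∂ n).uniqueDiffOn
    (u₁ := coordFun u c) (u₂ := coordFun u c') ?_ ?_ ?_ (christoffelForm_chartChange g hy)).2 v w
  · filter_upwards [target_mem (chartChange_mem_target hy)] with z hz
      using (contDiffWithinAt_coordFun hu c' hz).1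
  · filter_upwards [chartOverlap_mem hy] with z hz using coordChangeAt_chartChange hz
  · filter_upwards [chartOverlap_mem hy] with z hz using coordFun_chartChange u hz

lemma coordHess_chartChange (g : Metric n M) {u : M → ℝ} (hu : ContMDiff (𝓡∂ n) 𝓘(ℝ, ℝ) 2 u)
    {c c' : M} {y : Rn n} (hy : y ∈ chartOverlap c c') : coordHess g u c y =
      (chartJac c c' y)ᵀ * coordHess g u c' (chartChange c c' y) * chartJac c c' y := by
  rw [← bilMat_hessianForm g hu hy.1, ← bilMat_hessianForm g hu (chartChange_mem_target hy),
    chartJac, ← bilMat_frame]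
  ext i j
  exact hessianForm_chartChange g hu hy (stdVec i) (stdVec j)

/-- In the frame of the coordinate vectors of the chart centred at `c`, covectors, tensor fields
and Hessians are transformed by one and the same invertible matrix. -/
lemma exists_chart_frame (g : Metric n M) {c : M} {y : Rn n}
    (hy : y ∈ (extChartAt (𝓡∂ n) c).target) : ∃ P : Matrix (Fin n) (Fin n) ℝ, IsUnit P.det ∧
      (∀ p : Cotan n ((extChartAt (𝓡∂ n) c).symm y), (fun i => p (chartDeriv c y (stdVec i))) =
        Pᵀ *ᵥ fun l => p (coordVec ((extChartAt (𝓡∂ n) c).symm y)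
          (extChartAt (𝓡∂ n) ((extChartAt (𝓡∂ n) c).symm y)
            ((extChartAt (𝓡∂ n) c).symm y)) l : Rn n)) ∧
      (∀ h : TwoTensor n M,
        coordTensor h c y = Pᵀ * tensorAt h ((extChartAt (𝓡∂ n) c).symm y) * P) ∧
      ∀ u : M → ℝ, ContMDiff (𝓡∂ n) 𝓘(ℝ, ℝ) 2 u →
        coordHess g u c y = Pᵀ * hess g u ((extChartAt (𝓡∂ n) c).symm y) * P := by
  have hyx : y ∈ chartOverlap c ((extChartAt (𝓡∂ n) c).symm y) := ⟨hy, mem_extChartAt_source _⟩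
  refine ⟨chartJac c ((extChartAt (𝓡∂ n) c).symm y) y, isUnit_det_chartJac g hyx, fun p => ?_,
    fun h => coordTensor_chartChange h hyx, fun u hu => coordHess_chartChange g hu hyx⟩
  refine Eq.trans ?_ (form_frame ((p : Rn n →L[ℝ] ℝ).comp (chartDeriv
    ((extChartAt (𝓡∂ n) c).symm y) (chartChange c ((extChartAt (𝓡∂ n) c).symm y) y) :
      Rn n →L[ℝ] Rn n)) fun i =>
    fderivWithin ℝ (chartChange c ((extChartAt (𝓡∂ n) c).symm y)) (range (𝓡∂ n)) y (stdVec i))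
  funext i
  exact congrArg (p : Rn n →L[ℝ] ℝ) (chartDeriv_chartChange hyx _)

end Christoffel

end HessianEq

/-! ### Eigenvalues and norms in an orthonormal frame -/

namespace HessianEq

set_option maxSynthPendingDepth 3

open Filter Topology

section Frames

variable {n : ℕ} [NeZero n] {G A X H R W : Matrix (Fin n) (Fin n) ℝ}

/-- The matrix `θ` with `(tr θ) g - θ = χ`, where `g`, `χ` have matrices `G`, `X`. -/
noncomputable def thetaMat (G X : Matrix (Fin n) (Fin n) ℝ) : Matrix (Fin n) (Fin n) ℝ :=
  ((G⁻¹ * X).trace / (n - 1)) • G - X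

lemma inv_mul_eta (hn : 2 ≤ n) (hG : IsUnit G.det) :
    G⁻¹ * ((G⁻¹ * H).trace • G - H + X) = traceSub G (H + thetaMat G X) := by
  have hn' : (n : ℝ) - 1 ≠ 0 := by
    have : (2 : ℝ) ≤ n := by exact_mod_cast hn
    linarith
  have h1 : (G⁻¹ * (H + thetaMat G X)) =
      G⁻¹ * H + (((G⁻¹ * X).trace / (n - 1)) • 1 - G⁻¹ * X) := by
    rw [thetaMat, Matrix.mul_add, Matrix.mul_sub, Matrix.mul_smul, Matrix.nonsing_inv_mul _ hG]
  have h2 : (G⁻¹ * H + (((G⁻¹ * X).trace / (n - 1)) • 1 - G⁻¹ * X)).trace =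
      (G⁻¹ * H).trace + (G⁻¹ * X).trace / (n - 1) := by
    simp only [Matrix.trace_add, Matrix.trace_sub, Matrix.trace_smul, Matrix.trace_one,
      Fintype.card_fin, smul_eq_mul]
    field_simp
    ring
  rw [traceSub, h1, h2, Matrix.mul_add, Matrix.mul_sub, Matrix.mul_smul,
    Matrix.nonsing_inv_mul _ hG]
  module

lemma thetaMat_frame (hR : IsUnit R.det) :
    thetaMat (Rᵀ * G * R) (Rᵀ * X * R) = Rᵀ * thetaMat G X * R := by
  rw [thetaMat, thetaMat, trace_inv_mul_frame hR, Matrix.mul_sub, Matrix.sub_mul, Matrix.mul_smul,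
    Matrix.smul_mul]

lemma charpoly_traceSub_frame (hR : IsUnit R.det) :
    (traceSub (Rᵀ * G * R) (Rᵀ * W * R)).charpoly = (traceSub G W).charpoly := by
  rw [traceSub_frame hR, charpoly_inv_conj hR]

lemma esymm_roots_charpoly (hG : G.PosDef) (hW : W.IsHermitian) {j : ℕ} (hj : j ≤ n) :
    (traceSub G W).charpoly.roots.esymm j = minorSum j (traceSub G W) := by
  obtain ⟨P, w, hP, h1, h2⟩ := exists_frame hG hW
  rw [← charpoly_traceSub_frame hP, ← minorSum_traceSub_frame hP hj, h1, h2,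
    traceSub_one_diagonal, minorSum_diagonal, Matrix.charpoly_diagonal]
  have h3 : (∏ i, (Polynomial.X - Polynomial.C (etaOf w i))).roots =
      Finset.univ.val.map (etaOf w) := by
    rw [← Polynomial.roots_multiset_prod_X_sub_C (Finset.univ.val.map (etaOf w)),
      Multiset.map_map]
    rfl
  rw [h3, Finset.esymm_map_val]
  rfl

lemma inv_eq_of_frame (h : Rᵀ * G * R = 1) : G⁻¹ = R * Rᵀ := by
  refine Matrix.inv_eq_right_inv ?_
  have h1 : R * (Rᵀ * G) = 1 := mul_eq_one_comm.1 h
  rw [← mul_eq_one_comm, Matrix.mul_assoc, h1]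

/-- The squared norm of a `(0,2)`-tensor is the sum of the squares of its components in an
orthonormal frame. -/
lemma sum_inv_mul_inv_eq (h : Rᵀ * G * R = 1) :
    ∑ i, ∑ j, ∑ k, ∑ l, G⁻¹ i k * G⁻¹ j l * A i j * A k l = ∑ i, ∑ j, ((Rᵀ * A * R) i j) ^ 2 := by
  have e1 : ∑ i, ∑ j, ((Rᵀ * A * R) i j) ^ 2 = ((Rᵀ * A * R)ᵀ * (Rᵀ * A * R)).trace := by
    rw [Finset.sum_comm]
    simp only [Matrix.trace, Matrix.diag_apply, Matrix.mul_apply (M := (Rᵀ * A * R)ᵀ),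
      Matrix.transpose_apply, sq]
  have e2 : ((Rᵀ * A * R)ᵀ * (Rᵀ * A * R)).trace = (Aᵀ * G⁻¹ * A * G⁻¹).trace := by
    rw [inv_eq_of_frame h, Matrix.transpose_mul, Matrix.transpose_mul, Matrix.transpose_transpose]
    calc (Rᵀ * (Aᵀ * R) * (Rᵀ * A * R)).trace = (Rᵀ * (Aᵀ * (R * Rᵀ) * A * R)).trace := by
          simp only [Matrix.mul_assoc]
      _ = _ := by rw [Matrix.trace_mul_comm]; simp only [Matrix.mul_assoc]
  have hs : ∀ l j, G⁻¹ l j = G⁻¹ j l := by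
    intro l j
    rw [inv_eq_of_frame h]
    simp [Matrix.mul_apply, mul_comm]
  rw [e1, e2]
  simp only [Matrix.trace, Matrix.diag_apply, Matrix.mul_apply, Matrix.transpose_apply,
    Finset.sum_mul]
  rw [Finset.sum_comm]
  refine Finset.sum_congr rfl fun j _ => ?_
  have h1 : ∀ k, ∑ i, ∑ l, G⁻¹ i k * G⁻¹ j l * A i j * A k l =
      ∑ l, ∑ i, A i j * G⁻¹ i k * A k l * G⁻¹ l j := by
    intro k
    rw [Finset.sum_comm]
    refine Finset.sum_congr rfl fun l _ => Finset.sum_congr rfl fun i _ => ?_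
    rw [hs l j]
    ring
  rw [Finset.sum_comm, Finset.sum_congr rfl fun k _ => h1 k, Finset.sum_comm]

/-- A frame which is orthonormal for a scalar product and diagonalizes a symmetric form. -/
lemma exists_orthonormal_frame {g B : Rn n →L[ℝ] Rn n →L[ℝ] ℝ} (hg : ∀ v w, g v w = g w v)
    (hpos : ∀ v, v ≠ 0 → 0 < g v v) (hB : ∀ v w, B v w = B w v) :
    ∃ (e : Fin n → Rn n) (w : Fin n → ℝ), IsUnit (frameMat e).det ∧
      (frameMat e)ᵀ * bilMat g * frameMat e = 1 ∧
      (frameMat e)ᵀ * bilMat B * frameMat e = Matrix.diagonal w := by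
  have hW : (bilMat B).IsHermitian := by
    ext i j
    simp [bilMat, hB (stdVec i) (stdVec j)]
  obtain ⟨P, w, hP, h1, h2⟩ := exists_frame (posDef_bilMat hg hpos) hW
  have hPe : frameMat (fun i => WithLp.toLp 2 fun l => P l i : Fin n → Rn n) = P := by
    ext l i; rfl
  exact ⟨fun i => WithLp.toLp 2 fun l => P l i, w, by rwa [hPe], by rwa [hPe], by rwa [hPe]⟩

lemma frame_apply {B : Rn n →L[ℝ] Rn n →L[ℝ] ℝ} {e : Fin n → Rn n}
    {N : Matrix (Fin n) (Fin n) ℝ} (h : (frameMat e)ᵀ * bilMat B * frameMat e = N) (i j : Fin n) :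
    B (e i) (e j) = N i j := by
  rw [← h, ← bilMat_frame]
  rfl

end Frames

section Pointwise

variable {n : ℕ} [NeZero n]
  {M : Type*} [TopologicalSpace M] [ChartedSpace (EuclideanHalfSpace n) M]
  [IsManifold (𝓡∂ n) ∞ M]

/-- The tensor field `θ` with `(tr θ) g - θ = χ`, in the chart centred at `c`. -/
noncomputable def thetaForm (g : Metric n M) (χ : TwoTensor n M) (c : M) (y : Rn n) :
    Rn n →L[ℝ] Rn n →L[ℝ] ℝ :=
  (((coordMetric g c y)⁻¹ * coordTensor χ c y).trace / (n - 1)) • metricForm g c y -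
    coordForm χ c y

lemma bilMat_add (A B : Rn n →L[ℝ] Rn n →L[ℝ] ℝ) : bilMat (A + B) = bilMat A + bilMat B := rfl

lemma bilMat_thetaForm (g : Metric n M) (χ : TwoTensor n M) (c : M) (y : Rn n) :
    bilMat (thetaForm g χ c y) = thetaMat (coordMetric g c y) (coordTensor χ c y) := rfl

lemma thetaForm_symm (g : Metric n M) {χ : TwoTensor n M} (hχ : SymmTensor χ) (c : M)
    (y v w : Rn n) : thetaForm g χ c y v w = thetaForm g χ c y w v := by
  simp only [thetaForm, sub_apply, smul_apply, metricForm_symm g c y v w,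
    coordForm_symm hχ c y v w]

/-- The tensor `W = ∇²u + θ` in the chart centred at `c`; it satisfies
`(tr W) g - W = Δu g - ∇²u + χ`. -/
noncomputable def wForm (g : Metric n M) (χ : TwoTensor n M) (u : M → ℝ) (c : M) (y : Rn n) :
    Rn n →L[ℝ] Rn n →L[ℝ] ℝ :=
  hessianForm g u c y + thetaForm g χ c y

lemma thetaForm_chartChange (g : Metric n M) (χ : TwoTensor n M) {c c' : M} {y : Rn n}
    (hy : y ∈ chartOverlap c c') (v w : Rn n) :
    thetaForm g χ c y v w = thetaForm g χ c' (chartChange c c' y)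
      (fderivWithin ℝ (chartChange c c') (range (𝓡∂ n)) y v)
      (fderivWithin ℝ (chartChange c c') (range (𝓡∂ n)) y w) := by
  have h1 : ((coordMetric g c y)⁻¹ * coordTensor χ c y).trace =
      ((coordMetric g c' (chartChange c c' y))⁻¹ * coordTensor χ c' (chartChange c c' y)).trace := by
    rw [coordMetric, coordMetric, coordTensor_chartChange _ hy, coordTensor_chartChange χ hy,
      trace_inv_mul_frame (isUnit_det_chartJac g hy)]
  simp only [thetaForm, sub_apply, smul_apply, h1]
  rw [coordForm_chartChange _ hy, coordForm_chartChange χ hy]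

variable {g : Metric n M} {χ : TwoTensor n M} {u : M → ℝ} {c : M} {y : Rn n}

lemma wForm_apply (v w : Rn n) :
    wForm g χ u c y v w = hessianForm g u c y v w + thetaForm g χ c y v w := rfl

lemma wForm_chartChange (hu : ContMDiff (𝓡∂ n) 𝓘(ℝ, ℝ) 2 u) {c' : M}
    (hy : y ∈ chartOverlap c c') (v w : Rn n) :
    wForm g χ u c y v w = wForm g χ u c' (chartChange c c' y)
      (fderivWithin ℝ (chartChange c c') (range (𝓡∂ n)) y v)
      (fderivWithin ℝ (chartChange c c') (range (𝓡∂ n)) y w) := by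
  rw [wForm_apply, wForm_apply, hessianForm_chartChange g hu hy, thetaForm_chartChange g χ hy]

lemma hessianForm_symm (g : Metric n M) (hu : ContMDiff (𝓡∂ n) 𝓘(ℝ, ℝ) 2 u)
    (hy : y ∈ (extChartAt (𝓡∂ n) c).target) (v w : Rn n) :
    hessianForm g u c y v w = hessianForm g u c y w v := by
  rw [hessianForm_apply, hessianForm_apply, christoffelForm_symm g hy v w,
    ((contDiffWithinAt_coordFun hu c hy).1.isSymmSndFDerivWithinAt (by simp)
      (𝓡∂ n).uniqueDiffOn ((𝓡∂ n).range_subset_closure_interior (target_subset c hy))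
      (target_subset c hy)).eq v w]

lemma wForm_symm (hχ : SymmTensor χ) (hu : ContMDiff (𝓡∂ n) 𝓘(ℝ, ℝ) 2 u)
    (hy : y ∈ (extChartAt (𝓡∂ n) c).target) (v w : Rn n) :
    wForm g χ u c y v w = wForm g χ u c y w v := by
  rw [wForm_apply, wForm_apply, hessianForm_symm g hu hy, thetaForm_symm g hχ]

lemma bilMat_wForm (hu : ContMDiff (𝓡∂ n) 𝓘(ℝ, ℝ) 2 u)
    (hy : y ∈ (extChartAt (𝓡∂ n) c).target) : bilMat (wForm g χ u c y) =
      coordHess g u c y + thetaMat (coordMetric g c y) (coordTensor χ c y) := by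
  rw [wForm, bilMat_add, bilMat_hessianForm g hu hy, bilMat_thetaForm]

lemma esymm_eigenvals (hn : 2 ≤ n) (hχ : SymmTensor χ) (hu : ContMDiff (𝓡∂ n) 𝓘(ℝ, ℝ) 2 u)
    (hy : y ∈ (extChartAt (𝓡∂ n) c).target) {j : ℕ} (hj : j ≤ n) :
    (eigenvals g ((extChartAt (𝓡∂ n) c).symm y)
      (etaTensor g χ u ((extChartAt (𝓡∂ n) c).symm y))).esymm j =
      minorSum j (traceSub (bilMat (metricForm g c y)) (bilMat (wForm g χ u c y))) := by
  obtain ⟨P, hP, -, hT, hH⟩ := exists_chart_frame g hy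
  have hG : coordMetric g c y = Pᵀ * gram g ((extChartAt (𝓡∂ n) c).symm y) * P := hT _
  have hGpos := posDef_coordMetric g hy
  have hGx : IsUnit (gram g ((extChartAt (𝓡∂ n) c).symm y)).det := by
    have h1 := hGpos.det_pos
    rw [hG, Matrix.det_mul, Matrix.det_mul] at h1
    exact (right_ne_zero_of_mul (left_ne_zero_of_mul h1.ne')).isUnit
  have hW : (bilMat (wForm g χ u c y)).IsHermitian := by
    ext a b
    simp [bilMat, wForm_symm hχ hu hy (stdVec a) (stdVec b)]
  change _ = minorSum j (traceSub (coordMetric g c y) _)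
  rw [← esymm_roots_charpoly hGpos hW hj, bilMat_wForm hu hy, hT χ, hH u hu]
  rw [hG, thetaMat_frame hP, ← Matrix.add_mul, ← Matrix.mul_add, charpoly_traceSub_frame hP,
    ← inv_mul_eta hn hGx]
  rfl

lemma frame_gram {e : Fin n → Rn n} {P : Matrix (Fin n) (Fin n) ℝ} {A B : Matrix (Fin n) (Fin n) ℝ}
    (h : A = Pᵀ * B * P) : (frameMat e)ᵀ * A * frameMat e =
      (P * frameMat e)ᵀ * B * (P * frameMat e) := by
  rw [h, Matrix.transpose_mul]
  simp only [Matrix.mul_assoc]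

lemma tensorNorm_hess (hu : ContMDiff (𝓡∂ n) 𝓘(ℝ, ℝ) 2 u)
    (hy : y ∈ (extChartAt (𝓡∂ n) c).target) {e : Fin n → Rn n}
    (he : (frameMat e)ᵀ * bilMat (metricForm g c y) * frameMat e = 1) :
    tensorNorm g ((extChartAt (𝓡∂ n) c).symm y) (hess g u ((extChartAt (𝓡∂ n) c).symm y)) =
      Real.sqrt (∑ i, ∑ j, (hessianForm g u c y (e i) (e j)) ^ 2) := by
  obtain ⟨P, hP, -, hT, hH⟩ := exists_chart_frame g hy
  have hG : bilMat (metricForm g c y) = Pᵀ * gram g ((extChartAt (𝓡∂ n) c).symm y) * P := hT _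
  rw [frame_gram hG] at he
  rw [tensorNorm, sum_inv_mul_inv_eq he]
  have h1 : ∀ i j, hessianForm g u c y (e i) (e j) =
      ((P * frameMat e)ᵀ * hess g u ((extChartAt (𝓡∂ n) c).symm y) * (P * frameMat e)) i j :=
    fun i j => frame_apply (by rw [bilMat_hessianForm g hu hy, frame_gram (hH u hu)]) i j
  simp only [h1]

lemma covecNorm_eq (hy : y ∈ (extChartAt (𝓡∂ n) c).target)
    (p : Cotan n ((extChartAt (𝓡∂ n) c).symm y)) (q : Rn n →L[ℝ] ℝ)
    (hpq : ∀ v, q v = p (chartDeriv c y v)) :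
    covecNorm g ((extChartAt (𝓡∂ n) c).symm y) p = Real.sqrt (covecSq (metricForm g c y) q) := by
  obtain ⟨P, hP, hp, hT, -⟩ := exists_chart_frame g hy
  have hG : bilMat (metricForm g c y) = Pᵀ * gram g ((extChartAt (𝓡∂ n) c).symm y) * P := hT _
  have h1 : (fun i => q (stdVec i)) = _ := (funext fun i => hpq (stdVec i)).trans (hp p)
  rw [covecSq, h1, hG, dotProduct_inv_frame hP, covecNorm]
  congr 1
  simp only [dotProduct, Matrix.mulVec, Finset.mul_sum]
  exact Finset.sum_congr rfl fun i _ => Finset.sum_congr rfl fun j _ => by ring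

lemma covecNorm_grad (hu : MDifferentiable (𝓡∂ n) 𝓘(ℝ, ℝ) u)
    (hy : y ∈ (extChartAt (𝓡∂ n) c).target) :
    covecNorm g ((extChartAt (𝓡∂ n) c).symm y) (grad u ((extChartAt (𝓡∂ n) c).symm y)) =
      Real.sqrt (covecSq (metricForm g c y) (fderivWithin ℝ (coordFun u c) (range (𝓡∂ n)) y)) :=
  covecNorm_eq hy _ _ fun v => (grad_chartDeriv hu hy v).symm

end Pointwise

end HessianEq

/-! ### Smoothness of the data in charts -/

namespace HessianEq

set_option maxSynthPendingDepth 3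

open Filter Topology

section MatrixSmooth

variable {E : Type*} [NormedAddCommGroup E] [NormedSpace ℝ E] {S : Set E} {y : E}
  {ι : Type*} [Fintype ι] [DecidableEq ι] {m : WithTop ℕ∞} {N : E → Matrix ι ι ℝ}

lemma contDiffWithinAt_det (h : ∀ i j, ContDiffWithinAt ℝ m (fun z => N z i j) S y) :
    ContDiffWithinAt ℝ m (fun z => (N z).det) S y := by
  simp only [Matrix.det_apply']
  exact ContDiffWithinAt.sum fun σ _ =>
    contDiffWithinAt_const.mul (contDiffWithinAt_prod fun i _ => h _ _)

lemma contDiffWithinAt_inv_apply (h : ∀ i j, ContDiffWithinAt ℝ m (fun z => N z i j) S y)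
    (hdet : (N y).det ≠ 0) (i j : ι) : ContDiffWithinAt ℝ m (fun z => (N z)⁻¹ i j) S y := by
  simp only [Matrix.inv_def, Matrix.smul_apply, Ring.inverse_eq_inv', smul_eq_mul,
    Matrix.adjugate_apply]
  refine ((contDiffWithinAt_det h).inv hdet).mul (contDiffWithinAt_det fun a b => ?_)
  rcases eq_or_ne a j with rfl | hne
  · simp only [Matrix.updateRow_self]
    exact contDiffWithinAt_const
  · simp only [Matrix.updateRow_ne hne]
    exact h a b

end MatrixSmooth

section ChartSmooth

variable {n : ℕ} [NeZero n]
  {M : Type*} [TopologicalSpace M] [ChartedSpace (EuclideanHalfSpace n) M]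
  [IsManifold (𝓡∂ n) ∞ M] {g : Metric n M} {χ : TwoTensor n M} {c : M} {y : Rn n}

lemma contDiffWithinAt_coordForm {h : TwoTensor n M} (hh : SmoothTensor h)
    (hy : y ∈ (extChartAt (𝓡∂ n) c).target) :
    ContDiffWithinAt ℝ ∞ (coordForm h c) (range (𝓡∂ n)) y :=
  (contDiffOn_coordForm hh c y hy).mono_of_mem_nhdsWithin (target_mem hy)

lemma contDiffWithinAt_coordTensor {h : TwoTensor n M} (hh : SmoothTensor h)
    (hy : y ∈ (extChartAt (𝓡∂ n) c).target) (i j : Fin n) :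
    ContDiffWithinAt ℝ ∞ (fun z => coordTensor h c z i j) (range (𝓡∂ n)) y :=
  ((contDiffWithinAt_coordForm hh hy).clm_apply contDiffWithinAt_const).clm_apply
    contDiffWithinAt_const

lemma contDiffWithinAt_inv_coordMetric (hy : y ∈ (extChartAt (𝓡∂ n) c).target) (i j : Fin n) :
    ContDiffWithinAt ℝ ∞ (fun z => (coordMetric g c z)⁻¹ i j) (range (𝓡∂ n)) y :=
  contDiffWithinAt_inv_apply (fun a b => contDiffWithinAt_coordTensor g.contMDiff hy a b)
    (posDef_coordMetric g hy).det_pos.ne' i j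

lemma contDiffWithinAt_pd_coordMetric (hy : y ∈ (extChartAt (𝓡∂ n) c).target) (m i j : Fin n) :
    ContDiffWithinAt ℝ 2 (pd m (fun z => coordMetric g c z i j)) (range (𝓡∂ n)) y := by
  have h1 := (contDiffWithinAt_coordTensor g.contMDiff hy i j).fderivWithin_right
    (m := 2) (𝓡∂ n).uniqueDiffOn (by norm_cast) (target_subset c hy)
  exact h1.clm_apply contDiffWithinAt_const

lemma contDiffWithinAt_christoffel (hy : y ∈ (extChartAt (𝓡∂ n) c).target) (l i j : Fin n) :
    ContDiffWithinAt ℝ 2 (fun z => christoffel g c z l i j) (range (𝓡∂ n)) y := by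
  unfold christoffel
  exact contDiffWithinAt_const.mul (ContDiffWithinAt.sum fun m _ =>
    ((contDiffWithinAt_inv_coordMetric hy l m).of_le (by norm_cast)).mul
      (((contDiffWithinAt_pd_coordMetric hy i j m).add
        (contDiffWithinAt_pd_coordMetric hy j i m)).sub (contDiffWithinAt_pd_coordMetric hy m i j)))

lemma contDiffWithinAt_christoffelForm (hy : y ∈ (extChartAt (𝓡∂ n) c).target) :
    ContDiffWithinAt ℝ 2 (christoffelForm g c) (range (𝓡∂ n)) y := by
  unfold christoffelForm
  exact ContDiffWithinAt.sum fun i _ => ContDiffWithinAt.sum fun j _ =>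
    ContDiffWithinAt.sum fun l _ => (contDiffWithinAt_christoffel hy l i j).smul
      contDiffWithinAt_const

lemma contDiffWithinAt_thetaForm (hχ : SmoothTensor χ)
    (hy : y ∈ (extChartAt (𝓡∂ n) c).target) :
    ContDiffWithinAt ℝ ∞ (thetaForm g χ c) (range (𝓡∂ n)) y := by
  unfold thetaForm
  have h : ContDiffWithinAt ℝ ∞ (fun z => ((coordMetric g c z)⁻¹ * coordTensor χ c z).trace /
      ((n : ℝ) - 1)) (range (𝓡∂ n)) y := ?_
  · exact (h.smul (contDiffWithinAt_metricForm g hy)).sub (contDiffWithinAt_coordForm hχ hy)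
  simp only [Matrix.trace, Matrix.diag_apply, Matrix.mul_apply]
  exact ContDiffWithinAt.div_const (ContDiffWithinAt.sum fun i _ => ContDiffWithinAt.sum fun j _ =>
    (contDiffWithinAt_inv_coordMetric hy i j).mul (contDiffWithinAt_coordTensor hχ hy j i)) _

lemma range_mem_nhds (hi : y ∈ interior (range (𝓡∂ n))) : range (𝓡∂ n) ∈ 𝓝 y :=
  mem_interior_iff_mem_nhds.1 hi

lemma target_mem_nhds (hy : y ∈ (extChartAt (𝓡∂ n) c).target) (hi : y ∈ interior (range (𝓡∂ n))) :
    (extChartAt (𝓡∂ n) c).target ∈ 𝓝 y := by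
  rw [← nhdsWithin_eq_nhds.2 (range_mem_nhds hi)]
  exact target_mem hy

lemma symm_mem_interior (hy : y ∈ (extChartAt (𝓡∂ n) c).target)
    (hi : y ∈ interior (range (𝓡∂ n))) :
    (extChartAt (𝓡∂ n) c).symm y ∈ (𝓡∂ n).interior M := by
  refine ((𝓡∂ n).isInteriorPoint_iff_of_mem_atlas (n := ∞) (by simp)
    (chart_mem_atlas _ c) (symm_mem_source hy)).2 ?_
  change extChartAt (𝓡∂ n) c ((extChartAt (𝓡∂ n) c).symm y) ∈
    interior (extChartAt (𝓡∂ n) c).target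
  rw [(extChartAt (𝓡∂ n) c).right_inv hy]
  exact mem_interior_iff_mem_nhds.2 (target_mem_nhds hy hi)

lemma mem_interior_of_symm_mem_interior (hy : y ∈ (extChartAt (𝓡∂ n) c).target)
    (hi : (extChartAt (𝓡∂ n) c).symm y ∈ (𝓡∂ n).interior M) : y ∈ interior (range (𝓡∂ n)) := by
  have h1 := ((𝓡∂ n).isInteriorPoint_iff_of_mem_atlas (n := ∞) (by simp)
    (chart_mem_atlas _ c) (symm_mem_source hy)).1 hi
  change extChartAt (𝓡∂ n) c ((extChartAt (𝓡∂ n) c).symm y) ∈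
    interior (extChartAt (𝓡∂ n) c).target at h1
  rw [(extChartAt (𝓡∂ n) c).right_inv hy] at h1
  exact interior_mono (target_subset c) h1

lemma contDiffAt_coordFun {u : M → ℝ} {m : WithTop ℕ∞} (hm : m ≤ ∞)
    (hu : ContMDiffOn (𝓡∂ n) 𝓘(ℝ, ℝ) m u ((𝓡∂ n).interior M))
    (hy : y ∈ (extChartAt (𝓡∂ n) c).target) (hi : y ∈ interior (range (𝓡∂ n))) :
    ContDiffAt ℝ m (coordFun u c) y := by
  have := isManifold_of_le (n := n) (M := M) m hm
  have h1 : ContMDiffOn 𝓘(ℝ, Rn n) 𝓘(ℝ, ℝ) m (coordFun u c)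
      ((extChartAt (𝓡∂ n) c).target ∩ interior (range (𝓡∂ n))) :=
    hu.comp ((contMDiffOn_extChartAt_symm c).mono inter_subset_left)
      fun z hz => symm_mem_interior hz.1 hz.2
  exact (contMDiffOn_iff_contDiffOn.1 h1).contDiffAt
    (inter_mem (target_mem_nhds hy hi) (isOpen_interior.mem_nhds hi))

/-- The inverse of the trivialization of the cotangent bundle over the chart centred at `c`. -/
lemma trivializationAt_symm_eq (hy : y ∈ (extChartAt (𝓡∂ n) c).target) (q : Rn n →L[ℝ] ℝ) :
    (trivializationAt (Rn n →L[ℝ] ℝ) (fun x : M => Cotan n x) c).toOpenPartialHomeomorph.symm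
      ((extChartAt (𝓡∂ n) c).symm y, q) =
      TotalSpace.mk' (Rn n →L[ℝ] ℝ) ((extChartAt (𝓡∂ n) c).symm y) (coordCovec c y q) := by
  have h1 := TangentBundle.continuousLinearMapAt_trivializationAt (I := 𝓡∂ n) (x₀ := c)
    (symm_mem_source hy)
  have h2 : (trivializationAt (Rn n →L[ℝ] ℝ) (fun x : M => Cotan n x) c).toOpenPartialHomeomorph.symm
      ((extChartAt (𝓡∂ n) c).symm y, q) =
      TotalSpace.mk' (Rn n →L[ℝ] ℝ) ((extChartAt (𝓡∂ n) c).symm y)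
        (((trivializationAt ℝ (Bundle.Trivial M ℝ) c).symmL ℝ ((extChartAt (𝓡∂ n) c).symm y)).comp
          (q.comp ((trivializationAt (Rn n) (TangentSpace (𝓡∂ n)) c).continuousLinearMapAt ℝ
            ((extChartAt (𝓡∂ n) c).symm y)))) := rfl
  rw [h2, h1]
  congr 1
  ext v
  have h3 : (trivializationAt ℝ (Bundle.Trivial M ℝ) c).symmL ℝ
      ((extChartAt (𝓡∂ n) c).symm y) = ContinuousLinearMap.id ℝ ℝ :=
    Trivial.symmL_trivialization _ _ _ _
  rw [h3]
  rfl

lemma contDiffAt_coordRHS {f : ∀ x : M, ℝ → Cotan n x → ℝ} (hf : SmoothRHS f)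
    (hy : y ∈ (extChartAt (𝓡∂ n) c).target) (hi : y ∈ interior (range (𝓡∂ n))) (z : ℝ)
    (q : Rn n →L[ℝ] ℝ) : ContDiffAt ℝ ∞ (coordRHS f c) (y, z, q) := by
  have hs : ContMDiffOn 𝓘(ℝ, Rn n × ℝ × (Rn n →L[ℝ] ℝ)) 𝓘(ℝ, Rn n) ∞
      (fun w : Rn n × ℝ × (Rn n →L[ℝ] ℝ) => w.1) ((extChartAt (𝓡∂ n) c).target ×ˢ univ) :=
    contDiff_fst.contMDiff.contMDiffOn
  have h1 := (contMDiffOn_extChartAt_symm (n := ∞) (I := 𝓡∂ n) c).comp hs fun w hw => hw.1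
  have h2 : ContMDiffOn 𝓘(ℝ, Rn n × ℝ × (Rn n →L[ℝ] ℝ)) 𝓘(ℝ, Rn n →L[ℝ] ℝ) ∞
      (fun w : Rn n × ℝ × (Rn n →L[ℝ] ℝ) => w.2.2) ((extChartAt (𝓡∂ n) c).target ×ˢ univ) :=
    (contDiff_snd.comp contDiff_snd).contMDiff.contMDiffOn
  have h3 : ContMDiffOn 𝓘(ℝ, Rn n × ℝ × (Rn n →L[ℝ] ℝ)) 𝓘(ℝ, ℝ) ∞
      (fun w : Rn n × ℝ × (Rn n →L[ℝ] ℝ) => w.2.1) ((extChartAt (𝓡∂ n) c).target ×ˢ univ) :=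
    (contDiff_fst.comp contDiff_snd).contMDiff.contMDiffOn
  have h4 := (trivializationAt (Rn n →L[ℝ] ℝ) (fun x : M => Cotan n x) c).contMDiffOn_symm
    (n := ∞) (IB := 𝓡∂ n)
  have h5 : ContMDiffOn 𝓘(ℝ, Rn n × ℝ × (Rn n →L[ℝ] ℝ)) ((𝓡∂ n).prod 𝓘(ℝ, Rn n →L[ℝ] ℝ)) ∞
      (fun w : Rn n × ℝ × (Rn n →L[ℝ] ℝ) => TotalSpace.mk' (Rn n →L[ℝ] ℝ)
        (E := fun x : M => Cotan n x) ((extChartAt (𝓡∂ n) c).symm w.1) (coordCovec c w.1 w.2.2))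
      ((extChartAt (𝓡∂ n) c).target ×ˢ univ) := by
    refine (h4.comp (h1.prodMk h2) fun w hw => ?_).congr fun w hw => ?_
    · rw [mem_preimage, Trivialization.mem_target]
      exact ⟨symm_mem_source hw.1, mem_univ _⟩
    · exact (trivializationAt_symm_eq hw.1 _).symm
  have h6 : ContMDiffOn 𝓘(ℝ, Rn n × ℝ × (Rn n →L[ℝ] ℝ)) 𝓘(ℝ, ℝ) ∞ (coordRHS f c)
      ((extChartAt (𝓡∂ n) c).target ×ˢ univ) := hf.comp_contMDiffOn (h5.prodMk h3)
  exact (contMDiffOn_iff_contDiffOn.1 h6).contDiffAt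
    (prod_mem_nhds (target_mem_nhds hy hi) univ_mem)

lemma c2BoundAt_coordRHS {f : ∀ x : M, ℝ → Cotan n x → ℝ} (hf : SmoothRHS f)
    {𝒜 : ChartCover n M} {R K : ℝ} (hK : RHSNormLE 𝒜 g f R K) (hc : c ∈ 𝒜.centers)
    (hp : y ∈ extChartAt (𝓡∂ n) c '' 𝒜.piece c)
    (hy : y ∈ (extChartAt (𝓡∂ n) c).target) (hi : y ∈ interior (range (𝓡∂ n))) {z : ℝ}
    {q : Rn n →L[ℝ] ℝ} (hz : |z| ≤ R)
    (hq : covecNorm g ((extChartAt (𝓡∂ n) c).symm y) (coordCovec c y q) ≤ R) :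
    C2BoundAt (coordRHS f c) (y, z, q) K := by
  have hd := contDiffAt_coordRHS hf hy hi z q
  have hu : UniqueDiffOn ℝ (range (𝓡∂ n) ×ˢ (univ : Set (ℝ × (Rn n →L[ℝ] ℝ)))) :=
    (𝓡∂ n).uniqueDiffOn.prod uniqueDiffOn_univ
  have hmem : (y, z, q) ∈ range (𝓡∂ n) ×ˢ (univ : Set (ℝ × (Rn n →L[ℝ] ℝ))) :=
    ⟨target_subset c hy, mem_univ _⟩
  have key : ∀ m : ℕ, m ≤ 2 → ‖iteratedFDeriv ℝ m (coordRHS f c) (y, z, q)‖ ≤ K := by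
    intro m hm
    have h1 := hK c hc y hp z q hz hq m hm
    rwa [iteratedFDerivWithin_eq_iteratedFDeriv hu (hd.of_le (by norm_cast; exact le_top)) hmem] at h1
  refine ⟨hd.of_le (by norm_cast), ?_, ?_, ?_⟩
  · simpa using key 0 (by norm_num)
  · simpa using key 1 (by norm_num)
  · have := key 2 le_rfl
    rw [← norm_iteratedFDeriv_fderiv] at this
    simpa using this

end ChartSmooth

end HessianEq

/-! ### Uniform bounds on compact sets -/

namespace HessianEq

set_option maxSynthPendingDepth 3

open Filter Topology

section Compactness

variable {E F : Type*} [NormedAddCommGroup E] [NormedSpace ℝ E] [NormedAddCommGroup F]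
  [NormedSpace ℝ F] {K S : Set E}

/-- A family of quadratic forms is dominated on a compact set by a family of positive definite
ones. -/
lemma exists_le_mul_of_homogeneous [FiniteDimensional ℝ F] {A B : E → F → ℝ} (hK : IsCompact K)
    (hA : ContinuousOn (fun w : E × F => A w.1 w.2) (K ×ˢ univ))
    (hB : ContinuousOn (fun w : E × F => B w.1 w.2) (K ×ˢ univ))
    (hAh : ∀ y (t : ℝ) v, A y (t • v) = t ^ 2 * A y v)
    (hBh : ∀ y (t : ℝ) v, B y (t • v) = t ^ 2 * B y v)
    (hpos : ∀ y ∈ K, ∀ v, v ≠ 0 → 0 < B y v) :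
    ∃ L, 1 ≤ L ∧ ∀ y ∈ K, ∀ v, A y v ≤ L * B y v := by
  have := FiniteDimensional.proper ℝ F
  have hne : ∀ v ∈ Metric.sphere (0 : F) 1, v ≠ 0 := fun v hv h => by simp [h] at hv
  have hsub : K ×ˢ Metric.sphere (0 : F) 1 ⊆ K ×ˢ univ := prod_mono_right (subset_univ _)
  obtain ⟨L, hL⟩ := (hK.prod (isCompact_sphere (0 : F) 1)).exists_bound_of_continuousOn
    ((hA.mono hsub).div (hB.mono hsub) fun w hw => (hpos _ hw.1 _ (hne _ hw.2)).ne')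
  refine ⟨max 1 L, le_max_left _ _, fun y hy v => ?_⟩
  rcases eq_or_ne v 0 with rfl | hv
  · have h1 := hAh y 0 0
    have h2 := hBh y 0 0
    simp only [smul_zero, ne_eq, OfNat.ofNat_ne_zero, not_false_eq_true, zero_pow, zero_mul] at h1 h2
    rw [h1, h2, mul_zero]
  · have hn : 0 < ‖v‖ := norm_pos_iff.2 hv
    have hs : ‖v‖⁻¹ • v ∈ Metric.sphere (0 : F) 1 := by
      simp [norm_smul, hn.ne']
    have hv' : v = ‖v‖ • (‖v‖⁻¹ • v) := by rw [smul_smul, mul_inv_cancel₀ hn.ne', one_smul]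
    have hp := hpos y hy _ (hne _ hs)
    have h1 : A y (‖v‖⁻¹ • v) ≤ L * B y (‖v‖⁻¹ • v) :=
      (div_le_iff₀ hp).1 ((le_abs_self _).trans (hL (y, _) ⟨hy, hs⟩))
    have h2 := h1.trans (mul_le_mul_of_nonneg_right (le_max_right 1 L) hp.le)
    rw [hv', hAh, hBh]
    calc _ ≤ ‖v‖ ^ 2 * (max 1 L * B y (‖v‖⁻¹ • v)) := by gcongr
      _ = _ := by ring

lemma C2BoundAt.mono {Φ : E → F} {y : E} {L L' : ℝ} (h : C2BoundAt Φ y L) (hL : L ≤ L') :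
    C2BoundAt Φ y L' :=
  ⟨h.1, h.2.trans hL, h.3.trans hL, h.4.trans hL⟩

lemma fderivWithin_eventuallyEq {Φ : E → F} {y : E} (hi : y ∈ interior S) :
    fderivWithin ℝ Φ S =ᶠ[𝓝 y] fderiv ℝ Φ := by
  filter_upwards [isOpen_interior.mem_nhds hi] with z hz
  exact fderivWithin_of_mem_nhds (mem_interior_iff_mem_nhds.1 hz)

lemma fderivWithin_fderivWithin_eq {Φ : E → F} {y : E} (hi : y ∈ interior S) :
    fderivWithin ℝ (fderivWithin ℝ Φ S) S y = fderiv ℝ (fderiv ℝ Φ) y := by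
  rw [fderivWithin_of_mem_nhds (mem_interior_iff_mem_nhds.1 hi),
    (fderivWithin_eventuallyEq hi).fderiv_eq]

lemma exists_c2Bound (hS : UniqueDiffOn ℝ S) (hK : IsCompact K) (hKS : K ⊆ S) {Φ : E → F}
    (hΦ : ∀ y ∈ K, ContDiffWithinAt ℝ 2 Φ S y) :
    ∃ L, 1 ≤ L ∧ ∀ y ∈ K, ‖Φ y‖ ≤ L ∧ (y ∈ interior S → C2BoundAt Φ y L) := by
  have h1 : ∀ y ∈ K, ContDiffWithinAt ℝ 1 (fderivWithin ℝ Φ S) S y := fun y hy =>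
    (hΦ y hy).fderivWithin_right hS (by norm_num) (hKS hy)
  have h2 : ∀ y ∈ K, ContDiffWithinAt ℝ 0 (fderivWithin ℝ (fderivWithin ℝ Φ S) S) S y :=
    fun y hy => (h1 y hy).fderivWithin_right hS (by norm_num) (hKS hy)
  obtain ⟨L₀, hL₀⟩ := hK.exists_bound_of_continuousOn fun y hy =>
    (hΦ y hy).continuousWithinAt.mono hKS
  obtain ⟨L₁, hL₁⟩ := hK.exists_bound_of_continuousOn fun y hy =>
    (h1 y hy).continuousWithinAt.mono hKS
  obtain ⟨L₂, hL₂⟩ := hK.exists_bound_of_continuousOn fun y hy =>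
    (h2 y hy).continuousWithinAt.mono hKS
  refine ⟨max 1 (max L₀ (max L₁ L₂)), le_max_left _ _, fun y hy => ⟨?_, fun hi => ⟨?_, ?_, ?_, ?_⟩⟩⟩
  · exact (hL₀ y hy).trans (by simp)
  · exact (hΦ y hy).contDiffAt (mem_interior_iff_mem_nhds.1 hi)
  · exact (hL₀ y hy).trans (by simp)
  · rw [← fderivWithin_of_mem_nhds (mem_interior_iff_mem_nhds.1 hi)]
    exact (hL₁ y hy).trans (by simp)
  · rw [← fderivWithin_fderivWithin_eq hi]
    exact (hL₂ y hy).trans (by simp)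

end Compactness

section Covectors

variable {n : ℕ} [NeZero n] {g : Rn n →L[ℝ] Rn n →L[ℝ] ℝ}

lemma covecSq_eq_sum_sq {e : Fin n → Rn n} (he : (frameMat e)ᵀ * bilMat g * frameMat e = 1)
    (p : Rn n →L[ℝ] ℝ) : covecSq g p = ∑ i, p (e i) ^ 2 := by
  have h1 := form_frame p e
  rw [covecSq, inv_eq_of_frame he, ← Matrix.mulVec_mulVec, ← h1, Matrix.dotProduct_mulVec,
    ← Matrix.mulVec_transpose, ← h1]
  simp [dotProduct, sq]

lemma covecSq_smul (t : ℝ) (p : Rn n →L[ℝ] ℝ) : covecSq g (t • p) = t ^ 2 * covecSq g p := by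
  have h : (fun i => (t • p) (stdVec i)) = t • fun i => p (stdVec i) := rfl
  rw [covecSq, h, Matrix.mulVec_smul, dotProduct_smul, smul_dotProduct, covecSq]
  simp only [smul_eq_mul]
  ring

lemma covecSq_nonneg (hg : ∀ v w, g v w = g w v) (hpos : ∀ v, v ≠ 0 → 0 < g v v)
    (p : Rn n →L[ℝ] ℝ) : 0 ≤ covecSq g p := by
  obtain ⟨e, w, -, he1, -⟩ := exists_orthonormal_frame hg hpos hg
  rw [covecSq_eq_sum_sq he1]
  positivity

lemma covecSq_pos (hg : ∀ v w, g v w = g w v) (hpos : ∀ v, v ≠ 0 → 0 < g v v)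
    {p : Rn n →L[ℝ] ℝ} (hp : p ≠ 0) : 0 < covecSq g p := by
  obtain ⟨e, w, he, he1, -⟩ := exists_orthonormal_frame hg hpos hg
  rw [covecSq_eq_sum_sq he1]
  by_contra! h
  have h0 := (Finset.sum_eq_zero_iff_of_nonneg fun i _ => sq_nonneg (p (e i))).1
    (le_antisymm h (by positivity))
  refine hp (ContinuousLinearMap.ext fun v => ?_)
  obtain ⟨c, rfl⟩ := exists_frame_coords he v
  rw [map_sum, zero_apply]
  refine Finset.sum_eq_zero fun i hi => ?_
  rw [map_smul, pow_eq_zero_iff (two_ne_zero) |>.1 (h0 i hi), smul_zero]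

/-- Values of two forms in a frame which diagonalizes both. -/
lemma forms_frame_coords {B : Rn n →L[ℝ] Rn n →L[ℝ] ℝ} {e : Fin n → Rn n} {w : Fin n → ℝ}
    (h : (frameMat e)ᵀ * bilMat B * frameMat e = Matrix.diagonal w) (c : Fin n → ℝ) :
    B (∑ i, c i • e i) (∑ i, c i • e i) = ∑ i, w i * c i ^ 2 := by
  have h1 := frame_apply h
  simp only [map_sum, map_smul, sum_apply, smul_apply, smul_eq_mul, h1, Matrix.diagonal_apply,
    mul_ite, mul_zero, Finset.sum_ite_eq', Finset.mem_univ, if_true]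
  exact Finset.sum_congr rfl fun i _ => by ring

end Covectors

section ChartBounds

variable {n : ℕ} [NeZero n]
  {M : Type*} [TopologicalSpace M] [ChartedSpace (EuclideanHalfSpace n) M]
  [IsManifold (𝓡∂ n) ∞ M] {g : Metric n M} {χ : TwoTensor n M} {c : M} {K : Set (Rn n)}

lemma continuousOn_of_contDiffWithinAt {F : Type*} [NormedAddCommGroup F] [NormedSpace ℝ F]
    {m : WithTop ℕ∞} {Φ : Rn n → F} (hKT : K ⊆ (extChartAt (𝓡∂ n) c).target)
    (h : ∀ y ∈ K, ContDiffWithinAt ℝ m Φ (range (𝓡∂ n)) y) : ContinuousOn Φ K :=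
  fun y hy => (h y hy).continuousWithinAt.mono (hKT.trans (target_subset c))

lemma continuousOn_metricForm (hKT : K ⊆ (extChartAt (𝓡∂ n) c).target) :
    ContinuousOn (metricForm g c) K :=
  continuousOn_of_contDiffWithinAt hKT fun _ hy => contDiffWithinAt_metricForm g (hKT hy)

lemma continuousOn_wForm {u : M → ℝ} (hχ : SmoothTensor χ) (hu : ContMDiff (𝓡∂ n) 𝓘(ℝ, ℝ) 2 u)
    (hKT : K ⊆ (extChartAt (𝓡∂ n) c).target) : ContinuousOn (wForm g χ u c) K := by
  have h1 : ContinuousOn (fderivWithin ℝ (coordFun u c) (range (𝓡∂ n))) K :=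
    continuousOn_of_contDiffWithinAt hKT fun y hy => (contDiffWithinAt_coordFun hu c (hKT hy)).2
  have h2 : ContinuousOn (fderivWithin ℝ (fderivWithin ℝ (coordFun u c) (range (𝓡∂ n)))
      (range (𝓡∂ n))) K :=
    continuousOn_of_contDiffWithinAt (m := 0) hKT fun y hy =>
      (contDiffWithinAt_coordFun hu c (hKT hy)).2.fderivWithin_right (𝓡∂ n).uniqueDiffOn
        (by norm_num) (target_subset c (hKT hy))
  have h3 : ContinuousOn (christoffelForm g c) K :=
    continuousOn_of_contDiffWithinAt hKT fun y hy => contDiffWithinAt_christoffelForm (hKT hy)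
  have h4 : ContinuousOn (thetaForm g χ c) K :=
    continuousOn_of_contDiffWithinAt hKT fun y hy => contDiffWithinAt_thetaForm hχ (hKT hy)
  have h5 := ((ContinuousLinearMap.compL ℝ (Rn n) (Rn n) ℝ).continuous.comp_continuousOn h1).clm_comp
    h3
  exact (h2.sub h5).add h4

lemma continuousOn_inv_coordMetric (hKT : K ⊆ (extChartAt (𝓡∂ n) c).target) (i j : Fin n) :
    ContinuousOn (fun y => (coordMetric g c y)⁻¹ i j) K :=
  continuousOn_of_contDiffWithinAt hKT fun _ hy => contDiffWithinAt_inv_coordMetric (hKT hy) i j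

lemma continuousOn_form {B : Rn n → Rn n →L[ℝ] Rn n →L[ℝ] ℝ} (hB : ContinuousOn B K) :
    ContinuousOn (fun w : Rn n × Rn n => B w.1 w.2 w.2) (K ×ˢ univ) :=
  ((hB.comp continuousOn_fst fun _ hw => hw.1).clm_apply continuousOn_snd).clm_apply
    continuousOn_snd

lemma continuousOn_covecSq (hKT : K ⊆ (extChartAt (𝓡∂ n) c).target) :
    ContinuousOn (fun w : Rn n × (Rn n →L[ℝ] ℝ) => covecSq (metricForm g c w.1) w.2)
      (K ×ˢ univ) := by
  unfold covecSq dotProduct Matrix.mulVec dotProduct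
  have h1 : ∀ i : Fin n, ContinuousOn (fun w : Rn n × (Rn n →L[ℝ] ℝ) => w.2 (stdVec i))
      (K ×ˢ univ) := fun i => continuousOn_snd.clm_apply continuousOn_const
  exact continuousOn_finsetSum _ fun i _ => (h1 i).mul (continuousOn_finsetSum _ fun j _ =>
    ((continuousOn_inv_coordMetric hKT i j).comp continuousOn_fst fun _ hw => hw.1).mul (h1 j))

/-- The bounds at `y` in the chart centred at `c` which are needed at a maximum point of the test
function: they involve only the metric `g`, the tensor `χ` and the function `us`. -/
structure ChartBound (g : Metric n M) (χ : TwoTensor n M) (us : M → ℝ) (c : M) (y : Rn n)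
    (L : ℝ) : Prop where
  us_bound : y ∈ interior (range (𝓡∂ n)) → C2BoundAt (coordFun us c) y L
  metric_bound : y ∈ interior (range (𝓡∂ n)) → C2BoundAt (metricForm g c) y L
  theta_bound : y ∈ interior (range (𝓡∂ n)) → C2BoundAt (thetaForm g χ c) y L
  christoffel_bound : y ∈ interior (range (𝓡∂ n)) → C2BoundAt (christoffelForm g c) y L
  abs_us_le : |coordFun us c y| ≤ L
  norm_theta_le : ‖thetaForm g χ c y‖ ≤ L
  sq_norm_le : ∀ v, ‖v‖ ^ 2 ≤ L * metricForm g c y v v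
  sq_norm_covec_le : ∀ q, ‖q‖ ^ 2 ≤ L * covecSq (metricForm g c y) q

lemma metricForm_nonneg (g : Metric n M) {y : Rn n} (hy : y ∈ (extChartAt (𝓡∂ n) c).target)
    (v : Rn n) : 0 ≤ metricForm g c y v v := by
  rcases eq_or_ne v 0 with rfl | hv
  · simp
  · exact (metricForm_pos g hy hv).le

lemma ChartBound.mono {us : M → ℝ} {y : Rn n} {L L' : ℝ} (h : ChartBound g χ us c y L)
    (hy : y ∈ (extChartAt (𝓡∂ n) c).target) (hL : L ≤ L') : ChartBound g χ us c y L' where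
  us_bound hi := (h.us_bound hi).mono hL
  metric_bound hi := (h.metric_bound hi).mono hL
  theta_bound hi := (h.theta_bound hi).mono hL
  christoffel_bound hi := (h.christoffel_bound hi).mono hL
  abs_us_le := h.abs_us_le.trans hL
  norm_theta_le := h.norm_theta_le.trans hL
  sq_norm_le v := (h.sq_norm_le v).trans
    (mul_le_mul_of_nonneg_right hL (metricForm_nonneg g hy v))
  sq_norm_covec_le q := (h.sq_norm_covec_le q).trans (mul_le_mul_of_nonneg_right hL
    (covecSq_nonneg (metricForm_symm g c y) (fun _ hv => metricForm_pos g hy hv) q))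

lemma exists_chartBound {us : M → ℝ} (hχ : SmoothTensor χ)
    (hus : ContMDiff (𝓡∂ n) 𝓘(ℝ, ℝ) 2 us) (hK : IsCompact K)
    (hKT : K ⊆ (extChartAt (𝓡∂ n) c).target) :
    ∃ L, 1 ≤ L ∧ ∀ y ∈ K, ChartBound g χ us c y L := by
  have hKS := hKT.trans (target_subset c)
  have hS := (𝓡∂ n).uniqueDiffOn
  obtain ⟨L₁, h1, hL₁⟩ := exists_c2Bound hS hK hKS fun y hy =>
    (contDiffWithinAt_coordFun hus c (hKT hy)).1
  obtain ⟨L₂, h2, hL₂⟩ := exists_c2Bound hS hK hKS fun y hy =>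
    (contDiffWithinAt_metricForm g (hKT hy)).of_le (m := 2) (by norm_cast)
  obtain ⟨L₃, h3, hL₃⟩ := exists_c2Bound hS hK hKS fun y hy =>
    (contDiffWithinAt_thetaForm (g := g) hχ (hKT hy)).of_le (m := 2) (by norm_cast)
  obtain ⟨L₄, h4, hL₄⟩ := exists_c2Bound hS hK hKS fun y hy =>
    contDiffWithinAt_christoffelForm (g := g) (hKT hy)
  obtain ⟨L₅, h5, hL₅⟩ := exists_le_mul_of_homogeneous (A := fun _ (v : Rn n) => ‖v‖ ^ 2)
    (B := fun y v => metricForm g c y v v) hK (by fun_prop)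
    (continuousOn_form (continuousOn_metricForm hKT))
    (fun y t v => by rw [norm_smul, mul_pow, Real.norm_eq_abs, sq_abs])
    (fun y t v => by simp only [map_smul, smul_apply, smul_eq_mul]; ring)
    (fun y hy v hv => metricForm_pos g (hKT hy) hv)
  obtain ⟨L₆, h6, hL₆⟩ := exists_le_mul_of_homogeneous (A := fun _ (q : Rn n →L[ℝ] ℝ) => ‖q‖ ^ 2)
    (B := fun y q => covecSq (metricForm g c y) q) hK (by fun_prop) (continuousOn_covecSq hKT)
    (fun y t v => by rw [norm_smul, mul_pow, Real.norm_eq_abs, sq_abs])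
    (fun y t v => covecSq_smul t v)
    (fun y hy q hq => covecSq_pos (metricForm_symm g c y)
      (fun _ hv => metricForm_pos g (hKT hy) hv) hq)
  refine ⟨L₁ + L₂ + L₃ + L₄ + L₅ + L₆, by linarith, fun y hy => ⟨fun hi => ?_, fun hi => ?_,
    fun hi => ?_, fun hi => ?_, ?_, ?_, fun v => ?_, fun q => ?_⟩⟩
  · exact ((hL₁ y hy).2 hi).mono (by linarith)
  · exact ((hL₂ y hy).2 hi).mono (by linarith)
  · exact ((hL₃ y hy).2 hi).mono (by linarith)
  · exact ((hL₄ y hy).2 hi).mono (by linarith)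
  · exact (hL₁ y hy).1.trans (by linarith)
  · exact (hL₃ y hy).1.trans (by linarith)
  · exact (hL₅ y hy v).trans (mul_le_mul_of_nonneg_right (by linarith)
      (metricForm_nonneg g (hKT hy) v))
  · exact (hL₆ y hy q).trans (mul_le_mul_of_nonneg_right (by linarith)
      (covecSq_nonneg (metricForm_symm g c y) (fun _ hv => metricForm_pos g (hKT hy) hv) q))

lemma inCone_of_admissible (hn : 2 ≤ n) {k : ℕ} (hk : k ≤ n) (hχ : SymmTensor χ) {u : M → ℝ}
    (hu : ContMDiff (𝓡∂ n) 𝓘(ℝ, ℝ) 2 u) (ha : Admissible g χ k u) {y : Rn n}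
    (hy : y ∈ (extChartAt (𝓡∂ n) c).target) {j : ℕ} (hj : j ≤ k) :
    0 < minorSum j (traceSub (bilMat (metricForm g c y)) (bilMat (wForm g χ u c y))) := by
  rw [← esymm_eigenvals hn hχ hu hy (hj.trans hk)]
  rcases Nat.eq_zero_or_pos j with rfl | hj0
  · simp [Multiset.esymm]
  · exact ha _ j hj0 hj

/-- An orthonormal frame of eigenvectors of `W`. -/
lemma exists_eigenframe (g : Metric n M) {u : M → ℝ} (hχ : SymmTensor χ)
    (hu : ContMDiff (𝓡∂ n) 𝓘(ℝ, ℝ) 2 u) {y : Rn n} (hy : y ∈ (extChartAt (𝓡∂ n) c).target) :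
    ∃ (e : Fin n → Rn n) (w : Fin n → ℝ), IsUnit (frameMat e).det ∧
      (frameMat e)ᵀ * bilMat (metricForm g c y) * frameMat e = 1 ∧
      (frameMat e)ᵀ * bilMat (wForm g χ u c y) * frameMat e = Matrix.diagonal w :=
  exists_orthonormal_frame (metricForm_symm g c y) (fun _ hv => metricForm_pos g hy hv)
    (wForm_symm hχ hu hy)

lemma inCone_eigenframe (hn : 2 ≤ n) {k : ℕ} (hk : k ≤ n) (hχ : SymmTensor χ) {u : M → ℝ}
    (hu : ContMDiff (𝓡∂ n) 𝓘(ℝ, ℝ) 2 u) (ha : Admissible g χ k u) {y : Rn n}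
    (hy : y ∈ (extChartAt (𝓡∂ n) c).target) {e : Fin n → Rn n} {w : Fin n → ℝ}
    (he : IsUnit (frameMat e).det)
    (h1 : (frameMat e)ᵀ * bilMat (metricForm g c y) * frameMat e = 1)
    (h2 : (frameMat e)ᵀ * bilMat (wForm g χ u c y) * frameMat e = Matrix.diagonal w) :
    InCone Finset.univ (etaOf w) k := by
  intro j hj
  have h3 := inCone_of_admissible hn hk hχ hu ha hy hj
  rwa [← minorSum_traceSub_frame he (hj.trans hk), h1, h2, traceSub_one_diagonal,
    minorSum_diagonal] at h3

lemma InCone.pos_of_full {ι : Type*} [DecidableEq ι] {s : Finset ι} {x : ι → ℝ}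
    (h : InCone s x s.card) {i : ι} (hi : i ∈ s) : 0 < x i := by
  obtain ⟨m, hm⟩ : ∃ m, s.card = m + 1 := ⟨s.card - 1, by
    have := Finset.card_pos.2 ⟨i, hi⟩; omega⟩
  have h1 := h _ le_rfl
  have h2 := (hm ▸ h).erase hi (s.erase i).card (by rw [Finset.card_erase_of_mem hi]; omega)
  rw [es_card, ← Finset.mul_prod_erase _ _ hi] at h1
  rw [es_card] at h2
  exact (pos_iff_pos_of_mul_pos h1).2 h2

/-- For `k = n`, admissibility means that `(tr W) g - W` is positive definite. -/
lemma etaForm_pos (hn : 2 ≤ n) (hχ : SymmTensor χ) {u : M → ℝ}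
    (hu : ContMDiff (𝓡∂ n) 𝓘(ℝ, ℝ) 2 u) (ha : Admissible g χ n u) {y : Rn n}
    (hy : y ∈ (extChartAt (𝓡∂ n) c).target) {v : Rn n} (hv : v ≠ 0) :
    0 < ((bilMat (metricForm g c y))⁻¹ * bilMat (wForm g χ u c y)).trace * metricForm g c y v v -
      wForm g χ u c y v v := by
  obtain ⟨e, w, he, h1, h2⟩ := exists_eigenframe g hχ hu hy
  have h3 := inCone_eigenframe hn le_rfl hχ hu ha hy he h1 h2
  obtain ⟨a, rfl⟩ := exists_frame_coords he v
  have h4 : ((bilMat (metricForm g c y))⁻¹ * bilMat (wForm g χ u c y)).trace = ∑ i, w i := by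
    rw [← trace_inv_mul_frame he, h1, h2, inv_one, Matrix.one_mul, Matrix.trace_diagonal]
  have h1' : (frameMat e)ᵀ * bilMat (metricForm g c y) * frameMat e =
      Matrix.diagonal fun _ => 1 := by rw [h1, Matrix.diagonal_one]
  rw [h4, forms_frame_coords h1', forms_frame_coords h2, Finset.mul_sum, ← Finset.sum_sub_distrib]
  have h5 : ∀ i, 0 < etaOf w i := fun i => InCone.pos_of_full (s := Finset.univ)
    (by rwa [Finset.card_univ, Fintype.card_fin]) (Finset.mem_univ i)
  obtain ⟨i, hi⟩ : ∃ i, a i ≠ 0 := by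
    by_contra! h
    exact hv (by simp [h])
  have h6 : ∀ i, (∑ j, w j) * (1 * a i ^ 2) - w i * a i ^ 2 = etaOf w i * a i ^ 2 := fun i => by
    rw [etaOf]; ring
  simp only [h6]
  exact Finset.sum_pos' (fun i _ => mul_nonneg (h5 i).le (sq_nonneg _))
    ⟨i, Finset.mem_univ i, mul_pos (h5 i) (by positivity)⟩

/-- A uniform lower bound for `(tr W) g - W` when `k = n`. -/
lemma exists_barrier (hn : 2 ≤ n) (hχ : SmoothTensor χ) (hχs : SymmTensor χ) {us : M → ℝ}
    (hus : ContMDiff (𝓡∂ n) 𝓘(ℝ, ℝ) 2 us) (ha : Admissible g χ n us) (hK : IsCompact K)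
    (hKT : K ⊆ (extChartAt (𝓡∂ n) c).target) :
    ∃ L, 1 ≤ L ∧ ∀ y ∈ K, ∀ v, metricForm g c y v v ≤ L *
      (((bilMat (metricForm g c y))⁻¹ * bilMat (wForm g χ us c y)).trace * metricForm g c y v v -
        wForm g χ us c y v v) := by
  have hw := continuousOn_wForm (g := g) hχ hus hKT
  have ht : ContinuousOn (fun y => ((bilMat (metricForm g c y))⁻¹ *
      bilMat (wForm g χ us c y)).trace) K := by
    simp only [Matrix.trace, Matrix.diag_apply, Matrix.mul_apply]
    exact continuousOn_finsetSum _ fun i _ => continuousOn_finsetSum _ fun j _ =>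
      (continuousOn_inv_coordMetric hKT i j).mul
        ((hw.clm_apply continuousOn_const).clm_apply continuousOn_const)
  exact exists_le_mul_of_homogeneous (A := fun y v => metricForm g c y v v)
    (B := fun y v => ((bilMat (metricForm g c y))⁻¹ * bilMat (wForm g χ us c y)).trace *
      metricForm g c y v v - wForm g χ us c y v v) hK
    (continuousOn_form (continuousOn_metricForm hKT))
    (((ht.comp continuousOn_fst fun _ hx => hx.1).mul
      (continuousOn_form (continuousOn_metricForm hKT))).sub (continuousOn_form hw))
    (fun y t v => by simp only [map_smul, smul_apply, smul_eq_mul]; ring)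
    (fun y t v => by simp only [map_smul, smul_apply, smul_eq_mul]; ring)
    (fun y hy v hv => etaForm_pos hn hχs hus ha (hKT hy) hv)

end ChartBounds

end HessianEq

/-! ### The test function on the manifold -/

namespace HessianEq

set_option maxSynthPendingDepth 3

open Filter Topology

section TestFunction

variable {n : ℕ} [NeZero n]
  {M : Type*} [TopologicalSpace M] [ChartedSpace (EuclideanHalfSpace n) M]
  [IsManifold (𝓡∂ n) ∞ M] {g : Metric n M} {χ : TwoTensor n M} {u us : M → ℝ} {c : M} {y : Rn n}

/-- The exponent `(b/2) |∇u|² + a (u_* - u)` of the test function. -/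
noncomputable def testFun (g : Metric n M) (a b : ℝ) (u us : M → ℝ) (x : M) : ℝ :=
  b / 2 * covecNorm g x (grad u x) ^ 2 + a * (us x - u x)

lemma covecNorm_grad_sq (hu : ContMDiff (𝓡∂ n) 𝓘(ℝ, ℝ) 2 u)
    (hy : y ∈ (extChartAt (𝓡∂ n) c).target) :
    covecNorm g ((extChartAt (𝓡∂ n) c).symm y) (grad u ((extChartAt (𝓡∂ n) c).symm y)) ^ 2 =
      covecSq (metricForm g c y) (fderivWithin ℝ (coordFun u c) (range (𝓡∂ n)) y) := by
  rw [covecNorm_grad (hu.mdifferentiable (by simp)) hy, Real.sq_sqrt]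
  exact covecSq_nonneg (metricForm_symm g c y) (fun _ hv => metricForm_pos g hy hv) _

lemma testFun_symm (hu : ContMDiff (𝓡∂ n) 𝓘(ℝ, ℝ) 2 u) (a b : ℝ)
    (hy : y ∈ (extChartAt (𝓡∂ n) c).target) :
    testFun g a b u us ((extChartAt (𝓡∂ n) c).symm y) =
      b / 2 * covecSq (metricForm g c y) (fderivWithin ℝ (coordFun u c) (range (𝓡∂ n)) y) +
        a * (coordFun us c y - coordFun u c y) := by
  rw [testFun, covecNorm_grad_sq hu hy]
  rfl

lemma testExp_eq_testFun (hu : ContMDiff (𝓡∂ n) 𝓘(ℝ, ℝ) 2 u) (a b : ℝ)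
    (hy : y ∈ (extChartAt (𝓡∂ n) c).target) (hi : y ∈ interior (range (𝓡∂ n))) :
    testExp a b (coordFun u c) (coordFun us c) (metricForm g c) y =
      testFun g a b u us ((extChartAt (𝓡∂ n) c).symm y) := by
  rw [testFun_symm hu a b hy, testExp, (fderivWithin_eventuallyEq hi).self_of_nhds]

lemma hessForm_eq_hessianForm (hi : y ∈ interior (range (𝓡∂ n))) :
    hessForm (coordFun u c) (christoffelForm g c) y = hessianForm g u c y := by
  rw [hessForm, hessianForm, fderivWithin_fderivWithin_eq hi,
    (fderivWithin_eventuallyEq hi).self_of_nhds]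

lemma continuousOn_testFun {K : Set (Rn n)} (hu : ContMDiff (𝓡∂ n) 𝓘(ℝ, ℝ) 2 u)
    (hus : ContMDiff (𝓡∂ n) 𝓘(ℝ, ℝ) 2 us) (a b : ℝ) (hKT : K ⊆ (extChartAt (𝓡∂ n) c).target) :
    ContinuousOn (fun y => testFun g a b u us ((extChartAt (𝓡∂ n) c).symm y)) K := by
  have h1 : ContinuousOn (fderivWithin ℝ (coordFun u c) (range (𝓡∂ n))) K :=
    continuousOn_of_contDiffWithinAt hKT fun y hy => (contDiffWithinAt_coordFun hu c (hKT hy)).2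
  have h2 : ContinuousOn (coordFun u c) K :=
    continuousOn_of_contDiffWithinAt hKT fun y hy => (contDiffWithinAt_coordFun hu c (hKT hy)).1
  have h3 : ContinuousOn (coordFun us c) K :=
    continuousOn_of_contDiffWithinAt hKT fun y hy => (contDiffWithinAt_coordFun hus c (hKT hy)).1
  have h4 : ContinuousOn (fun y => covecSq (metricForm g c y)
      (fderivWithin ℝ (coordFun u c) (range (𝓡∂ n)) y)) K :=
    (continuousOn_covecSq hKT).comp (continuousOn_id.prodMk h1) fun y hy => ⟨hy, mem_univ _⟩
  exact ((continuousOn_const.mul h4).add (continuousOn_const.mul (h3.sub h2))).congr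
    fun y hy => testFun_symm hu a b (hKT hy)

lemma coordRHS_grad (hu : ContMDiff (𝓡∂ n) 𝓘(ℝ, ℝ) 2 u) (f : ∀ x : M, ℝ → Cotan n x → ℝ)
    (hy : y ∈ (extChartAt (𝓡∂ n) c).target) :
    coordRHS f c (y, coordFun u c y, fderivWithin ℝ (coordFun u c) (range (𝓡∂ n)) y) =
      f ((extChartAt (𝓡∂ n) c).symm y) (u ((extChartAt (𝓡∂ n) c).symm y))
        (grad u ((extChartAt (𝓡∂ n) c).symm y)) := by
  simp only [coordRHS, coordCovec_fderivWithin (hu.mdifferentiable (by simp)) hy]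
  rfl

/-- At an interior maximum point of the test function on `M`, the coordinate expressions in a chart
are in the situation `InteriorMax`. -/
lemma exists_interiorMax {k : ℕ} (hn : 2 ≤ n) (hk : k + 1 ≤ n)
    (hχs : SymmTensor χ) {𝒜 : ChartCover n M} {K₁ K₃ c₀ L₀ L ε a b w₀ : ℝ}
    {f : ∀ x : M, ℝ → Cotan n x → ℝ} (hf : SmoothRHS f)
    (hu4 : ContMDiffOn (𝓡∂ n) 𝓘(ℝ, ℝ) 4 u ((𝓡∂ n).interior M))
    (hu : ContMDiff (𝓡∂ n) 𝓘(ℝ, ℝ) 2 u) (ha : Admissible g χ (k + 1) u)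
    (hsol : IsSolution g χ (k + 1) f u) (hC1 : C1NormLE g u K₁) (hRHS : RHSNormLE 𝒜 g f K₁ K₃)
    (hlow : ∀ x z p, |z| ≤ K₁ → covecNorm g x p ≤ K₁ → c₀ ≤ f x z p)
    (hc : c ∈ 𝒜.centers) (hp : y ∈ extChartAt (𝓡∂ n) c '' 𝒜.piece c)
    (hy : y ∈ (extChartAt (𝓡∂ n) c).target) (hi : y ∈ interior (range (𝓡∂ n)))
    (hB : ChartBound g χ us c y L₀) (hL : 1 ≤ L) (hL₀ : 0 ≤ L₀) (hL₀L : L₀ ≤ L) (hK₃ : K₃ ≤ L)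
    (hLc : 1 ≤ L * c₀)
    (hLK : L₀ * K₁ ^ 2 ≤ L)
    (hbar : k + 1 = n → ∀ v, ε * metricForm g c y v v ≤
      ((bilMat (metricForm g c y))⁻¹ * bilMat (wForm g χ us c y)).trace * metricForm g c y v v -
        wForm g χ us c y v v)
    (hmax : ∀ z ∈ (extChartAt (𝓡∂ n) c).target, ∀ v, wForm g χ u c z v v *
      Real.exp (testFun g a b u us ((extChartAt (𝓡∂ n) c).symm z)) ≤
        w₀ * Real.exp (testFun g a b u us ((extChartAt (𝓡∂ n) c).symm y)) * metricForm g c z v v)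
    (hatt : ∃ v, v ≠ 0 ∧ wForm g χ u c y v v = w₀ * metricForm g c y v v) :
    ∃ D : InteriorMax n k L ε a b, D.w₀ = w₀ := by
  have hfd : fderivWithin ℝ (coordFun u c) (range (𝓡∂ n)) y = fderiv ℝ (coordFun u c) y :=
    (fderivWithin_eventuallyEq hi).self_of_nhds
  have hcov : covecNorm g ((extChartAt (𝓡∂ n) c).symm y)
      (coordCovec c y (fderiv ℝ (coordFun u c) y)) ≤ K₁ := by
    rw [← hfd, coordCovec_fderivWithin (hu.mdifferentiable (by simp)) hy]
    exact (hC1 _).2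
  have hcovsq : covecSq (metricForm g c y) (fderiv ℝ (coordFun u c) y) ≤ K₁ ^ 2 := by
    rw [← hfd, ← covecNorm_grad_sq hu hy]
    exact pow_le_pow_left₀ (Real.sqrt_nonneg _) (hC1 _).2 2
  have hT : ∀ᶠ z in 𝓝 y, z ∈ (extChartAt (𝓡∂ n) c).target := target_mem_nhds hy hi
  have hI : ∀ᶠ z in 𝓝 y, z ∈ interior (range (𝓡∂ n)) := isOpen_interior.mem_nhds hi
  have hBL := hB.mono hy hL₀L
  have hfy := coordRHS_grad hu f hy
  rw [hfd] at hfy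
  exact ⟨{
    y₀ := y
    u := coordFun u c
    us := coordFun us c
    g := metricForm g c
    θ := thetaForm g χ c
    Γ := christoffelForm g c
    f := coordRHS f c
    w₀ := w₀
    contDiffAt_u := contDiffAt_coordFun (by norm_cast) hu4 hy hi
    norm_fderiv_u_le := by
      have h1 := (hB.sq_norm_covec_le (fderiv ℝ (coordFun u c) y)).trans
        (mul_le_mul_of_nonneg_left hcovsq hL₀)
      have h2 : L ≤ L ^ 2 := by nlinarith
      exact (sq_le_sq₀ (norm_nonneg _) (by linarith)).1 ((h1.trans hLK).trans h2)
    us_bound := hBL.us_bound hi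
    g_bound := hBL.metric_bound hi
    θ_bound := hBL.theta_bound hi
    Γ_bound := hBL.christoffel_bound hi
    f_bound := (c2BoundAt_coordRHS hf hRHS hc hp hy hi (hC1 _).1 hcov).mono hK₃
    g_symm := Eventually.of_forall fun z => metricForm_symm g c z
    θ_symm := Eventually.of_forall fun z => thetaForm_symm g hχs c z
    Γ_symm := by filter_upwards [hT] with z hz using christoffelForm_symm g hz
    sq_norm_le := hBL.sq_norm_le
    compat := fun v x z => by
      have h1 := (koszul_christoffelForm g hy).compat (uniqueDiffWithinAt_range hy)
        (differentiableWithinAt_metricForm g hy) (metricForm_symm g c) v x z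
      rwa [(fderivWithin_eventuallyEq hi).self_of_nhds] at h1
    equation := by
      filter_upwards [hT, hI] with z hz hzi
      rw [hessForm_eq_hessianForm hzi, ← (fderivWithin_eventuallyEq hzi).self_of_nhds,
        coordRHS_grad hu f hz, ← hsol, esymm_eigenvals hn hχs hu hz hk]
      rfl
    admissible := fun j hj => by
      rw [hessForm_eq_hessianForm hi]
      exact inCone_of_admissible hn hk hχs hu ha hy hj
    one_le := by
      rw [hfy]
      exact hLc.trans (mul_le_mul_of_nonneg_left (hlow _ _ _ (hC1 _).1 (hC1 _).2) (by linarith))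
    barrier := fun hkn v => by
      rw [hessForm_eq_hessianForm hi]
      exact hbar hkn v
    le_max := by
      filter_upwards [hT, hI] with z hz hzi v
      rw [hessForm_eq_hessianForm hzi, testExp_eq_testFun hu a b hz hzi,
        testExp_eq_testFun hu a b hy hi]
      exact hmax z hz v
    max_attained := by
      obtain ⟨v, hv, h⟩ := hatt
      exact ⟨v, hv, by rw [hessForm_eq_hessianForm hi]; exact h⟩ }, rfl⟩

end TestFunction

section GlobalMax

variable {n : ℕ} [NeZero n]
  {M : Type*} [TopologicalSpace M] [ChartedSpace (EuclideanHalfSpace n) M]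
  [IsManifold (𝓡∂ n) ∞ M] {g : Metric n M} {χ : TwoTensor n M} {u : M → ℝ}

lemma image_piece_subset (𝒜 : ChartCover n M) {c : M} (hc : c ∈ 𝒜.centers) :
    extChartAt (𝓡∂ n) c '' 𝒜.piece c ⊆ (extChartAt (𝓡∂ n) c).target := by
  rintro _ ⟨x, hx, rfl⟩
  refine (extChartAt (𝓡∂ n) c).map_source ?_
  rw [extChartAt_source]
  exact 𝒜.piece_subset c hc hx

lemma isCompact_image_piece (𝒜 : ChartCover n M) {c : M} (hc : c ∈ 𝒜.centers) :
    IsCompact (extChartAt (𝓡∂ n) c '' 𝒜.piece c) :=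
  (𝒜.isCompact_piece c hc).image_of_continuousOn
    ((continuousOn_extChartAt c).mono (by rw [extChartAt_source]; exact 𝒜.piece_subset c hc))

lemma exists_piece (𝒜 : ChartCover n M) (x : M) : ∃ c ∈ 𝒜.centers,
    ∃ y ∈ extChartAt (𝓡∂ n) c '' 𝒜.piece c, (extChartAt (𝓡∂ n) c).symm y = x := by
  obtain ⟨c, hc, hx⟩ := 𝒜.cover x
  refine ⟨c, hc, _, ⟨x, hx, rfl⟩, (extChartAt (𝓡∂ n) c).left_inv ?_⟩
  rw [extChartAt_source]
  exact 𝒜.piece_subset c hc hx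

/-- The maximum over `M` of the largest eigenvalue of `W`, weighted by the positive function
`exp φ`, is attained. -/
lemma exists_max [Nonempty M] (𝒜 : ChartCover n M) (hχ : SmoothTensor χ)
    (hu : ContMDiff (𝓡∂ n) 𝓘(ℝ, ℝ) 2 u) {φ : M → ℝ}
    (hφ : ∀ c ∈ 𝒜.centers, ContinuousOn (fun y => φ ((extChartAt (𝓡∂ n) c).symm y))
      (extChartAt (𝓡∂ n) c '' 𝒜.piece c)) :
    ∃ c ∈ 𝒜.centers, ∃ y ∈ extChartAt (𝓡∂ n) c '' 𝒜.piece c, ∃ w₀ : ℝ,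
      (∃ v, v ≠ 0 ∧ wForm g χ u c y v v = w₀ * metricForm g c y v v) ∧
      ∀ c', ∀ z ∈ (extChartAt (𝓡∂ n) c').target, ∀ v,
        wForm g χ u c' z v v * Real.exp (φ ((extChartAt (𝓡∂ n) c').symm z)) ≤
          w₀ * Real.exp (φ ((extChartAt (𝓡∂ n) c).symm y)) * metricForm g c' z v v := by
  set Q : M → Rn n × Rn n → ℝ := fun c w => wForm g χ u c w.1 w.2 w.2 *
    Real.exp (φ ((extChartAt (𝓡∂ n) c).symm w.1)) / metricForm g c w.1 w.2 w.2 with hQ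
  set A : Set ℝ := ⋃ c ∈ 𝒜.centers, Q c ''
    ((extChartAt (𝓡∂ n) c '' 𝒜.piece c) ×ˢ Metric.sphere (0 : Rn n) 1) with hA
  have hsne : ∀ v ∈ Metric.sphere (0 : Rn n) 1, v ≠ 0 := fun v hv h => by simp [h] at hv
  have hAc : IsCompact A := by
    refine 𝒜.centers.isCompact_biUnion fun c hc => ?_
    have hKT := image_piece_subset 𝒜 hc
    refine ((isCompact_image_piece 𝒜 hc).prod (isCompact_sphere 0 1)).image_of_continuousOn ?_
    have hsub : (extChartAt (𝓡∂ n) c '' 𝒜.piece c) ×ˢ Metric.sphere (0 : Rn n) 1 ⊆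
        (extChartAt (𝓡∂ n) c '' 𝒜.piece c) ×ˢ univ := prod_mono_right (subset_univ _)
    refine ContinuousOn.div (ContinuousOn.mul
      ((continuousOn_form (continuousOn_wForm hχ hu hKT)).mono hsub) ?_)
      ((continuousOn_form (continuousOn_metricForm hKT)).mono hsub)
      fun w hw => (metricForm_pos g (hKT hw.1) (hsne _ hw.2)).ne'
    exact Real.continuous_exp.comp_continuousOn
      ((hφ c hc).comp continuousOn_fst fun w hw => hw.1)
  have hAne : A.Nonempty := by
    obtain ⟨x⟩ := ‹Nonempty M›
    obtain ⟨c, hc, y, hy, -⟩ := exists_piece 𝒜 x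
    refine ⟨_, mem_biUnion hc ⟨(y, stdVec 0), ⟨hy, ?_⟩, rfl⟩⟩
    simp [stdVec]
  obtain ⟨m, hm, hmax⟩ := hAc.exists_isGreatest hAne
  obtain ⟨c, hc, ⟨y, v⟩, ⟨hy, hv⟩, hm⟩ : ∃ c ∈ 𝒜.centers, ∃ w ∈
      (extChartAt (𝓡∂ n) c '' 𝒜.piece c) ×ˢ Metric.sphere (0 : Rn n) 1, Q c w = m := by
    simpa only [hA, mem_iUnion, exists_prop, mem_image] using hm
  have hexp := Real.exp_pos (φ ((extChartAt (𝓡∂ n) c).symm y))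
  have hgv := metricForm_pos g (image_piece_subset 𝒜 hc hy) (hsne v hv)
  refine ⟨c, hc, y, hy, m / Real.exp (φ ((extChartAt (𝓡∂ n) c).symm y)), ⟨v, hsne v hv, ?_⟩, ?_⟩
  · rw [← hm]
    simp only [hQ]
    field_simp
  · rw [div_mul_cancel₀ _ hexp.ne']
    -- on the compact pieces the estimate is homogeneous in the vector
    have key : ∀ c' ∈ 𝒜.centers, ∀ z ∈ extChartAt (𝓡∂ n) c' '' 𝒜.piece c', ∀ v : Rn n,
        wForm g χ u c' z v v * Real.exp (φ ((extChartAt (𝓡∂ n) c').symm z)) ≤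
          m * metricForm g c' z v v := by
      intro c' hc' z hz v
      rcases eq_or_ne v 0 with rfl | hv0
      · simp
      have hn : 0 < ‖v‖ := norm_pos_iff.2 hv0
      have hs : ‖v‖⁻¹ • v ∈ Metric.sphere (0 : Rn n) 1 := by simp [norm_smul, hn.ne']
      have hle : Q c' (z, ‖v‖⁻¹ • v) ≤ m :=
        hmax (mem_biUnion hc' ⟨(z, ‖v‖⁻¹ • v), ⟨hz, hs⟩, rfl⟩)
      simp only [hQ] at hle
      rw [div_le_iff₀ (metricForm_pos g (image_piece_subset 𝒜 hc' hz) (hsne _ hs))] at hle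
      simp only [map_smul, smul_apply, smul_eq_mul] at hle
      have h2 : 0 < ‖v‖⁻¹ * ‖v‖⁻¹ := by positivity
      refine le_of_mul_le_mul_left ?_ h2
      calc _ = ‖v‖⁻¹ * (‖v‖⁻¹ * wForm g χ u c' z v v) *
            Real.exp (φ ((extChartAt (𝓡∂ n) c').symm z)) := by ring
        _ ≤ _ := hle
        _ = _ := by ring
    intro c' z hz v
    obtain ⟨d, hd, z', hz', hx⟩ := exists_piece 𝒜 ((extChartAt (𝓡∂ n) c').symm z)
    have hov : z ∈ chartOverlap c' d := by
      refine ⟨hz, ?_⟩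
      rw [← hx]
      exact (extChartAt (𝓡∂ n) d).map_target (image_piece_subset 𝒜 hd hz')
    have hz'' : chartChange c' d z = z' := by
      rw [chartChange, ← hx]
      exact (extChartAt (𝓡∂ n) d).right_inv (image_piece_subset 𝒜 hd hz')
    rw [wForm_chartChange hu hov, coordForm_chartChange _ hov, hz'', ← hx]
    exact key d hd z' hz' _

end GlobalMax

end HessianEq

/-! ### The global estimate -/

namespace HessianEq

set_option maxSynthPendingDepth 3

open Filter Topology

section Global

variable {n : ℕ} [NeZero n]
  {M : Type*} [TopologicalSpace M] [ChartedSpace (EuclideanHalfSpace n) M]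
  [IsManifold (𝓡∂ n) ∞ M] {g : Metric n M} {χ : TwoTensor n M} {u us : M → ℝ} {c : M} {y : Rn n}
  {L : ℝ}

lemma ChartBound.abs_theta_frame_le (h : ChartBound g χ us c y L) {e : Fin n → Rn n}
    (he : (frameMat e)ᵀ * bilMat (metricForm g c y) * frameMat e = 1) (i j : Fin n) :
    |thetaForm g χ c y (e i) (e j)| ≤ L ^ 2 := by
  have hL : 0 ≤ L := (norm_nonneg _).trans h.norm_theta_le
  have h1 : ∀ i, ‖e i‖ ^ 2 ≤ L := fun i => by
    have := h.sq_norm_le (e i)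
    rwa [frame_apply he i i, Matrix.one_apply_eq, mul_one] at this
  have h2 : ‖e i‖ * ‖e j‖ ≤ L := by nlinarith [h1 i, h1 j, sq_nonneg (‖e i‖ - ‖e j‖)]
  calc |thetaForm g χ c y (e i) (e j)| ≤ ‖thetaForm g χ c y‖ * ‖e i‖ * ‖e j‖ :=
        (thetaForm g χ c y).le_opNorm₂ (e i) (e j)
    _ = ‖thetaForm g χ c y‖ * (‖e i‖ * ‖e j‖) := by ring
    _ ≤ L * L := mul_le_mul h.norm_theta_le h2 (by positivity) hL
    _ = L ^ 2 := by ring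

/-- In the cone, an upper bound for the eigenvalues of `W` bounds the Hessian. -/
lemma tensorNorm_hess_le {k : ℕ} (hn : 2 ≤ n) (hk : k + 1 ≤ n) (hχ : SymmTensor χ)
    (hu : ContMDiff (𝓡∂ n) 𝓘(ℝ, ℝ) 2 u) (ha : Admissible g χ (k + 1) u)
    (hy : y ∈ (extChartAt (𝓡∂ n) c).target) (hB : ChartBound g χ us c y L) {Λ : ℝ} (hΛ : 0 ≤ Λ)
    (h : ∀ v, wForm g χ u c y v v ≤ Λ * metricForm g c y v v) :
    tensorNorm g ((extChartAt (𝓡∂ n) c).symm y) (hess g u ((extChartAt (𝓡∂ n) c).symm y)) ≤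
      n * (n * Λ + L ^ 2) := by
  obtain ⟨e, w, he, h1, h2⟩ := exists_eigenframe g hχ hu hy
  have hw : ∀ i, w i ≤ Λ := fun i => by
    have := h (e i)
    rwa [frame_apply h1 i i, frame_apply h2 i i, Matrix.one_apply_eq, mul_one,
      Matrix.diagonal_apply_eq] at this
  have hpos := sum_pos_of_inCone (by simpa using hn) (inCone_eigenframe hn hk hχ hu ha hy he h1 h2)
  have hn' : (2 : ℝ) ≤ n := by exact_mod_cast hn
  have habs : ∀ i, |w i| ≤ n * Λ := by
    intro i
    rw [abs_le]
    constructor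
    · rw [← Finset.add_sum_erase _ _ (Finset.mem_univ i)] at hpos
      have h3 : ∑ j ∈ Finset.univ.erase i, w j ≤ ∑ _j ∈ Finset.univ.erase i, Λ :=
        Finset.sum_le_sum fun j _ => hw j
      have h4 : ∑ _j ∈ Finset.univ.erase i, Λ ≤ ∑ _j : Fin n, Λ :=
        Finset.sum_le_sum_of_subset_of_nonneg (Finset.erase_subset _ _) fun _ _ _ => hΛ
      rw [Finset.sum_const Λ (s := Finset.univ), nsmul_eq_mul, Finset.card_univ,
        Fintype.card_fin] at h4
      linarith
    · nlinarith [hw i]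
  have hH : ∀ i j, |hessianForm g u c y (e i) (e j)| ≤ n * Λ + L ^ 2 := by
    intro i j
    have e1 := frame_apply h2 i j
    rw [wForm_apply] at e1
    have e2 : |Matrix.diagonal w i j| ≤ n * Λ := by
      rcases eq_or_ne i j with rfl | hij
      · rw [Matrix.diagonal_apply_eq]; exact habs i
      · rw [Matrix.diagonal_apply_ne _ hij, abs_zero]; positivity
    have e3 := hB.abs_theta_frame_le h1 i j
    rw [abs_le] at e2 e3 ⊢
    constructor <;> linarith [e2.1, e2.2, e3.1, e3.2]
  have hB0 : 0 ≤ n * Λ + L ^ 2 := by positivity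
  rw [tensorNorm_hess hu hy h1]
  refine Real.sqrt_le_iff.2 ⟨by positivity, ?_⟩
  calc ∑ i, ∑ j, hessianForm g u c y (e i) (e j) ^ 2
      ≤ ∑ _i : Fin n, ∑ _j : Fin n, (n * Λ + L ^ 2) ^ 2 :=
        Finset.sum_le_sum fun i _ => Finset.sum_le_sum fun j _ =>
          sq_le_sq' (abs_le.1 (hH i j)).1 (abs_le.1 (hH i j)).2
    _ = (n * (n * Λ + L ^ 2)) ^ 2 := by
        simp only [Finset.sum_const, Finset.card_univ, Fintype.card_fin, nsmul_eq_mul]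
        ring

/-- The Hessian bounds the eigenvalues of `W`. -/
lemma le_tensorNorm_hess (hχ : SymmTensor χ) (hu : ContMDiff (𝓡∂ n) 𝓘(ℝ, ℝ) 2 u)
    (hy : y ∈ (extChartAt (𝓡∂ n) c).target) (hB : ChartBound g χ us c y L) {w₀ : ℝ}
    (h : ∃ v, v ≠ 0 ∧ wForm g χ u c y v v = w₀ * metricForm g c y v v) :
    w₀ ≤ tensorNorm g ((extChartAt (𝓡∂ n) c).symm y)
      (hess g u ((extChartAt (𝓡∂ n) c).symm y)) + L ^ 2 := by
  obtain ⟨e, w, he, h1, h2⟩ := exists_eigenframe g hχ hu hy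
  set N := tensorNorm g ((extChartAt (𝓡∂ n) c).symm y)
    (hess g u ((extChartAt (𝓡∂ n) c).symm y)) with hN
  have hw : ∀ i, w i ≤ N + L ^ 2 := by
    intro i
    have e1 := frame_apply h2 i i
    rw [wForm_apply, Matrix.diagonal_apply_eq] at e1
    have e2 : hessianForm g u c y (e i) (e i) ≤ N := by
      rw [hN, tensorNorm_hess hu hy h1]
      refine Real.le_sqrt_of_sq_le ?_
      refine le_trans ?_ (Finset.single_le_sum
        (f := fun i => ∑ j, hessianForm g u c y (e i) (e j) ^ 2)
        (fun i _ => Finset.sum_nonneg fun j _ => sq_nonneg _) (Finset.mem_univ i))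
      exact Finset.single_le_sum (f := fun j => hessianForm g u c y (e i) (e j) ^ 2)
        (fun j _ => sq_nonneg _) (Finset.mem_univ i)
    have e3 := (abs_le.1 (hB.abs_theta_frame_le h1 i i)).2
    linarith
  obtain ⟨v, hv, hvw⟩ := h
  have hgv := metricForm_pos g hy hv
  obtain ⟨a, rfl⟩ := exists_frame_coords he v
  have h1' : (frameMat e)ᵀ * bilMat (metricForm g c y) * frameMat e =
      Matrix.diagonal fun _ => 1 := by rw [h1, Matrix.diagonal_one]
  refine le_of_mul_le_mul_right ?_ hgv
  rw [← hvw, forms_frame_coords h2, forms_frame_coords h1', Finset.mul_sum]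
  exact Finset.sum_le_sum fun i _ => by
    rw [one_mul]
    exact mul_le_mul_of_nonneg_right (hw i) (sq_nonneg _)

lemma exists_uniform_chartBound (g : Metric n M) (hχ : SmoothTensor χ)
    (hus : ContMDiff (𝓡∂ n) 𝓘(ℝ, ℝ) 2 us) (𝒜 : ChartCover n M) :
    ∃ L, 1 ≤ L ∧ ∀ c ∈ 𝒜.centers, ∀ y ∈ extChartAt (𝓡∂ n) c '' 𝒜.piece c,
      ChartBound g χ us c y L := by
  have h : ∀ c : M, ∃ L, 1 ≤ L ∧ (c ∈ 𝒜.centers → ∀ y ∈ extChartAt (𝓡∂ n) c '' 𝒜.piece c,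
      ChartBound g χ us c y L) := by
    intro c
    by_cases hc : c ∈ 𝒜.centers
    · obtain ⟨L, h1, h2⟩ := exists_chartBound (g := g) hχ hus (isCompact_image_piece 𝒜 hc)
        (image_piece_subset 𝒜 hc)
      exact ⟨L, h1, fun _ => h2⟩
    · exact ⟨1, le_rfl, fun h => absurd h hc⟩
  choose F hF hFB using h
  have hF0 : ∀ c, 0 ≤ F c := fun c => zero_le_one.trans (hF c)
  refine ⟨1 + ∑ c ∈ 𝒜.centers, F c, ?_, fun c hc y hy =>
    (hFB c hc y hy).mono (image_piece_subset 𝒜 hc hy) ?_⟩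
  · linarith [Finset.sum_nonneg fun c (_ : c ∈ 𝒜.centers) => hF0 c]
  · linarith [Finset.single_le_sum (fun c _ => hF0 c) hc]

lemma exists_uniform_barrier (hn : 2 ≤ n) (hχ : SmoothTensor χ) (hχs : SymmTensor χ)
    (hus : ContMDiff (𝓡∂ n) 𝓘(ℝ, ℝ) 2 us) {k : ℕ} (ha : Admissible g χ k us)
    (𝒜 : ChartCover n M) :
    ∃ ε, 0 < ε ∧ ∀ c ∈ 𝒜.centers, ∀ y ∈ extChartAt (𝓡∂ n) c '' 𝒜.piece c, k = n →
      ∀ v, ε * metricForm g c y v v ≤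
        ((bilMat (metricForm g c y))⁻¹ * bilMat (wForm g χ us c y)).trace *
          metricForm g c y v v - wForm g χ us c y v v := by
  have h : ∀ c : M, ∃ L, 1 ≤ L ∧ (c ∈ 𝒜.centers → k = n →
      ∀ y ∈ extChartAt (𝓡∂ n) c '' 𝒜.piece c, ∀ v, metricForm g c y v v ≤ L *
        (((bilMat (metricForm g c y))⁻¹ * bilMat (wForm g χ us c y)).trace *
          metricForm g c y v v - wForm g χ us c y v v)) := by
    intro c
    by_cases hc : c ∈ 𝒜.centers ∧ k = n
    · obtain ⟨hc, rfl⟩ := hc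
      obtain ⟨L, h1, h2⟩ := exists_barrier hn hχ hχs hus ha (isCompact_image_piece 𝒜 hc)
        (image_piece_subset 𝒜 hc)
      exact ⟨L, h1, fun _ _ => h2⟩
    · exact ⟨1, le_rfl, fun h1 h2 => absurd ⟨h1, h2⟩ hc⟩
  choose F hF hFB using h
  have hF0 : ∀ c, 0 ≤ F c := fun c => zero_le_one.trans (hF c)
  have hpos : 0 < 1 + ∑ c ∈ 𝒜.centers, F c := by
    linarith [Finset.sum_nonneg fun c (_ : c ∈ 𝒜.centers) => hF0 c]
  refine ⟨(1 + ∑ c ∈ 𝒜.centers, F c)⁻¹, inv_pos.2 hpos, fun c hc y hy hk v => ?_⟩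
  have h1 := hFB c hc hk y hy v
  have h2 := metricForm_nonneg g (image_piece_subset 𝒜 hc hy) v
  have h3 := nonneg_of_mul_nonneg_right (h2.trans h1) (zero_lt_one.trans_le (hF c))
  rw [inv_mul_le_iff₀ hpos]
  refine h1.trans (mul_le_mul_of_nonneg_right ?_ h3)
  linarith [Finset.single_le_sum (fun c _ => hF0 c) hc]

lemma abs_testFun_le {K₁ a b : ℝ} (ha : 0 ≤ a) (hb : 0 ≤ b) (hu : C1NormLE g u K₁)
    (hus : ∀ x, |us x| ≤ L) (x : M) :
    |testFun g a b u us x| ≤ b / 2 * K₁ ^ 2 + a * (L + K₁) := by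
  have h1 : covecNorm g x (grad u x) ^ 2 ≤ K₁ ^ 2 :=
    pow_le_pow_left₀ (Real.sqrt_nonneg _) (hu x).2 2
  have h2 : |us x - u x| ≤ L + K₁ := (abs_sub _ _).trans (add_le_add (hus x) (hu x).1)
  rw [testFun]
  refine (abs_add_le _ _).trans (add_le_add ?_ ?_)
  · rw [abs_of_nonneg (by positivity)]
    exact mul_le_mul_of_nonneg_left h1 (by positivity)
  · rw [abs_mul, abs_of_nonneg ha]
    exact mul_le_mul_of_nonneg_left h2 ha

end Global

end HessianEq

/-! ### The Hessian estimate -/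

namespace HessianEq

open Filter Topology

section Estimate

variable {n : ℕ} [NeZero n]
  {M : Type*} [TopologicalSpace M] [ChartedSpace (EuclideanHalfSpace n) M]
  [IsManifold (𝓡∂ n) ∞ M] {g : Metric n M} {χ : TwoTensor n M} {us : M → ℝ}

/-- The estimate for the equation of degree `k + 1`, given one admissible function `us`: the
constant is allowed to depend on `us`. -/
lemma exists_hessian_bound {k : ℕ} (hn : 2 ≤ n) (hk : k + 1 ≤ n) (hM : ((𝓡∂ n).boundary M).Nonempty)
    (hχ : SmoothTensor χ) (hχs : SymmTensor χ) (𝒜 : ChartCover n M) (K₁ K₃ c₀ : ℝ) (hc₀ : 0 < c₀)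
    (hus : ContMDiff (𝓡∂ n) 𝓘(ℝ, ℝ) 2 us) (hus' : Admissible g χ (k + 1) us) :
    ∃ C : ℝ, 0 < C ∧ ∀ (f : ∀ x : M, ℝ → Cotan n x → ℝ) (u : M → ℝ), SmoothRHS f →
      ContMDiffOn (𝓡∂ n) 𝓘(ℝ, ℝ) 4 u ((𝓡∂ n).interior M) → ContMDiff (𝓡∂ n) 𝓘(ℝ, ℝ) 2 u →
      Admissible g χ (k + 1) u → IsSolution g χ (k + 1) f u → C1NormLE g u K₁ →
      RHSNormLE 𝒜 g f K₁ K₃ →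
      (∀ x z p, |z| ≤ K₁ → covecNorm g x p ≤ K₁ → c₀ ≤ f x z p) →
      BddAbove (range fun x : M => tensorNorm g x (hess g u x)) ∧
      (⨆ x : M, tensorNorm g x (hess g u x)) ≤
        C * (1 + ⨆ y : (𝓡∂ n).boundary M, tensorNorm g (y : M) (hess g u (y : M))) := by
  have : Nonempty M := ⟨hM.some⟩
  obtain ⟨L₀, hL₀, hB⟩ := exists_uniform_chartBound g hχ hus 𝒜
  obtain ⟨ε, hε, hbar⟩ := exists_uniform_barrier hn hχ hχs hus hus' 𝒜
  -- `c₀⁻¹` is for `1 ≤ L f`, and `L₀ K₁²` for the coordinate gradient of `u`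
  set L := L₀ + |K₃| + c₀⁻¹ + L₀ * K₁ ^ 2 with hL
  have hinv : 0 < c₀⁻¹ := inv_pos.2 hc₀
  have hLK : 0 ≤ L₀ * K₁ ^ 2 := by positivity
  have hK₃ := abs_nonneg K₃
  have hL₀L : L₀ ≤ L := by linarith
  have hLc : 1 ≤ L * c₀ := by
    rw [← inv_mul_cancel₀ hc₀.ne']
    exact mul_le_mul_of_nonneg_right (by linarith) hc₀.le
  obtain ⟨a, b, C, ha, hb, hC⟩ := exists_bound_at_interiorMax hn hk (hL₀.trans hL₀L) hε
  -- the oscillation of the exponent `testFun` over `M` is at most `log E`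
  set E := Real.exp (2 * (b / 2 * K₁ ^ 2 + a * (L₀ + K₁))) with hE
  have hE0 : 0 < E := Real.exp_pos _
  set C' := |C| + L₀ ^ 2 + 1 with hC'
  have hC'1 : 1 ≤ C' := by
    have := abs_nonneg C
    nlinarith
  have hn0 : (0 : ℝ) < n := by exact_mod_cast (by omega : 0 < n)
  refine ⟨n * (n * (C' * E) + L₀ ^ 2), by positivity, ?_⟩
  intro f u hf hu4 hu hau hsol hC1 hRHS hlow
  have husL : ∀ x, |us x| ≤ L₀ := by
    intro x
    obtain ⟨c, hc, y, hy, rfl⟩ := exists_piece 𝒜 x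
    exact (hB c hc y hy).abs_us_le
  have htest := abs_testFun_le (g := g) ha hb.le hC1 husL
  obtain ⟨c, hc, y, hy, w₀, hatt, hmax⟩ := exists_max (g := g) (χ := χ) 𝒜 hχ hu
    (φ := testFun g a b u us) fun c hc => continuousOn_testFun hu hus a b (image_piece_subset 𝒜 hc)
  have hyT := image_piece_subset 𝒜 hc hy
  -- `max w₀ 0`, corrected by the oscillation of the exponent, bounds the Hessian everywhere
  have hbound : ∀ x, tensorNorm g x (hess g u x) ≤ n * (n * (max w₀ 0 * E) + L₀ ^ 2) := by
    intro x
    obtain ⟨d, hd, z, hz, rfl⟩ := exists_piece 𝒜 x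
    have hzT := image_piece_subset 𝒜 hd hz
    refine tensorNorm_hess_le hn hk hχs hu hau hzT (hB d hd z hz) (by positivity) fun v => ?_
    have h1 := hmax d z hzT v
    set s := testFun g a b u us ((extChartAt (𝓡∂ n) d).symm z) with hs
    set t := testFun g a b u us ((extChartAt (𝓡∂ n) c).symm y) with ht
    have h2 : Real.exp t ≤ E * Real.exp s := by
      rw [hE, ← Real.exp_add, Real.exp_le_exp]
      have := (abs_le.1 (htest ((extChartAt (𝓡∂ n) d).symm z))).1
      have := (abs_le.1 (htest ((extChartAt (𝓡∂ n) c).symm y))).2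
      linarith
    have hg := metricForm_nonneg g hzT v
    refine le_of_mul_le_mul_right (h1.trans ?_) (Real.exp_pos s)
    calc w₀ * Real.exp t * metricForm g d z v v
        ≤ max w₀ 0 * (E * Real.exp s) * metricForm g d z v v := by
          refine mul_le_mul_of_nonneg_right ?_ hg
          exact mul_le_mul (le_max_left _ _) h2 (Real.exp_pos _).le (le_max_right _ _)
      _ = _ := by ring
  have hbdd : ∀ {ι : Type _} (F : ι → M), BddAbove (range fun i => tensorNorm g (F i)
      (hess g u (F i))) := fun F => ⟨_, by rintro _ ⟨i, rfl⟩; exact hbound (F i)⟩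
  refine ⟨hbdd id, ciSup_le fun x => (hbound x).trans ?_⟩
  set B := ⨆ y : (𝓡∂ n).boundary M, tensorNorm g (y : M) (hess g u (y : M)) with hBdef
  have hB0 : 0 ≤ B := Real.iSup_nonneg fun _ => Real.sqrt_nonneg _
  have hw₀ : w₀ ≤ C' * (1 + B) := by
    have hCB : |C| + L₀ ^ 2 + B ≤ C' * (1 + B) := by nlinarith
    by_cases hi : y ∈ interior (range (𝓡∂ n))
    · obtain ⟨D, hD⟩ := exists_interiorMax (ε := ε) (w₀ := w₀) hn hk hχs hf hu4 hu hau hsol hC1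
        hRHS hlow hc hy hyT hi (hB c hc y hy) (hL₀.trans hL₀L) (by linarith) hL₀L
        (by linarith [le_abs_self K₃]) hLc (by linarith) (hbar c hc y hy) (fun z hz v => hmax c z hz v)
        hatt
      have h1 := hC D
      rw [hD] at h1
      nlinarith [le_abs_self C, sq_nonneg L₀]
    · have hbd : (extChartAt (𝓡∂ n) c).symm y ∈ (𝓡∂ n).boundary M := by
        rw [← (𝓡∂ n).compl_interior]
        exact fun h => hi (mem_interior_of_symm_mem_interior hyT h)
      have h1 := le_tensorNorm_hess hχs hu hyT (hB c hc y hy) hatt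
      have h2 : tensorNorm g ((extChartAt (𝓡∂ n) c).symm y)
          (hess g u ((extChartAt (𝓡∂ n) c).symm y)) ≤ B :=
        le_ciSup (hbdd fun y : (𝓡∂ n).boundary M => (y : M)) ⟨_, hbd⟩
      linarith [abs_nonneg C]
  have hmax0 : max w₀ 0 ≤ C' * (1 + B) := max_le hw₀ (by positivity)
  have h1 : max w₀ 0 * E ≤ C' * (1 + B) * E := mul_le_mul_of_nonneg_right hmax0 hE0.le
  calc (n : ℝ) * (n * (max w₀ 0 * E) + L₀ ^ 2)
      ≤ n * (n * (C' * (1 + B) * E) + L₀ ^ 2 * (1 + B)) := by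
        have h2 : L₀ ^ 2 ≤ L₀ ^ 2 * (1 + B) := by nlinarith [sq_nonneg L₀]
        gcongr
    _ = _ := by ring

end Estimate

end HessianEq

theorem theorem1p2 {n : ℕ} [NeZero n] (hn : 2 ≤ n) (k : ℕ) (hk : 1 ≤ k) (hkn : k ≤ n)
    {M : Type*} [TopologicalSpace M] [T2Space M] [CompactSpace M]
    [ChartedSpace (EuclideanHalfSpace n) M] [IsManifold (𝓡∂ n) ∞ M]
    (hM : ((𝓡∂ n).boundary M).Nonempty)
    (g : HessianEq.Metric n M)
    (χ : HessianEq.TwoTensor n M) (hχ : HessianEq.SmoothTensor χ) (hχs : HessianEq.SymmTensor χ)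
    (𝒜 : HessianEq.ChartCover n M)
    (K₁ K₂ K₃ c₀ : ℝ) (hc₀ : 0 < c₀) :
    ∃ C : ℝ, 0 < C ∧
      ∀ (f : ∀ x : M, ℝ → HessianEq.Cotan n x → ℝ) (u₀ u : M → ℝ),
        HessianEq.SmoothRHS f → (∀ x z p, 0 < f x z p) →
        ContMDiff (𝓡∂ n) 𝓘(ℝ, ℝ) 2 u₀ → HessianEq.Admissible g χ k u₀ →
        ContMDiffOn (𝓡∂ n) 𝓘(ℝ, ℝ) 4 u ((𝓡∂ n).interior M) → ContMDiff (𝓡∂ n) 𝓘(ℝ, ℝ) 2 u →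
        HessianEq.Admissible g χ k u → HessianEq.IsSolution g χ k f u →
        HessianEq.C1NormLE g u K₁ → HessianEq.C2NormLE g u₀ K₂ →
        HessianEq.RHSNormLE 𝒜 g f K₁ K₃ →
        (∀ x z p, |z| ≤ K₁ → HessianEq.covecNorm g x p ≤ K₁ → c₀ ≤ f x z p) →
        BddAbove (range fun x : M => HessianEq.tensorNorm g x (HessianEq.hess g u x)) ∧
        (⨆ x : M, HessianEq.tensorNorm g x (HessianEq.hess g u x)) ≤
          C * (1 + ⨆ y : (𝓡∂ n).boundary M,
            HessianEq.tensorNorm g (y : M) (HessianEq.hess g u (y : M))) := by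
  obtain ⟨k, rfl⟩ := Nat.exists_eq_add_of_le' hk
  by_cases h : ∃ us : M → ℝ, ContMDiff (𝓡∂ n) 𝓘(ℝ, ℝ) 2 us ∧ HessianEq.Admissible g χ (k + 1) us
  · obtain ⟨us, hus, hus'⟩ := h
    obtain ⟨C, hC, hCb⟩ := HessianEq.exists_hessian_bound hn hkn hM hχ hχs 𝒜 K₁ K₃ c₀ hc₀ hus hus'
    exact ⟨C, hC, fun f _ u hf _ _ _ hu4 hu hau hsol hC1 _ hRHS hlow =>
      hCb f u hf hu4 hu hau hsol hC1 hRHS hlow⟩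
  -- without admissible functions there is no solution either
  · exact ⟨1, one_pos, fun f _ u _ _ _ _ _ hu hau _ _ _ _ _ => absurd ⟨u, hu, hau⟩ h⟩
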